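/- Let $\alpha\ge 0$ and $a>0$ be real, $\mathbb R_+=[0,\infty)$, $\mathbb R_-=(-\infty,0]$. Let $\mathcal M_1(\mathbb R_+)$ and $\mathcal M_{1/2}(\mathbb R_-)$ be the sets of Borel measures of total mass $1$ on $\mathbb R_+$ and $1/2$ on $\mathbb R_-$, with the weak topology. Let $I_\alpha$, $J_\alpha$ be the modified and the ordinary Bessel functions of the first kind, $0<j_{\alpha,0}<j_{\alpha,1}<\cdots$ the positive zeros of $J_\alpha$, and for $N\ge 1$ put $$w_{\alpha,N}(x)=x^{\alpha/2}I_\alpha(2N\sqrt{ax})e^{-Nx},\quad V_N=-\tfrac1N\log w_{\alpha,N},\quad \mathbb A_N=\Big\{-\Big(\frac{j_{\alpha,k}}{2\sqrt a\,N}\Big)^2: k\ge 0\Big\},\quad \sigma_N=\frac1N\sum_{u\in\mathbb A_N}\delta(u).$$ Let $d\sigma(x)=\frac{\sqrt a}{\pi}|x|^{-1/2}dx$ on $\mathbb R_-$ and $$\mathcal E(\mathbb R_-)=\bigcup_{N\ge 1}\{\nu\in\mathcal M_{1/2}(\mathbb R_-):\nu\le\sigma_N\}\ \cup\ \{\nu\in\mathcal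 M_{1/2}(\mathbb R_-):\nu\le\sigma\},$$ with the induced topology; $\mathcal M_1(\mathbb R_+)\times\mathcal E(\mathbb R_-)$ carries the product topology. Rate functional. Let $T(x)=\big(\frac{x}{1+x^2},\frac{x^2}{1+x^2}\big)\in\mathbb R^2$, let $T_*$ denote push-forward by $T$, and let $\mathcal V(T(x))=x-2\sqrt{ax}-\frac34\log(1+x^2)$ for $x\ge 0$, $\mathcal V((0,1))=+\infty$. Define $$\mathcal J(\mu,\nu)=\iint\log\frac1{|z-w|}dT_*\mu(z)dT_*\mu(w)-\iint\log\frac1{|z-\xi|}dT_*\mu(z)dT_*\nu(\xi)+\iint\log\frac1{|\xi-\zeta|}dT_*\nu(\xi)dT_*\nu(\zeta)+\int\mathcal V\,dT_*\mu$$ if $T_*\mu$ and $T_*\nu$ both have finite logarithmic energy, and $\mathcal J(\mu,\nu)=+\infty$ otherwise. The gas. For $N\geq 2$ even let $\mathbb P_N$ be the measure on $\mathbb R_+^N\times\mathbb R_-^{N/2}$ $$\frac1{Z_N}\,\frac{\prod_{i<j\le N}(x_j-x_i)^2\prod_{i<j\le N/2}(u_j-u_i)^2}{\prod_{i\le N}\prod_{j\le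 N/2}(x_i-u_j)}\prod_{i=1}^Ne^{-NV_N(x_i)}dx_i\prod_{j=1}^{N/2}|u_j|\,d\sigma_N(u_j),$$ with $Z_N$ the total mass of the unnormalized measure, and let $\mu^N=\frac1N\sum_{i=1}^N\delta(x_i)$, $\nu^N=\frac1N\sum_{j=1}^{N/2}\delta(u_j)$. Theorem. For every even $N\ge 2$, $\mathbb P_N$ is a well-defined probability measure and $(\mu^N,\nu^N)\in\mathcal M_1(\mathbb R_+)\times\mathcal E(\mathbb R_-)$ almost surely. The sequence $(\mu^N,\nu^N)_N$ ($N$ even) satisfies a large deviation principle on $\mathcal M_1(\mathbb R_+)\times\mathcal E(\mathbb R_-)$ at speed $N^2$ with good rate function $\mathcal J-\min\mathcal J$. More precisely: (a) for every $\gamma\in\mathbb R$ the level set $\{(\mu,\nu)\in\mathcal M_1(\mathbb R_+)\times\mathcal E(\mathbb R_-):\mathcal J(\mu,\nu)\le\gamma\}$ is compact; (b) $\mathcal J$ has a unique minimizer $(\mu^*,\nu^*)$ on $\mathcal M_1(\mathbb R_+)\times\mathcal E(\mathbb R_-)$, and $\mathcal J(\mu^*,\nu^*)$ is finite; (c) for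 every closed $\mathcal F\subset\mathcal M_1(\mathbb R_+)\times\mathcal E(\mathbb R_-)$, $$\limsup_{N\to\infty}\frac1{N^2}\log\mathbb P_N\big((\mu^N,\nu^N)\in\mathcal F\big)\le-\inf_{(\mu,\nu)\in\mathcal F}\{\mathcal J(\mu,\nu)-\mathcal J(\mu^*,\nu^*)\};$$ (d) for every open $\mathcal O\subset\mathcal M_1(\mathbb R_+)\times\mathcal E(\mathbb R_-)$, $$\liminf_{N\to\infty}\frac1{N^2}\log\mathbb P_N\big((\mu^N,\nu^N)\in\mathcal O\big)\ge-\inf_{(\mu,\nu)\in\mathcal O}\{\mathcal J(\mu,\nu)-\mathcal J(\mu^*,\nu^*)\}.$$ -/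

import Mathlib

open MeasureTheory Set Filter Topology
open scoped ENNReal NNReal

noncomputable section

namespace CoulombGas

/-! ### Bessel functions and weights -/

/-- The modified Bessel function of the first kind `I_α(x)`, for `x ≥ 0` and `α ≥ 0`. -/
def besselI (α x : ℝ) : ℝ :=
  ∑' k : ℕ, 1 / ((k.factorial : ℝ) * Real.Gamma (k + α + 1)) * (x / 2) ^ (2 * (k : ℝ) + α)

/-- The Bessel function of the first kind `J_α(x)`, for `x ≥ 0` and `α ≥ 0`. -/
def besselJ (α x : ℝ) : ℝ :=
  ∑' k : ℕ, (-1) ^ k / ((k.factorial : ℝ) * Real.Gamma (k + α + 1))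
    * (x / 2) ^ (2 * (k : ℝ) + α)

/-- The weight `w_{α,N}(x) = x^{α/2} I_α(2N√(ax)) e^{-Nx}` on `x ≥ 0`. -/
def weight (α a : ℝ) (N : ℕ) (x : ℝ) : ℝ :=
  x ^ (α / 2) * besselI α (2 * N * √(a * x)) * Real.exp (-(N * x))

/-- The potential `V_N = -(1/N) log w_{α,N}`; only its values at `x > 0`, where the weight is
positive, matter, since it is integrated against Lebesgue measure. -/
def potential (α a : ℝ) (N : ℕ) (x : ℝ) : ℝ :=
  -(1 / (N : ℝ)) * Real.log (weight α a N x)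

/-! ### The half-lines, the constraints and the spaces of measures -/

/-- `ℝ_+ = [0, ∞)`. -/
abbrev RPlus : Type := Set.Ici (0 : ℝ)

/-- `ℝ_- = (-∞, 0]`. -/
abbrev RMinus : Type := Set.Iic (0 : ℝ)

/-- The rescaled squared Bessel zeros `𝔸_N = { -(j / (2√a N))² : j > 0, J_α(j) = 0 }`. -/
def besselSet (α a : ℝ) (N : ℕ) : Set RMinus :=
  {u | ∃ j : ℝ, 0 < j ∧ besselJ α j = 0 ∧ (u : ℝ) = -(j / (2 * √a * N)) ^ 2}

/-- `σ_N = (1/N) ∑_{u ∈ 𝔸_N} δ(u)`. -/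
def sigmaN (α a : ℝ) (N : ℕ) : Measure RMinus :=
  (N : ℝ≥0∞)⁻¹ • Measure.sum fun u : besselSet α a N => Measure.dirac (u : RMinus)

/-- The measure `σ` on `ℝ_-` with density `(√a/π) |x|^{-1/2}`. -/
def sigma (a : ℝ) : Measure RMinus :=
  (Measure.comap Subtype.val (volume : Measure ℝ) : Measure RMinus).withDensity fun x =>
    ENNReal.ofReal (√a / Real.pi * |(x : ℝ)| ^ (-(1 / 2) : ℝ))

/-- The measures on `ℝ_-` of total mass `1/2` which are dominated by `lam`. -/
def constrained (lam : Measure RMinus) : Set (FiniteMeasure RMinus) :=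
  {ν | ν.mass = 1 / 2 ∧ (ν : Measure RMinus) ≤ lam}

/-- The set `ℰ(ℝ_-)`, to be used with the topology induced by the weak topology of finite
measures on `ℝ_-`. -/
def E (α a : ℝ) : Set (FiniteMeasure RMinus) :=
  (⋃ N : ℕ, ⋃ _ : 1 ≤ N, constrained (sigmaN α a N)) ∪ constrained (sigma a)

/-! ### The rate function -/

/-- The Euclidean plane. -/
abbrev Plane : Type := EuclideanSpace ℝ (Fin 2)

/-- The inverse stereographic projection of `ℝ` onto the circle of centre `(0,1/2)` and radius
`1/2`, deprived of the point `(0,1)`. -/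
def T (x : ℝ) : Plane := !₂[x / (1 + x ^ 2), x ^ 2 / (1 + x ^ 2)]

/-- The distance between two points of the circle is at most `1`, so that `log (1/|z-w|) ≥ 0`. -/
theorem dist_T_le_one (x y : ℝ) : dist (T x) (T y) ≤ 1 := by
  have hx : 0 < 1 + x ^ 2 := by positivity
  have hy : 0 < 1 + y ^ 2 := by positivity
  rw [EuclideanSpace.dist_eq]
  refine Real.sqrt_le_one.mpr ?_
  simp only [T, Fin.sum_univ_two, Real.dist_eq, sq_abs, PiLp.toLp_apply, Matrix.cons_val_zero,
    Matrix.cons_val_one]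
  rw [div_sub_div _ _ hx.ne' hy.ne', div_sub_div _ _ hx.ne' hy.ne', div_pow, div_pow, ← add_div,
    div_le_one (by positivity)]
  nlinarith [mul_nonneg (mul_pos hx hy).le (sq_nonneg (1 + x * y))]

/-- Integral of an extended real function, as the integral of the positive part minus that of the
negative part. Below, the negative part always has a finite integral. -/
def eintegral {X : Type*} [MeasurableSpace X] (m : Measure X) (f : X → EReal) : EReal :=
  ((∫⁻ x, (f x).toENNReal ∂m : ℝ≥0∞) : EReal) - ((∫⁻ x, (-f x).toENNReal ∂m : ℝ≥0∞) : EReal)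

/-- The kernel `log (1/|z-w|)`, which is `+∞` on the diagonal. -/
def logKernel (z w : Plane) : EReal := -ENNReal.log (edist z w)

/-- The mutual logarithmic energy `∬ log (1/|z-w|) dm(z) dm'(w)`; the logarithmic energy of `m`
when `m' = m`. -/
def logEnergy (m m' : Measure Plane) : EReal :=
  eintegral (m.prod m') fun p => logKernel p.1 p.2

/-- The limiting potential seen on the circle: `x - 2√(ax) - (3/4) log (1+x²)` at the point `T x`,
and `+∞` at `(0,1)`; the real number `z₁/(1-z₂)` is the stereographic projection of `z`. -/
def circlePotential (a : ℝ) (z : Plane) : EReal :=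
  if z = !₂[0, 1] then ⊤ else
    ((fun x : ℝ => x - 2 * √(a * x) - 3 / 4 * Real.log (1 + x ^ 2)) (z 0 / (1 - z 1)) : ℝ)

theorem circlePotential_T (a x : ℝ) :
    circlePotential a (T x)
      = ((x - 2 * √(a * x) - 3 / 4 * Real.log (1 + x ^ 2) : ℝ) : EReal) := by
  have hx : (1 + x ^ 2 : ℝ) ≠ 0 := by positivity
  have h1 : 1 - (T x) 1 = 1 / (1 + x ^ 2) := by
    simp only [T, PiLp.toLp_apply, Matrix.cons_val_one, Matrix.cons_val_zero]
    field_simp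
    ring
  have hne : T x ≠ !₂[0, 1] := by
    intro h
    rw [h] at h1
    simp at h1
    exact hx h1.symm
  have h0 : (T x) 0 / (1 - (T x) 1) = x := by
    rw [h1]
    simp only [T, PiLp.toLp_apply, Matrix.cons_val_zero]
    field_simp
  rw [circlePotential, if_neg hne, h0]

open Classical in
/-- The rate functional on measures on the circle. -/
def circleJ (a : ℝ) (m m' : Measure Plane) : EReal :=
  if (logEnergy m m ≠ ⊤ ∧ logEnergy m m ≠ ⊥) ∧ (logEnergy m' m' ≠ ⊤ ∧ logEnergy m' m' ≠ ⊥) then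
    logEnergy m m - logEnergy m m' + logEnergy m' m' + eintegral m (circlePotential a)
  else ⊤

/-- The functional `𝒥(μ,ν)`, through the push-forwards `T_*μ` and `T_*ν`. -/
def J (a : ℝ) (μ : ProbabilityMeasure RPlus) (ν : FiniteMeasure RMinus) : EReal :=
  circleJ a ((μ : Measure RPlus).map fun x : RPlus => T (x : ℝ))
    ((ν : Measure RMinus).map fun x : RMinus => T (x : ℝ))

/-! ### The gas, with `N = 2n` particles on `ℝ_+` and `N/2 = n` particles on `ℝ_-` -/

/-- Configurations of the two types of particles. -/
abbrev Config (n : ℕ) : Type := (Fin (2 * n) → RPlus) × (Fin n → RMinus)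

/-- The unnormalized density of the gas with respect to `∏ dx_i ∏ dσ_N(u_i)`, `N = 2n`. -/
def gasDensity (α a : ℝ) (n : ℕ) (ω : Config n) : ℝ≥0∞ :=
  ENNReal.ofReal
    ((Matrix.vandermonde fun i => (ω.1 i : ℝ)).det ^ 2
        * (Matrix.vandermonde fun j => (ω.2 j : ℝ)).det ^ 2
        / (∏ i, ∏ j, ((ω.1 i : ℝ) - (ω.2 j : ℝ)))
      * (∏ i, Real.exp (-((2 * n : ℕ) * potential α a (2 * n) (ω.1 i))))
      * ∏ j, |(ω.2 j : ℝ)|)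

/-- The reference measure `∏ dx_i ∏ dσ_N(u_i)`, `N = 2n`. -/
def gasBase (α a : ℝ) (n : ℕ) : Measure (Config n) :=
  (Measure.pi fun _ => (Measure.comap Subtype.val (volume : Measure ℝ) : Measure RPlus)).prod
    (Measure.pi fun _ => sigmaN α a (2 * n))

/-- The normalization constant `Z_N`, `N = 2n`. -/
def partitionFunction (α a : ℝ) (n : ℕ) : ℝ≥0∞ :=
  ∫⁻ ω, gasDensity α a n ω ∂gasBase α a n

/-- The law `ℙ_N` of the gas, `N = 2n`. -/
def gas (α a : ℝ) (n : ℕ) : Measure (Config n) :=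
  (partitionFunction α a n)⁻¹ • (gasBase α a n).withDensity (gasDensity α a n)

/-- The empirical measure `μ^N = (1/N) ∑ δ(x_i)`, `N = 2n`. -/
def muN {n : ℕ} (ω : Config n) : FiniteMeasure RPlus :=
  ((2 * n : ℕ) : ℝ≥0)⁻¹ • ∑ i, (diracProba (ω.1 i)).toFiniteMeasure

/-- The empirical measure `ν^N = (1/N) ∑ δ(u_i)`, `N = 2n`. -/
def nuN {n : ℕ} (ω : Config n) : FiniteMeasure RMinus :=
  ((2 * n : ℕ) : ℝ≥0)⁻¹ • ∑ j, (diracProba (ω.2 j)).toFiniteMeasure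

/-- The event `(μ^N, ν^N) ∈ F`, `N = 2n`, for a set `F` in `ℳ₁(ℝ_+) × ℰ(ℝ_-)`. -/
def event {α a : ℝ} (n : ℕ) (F : Set (ProbabilityMeasure RPlus × E α a)) : Set (Config n) :=
  {ω | ∃ p ∈ F, p.1.toFiniteMeasure = muN ω ∧ (p.2 : FiniteMeasure RMinus) = nuN ω}

/-- The quantity `(1/N²) log ℙ_N((μ^N, ν^N) ∈ F)`, `N = 2n`, with `log 0 = -∞`. -/
def logProb {α a : ℝ} (n : ℕ) (F : Set (ProbabilityMeasure RPlus × E α a)) : EReal :=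
  ((1 / ((2 * n : ℕ) : ℝ) ^ 2 : ℝ) : EReal) * ENNReal.log (gas α a n (event n F))

end CoulombGas

end

noncomputable section

namespace CoulombGas

/-! ### Sturm comparison -/

/-! The map `T` carries the gas to a circle. Written with the kernel `lk` of the circle, the
Vandermonde factors and the mutual product become exp(-`interact`), and each particle keeps only a
power of 1 + x² (`gasDensity_eq`). So the density is exp(-N² · energy) up to factors exp(o(N²)), and
the rate has to be the energy of the limiting measures. Three things stand in the way: the kernel is
singular, mass may escape to infinity, that is to the point (0,1), and the mutual energy enters with
a minus sign.

The mutual energy is tamed as follows. For x ≥ 0 > u the kernel is at most `absorb x` plus the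
positive part of log(1/|u|) (`lk_le`). The potential dominates the first term (`le_pot`). The second
is integrable uniformly over ℰ, because the positive zeros of J_α stay at distance at least 2 from
the origin and from each other (`lintegral_le_of_mem_E`). Hence the weakly continuous truncations
`phi a L` satisfy `phi` - `tau` ≤ `J` (`phi_sub_tau_le_J`), determine `J` in the limit
(`J_le_of_eventually`) and are coercive (`phi_coercive`). A level set of `J` is thus an intersection
of closed sets inside a tight set (`isCompact_level`). Tight sets are compact because ℰ is closed:
by Sturm comparison far zeros are spaced by almost π at least, so limits of measures below σ_N, N
unbounded, are below σ (`isClosed_E`).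

The minimizer is unique because `J` is the energy of μ - ν/2, plus 3/4 of the energy of ν, plus a
linear term, and the energy of a neutral charge is positive definite. This is read off a Fourier
expansion on the circle (`two_mul_en_add_le`). Finite energy excludes atoms, hence forces ν ≤ σ,
which is a convex condition.

For the upper bound, `phi_le_hamil` bounds the truncations at the empirical measures by the energy
of the configuration, and compactness (`exists_limit`) turns this into a bound on closed events
(`eventually_unnorm_event_le`).

For the lower bound, assume that μ has a bounded density and that ν ≤ (1-ε)σ, with compact supports
away from 0. Each quantile cell of ν then contains a rescaled Bessel zero
(`exists_besselSet_in_cells`). Independent points drawn in the cells of μ have the right mean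
energy, so Markov's inequality gives enough volume to configurations of nearly that energy
(`le_volume_cells`). Mollifying, truncating and mixing reach every pair, since the lower bound
survives limits along which the self-energies and the potential do not increase
(`lowerBound_of_tendsto`). Both bounds applied to the whole space give the partition function. -/

/-- Two zeros of a nontrivial solution of `v'' = -q v` with `q < ω²` are at distance at
least `π / ω`. -/
theorem sturm_gap {v v' q : ℝ → ℝ} {c d ω : ℝ} (hω : 0 < ω)
    (hv : ∀ x ∈ Icc c d, HasDerivAt v (v' x) x)
    (hv' : ∀ x ∈ Icc c d, HasDerivAt v' (-(q x * v x)) x)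
    (hq : ∀ x ∈ Ioo c d, q x < ω ^ 2) (hc : v c = 0) (hd : v d = 0)
    (hne : ∃ m ∈ Ioo c d, v m ≠ 0) : Real.pi / ω ≤ d - c := by
  by_contra! hlt
  obtain ⟨m, hm, hvm⟩ := hne
  wlog hpos : 0 < v m generalizing v v'
  · refine this (v := fun x => -v x) (v' := fun x => -v' x) (fun x hx => (hv x hx).neg)
      (fun x hx => by simpa using! (hv' x hx).neg) (by simp [hc]) (by simp [hd])
      (by simpa using hvm) ?_
    have := lt_of_le_of_ne (not_lt.mp hpos) hvm
    linarith
  have hcont : ContinuousOn v (Icc c d) := fun x hx => (hv x hx).continuousAt.continuousWithinAt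
  -- The zeros nearest to `m` on either side: `v` keeps its sign between them.
  obtain ⟨c', ⟨⟨hc'1, hc'0⟩, hc'2⟩⟩ : ∃ c', IsGreatest {x | x ∈ Icc c m ∧ v x = 0} c' := by
    apply IsCompact.exists_isGreatest (s := {x | x ∈ Icc c m ∧ v x = 0}) ?_
      ⟨c, ⟨le_rfl, hm.1.le⟩, hc⟩
    exact isCompact_Icc.of_isClosed_subset ((hcont.mono (Icc_subset_Icc_right hm.2.le)).preimage_isClosed_of_isClosed
      isClosed_Icc (isClosed_singleton (x := (0 : ℝ)))) fun x hx => hx.1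
  obtain ⟨d', ⟨⟨hd'1, hd'0⟩, hd'2⟩⟩ : ∃ d', IsLeast {x | x ∈ Icc m d ∧ v x = 0} d' := by
    apply IsCompact.exists_isLeast (s := {x | x ∈ Icc m d ∧ v x = 0}) ?_
      ⟨d, ⟨hm.2.le, le_rfl⟩, hd⟩
    exact isCompact_Icc.of_isClosed_subset ((hcont.mono (Icc_subset_Icc_left hm.1.le)).preimage_isClosed_of_isClosed
      isClosed_Icc (isClosed_singleton (x := (0 : ℝ)))) fun x hx => hx.1
  have hc'm : c' < m := lt_of_le_of_ne hc'1.2 (by rintro rfl; exact hvm hc'0)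
  have hmd' : m < d' := lt_of_le_of_ne hd'1.1 (by rintro rfl; exact hvm hd'0)
  have hsub : Icc c' d' ⊆ Icc c d := Icc_subset_Icc hc'1.1 hd'1.2
  have hvpos : ∀ x ∈ Ioo c' d', 0 < v x := by
    intro x hx
    by_contra! hx0
    rcases le_total x m with hxm | hxm
    · obtain ⟨z, hz, hz0⟩ := intermediate_value_Icc hxm
        (hcont.mono (Icc_subset_Icc (hc'1.1.trans hx.1.le) hm.2.le)) (show (0:ℝ) ∈ Icc (v x) (v m)
          from ⟨hx0, hpos.le⟩)
      have := hc'2 ⟨⟨hc'1.1.trans (hx.1.le.trans hz.1), hz.2⟩, hz0⟩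
      linarith [hx.1, hz.1]
    · obtain ⟨z, hz, hz0⟩ := intermediate_value_Icc' hxm
        (hcont.mono (Icc_subset_Icc hm.1.le (hx.2.le.trans hd'1.2))) (show (0:ℝ) ∈ Icc (v x) (v m)
          from ⟨hx0, hpos.le⟩)
      have := hd'2 ⟨⟨hz.1, (hz.2.trans hx.2.le).trans hd'1.2⟩, hz0⟩
      linarith [hx.2, hz.2]
  -- Wronskian of `v` with the comparison solution sin(ω(x - c')). It increases strictly as long as
  -- the sine is positive, yet it vanishes at `c'` and is nonpositive at `d'`, where `v` decreases
  -- to 0.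
  set W : ℝ → ℝ := fun x => v' x * Real.sin (ω * (x - c')) - v x * (ω * Real.cos (ω * (x - c')))
  have hlin : ∀ x : ℝ, HasDerivAt (fun x => ω * (x - c')) ω x := fun x => by
    simpa using ((hasDerivAt_id x).sub_const c').const_mul ω
  have hW : ∀ x ∈ Icc c' d', HasDerivAt W ((ω ^ 2 - q x) * v x * Real.sin (ω * (x - c'))) x := by
    intro x hx
    have h1 := (hv' x (hsub hx)).mul (hlin x).sin
    have h2 := (hv x (hsub hx)).mul ((hlin x).cos.const_mul ω)
    refine (h1.sub h2).congr_deriv ?_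
    ring
  have hsin : ∀ x ∈ Ioc c' d', 0 < Real.sin (ω * (x - c')) := by
    intro x hx
    apply Real.sin_pos_of_pos_of_lt_pi (mul_pos hω (sub_pos.mpr hx.1))
    have : x - c' < Real.pi / ω := by linarith [hx.2, hd'1.2, hc'1.1]
    rwa [lt_div_iff₀ hω, mul_comm] at this
  have hmono : StrictMonoOn W (Icc c' d') := by
    apply strictMonoOn_of_deriv_pos (convex_Icc c' d')
      fun x hx => (hW x hx).continuousAt.continuousWithinAt
    intro x hx
    rw [interior_Icc] at hx
    rw [(hW x (Ioo_subset_Icc_self hx)).deriv]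
    have := hq x ⟨hc'1.1.trans_lt hx.1, hx.2.trans_le hd'1.2⟩
    exact mul_pos (mul_pos (by linarith) (hvpos x hx)) (hsin x ⟨hx.1, hx.2.le⟩)
  have hlt' := hmono (left_mem_Icc.mpr (hc'm.trans hmd').le)
    (right_mem_Icc.mpr (hc'm.trans hmd').le) (hc'm.trans hmd')
  have hv'd : v' d' ≤ 0 := by
    have hder := (hv d' (hsub (right_mem_Icc.mpr (hc'm.trans hmd').le))).hasDerivWithinAt (s := Iio d')
    rw [hasDerivWithinAt_iff_tendsto_slope' (by simp)] at hder
    refine le_of_tendsto hder ?_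
    filter_upwards [Ioo_mem_nhdsLT (hc'm.trans hmd')] with x hx
    rw [slope_def_field, hd'0]
    exact div_nonpos_of_nonneg_of_nonpos (by linarith [hvpos x hx]) (by linarith [hx.2])
  have hs := hsin d' ⟨hc'm.trans hmd', le_rfl⟩
  simp only [W, sub_self, mul_zero, Real.sin_zero, hc'0, hd'0, zero_mul, sub_zero] at hlt'
  nlinarith

/-- A solution of `v'' = -q v` with `ω² ≤ q` has a zero in each interval of length `π / ω`. -/
theorem sturm_exists {v v' q : ℝ → ℝ} {c ω : ℝ} (hω : 0 < ω)
    (hv : ∀ x ∈ Icc c (c + Real.pi / ω), HasDerivAt v (v' x) x)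
    (hv' : ∀ x ∈ Icc c (c + Real.pi / ω), HasDerivAt v' (-(q x * v x)) x)
    (hq : ∀ x ∈ Icc c (c + Real.pi / ω), ω ^ 2 ≤ q x) :
    ∃ x ∈ Icc c (c + Real.pi / ω), v x = 0 := by
  by_contra! hne
  have hlen : c < c + Real.pi / ω := by have := Real.pi_pos; linarith [div_pos this hω]
  set d := c + Real.pi / ω
  wlog hpos : 0 < v c generalizing v v'
  · refine this (v := fun x => -v x) (v' := fun x => -v' x) (fun x hx => (hv x hx).neg)
      (fun x hx => by simpa using! (hv' x hx).neg) (by simpa using hne) ?_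
    have := lt_of_le_of_ne (not_lt.mp hpos) (hne c (left_mem_Icc.mpr hlen.le))
    linarith
  have hcont : ContinuousOn v (Icc c d) := fun x hx => (hv x hx).continuousAt.continuousWithinAt
  have hvpos : ∀ x ∈ Icc c d, 0 < v x := by
    intro x hx
    by_contra! hx0
    obtain ⟨z, hz, hz0⟩ := intermediate_value_Icc' hx.1
      (hcont.mono (Icc_subset_Icc le_rfl hx.2)) (show (0:ℝ) ∈ Icc (v x) (v c) from ⟨hx0, hpos.le⟩)
    exact hne z ⟨hz.1, hz.2.trans hx.2⟩ hz0
  -- The same Wronskian now decreases, but it equals -ω v(c) < 0 at `c` and ω v(d) > 0 at `d`, half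
  -- a period later.
  set W : ℝ → ℝ := fun x => v' x * Real.sin (ω * (x - c)) - v x * (ω * Real.cos (ω * (x - c)))
  have hlin : ∀ x : ℝ, HasDerivAt (fun x => ω * (x - c)) ω x := fun x => by
    simpa using ((hasDerivAt_id x).sub_const c).const_mul ω
  have hW : ∀ x ∈ Icc c d, HasDerivAt W ((ω ^ 2 - q x) * v x * Real.sin (ω * (x - c))) x := by
    intro x hx
    have h1 := (hv' x hx).mul (hlin x).sin
    have h2 := (hv x hx).mul ((hlin x).cos.const_mul ω)
    refine (h1.sub h2).congr_deriv ?_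
    ring
  have hanti : AntitoneOn W (Icc c d) := by
    apply antitoneOn_of_deriv_nonpos (convex_Icc c d)
      (fun x hx => (hW x hx).continuousAt.continuousWithinAt)
      (fun x hx => (hW x (interior_subset hx)).differentiableAt.differentiableWithinAt)
    intro x hx
    rw [interior_Icc] at hx
    have hx' := Ioo_subset_Icc_self hx
    rw [(hW x hx').deriv]
    refine mul_nonpos_of_nonpos_of_nonneg (mul_nonpos_of_nonpos_of_nonneg ?_ (hvpos x hx').le) ?_
    · linarith [hq x hx']
    · apply Real.sin_nonneg_of_nonneg_of_le_pi (mul_nonneg hω.le (sub_nonneg.mpr hx'.1))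
      have : x - c ≤ Real.pi / ω := by simp only [d] at hx'; linarith [hx'.2]
      rwa [le_div_iff₀ hω, mul_comm] at this
  have h := hanti (left_mem_Icc.mpr hlen.le) (right_mem_Icc.mpr hlen.le) hlen.le
  have e : ω * (d - c) = Real.pi := by simp only [d]; field_simp; ring
  simp only [W, e, sub_self, mul_zero, Real.sin_zero, Real.sin_pi, Real.cos_pi, Real.cos_zero] at h
  nlinarith [hvpos d (right_mem_Icc.mpr hlen.le), mul_pos hω hpos,
    mul_pos hω (hvpos d (right_mem_Icc.mpr hlen.le))]

/-! ### The entire function behind the Bessel function -/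

/-- Coefficients of the entire function `besselF`. -/
def besselCoeff (α : ℝ) (k : ℕ) : ℝ := (-1) ^ k / ((k.factorial : ℝ) * Real.Gamma (k + α + 1))

/-- The entire function `F` with `J_α(x) = (x/2)^α F(x²/4)`. -/
def besselF (α z : ℝ) : ℝ := ∑' k : ℕ, besselCoeff α k * z ^ k

/-- The positive minimum of `Γ` on the positive half-line. -/
theorem exists_gamma_lower : ∃ c : ℝ, 0 < c ∧ ∀ x : ℝ, 1 ≤ x → c ≤ Real.Gamma x := by
  obtain ⟨x₀, hx₀, hmin⟩ := isCompact_Icc.exists_isMinOn (nonempty_Icc.mpr (by norm_num : (1:ℝ) ≤ 2))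
    (fun x hx => (Real.differentiableAt_Gamma (s := x) (fun m => by
      have := hx.1; have : (0:ℝ) ≤ m := m.cast_nonneg; intro h; linarith)).continuousAt.continuousWithinAt)
  have hpos : 0 < Real.Gamma x₀ := Real.Gamma_pos_of_pos (by linarith [hx₀.1])
  refine ⟨min (Real.Gamma x₀) 1, lt_min hpos one_pos, fun x hx => ?_⟩
  rcases le_total x 2 with h | h
  · exact (min_le_left _ _).trans (hmin ⟨hx, h⟩)
  · refine (min_le_right _ _).trans ?_
    have := Real.Gamma_strictMonoOn_Ici.monotoneOn (self_mem_Ici) (mem_Ici.mpr h) h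
    rwa [Real.Gamma_two] at this

theorem abs_besselCoeff_le {α : ℝ} (hα : 0 ≤ α) :
    ∃ C : ℝ, 0 ≤ C ∧ ∀ k, |besselCoeff α k| ≤ C / k.factorial := by
  obtain ⟨c, hc, h⟩ := exists_gamma_lower
  refine ⟨1 / c, by positivity, fun k => ?_⟩
  have h1 : c ≤ Real.Gamma (k + α + 1) := h _ (by have : (0:ℝ) ≤ k := k.cast_nonneg; linarith)
  have hk : (0:ℝ) < k.factorial := by positivity
  rw [besselCoeff, abs_div, abs_pow, abs_neg, abs_one, one_pow,
    abs_of_pos (mul_pos hk (hc.trans_le h1)), div_div]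
  rw [mul_comm c]
  gcongr

theorem summable_besselF {α : ℝ} (hα : 0 ≤ α) (z : ℝ) :
    Summable fun k : ℕ => besselCoeff α k * z ^ k := by
  obtain ⟨C, hC, h⟩ := abs_besselCoeff_le hα
  refine Summable.of_norm_bounded (((Real.summable_pow_div_factorial |z|)).mul_left C) fun k => ?_
  rw [norm_mul, norm_pow, Real.norm_eq_abs, Real.norm_eq_abs]
  calc _ ≤ C / k.factorial * |z| ^ k := by gcongr; exact h k
    _ = _ := by ring

theorem besselCoeff_succ {α : ℝ} (k : ℕ) :
    besselCoeff α (k + 1) * (k + 1) = -besselCoeff (α + 1) k := by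
  simp only [besselCoeff, Nat.factorial_succ, Nat.cast_mul, Nat.cast_add, Nat.cast_one, pow_succ]
  rw [show (k : ℝ) + 1 + α + 1 = k + (α + 1) + 1 by ring]
  have : (k : ℝ) + 1 ≠ 0 := by positivity
  -- No sign condition on `α` is available here; if the Gamma value is 0, both sides vanish because
  -- division by zero gives 0.
  by_cases hG : Real.Gamma (k + (α + 1) + 1) = 0
  · simp [hG]
  have hk : (k.factorial : ℝ) ≠ 0 := by positivity
  field_simp

theorem hasDerivAt_besselF {α : ℝ} (hα : 0 ≤ α) (z : ℝ) :
    HasDerivAt (besselF α) (-besselF (α + 1) z) z := by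
  obtain ⟨C, hC, h⟩ := abs_besselCoeff_le hα
  obtain ⟨C', hC', h'⟩ := abs_besselCoeff_le (α := α + 1) (by linarith)
  set R := |z| + 1
  have hz : z ∈ Metric.ball (0:ℝ) R := by simp [R]
  have key := hasDerivAt_tsum_of_isPreconnected
    (u := fun k : ℕ => (if k = 0 then 0 else C' * (R ^ (k - 1) / (k-1).factorial)))
    (g := fun k z => besselCoeff α k * z ^ k)
    (g' := fun k z => besselCoeff α k * (k * z ^ (k - 1))) (t := Metric.ball 0 R) (y₀ := 0) (y := z)
    ?_ Metric.isOpen_ball (convex_ball 0 R).isPreconnected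
    (fun k y _ => (hasDerivAt_pow k y).const_mul _) ?_ (by simp [R]; positivity)
    (summable_besselF hα 0) hz
  · refine key.congr_deriv ?_
    have hs : Summable fun k : ℕ => besselCoeff α k * (k * z ^ (k - 1)) := by
      rw [← summable_nat_add_iff 1]
      refine (summable_besselF (α := α + 1) (by linarith) z).neg.congr fun k => ?_
      rw [← neg_mul, ← besselCoeff_succ]; push_cast; ring
    rw [hs.tsum_eq_zero_add, besselF, ← tsum_neg]
    simp only [CharP.cast_eq_zero, zero_mul, mul_zero, zero_add]
    refine tsum_congr fun k => ?_
    rw [← neg_mul, ← besselCoeff_succ]; push_cast; ring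
  · rw [← summable_nat_add_iff 1]
    simpa using (Real.summable_pow_div_factorial R).mul_left C'
  · intro k y hy
    rcases k with _ | k
    · simp
    · simp only [Nat.add_eq_zero_iff, one_ne_zero, and_false, if_false, Nat.add_sub_cancel]
      rw [show besselCoeff α (k+1) * (((k + 1 : ℕ) : ℝ) * y ^ k) = -besselCoeff (α+1) k * y ^ k by
        rw [← besselCoeff_succ]; push_cast; ring]
      rw [norm_mul, norm_neg, norm_pow, Real.norm_eq_abs, Real.norm_eq_abs]
      have : |y| ≤ R := by simpa using (mem_ball_zero_iff.mp hy).le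
      calc _ ≤ C' / k.factorial * R ^ k := by gcongr; exact h' k
        _ = _ := by ring

/-- Since F' = -F_{α+1} and F'' = F_{α+2}, this is the differential equation z F'' + (α+1) F' + F =
0, that is Bessel's equation in the variable z = x²/4. -/
theorem besselF_recurrence {α : ℝ} (hα : 0 ≤ α) (z : ℝ) :
    besselF α z = (α + 1) * besselF (α + 1) z - z * besselF (α + 2) z := by
  have h1 := (summable_besselF (α := α + 1) (by linarith) z).mul_left (α + 1)
  have h2 := (summable_besselF (α := α + 2) (by linarith) z).mul_left z
  have h3 : Summable fun k : ℕ => -(besselCoeff (α + 1) k * k * z ^ k) := by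
    rw [← summable_nat_add_iff 1]
    refine h2.congr fun k => ?_
    have := besselCoeff_succ (α := α + 1) k
    rw [show α + 1 + 1 = α + 2 by ring] at this
    push_cast; rw [this]; ring
  have h4 : z * besselF (α + 2) z = ∑' k : ℕ, -(besselCoeff (α + 1) k * k * z ^ k) := by
    rw [h3.tsum_eq_zero_add, besselF, ← tsum_mul_left]
    simp only [CharP.cast_eq_zero, zero_mul, mul_zero, neg_zero, zero_add]
    refine tsum_congr fun k => ?_
    have := besselCoeff_succ (α := α + 1) k
    rw [show α + 1 + 1 = α + 2 by ring] at this
    push_cast; rw [this]; ring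
  rw [h4, besselF, besselF, ← tsum_mul_left, ← h1.tsum_sub h3]
  refine tsum_congr fun k => ?_
  have hG : Real.Gamma (k + (α + 1) + 1) = (k + α + 1) * Real.Gamma (k + α + 1) := by
    rw [← Real.Gamma_add_one (by positivity)]; congr 1; ring
  simp only [besselCoeff]
  rw [hG]
  have : (k : ℝ) + α + 1 ≠ 0 := by positivity
  have : Real.Gamma (k + α + 1) ≠ 0 := (Real.Gamma_pos_of_pos (by positivity)).ne'
  have hk : (k.factorial : ℝ) ≠ 0 := by positivity
  field_simp
  ring

theorem besselJ_eq {α x : ℝ} (hx : 0 < x) :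
    besselJ α x = (x / 2) ^ α * besselF α (x ^ 2 / 4) := by
  rw [besselJ, besselF, ← tsum_mul_left]
  refine tsum_congr fun k => ?_
  rw [Real.rpow_add (by positivity), besselCoeff]
  have : (x / 2) ^ (2 * (k : ℝ)) = (x ^ 2 / 4) ^ k := by
    rw [show (2 * (k:ℝ)) = ((2 * k : ℕ) : ℝ) by push_cast; ring, Real.rpow_natCast, pow_mul]
    congr 1; ring
  rw [this]; ring

theorem besselJ_eq_zero_iff {α x : ℝ} (hx : 0 < x) :
    besselJ α x = 0 ↔ besselF α (x ^ 2 / 4) = 0 := by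
  rw [besselJ_eq hx, mul_eq_zero, or_iff_right (Real.rpow_pos_of_pos (by positivity) _).ne']

/-- For z < 1 the series is alternating with decreasing terms, hence at least its first two terms b₀
- b₁, and b₁ ≤ z b₀. -/
theorem besselF_pos {α z : ℝ} (hα : 0 ≤ α) (hz : 0 ≤ z) (hz1 : z < 1) : 0 < besselF α z := by
  set b : ℕ → ℝ := fun k => z ^ k / ((k.factorial : ℝ) * Real.Gamma (k + α + 1))
  have hG : ∀ k : ℕ, 0 < Real.Gamma (k + α + 1) := fun k => Real.Gamma_pos_of_pos (by positivity)
  have hb : ∀ k, besselCoeff α k * z ^ k = (-1) ^ k * b k := fun k => by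
    simp only [besselCoeff, b]; ring
  have hsucc : ∀ k, b (k + 1) = b k * (z / ((k + 1) * (k + α + 1))) := fun k => by
    simp only [b, Nat.factorial_succ]
    push_cast
    rw [show (k : ℝ) + 1 + α + 1 = (k + α + 1) + 1 by ring, Real.Gamma_add_one (by positivity)]
    have := (hG k).ne'
    have : (k : ℝ) + α + 1 ≠ 0 := by positivity
    field_simp
    ring
  have hfac : ∀ k : ℕ, z / (((k : ℝ) + 1) * (k + α + 1)) ≤ z := fun k => by
    apply div_le_self hz
    have : (0:ℝ) ≤ k := k.cast_nonneg
    nlinarith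
  have hb0 : ∀ k, 0 ≤ b k := fun k => by have := hG k; positivity
  have hanti : Antitone b := antitone_nat_of_succ_le fun k => by
    rw [hsucc]; exact mul_le_of_le_one_right (hb0 k) ((hfac k).trans hz1.le)
  have hsum : Tendsto (fun n ↦ ∑ i ∈ Finset.range n, (-1) ^ i * b i) atTop (𝓝 (besselF α z)) := by
    simpa only [← hb] using! (summable_besselF hα z).hasSum.tendsto_sum_nat
  have h := hanti.alternating_series_le_tendsto hsum 1
  have h0 : 0 < b 0 := by simp only [b]; have := hG 0; positivity
  have e := hsucc 0
  simp only [mul_one, Finset.sum_range_succ, Finset.sum_range_zero, pow_zero, one_mul, pow_one, zero_add,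
    neg_mul] at h
  rw [zero_add] at e
  rw [e] at h
  have := hfac 0
  nlinarith

/-- The square of a positive zero of the Bessel function is at least `4`. -/
theorem two_le_of_besselJ_eq_zero {α x : ℝ} (hα : 0 ≤ α) (hx : 0 < x) (h : besselJ α x = 0) :
    2 ≤ x := by
  by_contra! hlt
  rw [besselJ_eq_zero_iff hx] at h
  have := besselF_pos (z := x ^ 2 / 4) hα (by positivity) (by nlinarith)
  linarith

/-! ### Bessel's equation in normal form and the spacing of the zeros -/

/-- `√x J_α(x)` up to a constant. -/
def besselV (α x : ℝ) : ℝ := x ^ (α + 1 / 2) * besselF α (x ^ 2 / 4)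

/-- The derivative of `besselV`. -/
def besselV' (α x : ℝ) : ℝ :=
  (α + 1 / 2) * x ^ (α - 1 / 2) * besselF α (x ^ 2 / 4)
    - x ^ (α + 3 / 2) / 2 * besselF (α + 1) (x ^ 2 / 4)

theorem hasDerivAt_besselV {α x : ℝ} (hα : 0 ≤ α) (hx : 0 < x) :
    HasDerivAt (besselV α) (besselV' α x) x := by
  have h2 : HasDerivAt (fun x : ℝ => x ^ 2 / 4) (x / 2) x :=
    ((hasDerivAt_pow 2 x).div_const 4).congr_deriv (by push_cast; ring)
  have hF := (hasDerivAt_besselF hα (x ^ 2 / 4)).comp x h2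
  refine ((Real.hasDerivAt_rpow_const (p := α + 1 / 2) (Or.inl hx.ne')).mul hF).congr_deriv ?_
  rw [besselV', show α + 3 / 2 = (α + 1/2) + 1 by ring, Real.rpow_add_one hx.ne' (α + 1/2),
    show α + 1 / 2 - 1 = α - 1 / 2 by ring]
  simp only [Function.comp]
  ring

/-- The factor √x removes the first-order term of Bessel's equation, leaving v'' = -q v with q = 1 +
(1/4 - α²)/x², to which Sturm comparison applies; q tends to 1, whence the asymptotic spacing π. -/
theorem hasDerivAt_besselV' {α x : ℝ} (hα : 0 ≤ α) (hx : 0 < x) :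
    HasDerivAt (besselV' α) (-((1 + (1 / 4 - α ^ 2) / x ^ 2) * besselV α x)) x := by
  have h2 : HasDerivAt (fun x : ℝ => x ^ 2 / 4) (x / 2) x :=
    ((hasDerivAt_pow 2 x).div_const 4).congr_deriv (by push_cast; ring)
  have hF := (hasDerivAt_besselF hα (x ^ 2 / 4)).comp x h2
  have hF1 := (hasDerivAt_besselF (α := α + 1) (by linarith) (x ^ 2 / 4)).comp x h2
  refine ((((Real.hasDerivAt_rpow_const (p := α - 1 / 2) (Or.inl hx.ne')).const_mul
    (α + 1 / 2)).mul hF).sub (((Real.hasDerivAt_rpow_const (p := α + 3 / 2)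
      (Or.inl hx.ne')).div_const 2).mul hF1)).congr_deriv ?_
  simp only [besselV, Function.comp]
  rw [besselF_recurrence hα]
  rw [show α + 1 + 1 = α + 2 by ring]
  set A := besselF (α + 1) (x ^ 2 / 4)
  set B := besselF (α + 2) (x ^ 2 / 4)
  have e1 : x ^ (α - 1 / 2) = x ^ (α - 1 / 2 - 1) * x := by
    rw [← Real.rpow_add_one hx.ne']; congr 1; ring
  have e2 : x ^ (α + 1 / 2) = x ^ (α - 1 / 2 - 1) * x ^ 2 := by
    rw [← Real.rpow_natCast, ← Real.rpow_add hx]; congr 1; push_cast; ring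
  have e3 : x ^ (α + 3 / 2 - 1) = x ^ (α - 1 / 2 - 1) * x ^ 2 := by
    rw [← Real.rpow_natCast, ← Real.rpow_add hx]; congr 1; push_cast; ring
  have e4 : x ^ (α + 3 / 2) = x ^ (α - 1 / 2 - 1) * x ^ 3 := by
    rw [← Real.rpow_natCast, ← Real.rpow_add hx]; congr 1; push_cast; ring
  rw [e1, e2, e3, e4]
  set t := x ^ (α - 1 / 2 - 1)
  field_simp
  ring

theorem analyticOnNhd_besselF {α : ℝ} (hα : 0 ≤ α) : AnalyticOnNhd ℝ (besselF α) univ := by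
  have hr : (FormalMultilinearSeries.ofScalars ℝ (besselCoeff α)).radius = ⊤ := by
    rw [FormalMultilinearSeries.radius_eq_top_iff_summable_norm]
    intro r
    refine ((summable_besselF hα r).norm).congr fun k => ?_
    rw [FormalMultilinearSeries.ofScalars_norm, norm_mul, norm_pow]
    simp
  have h := (FormalMultilinearSeries.ofScalars ℝ (besselCoeff α)).hasFPowerSeriesOnBall
    (by rw [hr]; exact ENNReal.zero_lt_top)
  have e : (FormalMultilinearSeries.ofScalars ℝ (besselCoeff α)).sum = besselF α := by
    ext z
    simp only [FormalMultilinearSeries.sum, FormalMultilinearSeries.ofScalars_apply_eq, smul_eq_mul, besselF]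
  rw [e, hr] at h
  have := h.analyticOnNhd
  simpa using this

/-- By the identity theorem: an analytic F vanishing on an interval would vanish at 0, where it is
positive. This is the nontriviality required by `sturm_gap`. -/
theorem exists_besselV_ne_zero {α c d : ℝ} (hα : 0 ≤ α) (hc : 0 < c) (hcd : c < d) :
    ∃ m ∈ Ioo c d, besselV α m ≠ 0 := by
  by_contra! h
  have hz : ∀ z ∈ Ioo (c ^ 2 / 4) (d ^ 2 / 4), besselF α z = 0 := by
    intro z hz
    have hz0 : 0 < z := lt_trans (by positivity) hz.1
    have h1 : 2 * √z ∈ Ioo c d := by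
      constructor
      · rw [← Real.sqrt_sq hc.le, show (2:ℝ) = √4 by
          rw [show (4:ℝ) = 2 ^ 2 by norm_num, Real.sqrt_sq (by norm_num)], ← Real.sqrt_mul (by norm_num)]
        exact Real.sqrt_lt_sqrt (by positivity) (by linarith [hz.1])
      · rw [← Real.sqrt_sq (hc.trans hcd).le, show (2:ℝ) = √4 by
          rw [show (4:ℝ) = 2 ^ 2 by norm_num, Real.sqrt_sq (by norm_num)], ← Real.sqrt_mul (by norm_num)]
        exact Real.sqrt_lt_sqrt (by positivity) (by linarith [hz.2])
    have h2 := h _ h1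
    rw [besselV, mul_eq_zero, or_iff_right (Real.rpow_pos_of_pos (by positivity) _).ne', mul_pow,
      Real.sq_sqrt hz0.le] at h2
    rwa [show (2:ℝ) ^ 2 * z / 4 = z by ring] at h2
  have hlt : c ^ 2 / 4 < d ^ 2 / 4 := by nlinarith
  obtain ⟨m, hm⟩ := exists_between hlt
  have := (analyticOnNhd_besselF hα).eqOn_zero_of_preconnected_of_eventuallyEq_zero
    isPreconnected_univ (mem_univ m) (by
      filter_upwards [Ioo_mem_nhds hm.1 hm.2] with z hz' using hz z hz') (mem_univ 0)
  have h0 := besselF_pos (z := 0) hα le_rfl one_pos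
  simp only [Pi.zero_apply] at this
  linarith

theorem besselV_eq_zero_iff {α x : ℝ} (hx : 0 < x) : besselV α x = 0 ↔ besselJ α x = 0 := by
  rw [besselJ_eq_zero_iff hx, besselV, mul_eq_zero,
    or_iff_right (Real.rpow_pos_of_pos (by positivity) _).ne']

/-- Spacing of the Bessel zeros beyond `R`. -/
theorem besselJ_zero_gap {α R c d : ℝ} (hα : 0 ≤ α) (hR : 0 < R) (hc : R ≤ c) (hcd : c < d)
    (h1 : besselJ α c = 0) (h2 : besselJ α d = 0) :
    Real.pi / √(1 + 1 / (4 * R ^ 2)) ≤ d - c := by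
  have hc0 := hR.trans_le hc
  refine sturm_gap (v := besselV α) (v' := besselV' α) (q := fun x => 1 + (1 / 4 - α ^ 2) / x ^ 2)
    (Real.sqrt_pos.mpr (by positivity)) (fun x hx => hasDerivAt_besselV hα (hc0.trans_le hx.1))
    (fun x hx => hasDerivAt_besselV' hα (hc0.trans_le hx.1)) (fun x hx => ?_)
    ((besselV_eq_zero_iff hc0).mpr h1) ((besselV_eq_zero_iff (hc0.trans hcd)).mpr h2)
    (exists_besselV_ne_zero hα hc0 hcd)
  rw [Real.sq_sqrt (by positivity)]
  have hx0 : 0 < x := hc0.trans hx.1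
  have hxR : R < x := hc.trans_lt hx.1
  have : (1 / 4 - α ^ 2) / x ^ 2 ≤ (1 / 4) / x ^ 2 := by gcongr; nlinarith
  have : (1 / 4 : ℝ) / x ^ 2 < (1 / 4) / R ^ 2 := by gcongr
  have : (1 / 4 : ℝ) / R ^ 2 = 1 / (4 * R ^ 2) := by field_simp
  linarith

/-- A crude spacing valid for all zeros at once. They lie beyond R = 2, where the Sturm frequency
√(1 + 1/16) is at most 3/2, and π/(3/2) ≥ 2. -/
theorem besselJ_zero_gap_two {α c d : ℝ} (hα : 0 ≤ α) (hc : 0 < c) (hcd : c < d)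
    (h1 : besselJ α c = 0) (h2 : besselJ α d = 0) : 2 ≤ d - c := by
  refine le_trans ?_ (besselJ_zero_gap hα two_pos (two_le_of_besselJ_eq_zero hα hc h1) hcd h1 h2)
  have hs : √(1 + 1 / (4 * 2 ^ 2) : ℝ) ≤ 3 / 2 := by
    rw [Real.sqrt_le_left (by norm_num)]; norm_num
  rw [le_div_iff₀ (Real.sqrt_pos.mpr (by positivity))]
  linarith [Real.pi_gt_three]

/-- Existence of Bessel zeros far away. -/
theorem exists_besselJ_zero {α ω : ℝ} (hα : 0 ≤ α) (hω : 0 < ω) (hω1 : ω < 1) :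
    ∃ R : ℝ, 0 < R ∧ ∀ y, R ≤ y → ∃ j ∈ Icc y (y + Real.pi / ω), besselJ α j = 0 := by
  -- Beyond this point (α² - 1/4)/x² ≤ 1 - ω², so the coefficient of the equation is at least ω².
  refine ⟨(α + 1) / √(1 - ω ^ 2), ?_, fun y hy => ?_⟩
  · have : 0 < 1 - ω ^ 2 := by nlinarith
    have := Real.sqrt_pos.mpr this
    positivity
  have h1 : 0 < 1 - ω ^ 2 := by nlinarith
  have h2 := Real.sqrt_pos.mpr h1
  have hy0 : 0 < y := lt_of_lt_of_le (by positivity) hy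
  have hq : ∀ x ∈ Icc y (y + Real.pi / ω), ω ^ 2 ≤ 1 + (1 / 4 - α ^ 2) / x ^ 2 := by
    intro x hx
    have hx0 := hy0.trans_le hx.1
    rw [div_le_iff₀ h2] at hy
    have h3 : α + 1 ≤ x * √(1 - ω ^ 2) := hy.trans (by gcongr; exact hx.1)
    have h4 : (α + 1) ^ 2 ≤ x ^ 2 * (1 - ω ^ 2) := by
      calc _ ≤ (x * √(1 - ω ^ 2)) ^ 2 := by gcongr
        _ = _ := by rw [mul_pow, Real.sq_sqrt h1.le]
    have h5 : -(1 - ω ^ 2) ≤ (1 / 4 - α ^ 2) / x ^ 2 := by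
      rw [le_div_iff₀ (by positivity)]; nlinarith
    linarith
  obtain ⟨j, hj, hj0⟩ := sturm_exists (v := besselV α) (v' := besselV' α) hω
    (fun x hx => hasDerivAt_besselV hα (hy0.trans_le hx.1))
    (fun x hx => hasDerivAt_besselV' hα (hy0.trans_le hx.1)) hq
  exact ⟨j, hj, (besselV_eq_zero_iff (hy0.trans_le hj.1)).mp hj0⟩

/-! ### Bounds for the weight -/

theorem exists_factorial_le_gamma {α : ℝ} (hα : 0 ≤ α) :
    ∃ c : ℝ, 0 < c ∧ ∀ k : ℕ, c * k.factorial ≤ Real.Gamma (k + α + 1) := by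
  obtain ⟨c, hc, h⟩ := exists_gamma_lower
  refine ⟨min c 1, lt_min hc one_pos, fun k => ?_⟩
  rcases k with _ | k
  · simp only [Nat.factorial_zero, Nat.cast_one, mul_one, CharP.cast_eq_zero, zero_add]
    exact (min_le_left _ _).trans (h _ (by linarith))
  · have hk : (0:ℝ) ≤ k := k.cast_nonneg
    have h1 : Real.Gamma (((k + 1 : ℕ) : ℝ) + 1) ≤ Real.Gamma (((k + 1 : ℕ) : ℝ) + α + 1) := by
      apply Real.Gamma_strictMonoOn_Ici.monotoneOn
      · simp only [mem_Ici]; push_cast; linarith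
      · simp only [mem_Ici]; push_cast; linarith
      · linarith
    rw [Real.Gamma_nat_eq_factorial] at h1
    refine le_trans ?_ h1
    exact mul_le_of_le_one_left (by positivity) (min_le_right _ _)

theorem exists_gamma_le_factorial {α : ℝ} (hα : 0 ≤ α) :
    ∃ D : ℝ, 0 < D ∧ ∃ m : ℕ, ∀ k : ℕ,
      Real.Gamma (k + α + 1) ≤ D * k.factorial * ((k : ℝ) + m + 1) ^ m := by
  refine ⟨max (Real.Gamma (α + 1)) 1, by positivity, ⌈α⌉₊, fun k => ?_⟩
  set m := ⌈α⌉₊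
  have hm : α ≤ m := Nat.le_ceil α
  rcases k with _ | k
  · simp only [Nat.factorial_zero, Nat.cast_one, mul_one, CharP.cast_eq_zero, zero_add]
    exact (le_max_left _ _).trans (le_mul_of_one_le_right (by positivity)
      (one_le_pow₀ (by linarith [(m.cast_nonneg : (0:ℝ) ≤ m)])))
  · have hk : (0:ℝ) ≤ k := k.cast_nonneg
    have h1 : Real.Gamma (((k + 1 : ℕ) : ℝ) + α + 1) ≤ Real.Gamma (((k + 1 + m : ℕ) : ℝ) + 1) := by
      apply Real.Gamma_strictMonoOn_Ici.monotoneOn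
      · simp only [mem_Ici]; push_cast; linarith
      · simp only [mem_Ici]; push_cast; linarith
      · push_cast; linarith
    rw [Real.Gamma_nat_eq_factorial] at h1
    refine h1.trans ?_
    have h2 : ((k + 1 + m).factorial : ℝ) ≤ (k + 1).factorial * ((k + 1 + m : ℕ) : ℝ) ^ m := by
      rw [← Nat.factorial_mul_ascFactorial]
      push_cast
      gcongr
      exact_mod_cast Nat.ascFactorial_le_pow_add (k + 1) m
    refine h2.trans ?_
    have h3 : ((k + 1 + m : ℕ) : ℝ) ^ m ≤ (((k + 1 : ℕ) : ℝ) + m + 1) ^ m := by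
      gcongr; push_cast; linarith
    calc _ ≤ ((k + 1).factorial : ℝ) * (((k + 1 : ℕ) : ℝ) + m + 1) ^ m := by gcongr
      _ ≤ max (Real.Gamma (α + 1)) 1 * ((k + 1).factorial * (((k + 1 : ℕ) : ℝ) + m + 1) ^ m) :=
        le_mul_of_one_le_left (by positivity) (le_max_right _ _)
      _ = _ := by ring

/-- The terms of the series of the modified Bessel function. -/
def besselITerm (α t : ℝ) (k : ℕ) : ℝ :=
  t ^ α * ((t ^ k) ^ 2 / ((k.factorial : ℝ) * Real.Gamma (k + α + 1)))

theorem besselI_eq {α y : ℝ} (hy : 0 < y) : besselI α y = ∑' k, besselITerm α (y / 2) k := by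
  rw [besselI]
  refine tsum_congr fun k => ?_
  rw [Real.rpow_add (by positivity), besselITerm]
  have : (y / 2) ^ (2 * (k : ℝ)) = ((y / 2) ^ k) ^ 2 := by
    rw [show (2 * (k:ℝ)) = ((k * 2 : ℕ) : ℝ) by push_cast; ring, Real.rpow_natCast, pow_mul]
  rw [this]; ring

theorem besselITerm_nonneg {α t : ℝ} (hα : 0 ≤ α) (ht : 0 < t) (k : ℕ) : 0 ≤ besselITerm α t k := by
  have : 0 < Real.Gamma (k + α + 1) := Real.Gamma_pos_of_pos (by positivity)
  unfold besselITerm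
  positivity

theorem exp_eq_tsum (t : ℝ) : Real.exp t = ∑' k : ℕ, t ^ k / k.factorial := by
  rw [Real.exp_eq_exp_ℝ, NormedSpace.exp_eq_tsum_div]

theorem pow_div_factorial_le_exp {t : ℝ} (ht : 0 ≤ t) (k : ℕ) :
    t ^ k / k.factorial ≤ Real.exp t := Real.pow_div_factorial_le_exp t ht k

/-- Of the two factors t^k/k! one is bounded by exp t and the other kept, so that summation gives
exp(2t), the true exponential order of the Bessel function at 2t. -/
theorem besselITerm_le {α : ℝ} (hα : 0 ≤ α) : ∃ C : ℝ, 0 < C ∧ ∀ t : ℝ, 0 < t → ∀ k,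
    besselITerm α t k ≤ C * t ^ α * Real.exp t * (t ^ k / k.factorial) := by
  obtain ⟨c, hc, h⟩ := exists_factorial_le_gamma hα
  refine ⟨1 / c, by positivity, fun t ht k => ?_⟩
  have hk : (0:ℝ) < k.factorial := by positivity
  calc besselITerm α t k ≤ t ^ α * ((t ^ k) ^ 2 / ((k.factorial : ℝ) * (c * k.factorial))) := by
        unfold besselITerm; gcongr; exact h k
    _ = 1 / c * t ^ α * ((t ^ k / k.factorial) * (t ^ k / k.factorial)) := by field_simp
    _ ≤ 1 / c * t ^ α * (Real.exp t * (t ^ k / k.factorial)) := by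
        gcongr; exact pow_div_factorial_le_exp ht.le k
    _ = _ := by ring

theorem summable_besselITerm {α t : ℝ} (hα : 0 ≤ α) (ht : 0 < t) :
    Summable (besselITerm α t) := by
  obtain ⟨C, hC, h⟩ := besselITerm_le hα
  exact Summable.of_nonneg_of_le (besselITerm_nonneg hα ht) (h t ht)
    ((Real.summable_pow_div_factorial t).mul_left _)

theorem besselI_le {α : ℝ} (hα : 0 ≤ α) : ∃ C : ℝ, 0 < C ∧ ∀ y : ℝ, 0 < y →
    besselI α y ≤ C * (y / 2) ^ α * Real.exp y := by
  obtain ⟨C, hC, h⟩ := besselITerm_le hα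
  refine ⟨C, hC, fun y hy => ?_⟩
  rw [besselI_eq hy]
  refine (Summable.tsum_le_tsum (h (y / 2) (by positivity)) (summable_besselITerm hα (by positivity))
    ((Real.summable_pow_div_factorial _).mul_left _)).trans_eq ?_
  rw [tsum_mul_left, ← exp_eq_tsum, mul_assoc, ← Real.exp_add]
  ring_nf

theorem besselI_pos {α y : ℝ} (hα : 0 ≤ α) (hy : 0 < y) : 0 < besselI α y := by
  rw [besselI_eq hy]
  refine (summable_besselITerm hα (by positivity)).tsum_pos
    (besselITerm_nonneg hα (by positivity)) 0 ?_
  have : 0 < Real.Gamma ((0:ℕ) + α + 1) := Real.Gamma_pos_of_pos (by positivity)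
  unfold besselITerm
  positivity

/-- Each term of the tail from M on is at most t/M times its predecessor, so the tail is at most
(t/M) exp t, half of the sum when M ≥ 2t. -/
theorem half_exp_le_sum {t : ℝ} (ht : 0 ≤ t) {M : ℕ} (hM : 1 ≤ M) (hMt : 2 * t ≤ M) :
    Real.exp t / 2 ≤ ∑ k ∈ Finset.range M, t ^ k / k.factorial := by
  have hs := Real.summable_pow_div_factorial t
  have hM0 : (0:ℝ) < M := by exact_mod_cast hM
  have h1 := hs.sum_add_tsum_nat_add M
  rw [← exp_eq_tsum] at h1
  have h2 : ∑' k : ℕ, t ^ (k + M) / (k + M).factorial ≤ t / M * Real.exp t := by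
    obtain ⟨M, rfl⟩ := Nat.exists_eq_add_of_le' hM
    have h3 : ∀ k : ℕ, t ^ (k + (M + 1)) / (k + (M + 1)).factorial
        ≤ t / (M + 1 : ℕ) * (t ^ (k + M) / (k + M).factorial) := fun k => by
      rw [← add_assoc, Nat.factorial_succ, pow_succ]
      have : ((M + 1 : ℕ) : ℝ) ≤ ((k + M + 1 : ℕ) : ℝ) := by push_cast; linarith [(k.cast_nonneg : (0:ℝ) ≤ k)]
      rw [Nat.cast_mul]
      calc _ = t / ((k + M + 1 : ℕ) : ℝ) * (t ^ (k + M) / (k + M).factorial) := by field_simp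
        _ ≤ _ := by gcongr
    have hs' : Summable fun k : ℕ => t ^ (k + M) / (k + M).factorial := (summable_nat_add_iff M).mpr hs
    refine (((summable_nat_add_iff (M + 1)).mpr hs).tsum_le_tsum h3 (hs'.mul_left _)).trans ?_
    rw [tsum_mul_left]
    gcongr
    have h4 := hs.sum_add_tsum_nat_add M
    rw [← exp_eq_tsum] at h4
    have : 0 ≤ ∑ i ∈ Finset.range M, t ^ i / (i.factorial : ℝ) :=
      Finset.sum_nonneg fun i _ => by positivity
    linarith
  have h3 : t / M ≤ 1 / 2 := by rw [div_le_div_iff₀ hM0 two_pos]; linarith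
  nlinarith [Real.exp_pos t]

/-- The terms are, up to a polynomial factor, the squares of t^k/k!. About 2t of these terms already
sum to exp(t)/2, and Cauchy–Schwarz over them bounds the sum of squares below by exp(2t) over a
polynomial. -/
theorem le_besselI {α : ℝ} (hα : 0 ≤ α) : ∃ c : ℝ, 0 < c ∧ ∃ m : ℕ, ∀ t : ℝ, 0 < t →
    c * t ^ α * Real.exp (2 * t) / (2 * t + m + 3) ^ (m + 1) ≤ besselI α (2 * t) := by
  obtain ⟨D, hD, m, h⟩ := exists_gamma_le_factorial hα
  refine ⟨1 / (4 * D), by positivity, m, fun t ht => ?_⟩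
  rw [besselI_eq (by positivity), mul_div_cancel_left₀ t two_ne_zero]
  set M := ⌈2 * t⌉₊ + 1
  have hM1 : 2 * t ≤ M := by
    have := Nat.le_ceil (2 * t); simp only [M]; push_cast; linarith
  have hM2 : (M : ℝ) ≤ 2 * t + 2 := by
    have := (Nat.ceil_lt_add_one (by positivity : 0 ≤ 2 * t)).le; simp only [M]; push_cast; linarith
  set B := 2 * t + m + 3
  have hB : 0 < B := by positivity
  refine le_trans ?_ ((summable_besselITerm hα ht).sum_le_tsum (Finset.range M)
    fun k _ => besselITerm_nonneg hα ht k)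
  have h1 : ∀ k ∈ Finset.range M, t ^ α / (D * B ^ m) * (t ^ k / k.factorial) ^ 2
      ≤ besselITerm α t k := by
    intro k hk
    have hk' : (k : ℝ) + 1 ≤ M := by exact_mod_cast Finset.mem_range.mp hk
    have hG : 0 < Real.Gamma (k + α + 1) := Real.Gamma_pos_of_pos (by positivity)
    have hkf : (0:ℝ) < k.factorial := by positivity
    have h2 : Real.Gamma (k + α + 1) ≤ D * k.factorial * B ^ m :=
      (h k).trans (by gcongr; simp only [B]; linarith)
    calc _ = t ^ α * ((t ^ k) ^ 2 / ((k.factorial : ℝ) * (D * k.factorial * B ^ m))) := by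
          field_simp
      _ ≤ _ := by unfold besselITerm; gcongr
  refine le_trans ?_ (Finset.sum_le_sum h1)
  rw [← Finset.mul_sum]
  have h3 := sq_sum_le_card_mul_sum_sq (s := Finset.range M) (f := fun k : ℕ => t ^ k / (k.factorial : ℝ))
  rw [Finset.card_range] at h3
  have h4 := half_exp_le_sum ht.le (M := M) (by simp [M]) hM1
  have h5 : (Real.exp t / 2) ^ 2 ≤ B * ∑ k ∈ Finset.range M, (t ^ k / (k.factorial : ℝ)) ^ 2 := by
    calc _ ≤ (∑ k ∈ Finset.range M, t ^ k / (k.factorial : ℝ)) ^ 2 := by gcongr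
      _ ≤ _ := h3
      _ ≤ _ := by
        gcongr
        simp only [B]; linarith [(m.cast_nonneg : (0:ℝ) ≤ m)]
  have h6 : (Real.exp t / 2) ^ 2 / B ≤ ∑ k ∈ Finset.range M, (t ^ k / (k.factorial : ℝ)) ^ 2 := by
    rw [div_le_iff₀ hB]; linarith
  calc _ = t ^ α / (D * B ^ m) * ((Real.exp t / 2) ^ 2 / B) := by
        rw [two_mul, Real.exp_add, pow_succ B]; field_simp; norm_num
    _ ≤ _ := by gcongr

theorem weight_pos {α a : ℝ} (hα : 0 ≤ α) (ha : 0 < a) {N : ℕ} (hN : 1 ≤ N) {x : ℝ} (hx : 0 < x) :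
    0 < weight α a N x := by
  have hN' : (0:ℝ) < N := by exact_mod_cast hN
  have := besselI_pos (y := 2 * N * √(a * x)) hα (by positivity)
  unfold weight
  positivity

/-- With `le_weight`, this says that `potential` is x - 2√(ax) up to O(log N / N) on compact sets of
(0,∞), which is where the square root in the limiting potential comes from. -/
theorem weight_le {α a : ℝ} (hα : 0 ≤ α) (ha : 0 < a) : ∃ C : ℝ, 0 < C ∧ ∀ N : ℕ, 1 ≤ N →
    ∀ x : ℝ, 0 < x →
      weight α a N x ≤ C * (N : ℝ) ^ α * x ^ α * Real.exp (-(N * (x - 2 * √(a * x)))) := by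
  obtain ⟨C, hC, h⟩ := besselI_le hα
  refine ⟨C * √a ^ α, by positivity, fun N hN x hx => ?_⟩
  have hN' : (0:ℝ) < N := by exact_mod_cast hN
  have h1 := h (2 * N * √(a * x)) (by positivity)
  have h2 : (2 * N * √(a * x) / 2) ^ α = (N : ℝ) ^ α * √a ^ α * x ^ (α / 2) := by
    rw [show 2 * N * √(a * x) / 2 = N * √a * √x by rw [Real.sqrt_mul ha.le]; ring,
      Real.mul_rpow (by positivity) (by positivity), Real.mul_rpow (by positivity) (by positivity),
      Real.sqrt_eq_rpow x, ← Real.rpow_mul hx.le]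
    congr 2; ring
  rw [h2] at h1
  have h3 : x ^ α = x ^ (α / 2) * x ^ (α / 2) := by rw [← Real.rpow_add hx]; ring_nf
  have h4 : Real.exp (-(N * (x - 2 * √(a * x)))) =
      Real.exp (2 * N * √(a * x)) * Real.exp (-(N * x)) := by rw [← Real.exp_add]; ring_nf
  rw [h3, h4]
  calc weight α a N x ≤ x ^ (α / 2) * (C * ((N : ℝ) ^ α * √a ^ α * x ^ (α / 2)) *
        Real.exp (2 * N * √(a * x))) * Real.exp (-(N * x)) := by
        unfold weight; gcongr
    _ = _ := by ring

/-- The polynomial loss of `le_besselI` becomes a power of N once x is confined to a compact set;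
such a power is invisible at speed N². -/
theorem le_weight {α a δ B : ℝ} (hα : 0 ≤ α) (ha : 0 < a) (hδ : 0 < δ) : ∃ c : ℝ, 0 < c ∧
    ∃ p : ℕ, ∀ N : ℕ, 1 ≤ N → ∀ x ∈ Icc δ B,
      c / (N : ℝ) ^ p * Real.exp (-(N * (x - 2 * √(a * x)))) ≤ weight α a N x := by
  obtain ⟨c, hc, m, h⟩ := le_besselI hα
  set K := 2 * √(a * B) + m + 3
  have hK : 0 < K := by positivity
  refine ⟨δ ^ (α / 2) * c * √(a * δ) ^ α / K ^ (m + 1), by positivity, m + 1, fun N hN x hx => ?_⟩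
  have hN' : (1:ℝ) ≤ N := by exact_mod_cast hN
  have hN0 : (0:ℝ) < N := by positivity
  have hx0 : 0 < x := hδ.trans_le hx.1
  have h1 := h (N * √(a * x)) (by positivity)
  have h2 : 2 * (N * √(a * x)) + m + 3 ≤ K * N := by
    have : √(a * x) ≤ √(a * B) := by gcongr; exact hx.2
    simp only [K]
    nlinarith [(m.cast_nonneg : (0:ℝ) ≤ m)]
  have h3 : √(a * δ) ≤ N * √(a * x) := by
    have : √(a * δ) ≤ √(a * x) := by gcongr; exact hx.1
    nlinarith [Real.sqrt_nonneg (a * x)]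
  have h4 : Real.exp (-(N * (x - 2 * √(a * x)))) =
      Real.exp (2 * (N * √(a * x))) * Real.exp (-(N * x)) := by rw [← Real.exp_add]; ring_nf
  rw [h4]
  calc _ = δ ^ (α / 2) * (c * √(a * δ) ^ α * Real.exp (2 * (N * √(a * x))) / (K * N) ^ (m + 1))
        * Real.exp (-(N * x)) := by rw [mul_pow]; field_simp
    _ ≤ x ^ (α / 2) * (c * (N * √(a * x)) ^ α * Real.exp (2 * (N * √(a * x))) /
        (2 * (N * √(a * x)) + m + 3) ^ (m + 1)) * Real.exp (-(N * x)) := by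
        gcongr; exact hx.1
    _ ≤ x ^ (α / 2) * besselI α (2 * (N * √(a * x))) * Real.exp (-(N * x)) := by gcongr
    _ = _ := by unfold weight; ring_nf

/-! ### The constraint measures -/

/-- The rescaled square root coordinate on `ℝ_-`, in which `σ` is Lebesgue measure. -/
def sOf (a : ℝ) (u : RMinus) : ℝ := 2 * √a / Real.pi * √(-(u : ℝ))

theorem continuous_sOf (a : ℝ) : Continuous (sOf a) := by unfold sOf; fun_prop

theorem sOf_nonneg (a : ℝ) (u : RMinus) : 0 ≤ sOf a u := by
  have := Real.pi_pos
  unfold sOf; positivity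

theorem eq_neg_sOf_sq {a : ℝ} (ha : 0 < a) (u : RMinus) :
    (u : ℝ) = -(Real.pi * sOf a u / (2 * √a)) ^ 2 := by
  have h : 0 ≤ -(u : ℝ) := neg_nonneg.mpr u.2
  have hp := Real.pi_pos
  have hs := Real.sqrt_pos.mpr ha
  have : Real.pi * sOf a u / (2 * √a) = √(-(u : ℝ)) := by unfold sOf; field_simp
  rw [this, Real.sq_sqrt h, neg_neg]

theorem sOf_injective {a : ℝ} (ha : 0 < a) : Function.Injective (sOf a) := fun u v h => by
  apply Subtype.ext
  rw [eq_neg_sOf_sq ha u, eq_neg_sOf_sq ha v, h]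

theorem measurableEmbedding_sOf {a : ℝ} (ha : 0 < a) : MeasurableEmbedding (sOf a) :=
  have : StandardBorelSpace RMinus := measurableSet_Iic.standardBorel
  (continuous_sOf a).measurable.measurableEmbedding (sOf_injective ha)

/-- The point of `𝔸_N` associated with `j` has coordinate `j / (π N)`. -/
theorem sOf_eq_of_besselSet {α a : ℝ} (ha : 0 < a) {N : ℕ} (hN : 1 ≤ N) {u : RMinus}
    (hu : u ∈ besselSet α a N) :
    0 < sOf a u ∧ besselJ α (Real.pi * N * sOf a u) = 0 := by
  obtain ⟨j, hj, hj0, hu⟩ := hu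
  have hp := Real.pi_pos
  have hs := Real.sqrt_pos.mpr ha
  have hN' : (0:ℝ) < N := by exact_mod_cast hN
  have h : sOf a u = j / (Real.pi * N) := by
    rw [sOf, hu, neg_neg, Real.sqrt_sq (by positivity)]
    field_simp
  rw [h]
  refine ⟨by positivity, ?_⟩
  rwa [mul_div_cancel₀]
  positivity

theorem mem_besselSet_of_zero {α a : ℝ} (ha : 0 < a) {N : ℕ} (hN : 1 ≤ N) {u : RMinus}
    (h0 : 0 < sOf a u) (h : besselJ α (Real.pi * N * sOf a u) = 0) : u ∈ besselSet α a N := by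
  have hp := Real.pi_pos
  have hs := Real.sqrt_pos.mpr ha
  have hN' : (0:ℝ) < N := by exact_mod_cast hN
  refine ⟨_, by positivity, h, ?_⟩
  rw [eq_neg_sOf_sq ha u]
  congr 2
  field_simp

/-- An injective index on `𝔸_N`. -/
def besselIndex (a : ℝ) (N : ℕ) (u : RMinus) : ℕ := ⌊Real.pi * N * sOf a u / 2⌋₊

theorem besselIndex_injOn {α a : ℝ} (hα : 0 ≤ α) (ha : 0 < a) {N : ℕ} (hN : 1 ≤ N) :
    InjOn (besselIndex a N) (besselSet α a N) := by
  intro u hu v hv huv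
  obtain ⟨hu0, hu1⟩ := sOf_eq_of_besselSet ha hN hu
  obtain ⟨hv0, hv1⟩ := sOf_eq_of_besselSet ha hN hv
  have hp := Real.pi_pos
  have hN' : (0:ℝ) < N := by exact_mod_cast hN
  by_contra hne
  wlog hlt : sOf a u < sOf a v generalizing u v
  · refine this hv hu huv.symm hv0 hv1 hu0 hu1 (fun h => hne h.symm) ?_
    exact lt_of_le_of_ne (not_lt.mp hlt) fun h => hne (sOf_injective ha h).symm
  have hgap := besselJ_zero_gap_two hα (by positivity)
    (by gcongr : Real.pi * N * sOf a u < Real.pi * N * sOf a v) hu1 hv1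
  have h1 := Nat.lt_floor_add_one (Real.pi * N * sOf a v / 2)
  have h2 := Nat.floor_le (by positivity : 0 ≤ Real.pi * N * sOf a u / 2)
  unfold besselIndex at huv
  rw [huv] at h2
  linarith

theorem countable_besselSet {α a : ℝ} (hα : 0 ≤ α) (ha : 0 < a) {N : ℕ} (hN : 1 ≤ N) :
    (besselSet α a N).Countable :=
  (mapsTo_univ (besselIndex a N) _).countable_of_injOn (besselIndex_injOn hα ha hN) countable_univ

/-- Zeros are at least 2, so indices start at 1 and 𝔸_N stays away from the origin at scale N⁻².
This makes log(1/|u|) integrable against σ_N, uniformly in N. -/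
theorem besselIndex_pos {α a : ℝ} (hα : 0 ≤ α) (ha : 0 < a) {N : ℕ} (hN : 1 ≤ N) {u : RMinus}
    (hu : u ∈ besselSet α a N) :
    1 ≤ besselIndex a N u ∧ ((besselIndex a N u : ℝ) / (√a * N)) ^ 2 ≤ -(u : ℝ) := by
  obtain ⟨hu0, hu1⟩ := sOf_eq_of_besselSet ha hN hu
  have hp := Real.pi_pos
  have hs := Real.sqrt_pos.mpr ha
  have hN' : (0:ℝ) < N := by exact_mod_cast hN
  have h2 := two_le_of_besselJ_eq_zero hα (by positivity) hu1
  refine ⟨Nat.le_floor (by push_cast; linarith), ?_⟩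
  rw [eq_neg_sOf_sq ha u, neg_neg]
  have h3 : (besselIndex a N u : ℝ) ≤ Real.pi * N * sOf a u / 2 := Nat.floor_le (by positivity)
  refine pow_le_pow_left₀ (by positivity) ?_ 2
  rw [div_le_div_iff₀ (by positivity) (by positivity)]
  calc (besselIndex a N u : ℝ) * (2 * √a) ≤ Real.pi * N * sOf a u / 2 * (2 * √a) := by gcongr
    _ = _ := by ring

theorem sigmaN_apply (α a : ℝ) (N : ℕ) {s : Set RMinus} (hs : MeasurableSet s) :
    sigmaN α a N s = (N : ℝ≥0∞)⁻¹ * ((besselSet α a N ∩ s).encard : ℝ≥0∞) := by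
  rw [sigmaN, Measure.smul_apply, Measure.sum_apply _ hs, smul_eq_mul]
  congr 1
  simp_rw [Measure.dirac_apply' _ hs]
  rw [← ENNReal.tsum_set_one, tsum_subtype (besselSet α a N) (fun u => s.indicator 1 u),
    tsum_subtype (besselSet α a N ∩ s) (fun _ => (1 : ℝ≥0∞))]
  refine tsum_congr fun u => ?_
  by_cases h1 : u ∈ besselSet α a N <;> by_cases h2 : u ∈ s <;> simp [h1, h2]

theorem lintegral_sigmaN (α a : ℝ) (N : ℕ) (f : RMinus → ℝ≥0∞) :
    ∫⁻ u, f u ∂sigmaN α a N = (N : ℝ≥0∞)⁻¹ * ∑' u : besselSet α a N, f u := by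
  rw [sigmaN, lintegral_smul_measure, lintegral_sum_measure, smul_eq_mul]
  simp only [lintegral_dirac]

theorem sigmaN_compl_besselSet {α a : ℝ} (hα : 0 ≤ α) (ha : 0 < a) {N : ℕ} (hN : 1 ≤ N) :
    sigmaN α a N (besselSet α a N)ᶜ = 0 := by
  rw [sigmaN_apply _ _ _ (countable_besselSet hα ha hN).measurableSet.compl]
  simp

theorem sigmaN_singleton {α a : ℝ} {N : ℕ} {u : RMinus}
    (hu : u ∈ besselSet α a N) : sigmaN α a N {u} = (N : ℝ≥0∞)⁻¹ := by
  rw [sigmaN_apply _ _ _ (measurableSet_singleton u), inter_eq_self_of_subset_right (by simpa)]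
  simp

theorem sigmaFinite_sigmaN {α a : ℝ} (hα : 0 ≤ α) (ha : 0 < a) {N : ℕ} (hN : 1 ≤ N) :
    SigmaFinite (sigmaN α a N) := by
  have hc := countable_besselSet hα ha hN
  refine MeasureTheory.Measure.sigmaFinite_of_countable (S := insert (besselSet α a N)ᶜ
    ((fun u => {u}) '' besselSet α a N)) ((hc.image _).insert _) ?_ ?_
  · rintro s (rfl | ⟨u, hu, rfl⟩)
    · rw [sigmaN_compl_besselSet hα ha hN]; exact ENNReal.zero_lt_top
    · rw [sigmaN_singleton hu]; simp; omega
  · rw [sUnion_insert, sUnion_image, biUnion_of_singleton, compl_union_self]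

/-- Integrals of decreasing functions of `|u|` against `σ_N`. -/
theorem lintegral_sigmaN_le {α a : ℝ} (hα : 0 ≤ α) (ha : 0 < a) {N : ℕ} (hN : 1 ≤ N)
    {φ : ℝ → ℝ≥0∞} (hφ : Antitone φ) :
    ∫⁻ u, φ (-(u : ℝ)) ∂sigmaN α a N ≤ ∫⁻ t in Ioi (0:ℝ), φ ((t / √a) ^ 2) := by
  have hs := Real.sqrt_pos.mpr ha
  have hN' : (0:ℝ) < N := by exact_mod_cast hN
  rw [lintegral_sigmaN]
  have h1 : ∑' u : besselSet α a N, φ (-((u : RMinus) : ℝ))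
      ≤ ∑' k : ℕ, φ ((((k + 1 : ℕ) : ℝ) / (√a * N)) ^ 2) := by
    -- The shift puts the k-th term at the right end of the interval (k/N, (k+1)/N], so that a
    -- decreasing function is bounded there by its integral.
    set e : besselSet α a N → ℕ := fun u => besselIndex a N u - 1
    have he : Function.Injective e := by
      intro u v huv
      apply Subtype.ext
      apply besselIndex_injOn hα ha hN u.2 v.2
      have h1 := (besselIndex_pos hα ha hN u.2).1
      have h2 := (besselIndex_pos hα ha hN v.2).1
      simp only [e] at huv
      omega
    refine le_trans (ENNReal.tsum_le_tsum fun u => ?_) (ENNReal.tsum_comp_le_tsum_of_injective he _)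
    apply hφ
    have h := besselIndex_pos hα ha hN u.2
    simp only [e]
    rw [Nat.sub_add_cancel h.1]
    exact h.2
  have h2 : ∀ k : ℕ, (N : ℝ≥0∞)⁻¹ * φ ((((k + 1 : ℕ) : ℝ) / (√a * N)) ^ 2) ≤
      ∫⁻ t in Ioc ((k : ℝ) / N) ((k + 1 : ℝ) / N), φ ((t / √a) ^ 2) := by
    intro k
    have hvol : volume (Ioc ((k : ℝ) / N) ((k + 1 : ℝ) / N)) = (N : ℝ≥0∞)⁻¹ := by
      rw [Real.volume_Ioc, ← sub_div, add_sub_cancel_left, one_div, ENNReal.ofReal_inv_of_pos hN',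
        ENNReal.ofReal_natCast]
    rw [← hvol, mul_comm, ← setLIntegral_const]
    refine setLIntegral_mono' measurableSet_Ioc fun t ht => hφ ?_
    have ht0 : 0 ≤ t := le_trans (by positivity) ht.1.le
    refine pow_le_pow_left₀ (by positivity) ?_ 2
    rw [div_le_div_iff₀ hs (by positivity)]
    have := ht.2
    rw [le_div_iff₀ hN'] at this
    push_cast
    nlinarith
  calc _ ≤ (N : ℝ≥0∞)⁻¹ * ∑' k : ℕ, φ ((((k + 1 : ℕ) : ℝ) / (√a * N)) ^ 2) := by gcongr
    _ = ∑' k : ℕ, (N : ℝ≥0∞)⁻¹ * φ ((((k + 1 : ℕ) : ℝ) / (√a * N)) ^ 2) := ENNReal.tsum_mul_left.symm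
    _ ≤ ∑' k : ℕ, ∫⁻ t in Ioc ((k : ℝ) / N) ((k + 1 : ℝ) / N), φ ((t / √a) ^ 2) :=
        ENNReal.tsum_le_tsum h2
    _ = ∫⁻ t in ⋃ k : ℕ, Ioc ((k : ℝ) / N) ((k + 1 : ℝ) / N), φ ((t / √a) ^ 2) := by
        rw [lintegral_iUnion (fun _ => measurableSet_Ioc)]
        have : Monotone fun k : ℕ => (k : ℝ) / N := fun i j h => by
          show (i : ℝ) / N ≤ j / N
          gcongr
        have hd := this.pairwise_disjoint_on_Ioc_succ
        simpa using hd
    _ ≤ _ := by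
        apply lintegral_mono_set
        intro t ht
        obtain ⟨k, hk⟩ := mem_iUnion.mp ht
        exact lt_of_le_of_lt (by positivity) hk.1

/-- Change of variables u = -(πt/(2√a))², whose Jacobian cancels the density of σ. The point 0,
negligible on both sides, is removed because the density is singular there. -/
theorem volume_image_sOf {a : ℝ} (ha : 0 < a) {s : Set RMinus} (hs : MeasurableSet s) :
    volume (sOf a '' s) = sigma a s := by
  have hp := Real.pi_pos
  have hsa := Real.sqrt_pos.mpr ha
  have haa : √a * √a = a := Real.mul_self_sqrt ha.le
  set B := sOf a '' s \ {0}
  have hB : MeasurableSet B := ((measurableEmbedding_sOf ha).measurableSet_image.mpr hs).diff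
    (measurableSet_singleton 0)
  have hB0 : ∀ t ∈ B, 0 < t := by
    rintro t ⟨⟨u, _, rfl⟩, h0⟩
    exact lt_of_le_of_ne (sOf_nonneg a u) (fun h => h0 h.symm)
  set ψ : ℝ → ℝ := fun t => -(Real.pi * t / (2 * √a)) ^ 2
  have hψ : ∀ t ∈ B, HasDerivWithinAt ψ (-(Real.pi ^ 2 * t / (2 * a))) B t := by
    intro t _
    have h1 : HasDerivAt (fun t : ℝ => Real.pi * t / (2 * √a)) (Real.pi / (2 * √a)) t := by
      simpa using (((hasDerivAt_id t).const_mul Real.pi).div_const (2 * √a))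
    refine ((h1.pow 2).neg.congr_deriv ?_).hasDerivWithinAt
    push_cast
    calc _ = -(Real.pi ^ 2 * t / (2 * (√a * √a))) := by field_simp
      _ = _ := by rw [haa]
  have hinj : InjOn ψ B := by
    intro x hx y hy hxy
    have h := neg_injective hxy
    have h2 := (sq_eq_sq₀ (by have := hB0 x hx; positivity) (by have := hB0 y hy; positivity)).mp h
    field_simp at h2
    exact h2
  have key := lintegral_image_eq_lintegral_abs_deriv_mul hB hψ hinj
    (fun x => ENNReal.ofReal (√a / Real.pi * |x| ^ (-(1 / 2) : ℝ)))
  have h1 : ∫⁻ x in B, ENNReal.ofReal |-(Real.pi ^ 2 * x / (2 * a))| *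
      ENNReal.ofReal (√a / Real.pi * |ψ x| ^ (-(1 / 2) : ℝ)) = volume (sOf a '' s) := by
    rw [← measure_sdiff_null (s := sOf a '' s) (t := {(0:ℝ)}) Real.volume_singleton, ← setLIntegral_one]
    refine setLIntegral_congr_fun hB fun x hx => ?_
    have hx := hB0 x hx
    rw [← ENNReal.ofReal_mul (abs_nonneg _), abs_neg, abs_of_pos (by positivity)]
    have : |ψ x| ^ (-(1 / 2) : ℝ) = (Real.pi * x / (2 * √a))⁻¹ := by
      simp only [ψ]
      rw [abs_neg, abs_of_pos (by positivity), ← Real.rpow_natCast, ← Real.rpow_mul (by positivity),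
        ← Real.rpow_neg_one]
      norm_num
    rw [this]
    have : Real.pi ^ 2 * x / (2 * a) * (√a / Real.pi * (Real.pi * x / (2 * √a))⁻¹) = 1 := by
      field_simp
      rw [sq, haa]
    rw [this, ENNReal.ofReal_one]
  rw [h1] at key
  rw [← key, sigma, withDensity_apply _ hs]
  have himg : ψ '' B = Subtype.val '' s \ {0} := by
    ext x
    constructor
    · rintro ⟨t, ⟨⟨u, hu, rfl⟩, h0⟩, rfl⟩
      have e : ψ (sOf a u) = u := (eq_neg_sOf_sq ha u).symm
      rw [e]
      refine ⟨⟨u, hu, rfl⟩, fun h => h0 ?_⟩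
      have h : (u : ℝ) = 0 := h
      simp [sOf, h]
    · rintro ⟨⟨u, hu, rfl⟩, h0⟩
      refine ⟨sOf a u, ⟨⟨u, hu, rfl⟩, fun h => h0 ?_⟩, (eq_neg_sOf_sq ha u).symm⟩
      have h : sOf a u = 0 := h
      show (u : ℝ) = 0
      rw [eq_neg_sOf_sq ha u, h]; simp
  rw [himg, setLIntegral_congr (sdiff_null_ae_eq_self (by simp : volume {(0:ℝ)} = 0))]
  have hemb : MeasurableEmbedding (Subtype.val : RMinus → ℝ) :=
    MeasurableEmbedding.subtype_coe measurableSet_Iic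
  have h2 : (Measure.comap Subtype.val (volume : Measure ℝ)).restrict s
      = Measure.comap (Subtype.val : RMinus → ℝ) (volume.restrict (Subtype.val '' s)) := by
    rw [hemb.comap_restrict, preimage_image_eq _ Subtype.val_injective]
  rw [h2]
  have h3 : Measure.map (Subtype.val : RMinus → ℝ) (Measure.comap (Subtype.val : RMinus → ℝ)
      (volume.restrict (Subtype.val '' s))) = volume.restrict (Subtype.val '' s) := by
    rw [map_comap_subtype_coe measurableSet_Iic, Measure.restrict_restrict measurableSet_Iic,
      inter_eq_self_of_subset_right]
    rintro _ ⟨u, _, rfl⟩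
    exact u.2
  conv_lhs => rw [← h3]
  rw [hemb.lintegral_map]

theorem sigma_preimage_sOf_le {a : ℝ} (ha : 0 < a) {B : Set ℝ} (hB : MeasurableSet B) :
    sigma a (sOf a ⁻¹' B) ≤ volume B := by
  rw [← volume_image_sOf ha ((continuous_sOf a).measurable hB)]
  exact measure_mono (image_preimage_subset _ _)

theorem map_sOf_sigma_le {a : ℝ} (ha : 0 < a) : (sigma a).map (sOf a) ≤ volume :=
  Measure.le_iff.mpr fun B hB => by
    rw [Measure.map_apply (continuous_sOf a).measurable hB]
    exact sigma_preimage_sOf_le ha hB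

/-- In the coordinate s of `sOf` one has |u| = (πs/(2√a))² ≥ (s/√a)², because π ≥ 2; this coarser
bound is the one that σ_N also obeys. -/
theorem lintegral_sigma_le {a : ℝ} (ha : 0 < a) {φ : ℝ → ℝ≥0∞} (hφ : Antitone φ) :
    ∫⁻ u, φ (-(u : ℝ)) ∂sigma a ≤ ∫⁻ t in Ioi (0:ℝ), φ ((t / √a) ^ 2) := by
  have hp := Real.pi_pos
  have hsa := Real.sqrt_pos.mpr ha
  have h1 : ∀ u : RMinus, φ (-(u : ℝ)) ≤ φ ((sOf a u / √a) ^ 2) := fun u => by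
    apply hφ
    conv_rhs => rw [eq_neg_sOf_sq ha u, neg_neg]
    have := sOf_nonneg a u
    refine pow_le_pow_left₀ (by positivity) ?_ 2
    rw [div_le_div_iff₀ hsa (by positivity)]
    nlinarith [Real.pi_gt_three, mul_nonneg this hsa.le]
  have hm : Measurable fun t : ℝ => φ ((t / √a) ^ 2) := hφ.measurable.comp (by fun_prop)
  calc _ ≤ ∫⁻ u, φ ((sOf a u / √a) ^ 2) ∂sigma a := lintegral_mono h1
    _ = ∫⁻ t, φ ((t / √a) ^ 2) ∂(sigma a).map (sOf a) :=
        (lintegral_map hm (continuous_sOf a).measurable).symm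
    _ = ∫⁻ t in Ici 0, φ ((t / √a) ^ 2) ∂(sigma a).map (sOf a) := by
        rw [Measure.restrict_eq_self_of_ae_mem]
        refine (ae_map_iff (continuous_sOf a).aemeasurable measurableSet_Ici).mpr ?_
        exact Eventually.of_forall (sOf_nonneg a)
    _ ≤ ∫⁻ t in Ici 0, φ ((t / √a) ^ 2) :=
        lintegral_mono' (Measure.restrict_mono le_rfl (map_sOf_sigma_le ha)) le_rfl
    _ = _ := setLIntegral_congr Ioi_ae_eq_Ici.symm

/-- Integrals of decreasing functions of `|u|` against the elements of `ℰ(ℝ_-)`. -/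
theorem lintegral_le_of_mem_E {α a : ℝ} (hα : 0 ≤ α) (ha : 0 < a) {ν : FiniteMeasure RMinus}
    (hν : ν ∈ E α a) {φ : ℝ → ℝ≥0∞} (hφ : Antitone φ) :
    ∫⁻ u, φ (-(u : ℝ)) ∂(ν : Measure RMinus) ≤ ∫⁻ t in Ioi (0:ℝ), φ ((t / √a) ^ 2) := by
  rcases hν with hν | hν
  · simp only [mem_iUnion] at hν
    obtain ⟨N, hN, -, h⟩ := hν
    exact (lintegral_mono' h le_rfl).trans (lintegral_sigmaN_le hα ha hN hφ)
  · exact (lintegral_mono' hν.2 le_rfl).trans (lintegral_sigma_le ha hφ)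

theorem mass_of_mem_E {α a : ℝ} {ν : FiniteMeasure RMinus} (hν : ν ∈ E α a) : ν.mass = 1 / 2 := by
  rcases hν with hν | hν
  · simp only [mem_iUnion] at hν
    obtain ⟨N, hN, h, -⟩ := hν
    exact h
  · exact hν.1

/-! ### Uniform integrability of the logarithm over ℰ -/

/-- The function `(log (1/r) - M)^+`. -/
def ell (M r : ℝ) : ℝ≥0∞ := if r ≤ 0 then ⊤ else ENNReal.ofReal (-Real.log r - M)

theorem antitone_ell (M : ℝ) : Antitone (ell M) := by
  intro r s hrs
  unfold ell
  split_ifs with h1 h2 h2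
  · exact le_rfl
  · linarith
  · exact le_top
  · apply ENNReal.ofReal_le_ofReal
    have := Real.log_le_log (not_le.mp h2) hrs
    linarith

theorem lintegral_ell_le {a : ℝ} (ha : 0 < a) {M : ℝ} (hM : 0 ≤ M) :
    ∫⁻ t in Ioi (0:ℝ), ell M ((t / √a) ^ 2) ≤ ENNReal.ofReal (8 * √a * Real.exp (-(M / 4))) := by
  have hs := Real.sqrt_pos.mpr ha
  set f : ℝ → ℝ := fun t => 4 * Real.exp (-(M / 4)) * √a ^ (1 / 2 : ℝ) * t ^ (-(1 / 2) : ℝ)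
  have h1 : ∀ t ∈ Ioi (0:ℝ), ell M ((t / √a) ^ 2) ≤
      (Ioc 0 √a).indicator (fun t => ENNReal.ofReal (f t)) t := by
    intro t ht
    have ht : 0 < t := ht
    have htt : 0 < t / √a := by positivity
    rw [ell, if_neg (not_le.mpr (by positivity)), Real.log_pow]
    push_cast
    by_cases hta : t ≤ √a
    · rw [indicator_of_mem (show t ∈ Ioc 0 √a from ⟨ht, hta⟩)]
      apply ENNReal.ofReal_le_ofReal
      -- The inequality y ≤ 4 exp(y/4), which trades the logarithm for the integrable power t^(-1/2)
      -- and produces the decay exp(-M/4).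
      have h2 : (-(2 * Real.log (t / √a)) - M) / 4 ≤ Real.exp ((-(2 * Real.log (t / √a)) - M) / 4) := by
        have := Real.add_one_le_exp ((-(2 * Real.log (t / √a)) - M) / 4)
        linarith
      have h3 : Real.exp ((-(2 * Real.log (t / √a)) - M) / 4) =
          Real.exp (-(M / 4)) * (√a ^ (1 / 2 : ℝ) * t ^ (-(1 / 2) : ℝ)) := by
        rw [Real.rpow_neg ht.le, ← div_eq_mul_inv, ← Real.div_rpow hs.le ht.le,
          Real.rpow_def_of_pos (by positivity), ← Real.exp_add]
        congr 1
        rw [Real.log_div ht.ne' hs.ne', Real.log_div hs.ne' ht.ne']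
        ring
      rw [h3] at h2
      simp only [f]
      linarith
    · rw [ENNReal.ofReal_of_nonpos]
      · exact zero_le
      · have : 0 ≤ Real.log (t / √a) := Real.log_nonneg ((one_le_div hs).mpr (not_le.mp hta).le)
        linarith
  refine (setLIntegral_mono' measurableSet_Ioi h1).trans ?_
  have hint : IntervalIntegrable (fun t : ℝ => t ^ (-(1 / 2) : ℝ)) volume 0 √a :=
    intervalIntegral.intervalIntegrable_rpow' (by norm_num)
  have hint' : IntegrableOn f (Ioc 0 √a) :=
    ((intervalIntegrable_iff_integrableOn_Ioc_of_le hs.le).mp hint).const_mul _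
  calc _ ≤ ∫⁻ t, (Ioc 0 √a).indicator (fun t => ENNReal.ofReal (f t)) t :=
        setLIntegral_le_lintegral _ _
    _ = ∫⁻ t in Ioc 0 √a, ENNReal.ofReal (f t) := lintegral_indicator measurableSet_Ioc _
    _ = ENNReal.ofReal (∫ t in Ioc 0 √a, f t) := by
        rw [ofReal_integral_eq_lintegral_ofReal hint']
        filter_upwards [ae_restrict_mem measurableSet_Ioc] with t ht
        have := ht.1
        show 0 ≤ f t
        positivity
    _ ≤ _ := by
        apply ENNReal.ofReal_le_ofReal
        rw [← intervalIntegral.integral_of_le hs.le]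
        simp only [f]
        rw [intervalIntegral.integral_const_mul, integral_rpow (Or.inl (by norm_num))]
        rw [show (-(1 / 2) + 1 : ℝ) = 1 / 2 by norm_num, Real.zero_rpow (by norm_num), sub_zero]
        have : √a ^ (1 / 2 : ℝ) * √a ^ (1 / 2 : ℝ) = √a := by
          rw [← Real.rpow_add hs]; norm_num
        apply le_of_eq
        calc _ = 8 * (√a ^ (1 / 2 : ℝ) * √a ^ (1 / 2 : ℝ)) * Real.exp (-(M / 4)) := by ring
          _ = _ := by rw [this]

theorem lintegral_ell_le_of_mem_E {α a : ℝ} (hα : 0 ≤ α) (ha : 0 < a) {ν : FiniteMeasure RMinus}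
    (hν : ν ∈ E α a) {M : ℝ} (hM : 0 ≤ M) :
    ∫⁻ u, ell M (-(u : ℝ)) ∂(ν : Measure RMinus) ≤
      ENNReal.ofReal (8 * √a * Real.exp (-(M / 4))) :=
  (lintegral_le_of_mem_E hα ha hν (antitone_ell M)).trans (lintegral_ell_le ha hM)

/-! ### Counting and closedness -/

/-- Points with gaps at least d fall into distinct cells of a grid of step d. -/
theorem encard_le_of_gap {S : Set ℝ} {A B d : ℝ} (hd : 0 < d) (hAB : A ≤ B) (hS : S ⊆ Icc A B)
    (hgap : ∀ x ∈ S, ∀ y ∈ S, x < y → d ≤ y - x) :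
    (S.encard : ℝ≥0∞) ≤ ENNReal.ofReal ((B - A) / d + 1) := by
  have hmaps : MapsTo (fun x => ⌊(x - A) / d⌋₊) S (Finset.range (⌊(B - A) / d⌋₊ + 1)) := by
    intro x hx
    simp only [Finset.coe_range, mem_Iio]
    apply Nat.lt_succ_of_le
    apply Nat.floor_mono
    gcongr
    exact (hS hx).2
  have hinj : InjOn (fun x => ⌊(x - A) / d⌋₊) S := by
    intro x hx y hy hxy
    by_contra hne
    wlog hlt : x < y generalizing x y
    · exact this hy hx hxy.symm (fun h => hne h.symm) (lt_of_le_of_ne (not_lt.mp hlt) (Ne.symm hne))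
    simp only at hxy
    have h3 : (y - A) / d < (x - A) / d + 1 := by
      have h0 := Nat.lt_floor_add_one ((y - A) / d)
      have h4 := Nat.floor_le (div_nonneg (sub_nonneg.mpr (hS hx).1) hd.le)
      rw [hxy] at h4
      linarith
    have h4 := hgap x hx y hy hlt
    rw [div_add_one hd.ne', div_lt_div_iff_of_pos_right hd] at h3
    linarith
  have h := Set.encard_le_encard_of_injOn hmaps hinj
  rw [Set.encard_coe_eq_coe_finsetCard, Finset.card_range] at h
  calc (S.encard : ℝ≥0∞) ≤ (((⌊(B - A) / d⌋₊ + 1 : ℕ) : ℕ∞) : ℝ≥0∞) := by exact_mod_cast h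
    _ = ENNReal.ofReal ((⌊(B - A) / d⌋₊ + 1 : ℕ) : ℝ) := by rw [ENNReal.ofReal_natCast]; rfl
    _ ≤ _ := by
      apply ENNReal.ofReal_le_ofReal
      push_cast
      have := Nat.floor_le (div_nonneg (sub_nonneg.mpr hAB) hd.le)
      linarith

theorem exists_besselJ_count {α ω : ℝ} (hα : 0 ≤ α) (hω : 1 < ω) : ∃ C : ℝ, 0 ≤ C ∧
    ∀ A B : ℝ, A ≤ B → ({j | 0 < j ∧ besselJ α j = 0 ∧ j ∈ Icc A B}.encard : ℝ≥0∞) ≤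
      ENNReal.ofReal ((B - A) * ω / Real.pi + C) := by
  have hp := Real.pi_pos
  -- Beyond `R` the Sturm spacing is at least π/ω. Below `R` the spacing 2 bounds the number of
  -- zeros by R/2 + 1, independently of the interval.
  set R : ℝ := 1 / (ω - 1)
  have hR : 0 < R := by have : 0 < ω - 1 := by linarith
                        positivity
  have hgapω : Real.pi / ω ≤ Real.pi / √(1 + 1 / (4 * R ^ 2)) := by
    gcongr
    rw [Real.sqrt_le_left (by linarith)]
    simp only [R]
    have : 0 < ω - 1 := by linarith
    field_simp
    nlinarith
  refine ⟨R / 2 + 2, by positivity, fun A B hAB => ?_⟩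
  have hsub : {j | 0 < j ∧ besselJ α j = 0 ∧ j ∈ Icc A B} ⊆
      {j | 0 < j ∧ besselJ α j = 0 ∧ j ∈ Icc 0 R} ∪ {j | R ≤ j ∧ besselJ α j = 0 ∧ j ∈ Icc A B} := by
    rintro j ⟨h1, h2, h3⟩
    rcases le_total j R with h | h
    · exact Or.inl ⟨h1, h2, h1.le, h⟩
    · exact Or.inr ⟨h, h2, h3⟩
  have h1 : ({j | 0 < j ∧ besselJ α j = 0 ∧ j ∈ Icc 0 R}.encard : ℝ≥0∞) ≤
      ENNReal.ofReal ((R - 0) / 2 + 1) :=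
    encard_le_of_gap two_pos hR.le (fun j hj => hj.2.2) fun x hx y hy hxy =>
      besselJ_zero_gap_two hα hx.1 hxy hx.2.1 hy.2.1
  have h2 : ({j | R ≤ j ∧ besselJ α j = 0 ∧ j ∈ Icc A B}.encard : ℝ≥0∞) ≤
      ENNReal.ofReal ((B - A) / (Real.pi / ω) + 1) :=
    encard_le_of_gap (by positivity) hAB (fun j hj => hj.2.2) fun x hx y hy hxy =>
      hgapω.trans (besselJ_zero_gap hα hR hx.1 hxy hx.2.1 hy.2.1)
  have h3 := (encard_le_encard hsub).trans (encard_union_le _ _)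
  calc _ ≤ (({j | 0 < j ∧ besselJ α j = 0 ∧ j ∈ Icc 0 R}.encard
        + {j | R ≤ j ∧ besselJ α j = 0 ∧ j ∈ Icc A B}.encard : ℕ∞) : ℝ≥0∞) := by exact_mod_cast h3
    _ ≤ ENNReal.ofReal ((R - 0) / 2 + 1) + ENNReal.ofReal ((B - A) / (Real.pi / ω) + 1) := by
        push_cast
        exact add_le_add h1 h2
    _ = _ := by
        have : 0 ≤ B - A := by linarith
        rw [← ENNReal.ofReal_add (by positivity) (by positivity)]
        congr 1
        field_simp
        ring

theorem exists_sigmaN_interval_le {α a ω : ℝ} (hα : 0 ≤ α) (ha : 0 < a) (hω : 1 < ω) :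
    ∃ C : ℝ, 0 ≤ C ∧ ∀ N : ℕ, 1 ≤ N → ∀ p q : ℝ, p ≤ q →
      sigmaN α a N (sOf a ⁻¹' Icc p q) ≤ ENNReal.ofReal ((q - p) * ω + C / N) := by
  obtain ⟨C, hC, h⟩ := exists_besselJ_count hα hω
  have hp := Real.pi_pos
  refine ⟨C, hC, fun N hN p q hpq => ?_⟩
  have hN' : (0:ℝ) < N := by exact_mod_cast hN
  rw [sigmaN_apply _ _ _ ((continuous_sOf a).measurable measurableSet_Icc)]
  have h1 : (besselSet α a N ∩ sOf a ⁻¹' Icc p q).encard ≤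
      {j | 0 < j ∧ besselJ α j = 0 ∧ j ∈ Icc (Real.pi * N * p) (Real.pi * N * q)}.encard := by
    refine encard_le_encard_of_injOn (f := fun u => Real.pi * N * sOf a u) ?_ ?_
    · rintro u ⟨hu, hu1, hu2⟩
      obtain ⟨h0, h1⟩ := sOf_eq_of_besselSet ha hN hu
      exact ⟨by positivity, h1, mul_le_mul_of_nonneg_left hu1 (by positivity),
        mul_le_mul_of_nonneg_left hu2 (by positivity)⟩
    · intro u _ v _ huv
      exact sOf_injective ha (mul_left_cancel₀ (by positivity) huv)
  calc _ ≤ (N : ℝ≥0∞)⁻¹ * ENNReal.ofReal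
        ((Real.pi * N * q - Real.pi * N * p) * ω / Real.pi + C) := by
        gcongr
        refine le_trans ?_ (h _ _ (by gcongr))
        exact_mod_cast h1
    _ = _ := by
        rw [← ENNReal.ofReal_natCast, ← ENNReal.ofReal_inv_of_pos hN', ← ENNReal.ofReal_mul (by positivity)]
        congr 1
        field_simp

/-- Lebesgue measure is the largest outer measure with these bounds on intervals, so comparison
there is enough, with no finiteness assumed of `m`. -/
theorem measure_le_volume_of_Ioc {m : Measure ℝ}
    (h : ∀ p q : ℝ, p ≤ q → m (Ioc p q) ≤ ENNReal.ofReal (q - p)) : m ≤ volume := by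
  rw [Measure.le_iff]
  intro s hs
  rw [Real.volume_eq_stieltjes_id]
  have h1 : m.toOuterMeasure ≤ StieltjesFunction.id.outer := by
    rw [StieltjesFunction.outer, OuterMeasure.le_ofFunction]
    intro t
    rw [StieltjesFunction.length_eq]
    refine le_iInf₂ fun p q => le_iInf fun hpq => ?_
    have hbot : (botSet : Set ℝ) = ∅ := by
      ext x
      simp [botSet, not_isBot]
    rw [hbot, sdiff_empty] at hpq
    refine (measure_mono hpq).trans ?_
    rcases le_total p q with hle | hle
    · exact h p q hle
    · rw [Ioc_eq_empty (not_lt.mpr hle)]; simp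
  rw [StieltjesFunction.measure_def]
  exact h1 s

theorem le_sigma_of_map_sOf_le {a : ℝ} (ha : 0 < a) {ν : Measure RMinus}
    (h : ν.map (sOf a) ≤ volume) : ν ≤ sigma a := by
  rw [Measure.le_iff]
  intro s hs
  rw [← volume_image_sOf ha hs]
  refine le_trans ?_ (h _)
  rw [(measurableEmbedding_sOf ha).map_apply, preimage_image_eq _ (sOf_injective ha)]

/-! ### Stability of the constraint under weak limits -/

instance : ProperSpace RMinus :=
  ⟨fun x r => isClosed_Iic.isClosedEmbedding_subtypeVal.isCompact_preimage
    (isCompact_closedBall (x : ℝ) r)⟩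

instance : ProperSpace RPlus :=
  ⟨fun x r => isClosed_Ici.isClosedEmbedding_subtypeVal.isCompact_preimage
    (isCompact_closedBall (x : ℝ) r)⟩

theorem isClosed_setOf_lintegral_le (f : BoundedContinuousFunction RMinus ℝ≥0) (b : ℝ≥0∞) :
    IsClosed {ν : FiniteMeasure RMinus | ∫⁻ u, f u ∂(ν : Measure RMinus) ≤ b} := by
  have h : Continuous fun ν : FiniteMeasure RMinus => ∫⁻ u, f u ∂(ν : Measure RMinus) := by
    simp_rw [← FiniteMeasure.testAgainstNN_coe_eq]
    exact ENNReal.continuous_coe.comp (FiniteMeasure.continuous_testAgainstNN_eval f)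
  exact isClosed_le h continuous_const

/-- Indicators of compact sets are limits of thickened indicators, and inner regularity does the
rest. As `lam` may be infinite, it is first restricted to a compact neighbourhood. -/
theorem le_of_forall_lintegral_le {ν lam : Measure RMinus} [IsFiniteMeasure ν]
    [IsFiniteMeasureOnCompacts lam]
    (h : ∀ f : BoundedContinuousFunction RMinus ℝ≥0, ∫⁻ u, f u ∂ν ≤ ∫⁻ u, f u ∂lam) :
    ν ≤ lam := by
  have hK : ∀ K : Set RMinus, IsCompact K → ν K ≤ lam K := by
    intro K hK
    set δs : ℕ → ℝ := fun n => 1 / ((n : ℝ) + 1)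
    have hδ : ∀ n, 0 < δs n := fun n => by positivity
    have hδ1 : ∀ n, δs n ≤ 1 := fun n => by
      simp only [δs]
      rw [div_le_one (by positivity)]
      linarith [(n.cast_nonneg : (0:ℝ) ≤ n)]
    have hlim : Tendsto δs atTop (𝓝 0) := tendsto_one_div_add_atTop_nhds_zero_nat
    have hcomp : IsCompact (Metric.cthickening 1 K) := hK.cthickening
    have : IsFiniteMeasure (lam.restrict (Metric.cthickening 1 K)) :=
      ⟨by rw [Measure.restrict_apply_univ]; exact hcomp.measure_lt_top⟩
    have h1 := tendsto_lintegral_thickenedIndicator_of_isClosed ν hK.isClosed hδ hlim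
    have h2 := tendsto_lintegral_thickenedIndicator_of_isClosed
      (lam.restrict (Metric.cthickening 1 K)) hK.isClosed hδ hlim
    rw [Measure.restrict_apply hK.measurableSet,
      inter_eq_self_of_subset_left (Metric.self_subset_cthickening K)] at h2
    refine le_of_tendsto_of_tendsto' h1 h2 fun n => (h _).trans ?_
    rw [← lintegral_indicator Metric.isClosed_cthickening.measurableSet]
    refine lintegral_mono fun u => ?_
    by_cases hu : u ∈ Metric.cthickening 1 K
    · rw [indicator_of_mem hu]
    · have : u ∉ Metric.thickening (δs n) K := fun h' =>
        hu (Metric.cthickening_mono (hδ1 n) K (Metric.thickening_subset_cthickening _ _ h'))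
      rw [thickenedIndicator_zero (hδ n) K this]
      simp
  rw [Measure.le_iff]
  intro s hs
  rw [hs.measure_eq_iSup_isCompact]
  exact iSup₂_le fun K hKs => iSup_le fun hKc => (hK K hKc).trans (measure_mono hKs)

theorem isClosed_constrained (lam : Measure RMinus) [IsFiniteMeasureOnCompacts lam] :
    IsClosed (constrained lam) := by
  have : constrained lam = {ν : FiniteMeasure RMinus | ν.mass = 1 / 2} ∩
      ⋂ f : BoundedContinuousFunction RMinus ℝ≥0,
        {ν : FiniteMeasure RMinus | ∫⁻ u, f u ∂(ν : Measure RMinus) ≤ ∫⁻ u, f u ∂lam} := by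
    ext ν
    simp only [constrained, mem_inter_iff, mem_iInter, mem_ofPred_eq]
    refine and_congr_right fun _ => ⟨fun h f => lintegral_mono' h le_rfl, le_of_forall_lintegral_le⟩
  rw [this]
  exact (isClosed_eq FiniteMeasure.continuous_mass continuous_const).inter
    (isClosed_iInter fun f => isClosed_setOf_lintegral_le f _)

theorem isFiniteMeasureOnCompacts_sigmaN {α a : ℝ} (hα : 0 ≤ α) (ha : 0 < a) {N : ℕ}
    (hN : 1 ≤ N) : IsFiniteMeasureOnCompacts (sigmaN α a N) := by
  refine ⟨fun K hK => ?_⟩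
  obtain ⟨C, -, h⟩ := exists_sigmaN_interval_le hα ha one_lt_two
  obtain ⟨q, hq⟩ := (hK.image (continuous_sOf a)).bddAbove
  have hsub : K ⊆ sOf a ⁻¹' Icc 0 (max q 0) := fun u hu =>
    ⟨sOf_nonneg a u, (hq (mem_image_of_mem _ hu)).trans (le_max_left _ _)⟩
  exact (measure_mono hsub).trans_lt ((h N hN _ _ (le_max_right _ _)).trans_lt ENNReal.ofReal_lt_top)

/-- A limit point outside ℰ is outside each closed set of measures below σ_N, so it is approached
with N arbitrarily large only. There the count of zeros gives intervals of length ℓ mass at most ωℓ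
+ C/N, for any ω > 1, and in the limit the bound by σ. -/
theorem isClosed_E {α a : ℝ} (hα : 0 ≤ α) (ha : 0 < a) : IsClosed (E α a) := by
  have hcl : ∀ N : ℕ, 1 ≤ N → IsClosed (constrained (sigmaN α a N)) := fun N hN =>
    have := isFiniteMeasureOnCompacts_sigmaN hα ha hN
    isClosed_constrained _
  rw [← closure_subset_iff_isClosed]
  intro ν hν
  by_contra hνE
  apply hνE
  refine Or.inr ⟨?_, ?_⟩
  · exact closure_minimal (fun ν' h => mass_of_mem_E h)
      (isClosed_eq FiniteMeasure.continuous_mass continuous_const) hν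
  apply le_sigma_of_map_sOf_le ha
  apply measure_le_volume_of_Ioc
  intro p q hpq
  have key : ∀ ω δ : ℝ, 1 < ω → 0 < δ →
      (ν : Measure RMinus).map (sOf a) (Ioc p q) ≤ ENNReal.ofReal ((q - p + 2 * δ) * ω) := by
    intro ω δ hω hδ
    obtain ⟨C, hC, h⟩ := exists_sigmaN_interval_le hα ha hω
    set f : BoundedContinuousFunction RMinus ℝ≥0 :=
      (thickenedIndicator hδ (Icc p q)).compContinuous ⟨sOf a, continuous_sOf a⟩
    have hf1 : ∀ u, (f u : ℝ≥0∞) ≤ (sOf a ⁻¹' Icc (p - δ) (q + δ)).indicator 1 u := by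
      intro u
      by_cases hu : u ∈ sOf a ⁻¹' Icc (p - δ) (q + δ)
      · rw [indicator_of_mem hu]
        exact ENNReal.coe_le_one_iff.mpr (thickenedIndicator_le_one hδ _ _)
      · have : sOf a u ∉ Metric.thickening δ (Icc p q) := fun h' => hu (by
          obtain ⟨z, hz, hz'⟩ := Metric.mem_thickening_iff.mp h'
          rw [Real.dist_eq, abs_lt] at hz'
          exact ⟨by linarith [hz.1], by linarith [hz.2]⟩)
        simp [f, thickenedIndicator_zero hδ _ this]
    have hm : MeasurableSet (sOf a ⁻¹' Icc (p - δ) (q + δ)) :=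
      (continuous_sOf a).measurable measurableSet_Icc
    have hf2 : ∀ lam : Measure RMinus, ∫⁻ u, f u ∂lam ≤ lam (sOf a ⁻¹' Icc (p - δ) (q + δ)) :=
      fun lam => (lintegral_mono hf1).trans_eq (lintegral_indicator_one hm)
    have hpq' : p - δ ≤ q + δ := by linarith
    have hM : ∀ M : ℕ, 1 ≤ M →
        ∫⁻ u, f u ∂(ν : Measure RMinus) ≤ ENNReal.ofReal ((q + δ - (p - δ)) * ω + C / M) := by
      intro M hM
      -- A finite union of closed sets, which cannot contain the limit point, and one closed
      -- condition which must then hold for it.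
      have hsub : E α a ⊆ (⋃ N ∈ Finset.Icc 1 M, constrained (sigmaN α a N)) ∪
          {ν' | ∫⁻ u, f u ∂(ν' : Measure RMinus) ≤
            ENNReal.ofReal ((q + δ - (p - δ)) * ω + C / M)} := by
        rintro ν' (hν' | hν')
        · simp only [mem_iUnion] at hν'
          obtain ⟨N, hN, hν'⟩ := hν'
          rcases le_total N M with hle | hle
          · exact Or.inl (mem_biUnion (Finset.mem_coe.mpr (Finset.mem_Icc.mpr ⟨hN, hle⟩)) hν')
          · refine Or.inr (((lintegral_mono' hν'.2 le_rfl).trans (hf2 _)).trans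
              ((h N hN _ _ hpq').trans (ENNReal.ofReal_le_ofReal ?_)))
            have : (0:ℝ) < M := by exact_mod_cast hM
            gcongr
        · refine Or.inr (((lintegral_mono' hν'.2 le_rfl).trans (hf2 _)).trans
            ((sigma_preimage_sOf_le ha measurableSet_Icc).trans ?_))
          rw [Real.volume_Icc]
          apply ENNReal.ofReal_le_ofReal
          have : 0 ≤ C / M := by positivity
          nlinarith
      have hcl' := closure_minimal hsub (((Finset.Icc 1 M).finite_toSet.isClosed_biUnion
        fun N hN => hcl N (Finset.mem_Icc.mp hN).1).union (isClosed_setOf_lintegral_le f _)) hν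
      refine hcl'.resolve_left fun h' => hνE ?_
      obtain ⟨N, hN, h'⟩ := mem_iUnion₂.mp h'
      exact Or.inl (mem_iUnion₂.mpr ⟨N, (Finset.mem_Icc.mp hN).1, h'⟩)
    have hlim : Tendsto (fun M : ℕ => ENNReal.ofReal ((q + δ - (p - δ)) * ω + C / M)) atTop
        (𝓝 (ENNReal.ofReal ((q + δ - (p - δ)) * ω + 0))) :=
      (ENNReal.continuous_ofReal.tendsto _).comp
        (tendsto_const_nhds.add (tendsto_const_div_atTop_nhds_zero_nat C))
    have h1 := ge_of_tendsto hlim (eventually_atTop.mpr ⟨1, hM⟩)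
    rw [Measure.map_apply (continuous_sOf a).measurable measurableSet_Ioc]
    calc _ ≤ (ν : Measure RMinus) (sOf a ⁻¹' Icc p q) :=
          measure_mono (preimage_mono Ioc_subset_Icc_self)
      _ = ∫⁻ u, (sOf a ⁻¹' Icc p q).indicator 1 u ∂(ν : Measure RMinus) :=
          (lintegral_indicator_one ((continuous_sOf a).measurable measurableSet_Icc)).symm
      _ ≤ ∫⁻ u, f u ∂(ν : Measure RMinus) := by
          refine lintegral_mono fun u => ?_
          by_cases hu : u ∈ sOf a ⁻¹' Icc p q
          · have : f u = 1 := thickenedIndicator_one hδ _ hu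
            rw [indicator_of_mem hu, this]; simp
          · rw [indicator_of_notMem hu]; exact zero_le
      _ ≤ _ := h1
      _ = _ := by congr 1; ring
  have hlim : Tendsto (fun δ : ℝ => ENNReal.ofReal ((q - p + 2 * δ) * (1 + δ))) (𝓝[>] 0)
      (𝓝 (ENNReal.ofReal (q - p))) := by
    have : Continuous fun δ : ℝ => ENNReal.ofReal ((q - p + 2 * δ) * (1 + δ)) :=
      ENNReal.continuous_ofReal.comp (by fun_prop)
    have h := this.tendsto 0
    simp only [mul_zero, add_zero, mul_one] at h
    exact h.mono_left nhdsWithin_le_nhds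
  refine ge_of_tendsto hlim ?_
  filter_upwards [self_mem_nhdsWithin] with δ hδ
  have hδ : 0 < δ := hδ
  exact key (1 + δ) δ (by linarith) hδ

/-! ### The logarithmic kernel seen from the line -/

/-- The distance between `T x` and `T y`. -/
def chord (x y : ℝ) : ℝ := |x - y| / (√(1 + x ^ 2) * √(1 + y ^ 2))

theorem dist_T (x y : ℝ) : dist (T x) (T y) = chord x y := by
  have hx : 0 < 1 + x ^ 2 := by positivity
  have hy : 0 < 1 + y ^ 2 := by positivity
  have h0 : 0 ≤ chord x y := by unfold chord; positivity
  rw [EuclideanSpace.dist_eq, ← Real.sqrt_sq h0]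
  congr 1
  simp only [T, Fin.sum_univ_two, Real.dist_eq, sq_abs, PiLp.toLp_apply, Matrix.cons_val_zero,
    Matrix.cons_val_one, chord, div_pow, mul_pow, Real.sq_sqrt hx.le, Real.sq_sqrt hy.le]
  field_simp
  ring

theorem chord_nonneg (x y : ℝ) : 0 ≤ chord x y := by unfold chord; positivity

theorem chord_le_one (x y : ℝ) : chord x y ≤ 1 := dist_T x y ▸ dist_T_le_one x y

theorem chord_comm (x y : ℝ) : chord x y = chord y x := by
  rw [← dist_T, dist_comm, dist_T]

theorem chord_self (x : ℝ) : chord x x = 0 := by simp [chord]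

theorem chord_pos {x y : ℝ} (h : x ≠ y) : 0 < chord x y := by
  have := abs_pos.mpr (sub_ne_zero.mpr h)
  unfold chord; positivity

theorem chord_eq_zero {x y : ℝ} : chord x y = 0 ↔ x = y :=
  ⟨fun h => by by_contra h1; exact (chord_pos h1).ne' h, fun h => h ▸ chord_self x⟩

theorem continuous_chord : Continuous fun p : ℝ × ℝ => chord p.1 p.2 := by
  unfold chord
  refine Continuous.div (by fun_prop) (by fun_prop) fun p => ?_
  positivity

theorem T_injective : Function.Injective T := fun x y h => by
  rw [← chord_eq_zero, ← dist_T, h, dist_self]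

theorem continuous_T : Continuous T := by
  rw [continuous_iff_continuousAt]
  intro x
  rw [ContinuousAt, tendsto_iff_dist_tendsto_zero]
  simp_rw [dist_T]
  have : Continuous fun y => chord y x := continuous_chord.comp (by fun_prop : Continuous fun y : ℝ => (y, x))
  simpa [chord_self] using this.tendsto x

/-- The logarithmic kernel `-log |T x - T y|`. -/
def lk (x y : ℝ) : ℝ := -Real.log (chord x y)

theorem lk_comm (x y : ℝ) : lk x y = lk y x := by rw [lk, lk, chord_comm]

theorem lk_nonneg (x y : ℝ) : 0 ≤ lk x y :=
  neg_nonneg.mpr (Real.log_nonpos (chord_nonneg x y) (chord_le_one x y))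

theorem lk_eq {x y : ℝ} (h : x ≠ y) :
    lk x y = 1 / 2 * Real.log (1 + x ^ 2) + 1 / 2 * Real.log (1 + y ^ 2) - Real.log |x - y| := by
  have hx : 0 < 1 + x ^ 2 := by positivity
  have hy : 0 < 1 + y ^ 2 := by positivity
  have := abs_pos.mpr (sub_ne_zero.mpr h)
  rw [lk, chord, Real.log_div (by positivity) (by positivity), Real.log_mul (by positivity)
    (by positivity), Real.log_sqrt hx.le, Real.log_sqrt hy.le]
  ring

/-- The logarithmic kernel with its value `+∞` on the diagonal. -/
def kern (x y : ℝ) : ℝ≥0∞ := if x = y then ⊤ else ENNReal.ofReal (lk x y)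

theorem kern_of_ne {x y : ℝ} (h : x ≠ y) : kern x y = ENNReal.ofReal (lk x y) := if_neg h

theorem kern_self (x : ℝ) : kern x x = ⊤ := if_pos rfl

theorem kern_comm (x y : ℝ) : kern x y = kern y x := by
  unfold kern; rw [lk_comm]; simp only [eq_comm]

theorem logKernel_T (x y : ℝ) : logKernel (T x) (T y) = (kern x y : EReal) := by
  rcases eq_or_ne x y with rfl | h
  · simp [logKernel, kern_self]
  · rw [logKernel, edist_dist, dist_T, kern_of_ne h, ENNReal.log_ofReal_of_pos (chord_pos h),
      EReal.coe_ennreal_ofReal, max_eq_left (lk_nonneg x y), lk, EReal.coe_neg]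

/-- The kernel truncated at the level `L`. -/
def kT (L x y : ℝ) : ℝ := -Real.log (max (chord x y) (Real.exp (-L)))

theorem continuous_kT (L : ℝ) : Continuous fun p : ℝ × ℝ => kT L p.1 p.2 := by
  unfold kT
  refine (Continuous.log (continuous_chord.max continuous_const) fun p => ?_).neg
  exact (lt_max_of_lt_right (Real.exp_pos _)).ne'

theorem kT_comm (L x y : ℝ) : kT L x y = kT L y x := by rw [kT, kT, chord_comm]

theorem kT_nonneg {L : ℝ} (hL : 0 ≤ L) (x y : ℝ) : 0 ≤ kT L x y :=
  neg_nonneg.mpr (Real.log_nonpos ((chord_nonneg x y).trans (le_max_left _ _))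
    (max_le (chord_le_one x y) (Real.exp_le_one_iff.mpr (by linarith))))

theorem kT_le (L x y : ℝ) : kT L x y ≤ L := by
  have h := Real.log_le_log (Real.exp_pos (-L)) (le_max_right (chord x y) (Real.exp (-L)))
  rw [Real.log_exp] at h
  unfold kT; linarith

theorem kT_self (L x : ℝ) : kT L x x = L := by
  rw [kT, chord_self, max_eq_right (Real.exp_pos _).le, Real.log_exp, neg_neg]

theorem kT_eq_min {x y : ℝ} (h : x ≠ y) (L : ℝ) : kT L x y = min (lk x y) L := by
  have hc := chord_pos h
  unfold kT lk
  rcases le_total (chord x y) (Real.exp (-L)) with h1 | h1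
  · have := Real.log_le_log hc h1
    rw [Real.log_exp] at this
    rw [max_eq_right h1, Real.log_exp, min_eq_right (by linarith), neg_neg]
  · have := Real.log_le_log (Real.exp_pos _) h1
    rw [Real.log_exp] at this
    rw [max_eq_left h1, min_eq_left (by linarith)]

theorem ofReal_kT (L x y : ℝ) :
    ENNReal.ofReal (kT L x y) = min (kern x y) (ENNReal.ofReal L) := by
  rcases eq_or_ne x y with rfl | h
  · rw [kT_self, kern_self, min_eq_right le_top]
  · rw [kT_eq_min h, kern_of_ne h, ENNReal.ofReal_min]

theorem ofReal_kT_le_kern (L x y : ℝ) : ENNReal.ofReal (kT L x y) ≤ kern x y :=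
  ofReal_kT L x y ▸ min_le_left _ _

theorem kT_mono {L M : ℝ} (h : L ≤ M) (x y : ℝ) : kT L x y ≤ kT M x y := by
  unfold kT
  refine neg_le_neg (Real.log_le_log (lt_max_of_lt_right (Real.exp_pos _)) ?_)
  exact max_le_max le_rfl (Real.exp_le_exp.mpr (by linarith))

/-- Truncations are continuous and bounded, so everything about the singular kernel is obtained from
them by monotone limits. -/
theorem kern_eq_iSup (x y : ℝ) : kern x y = ⨆ n : ℕ, ENNReal.ofReal (kT n x y) := by
  simp_rw [ofReal_kT, min_comm (kern x y), ← iSup_inf_eq]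
  simp [ENNReal.iSup_natCast]

theorem measurable_kern : Measurable fun p : ℝ × ℝ => kern p.1 p.2 := by
  simp_rw [kern_eq_iSup]
  exact Measurable.iSup fun n => (continuous_kT n).measurable.ennreal_ofReal

theorem measurable_lk : Measurable fun p : ℝ × ℝ => lk p.1 p.2 :=
  (Real.measurable_log.comp continuous_chord.measurable).neg

/-! ### Energies -/

/-- The mutual logarithmic energy of two measures on the line, seen on the circle. -/
def en (m m' : Measure ℝ) : ℝ≥0∞ := ∫⁻ p, kern p.1 p.2 ∂m.prod m'

/-- The truncated energy. -/
def enT (L : ℝ) (m m' : Measure ℝ) : ℝ := ∫ p, kT L p.1 p.2 ∂m.prod m'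

theorem measurable_logKernel : Measurable fun p : Plane × Plane => logKernel p.1 p.2 := by
  unfold logKernel
  exact ((continuous_neg (G := EReal)).measurable.comp
    (ENNReal.measurable_log.comp (measurable_fst.edist measurable_snd)))

theorem logEnergy_map_T (m m' : Measure ℝ) [SFinite m] [SFinite m'] :
    logEnergy (m.map T) (m'.map T) = (en m m' : EReal) := by
  have hT := continuous_T.measurable
  have h1 : Measurable fun p : Plane × Plane => (logKernel p.1 p.2).toENNReal :=
    EReal.continuous_toENNReal.measurable.comp measurable_logKernel
  have h2 : Measurable fun p : Plane × Plane => (-logKernel p.1 p.2).toENNReal :=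
    EReal.continuous_toENNReal.measurable.comp
      ((continuous_neg (G := EReal)).measurable.comp measurable_logKernel)
  rw [logEnergy, eintegral, Measure.map_prod_map _ _ hT hT,
    lintegral_map h1 (hT.prodMap hT), lintegral_map h2 (hT.prodMap hT)]
  simp only [Prod.map_fst, Prod.map_snd, logKernel_T, EReal.toENNReal_coe, en]
  have : ∀ x : ℝ≥0∞, (-(x : EReal)).toENNReal = 0 := fun x =>
    EReal.toENNReal_of_nonpos (by simpa using EReal.coe_ennreal_nonneg x)
  simp only [this, lintegral_zero, EReal.coe_ennreal_zero, sub_zero]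

theorem en_comm (m m' : Measure ℝ) [SFinite m] [SFinite m'] : en m m' = en m' m := by
  unfold en
  rw [← Measure.prod_swap, lintegral_map measurable_kern measurable_swap]
  simp only [Prod.fst_swap, Prod.snd_swap, kern_comm]

theorem enT_comm (L : ℝ) (m m' : Measure ℝ) [SFinite m] [SFinite m'] :
    enT L m m' = enT L m' m := by
  unfold enT
  rw [← Measure.prod_swap, integral_map measurable_swap.aemeasurable
    (continuous_kT L).aestronglyMeasurable]
  simp only [Prod.fst_swap, Prod.snd_swap, kT_comm]

theorem integrable_kT {L : ℝ} (hL : 0 ≤ L) (π : Measure (ℝ × ℝ)) [IsFiniteMeasure π] :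
    Integrable (fun p => kT L p.1 p.2) π :=
  Integrable.of_bound (continuous_kT L).aestronglyMeasurable L (.of_forall fun p => by
    rw [Real.norm_of_nonneg (kT_nonneg hL _ _)]; exact kT_le _ _ _)

theorem ofReal_enT {L : ℝ} (hL : 0 ≤ L) (m m' : Measure ℝ) [IsFiniteMeasure m]
    [IsFiniteMeasure m'] :
    ENNReal.ofReal (enT L m m') = ∫⁻ p, ENNReal.ofReal (kT L p.1 p.2) ∂m.prod m' :=
  ofReal_integral_eq_lintegral_ofReal (integrable_kT hL _)
    (.of_forall fun p => kT_nonneg hL _ _)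

theorem ofReal_enT_le_en {L : ℝ} (hL : 0 ≤ L) (m m' : Measure ℝ) [IsFiniteMeasure m]
    [IsFiniteMeasure m'] : ENNReal.ofReal (enT L m m') ≤ en m m' := by
  rw [ofReal_enT hL]
  exact lintegral_mono fun _ => ofReal_kT_le_kern _ _ _

theorem enT_nonneg {L : ℝ} (hL : 0 ≤ L) (m m' : Measure ℝ) : 0 ≤ enT L m m' :=
  integral_nonneg fun _ => kT_nonneg hL _ _

theorem enT_mono {L M : ℝ} (hL : 0 ≤ L) (h : L ≤ M) (m m' : Measure ℝ) [IsFiniteMeasure m]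
    [IsFiniteMeasure m'] : enT L m m' ≤ enT M m m' :=
  integral_mono (integrable_kT hL _) (integrable_kT (hL.trans h) _) fun _ => kT_mono h _ _

theorem en_eq_iSup (m m' : Measure ℝ) [IsFiniteMeasure m] [IsFiniteMeasure m'] :
    en m m' = ⨆ n : ℕ, ENNReal.ofReal (enT n m m') := by
  simp_rw [ofReal_enT (Nat.cast_nonneg _)]
  rw [← lintegral_iSup (fun n => (continuous_kT n).measurable.ennreal_ofReal)]
  · simp only [en, kern_eq_iSup]
  · exact fun n k h p => ENNReal.ofReal_le_ofReal (kT_mono (by exact_mod_cast h) _ _)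

theorem en_mono {m m' n n' : Measure ℝ} [SFinite m'] [SFinite n'] (h : m ≤ n) (h' : m' ≤ n') :
    en m m' ≤ en n n' := by
  unfold en
  exact lintegral_mono' (Measure.prod_mono h h') le_rfl

theorem en_add_left (m₁ m₂ m : Measure ℝ) [SFinite m₁] [SFinite m₂] [SFinite m] :
    en (m₁ + m₂) m = en m₁ m + en m₂ m := by
  simp only [en, Measure.add_prod, lintegral_add_measure]

theorem en_add_right (m m₁ m₂ : Measure ℝ) [SFinite m₁] [SFinite m₂] [SFinite m] :
    en m (m₁ + m₂) = en m m₁ + en m m₂ := by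
  simp only [en, Measure.prod_add, lintegral_add_measure]

theorem en_smul_left (c : ℝ≥0∞) (m m' : Measure ℝ) [SFinite m] [SFinite m'] :
    en (c • m) m' = c * en m m' := by
  simp only [en, Measure.prod_smul_left, lintegral_smul_measure, smul_eq_mul]

theorem en_smul_right (c : ℝ≥0∞) (m m' : Measure ℝ) [SFinite m] [SFinite m'] :
    en m (c • m') = c * en m m' := by
  rw [en, Measure.prod_smul_right, lintegral_smul_measure, smul_eq_mul, en]

/-- A measure with an atom has infinite energy. -/
theorem en_eq_top_of_atom {m : Measure ℝ} [SFinite m] {x : ℝ} (h : m {x} ≠ 0) : en m m = ⊤ := by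
  rw [eq_top_iff, en]
  calc (⊤ : ℝ≥0∞) = ∫⁻ p in ({x} ×ˢ {x} : Set (ℝ × ℝ)), kern p.1 p.2 ∂m.prod m := by
        have : ∀ p ∈ ({x} ×ˢ {x} : Set (ℝ × ℝ)), kern p.1 p.2 = ⊤ := by
          rintro ⟨y, z⟩ ⟨hy, hz⟩
          simp only [mem_singleton_iff] at hy hz
          subst hy hz
          exact kern_self _
        rw [setLIntegral_congr_fun (by measurability) this]
        rw [lintegral_const, Measure.restrict_apply_univ, Measure.prod_prod, ENNReal.top_mul]
        exact mul_ne_zero h h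
    _ ≤ _ := setLIntegral_le_lintegral _ _

/-! ### Positivity of the logarithmic energy -/

open scoped ComplexConjugate

/-- The Cayley transform, with values in the unit circle. -/
def cay (x : ℝ) : ℂ := (x - Complex.I) / (x + Complex.I)

theorem cay_denom_ne (x : ℝ) : (x : ℂ) + Complex.I ≠ 0 := fun h => by
  have := congrArg Complex.im h
  simp at this

theorem norm_cay_denom (x : ℝ) : ‖(x : ℂ) + Complex.I‖ = √(1 + x ^ 2) := by
  rw [Complex.norm_def, Complex.normSq_apply]
  simp; ring_nf

theorem continuous_cay : Continuous cay := by
  unfold cay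
  exact Continuous.div (by fun_prop) (by fun_prop) cay_denom_ne

theorem norm_cay (x : ℝ) : ‖cay x‖ = 1 := by
  have h : ‖(x : ℂ) - Complex.I‖ = ‖(x : ℂ) + Complex.I‖ := by
    rw [Complex.norm_def, Complex.norm_def, Complex.normSq_apply, Complex.normSq_apply]
    simp
  rw [cay, norm_div, h, div_self (norm_ne_zero_iff.mpr (cay_denom_ne x))]

theorem norm_cay_sub (x y : ℝ) : ‖cay x - cay y‖ = 2 * chord x y := by
  have h : cay x - cay y = 2 * Complex.I * ((x - y : ℝ) : ℂ) / ((x + Complex.I) * (y + Complex.I)) := by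
    rw [cay, cay, div_sub_div _ _ (cay_denom_ne x) (cay_denom_ne y)]
    congr 1
    push_cast; ring
  rw [h, norm_div, norm_mul, norm_mul, norm_mul, norm_cay_denom, norm_cay_denom, chord,
    Complex.norm_real, Complex.norm_I]
  simp; ring

theorem cay_injective : Function.Injective cay := fun x y h => by
  have := norm_cay_sub x y
  rw [h, sub_self, norm_zero] at this
  exact chord_eq_zero.mp (by linarith)

/-- The product `c(x) conj c(y)`. -/
def cayProd (x y : ℝ) : ℂ := cay x * conj (cay y)

theorem norm_cayProd (x y : ℝ) : ‖cayProd x y‖ = 1 := by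
  rw [cayProd, norm_mul, RCLike.norm_conj, norm_cay, norm_cay, one_mul]

theorem norm_one_sub_cayProd (x y : ℝ) : ‖1 - cayProd x y‖ = 2 * chord x y := by
  have h1 : cay y * conj (cay y) = 1 := by
    rw [Complex.mul_conj, Complex.normSq_eq_norm_sq, norm_cay]; simp
  have : 1 - cayProd x y = (cay y - cay x) * conj (cay y) := by
    rw [cayProd, sub_mul, h1]
  rw [this, norm_mul, RCLike.norm_conj, norm_cay, mul_one, norm_cay_sub, chord_comm]

theorem continuous_cayProd : Continuous fun p : ℝ × ℝ => cayProd p.1 p.2 := by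
  unfold cayProd
  exact (continuous_cay.comp continuous_fst).mul
    (Complex.continuous_conj.comp (continuous_cay.comp continuous_snd))

theorem norm_smul_cayProd {r : ℝ} (hr : 0 ≤ r) (x y : ℝ) : ‖(r : ℂ) * cayProd x y‖ = r := by
  rw [norm_mul, norm_cayProd, Complex.norm_real, Real.norm_of_nonneg hr, mul_one]

/-- The kernel `log 2 - log |1 - r c(x) conj c(y)|`. -/
def kr (r x y : ℝ) : ℝ := Real.log 2 - Real.log ‖1 - (r : ℂ) * cayProd x y‖

theorem one_sub_le_norm {r : ℝ} (hr : 0 ≤ r) (x y : ℝ) : 1 - r ≤ ‖1 - (r : ℂ) * cayProd x y‖ := by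
  have := norm_sub_norm_le (1 : ℂ) ((r : ℂ) * cayProd x y)
  rwa [norm_smul_cayProd hr, norm_one] at this

theorem kr_nonneg {r : ℝ} (hr : 0 ≤ r) (hr1 : r < 1) (x y : ℝ) : 0 ≤ kr r x y := by
  have h1 := one_sub_le_norm hr x y
  have h2 := norm_sub_le (1 : ℂ) ((r : ℂ) * cayProd x y)
  rw [norm_smul_cayProd hr, norm_one] at h2
  have := Real.log_le_log (by linarith) (h2.trans (by linarith : 1 + r ≤ 2))
  unfold kr; linarith

/-- For a unit number ζ one has |1 - rζ|² = (1-r)² + r|1-ζ|² ≥ r|1-ζ|². The regularized kernel thus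
exceeds `lk` by a constant tending to 0 as r tends to 1. -/
theorem kr_le {r : ℝ} (hr : 0 < r) {x y : ℝ} (h : x ≠ y) :
    kr r x y ≤ lk x y - 1 / 2 * Real.log r := by
  have hc := chord_pos h
  have h1 : ‖1 - (r : ℂ) * cayProd x y‖ ^ 2 = (1 - r) ^ 2 + r * ‖1 - cayProd x y‖ ^ 2 := by
    have h2 : Complex.normSq (cayProd x y) = 1 := by
      rw [Complex.normSq_eq_norm_sq, norm_cayProd, one_pow]
    rw [Complex.normSq_apply] at h2
    rw [← Complex.normSq_eq_norm_sq, ← Complex.normSq_eq_norm_sq, Complex.normSq_apply,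
      Complex.normSq_apply]
    simp
    linear_combination (r ^ 2 - r) * h2
  rw [norm_one_sub_cayProd] at h1
  have h3 : r * (2 * chord x y) ^ 2 ≤ ‖1 - (r : ℂ) * cayProd x y‖ ^ 2 := by
    rw [h1]; nlinarith [sq_nonneg (1 - r)]
  have h4 := Real.log_le_log (by positivity) h3
  rw [Real.log_mul hr.ne' (by positivity), Real.log_pow, Real.log_pow,
    Real.log_mul two_ne_zero hc.ne'] at h4
  push_cast at h4
  unfold kr lk; linarith

theorem ofReal_kr_le_kern {r : ℝ} (hr : 0 < r) (hr1 : r < 1) (x y : ℝ) :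
    ENNReal.ofReal (kr r x y) ≤ kern x y + ENNReal.ofReal (-(1 / 2 * Real.log r)) := by
  have hl := Real.log_nonpos hr.le hr1.le
  rcases eq_or_ne x y with rfl | h
  · simp [kern_self]
  · rw [kern_of_ne h, ← ENNReal.ofReal_add (lk_nonneg x y) (by linarith)]
    exact ENNReal.ofReal_le_ofReal ((kr_le hr h).trans (by linarith))

theorem continuous_kr {r : ℝ} (hr : 0 ≤ r) (hr1 : r < 1) :
    Continuous fun p : ℝ × ℝ => kr r p.1 p.2 := by
  unfold kr
  refine continuous_const.sub (Continuous.log ?_ fun p => ?_)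
  · exact (continuous_const.sub (continuous_const.mul continuous_cayProd)).norm
  · linarith [one_sub_le_norm hr p.1 p.2]

theorem kr_le_const {r : ℝ} (hr : 0 ≤ r) (hr1 : r < 1) (x y : ℝ) :
    kr r x y ≤ Real.log 2 - Real.log (1 - r) := by
  have := Real.log_le_log (by linarith) (one_sub_le_norm hr x y)
  unfold kr; linarith

theorem integrable_kr {r : ℝ} (hr : 0 ≤ r) (hr1 : r < 1) (π : Measure (ℝ × ℝ))
    [IsFiniteMeasure π] : Integrable (fun p => kr r p.1 p.2) π :=
  Integrable.of_bound (continuous_kr hr hr1).aestronglyMeasurable (Real.log 2 - Real.log (1 - r))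
    (.of_forall fun p => by
      rw [Real.norm_of_nonneg (kr_nonneg hr hr1 _ _)]; exact kr_le_const hr hr1 _ _)

/-- The Fourier coefficients of a measure on the circle. -/
def cayCoeff (m : Measure ℝ) (n : ℕ) : ℂ := ∫ x, cay x ^ n ∂m

/-- Taylor expansion of -log(1 - z) at z = r c(x) conj c(y), integrated term by term: on the unit
circle the logarithmic kernel is diagonal in Fourier series, with coefficients 1/n. -/
theorem hasSum_integral_kr {r : ℝ} (hr : 0 ≤ r) (hr1 : r < 1) (m m' : Measure ℝ)
    [IsFiniteMeasure m] [IsFiniteMeasure m'] :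
    HasSum (fun n : ℕ => r ^ n / n * (cayCoeff m n * conj (cayCoeff m' n)).re)
      (∫ p, kr r p.1 p.2 ∂m.prod m' - Real.log 2 * (m.prod m').real univ) := by
  -- The term n = 0 is a division by zero, hence 0, as it is absent from the Taylor series.
  set F : ℕ → ℝ × ℝ → ℂ := fun n p => ((r : ℂ) * cayProd p.1 p.2) ^ n / n with hF
  have hFc : ∀ n, Continuous (F n) := fun n =>
    ((continuous_const.mul continuous_cayProd).pow n).div_const _
  have hFn : ∀ n p, ‖F n p‖ ≤ r ^ n := fun n p => by
    rw [hF]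
    simp only [norm_div, norm_pow, norm_smul_cayProd hr]
    rcases n.eq_zero_or_pos with rfl | hn
    · simp
    · have : (1 : ℝ) ≤ ‖(n : ℂ)‖ := by rw [Complex.norm_natCast]; exact_mod_cast hn
      exact div_le_self (by positivity) this
  have hFi : ∀ n, Integrable (F n) (m.prod m') := fun n =>
    Integrable.of_bound (hFc n).aestronglyMeasurable _ (.of_forall (hFn n))
  have hs : Summable fun n => ∫ p, ‖F n p‖ ∂m.prod m' := by
    refine Summable.of_nonneg_of_le (fun n => integral_nonneg fun p => norm_nonneg _)
      (fun n => ?_) ((summable_geometric_of_lt_one hr hr1).mul_left ((m.prod m').real univ))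
    calc ∫ p, ‖F n p‖ ∂m.prod m' ≤ ∫ p, r ^ n ∂m.prod m' :=
          integral_mono (hFi n).norm (integrable_const _) (hFn n)
      _ = _ := by simp
  have h1 := hasSum_integral_of_summable_integral_norm hFi hs
  have h2 : ∀ p : ℝ × ℝ, ∑' n, F n p = -Complex.log (1 - (r : ℂ) * cayProd p.1 p.2) := fun p =>
    (Complex.hasSum_taylorSeries_neg_log (by rw [norm_smul_cayProd hr]; exact hr1)).tsum_eq
  simp_rw [h2] at h1
  have h3 := Complex.hasSum_re h1
  have hInt : Integrable (fun p : ℝ × ℝ => -Complex.log (1 - (r : ℂ) * cayProd p.1 p.2))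
      (m.prod m') := by
    have hcon : ContinuousOn (fun z : ℂ => -Complex.log (1 - z)) (Metric.closedBall 0 r) := by
      refine ContinuousOn.neg (ContinuousOn.clog (by fun_prop) fun z hz => ?_)
      rw [sub_eq_add_neg]
      apply Complex.mem_slitPlane_of_norm_lt_one
      rw [norm_neg]
      exact (mem_closedBall_zero_iff.mp hz).trans_lt hr1
    obtain ⟨C, hC⟩ := (isCompact_closedBall (0 : ℂ) r).exists_bound_of_continuousOn hcon
    have hmem : ∀ p : ℝ × ℝ, (r : ℂ) * cayProd p.1 p.2 ∈ Metric.closedBall (0 : ℂ) r := fun p =>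
      mem_closedBall_zero_iff.mpr (norm_smul_cayProd hr _ _).le
    exact Integrable.of_bound (hcon.comp_continuous (continuous_const.mul continuous_cayProd)
      hmem).aestronglyMeasurable C (.of_forall fun p => hC _ (hmem p))
  have h4 : (∫ p : ℝ × ℝ, -Complex.log (1 - (r : ℂ) * cayProd p.1 p.2) ∂m.prod m').re
      = ∫ p, kr r p.1 p.2 ∂m.prod m' - Real.log 2 * (m.prod m').real univ := by
    have := integral_re hInt
    simp only [RCLike.re_eq_complex_re] at this
    rw [← this]
    have h5 : ∫ p, kr r p.1 p.2 ∂m.prod m' - Real.log 2 * (m.prod m').real univ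
        = ∫ p, (kr r p.1 p.2 - Real.log 2) ∂m.prod m' := by
      rw [integral_sub (integrable_kr hr hr1 _) (integrable_const _)]
      simp [mul_comm]
    rw [h5]
    congr 1
    funext p
    rw [Complex.neg_re, Complex.log_re, kr]; ring
  rw [h4] at h3
  convert h3 using 2 with n
  have h6 : ∫ p, F n p ∂m.prod m' = (r : ℂ) ^ n / n * (cayCoeff m n * conj (cayCoeff m' n)) := by
    rw [cayCoeff, cayCoeff, ← integral_conj, ← integral_prod_mul, ← integral_const_mul]
    congr 1
    funext p
    simp only [hF, cayProd, map_pow]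
    ring
  rw [h6]
  have : (r : ℂ) ^ n / n = ((r ^ n / n : ℝ) : ℂ) := by push_cast; rfl
  rw [this, Complex.re_ofReal_mul]

/-- The energy of m - m' is a series of nonnegative terms, of which only the n-th is retained; equal
masses make the constants log 2 cancel. -/
theorem integral_kr_defect {r : ℝ} (hr : 0 ≤ r) (hr1 : r < 1) (m m' : Measure ℝ)
    [IsFiniteMeasure m] [IsFiniteMeasure m'] (h : m univ = m' univ) (n : ℕ) :
    2 * ∫ p, kr r p.1 p.2 ∂m.prod m' + r ^ n / n * ‖cayCoeff m n - cayCoeff m' n‖ ^ 2 ≤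
      ∫ p, kr r p.1 p.2 ∂m.prod m + ∫ p, kr r p.1 p.2 ∂m'.prod m' := by
  have h1 := hasSum_integral_kr hr hr1 m m
  have h2 := hasSum_integral_kr hr hr1 m' m'
  have h3 := hasSum_integral_kr hr hr1 m m'
  have hu : (m.prod m).real univ + (m'.prod m').real univ = 2 * (m.prod m').real univ := by
    simp only [Measure.real, ← univ_prod_univ, Measure.prod_prod, h]
    ring
  have h4 := (h1.add h2).sub (h3.mul_left 2)
  have h5 : ∀ k : ℕ, r ^ k / k * (cayCoeff m k * conj (cayCoeff m k)).re +
      r ^ k / k * (cayCoeff m' k * conj (cayCoeff m' k)).re -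
      2 * (r ^ k / k * (cayCoeff m k * conj (cayCoeff m' k)).re) =
      r ^ k / k * ‖cayCoeff m k - cayCoeff m' k‖ ^ 2 := fun k => by
    rw [← Complex.normSq_eq_norm_sq, Complex.normSq_sub, Complex.mul_conj, Complex.mul_conj,
      Complex.ofReal_re, Complex.ofReal_re]
    ring
  simp only [h5] at h4
  have h6 := le_hasSum h4 n fun k _ => by positivity
  have hl : Real.log 2 * (m.prod m).real univ + Real.log 2 * (m'.prod m').real univ =
    2 * (Real.log 2 * (m.prod m').real univ) := by rw [← mul_add, hu]; ring
  linarith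

theorem tendsto_kr (x y : ℝ) {r : ℕ → ℝ} (hr : Tendsto r atTop (𝓝 1)) (hr1 : ∀ k, r k < 1) :
    Tendsto (fun k => ENNReal.ofReal (kr (r k) x y)) atTop (𝓝 (kern x y)) := by
  rcases eq_or_ne x y with rfl | h
  · rw [kern_self]
    have h1 : cayProd x x = 1 := by
      rw [cayProd, Complex.mul_conj, Complex.normSq_eq_norm_sq, norm_cay]; simp
    have h2 : ∀ k, kr (r k) x x = Real.log 2 + -Real.log (1 - r k) := fun k => by
      rw [kr, h1, mul_one, ← Complex.ofReal_one, ← Complex.ofReal_sub, Complex.norm_real,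
        Real.norm_of_nonneg (by linarith [hr1 k])]
      ring
    simp_rw [h2]
    refine ENNReal.tendsto_ofReal_atTop.comp (tendsto_atTop_add_const_left _ _ ?_)
    refine tendsto_neg_atBot_atTop.comp (Real.tendsto_log_nhdsGT_zero.comp ?_)
    refine tendsto_nhdsWithin_iff.mpr ⟨?_, .of_forall fun k => by simpa using hr1 k⟩
    simpa using hr.const_sub 1
  · rw [kern_of_ne h]
    refine (ENNReal.continuous_ofReal.tendsto _).comp ?_
    have hc := chord_pos h
    have h1 : lk x y = Real.log 2 - Real.log ‖1 - ((1 : ℝ) : ℂ) * cayProd x y‖ := by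
      rw [Complex.ofReal_one, one_mul, norm_one_sub_cayProd, Real.log_mul two_ne_zero hc.ne', lk]
      ring
    rw [h1]
    have h2 : Continuous fun s : ℝ => ‖1 - (s : ℂ) * cayProd x y‖ := by fun_prop
    refine tendsto_const_nhds.sub (((h2.tendsto 1).comp hr).log ?_)
    rw [Complex.ofReal_one, one_mul, norm_one_sub_cayProd]
    positivity

/-- Positivity of the energy of neutral charges, with a quantitative defect. -/
theorem two_mul_en_add_le (m m' : Measure ℝ) [IsFiniteMeasure m] [IsFiniteMeasure m']
    (h : m univ = m' univ) (n : ℕ) :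
    2 * en m m' + ENNReal.ofReal (‖cayCoeff m n - cayCoeff m' n‖ ^ 2 / n) ≤
      en m m + en m' m' := by
  set r : ℕ → ℝ := fun k => 1 - 1 / ((k : ℝ) + 2) with hrdef
  have hr0 : ∀ k, 0 < r k := fun k => by
    have : (1:ℝ) / ((k : ℝ) + 2) < 1 := by
      rw [div_lt_one (by positivity)]
      have : (0:ℝ) ≤ k := Nat.cast_nonneg k
      linarith
    simp only [hrdef]; linarith
  have hr1 : ∀ k, r k < 1 := fun k => by
    have : (0:ℝ) < 1 / ((k : ℝ) + 2) := by positivity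
    simp only [hrdef]; linarith
  have hr : Tendsto r atTop (𝓝 1) := by
    have h1 : Tendsto (fun k : ℕ => 1 / ((k : ℝ) + 2)) atTop (𝓝 0) :=
      tendsto_const_nhds.div_atTop (tendsto_atTop_add_const_right _ _ tendsto_natCast_atTop_atTop)
    simpa [hrdef] using h1.const_sub 1
  set e : ℕ → Measure ℝ → Measure ℝ → ℝ≥0∞ := fun k m m' =>
    ∫⁻ p, ENNReal.ofReal (kr (r k) p.1 p.2) ∂m.prod m' with he
  have heq : ∀ k (μ ν : Measure ℝ) [IsFiniteMeasure μ] [IsFiniteMeasure ν],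
      ENNReal.ofReal (∫ p, kr (r k) p.1 p.2 ∂μ.prod ν) = e k μ ν := fun k μ ν _ _ =>
    ofReal_integral_eq_lintegral_ofReal (integrable_kr (hr0 k).le (hr1 k) _)
      (.of_forall fun p => kr_nonneg (hr0 k).le (hr1 k) _ _)
  have hnn : ∀ k (μ ν : Measure ℝ), 0 ≤ ∫ p, kr (r k) p.1 p.2 ∂μ.prod ν := fun k μ ν =>
    integral_nonneg fun p => kr_nonneg (hr0 k).le (hr1 k) _ _
  set o : ℕ → ℝ≥0∞ := fun k => ENNReal.ofReal (-(1 / 2 * Real.log (r k)))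
  have hup : ∀ k (μ : Measure ℝ) [IsFiniteMeasure μ],
      e k μ μ ≤ en μ μ + o k * (μ.prod μ) univ := fun k μ _ => by
    calc e k μ μ ≤ ∫⁻ p, (kern p.1 p.2 + o k) ∂μ.prod μ :=
          lintegral_mono fun p => ofReal_kr_le_kern (hr0 k) (hr1 k) _ _
      _ = _ := by rw [lintegral_add_left measurable_kern, lintegral_const, en]
  -- The mutual energy is bounded by Fatou's lemma, the self-energies by `kr_le`: these are the two
  -- directions in which the limit r → 1 is needed.
  have hlow : en m m' ≤ liminf (fun k => e k m m') atTop := by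
    refine le_trans (le_of_eq ?_) (lintegral_liminf_le fun k =>
      (continuous_kr (hr0 k).le (hr1 k)).measurable.ennreal_ofReal)
    exact lintegral_congr fun p => (tendsto_kr p.1 p.2 hr hr1).liminf_eq.symm
  set b : ℕ → ℝ≥0∞ := fun k => ENNReal.ofReal (r k ^ n / n * ‖cayCoeff m n - cayCoeff m' n‖ ^ 2)
  set c : ℕ → ℝ≥0∞ := fun k => en m m + o k * (m.prod m) univ + (en m' m' + o k * (m'.prod m') univ)
  have hk : ∀ k, 2 * e k m m' + b k ≤ c k := fun k => by
    have h1 := integral_kr_defect (hr0 k).le (hr1 k) m m' h n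
    have hrk := hr0 k
    refine le_trans ?_ (add_le_add (hup k m) (hup k m'))
    rw [← heq, ← heq, ← heq, ← ENNReal.ofReal_add (hnn _ _ _) (hnn _ _ _),
      ← ENNReal.ofReal_ofNat 2, ← ENNReal.ofReal_mul (by norm_num),
      ← ENNReal.ofReal_add (mul_nonneg (by norm_num) (hnn _ _ _)) (by positivity)]
    exact ENNReal.ofReal_le_ofReal h1
  have ho : Tendsto o atTop (𝓝 0) := by
    have h1 : Tendsto (fun k => -(1 / 2 * Real.log (r k))) atTop (𝓝 (-(1 / 2 * Real.log 1))) :=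
      ((hr.log one_ne_zero).const_mul _).neg
    simpa [o, Function.comp_def] using (ENNReal.continuous_ofReal.tendsto _).comp h1
  have hb : Tendsto b atTop (𝓝 (ENNReal.ofReal (‖cayCoeff m n - cayCoeff m' n‖ ^ 2 / n))) := by
    have h1 := ((hr.pow n).div_const (n : ℝ)).mul_const (‖cayCoeff m n - cayCoeff m' n‖ ^ 2)
    rw [one_pow, one_div_mul_eq_div] at h1
    exact (ENNReal.continuous_ofReal.tendsto _).comp h1
  have hoc : ∀ x : ℝ≥0∞, x ≠ ⊤ → Tendsto (fun k => o k * x) atTop (𝓝 0) := fun x hx => by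
    simpa using ENNReal.Tendsto.mul_const ho (Or.inr hx)
  have hc : Tendsto c atTop (𝓝 (en m m + en m' m')) := by
    simpa using (tendsto_const_nhds.add (hoc _ (measure_ne_top _ _))).add
      (tendsto_const_nhds.add (hoc _ (measure_ne_top _ _)))
  -- The mutual energy is not known to be finite yet, so the limit is taken below every `t` smaller
  -- than it. The case `t = 0` is kept apart, to bound the defect even when the mutual energy is 0.
  have key : ∀ t, t < en m m' ∨ t = 0 → 2 * t + ENNReal.ofReal (‖cayCoeff m n - cayCoeff m' n‖ ^ 2 / n) ≤
      en m m + en m' m' := fun t ht => by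
    refine le_of_tendsto_of_tendsto (tendsto_const_nhds.add hb) hc ?_
    have hev : ∀ᶠ k in atTop, t ≤ e k m m' := by
      rcases ht with ht | rfl
      · exact (eventually_lt_of_lt_liminf (ht.trans_le hlow)).mono fun k hk => hk.le
      · simp
    filter_upwards [hev] with k h1
    exact (add_le_add (by gcongr) le_rfl).trans (hk k)
  rcases eq_or_ne (en m m + en m' m') ⊤ with htop | htop
  · rw [htop]; exact le_top
  set d := ENNReal.ofReal (‖cayCoeff m n - cayCoeff m' n‖ ^ 2 / n)
  have h1 : en m m' ≤ (en m m + en m' m' - d) / 2 := by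
    refine le_of_forall_lt_imp_le_of_dense fun t ht => ?_
    rw [ENNReal.le_div_iff_mul_le (by simp) (by simp), mul_comm]
    exact ENNReal.le_sub_of_add_le_right ENNReal.ofReal_ne_top (key t (.inl ht))
  have hd : d ≤ en m m + en m' m' := le_trans (by simp [d]) (key 0 (.inr rfl))
  rw [ENNReal.le_div_iff_mul_le (by simp) (by simp), mul_comm] at h1
  calc _ ≤ (en m m + en m' m' - d) + d := add_le_add h1 le_rfl
    _ = _ := tsub_add_cancel_of_le hd

theorem two_mul_en_le (m m' : Measure ℝ) [IsFiniteMeasure m] [IsFiniteMeasure m']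
    (h : m univ = m' univ) : 2 * en m m' ≤ en m m + en m' m' :=
  le_trans (by simp) (two_mul_en_add_le m m' h 0)

theorem en_ne_top {m m' : Measure ℝ} [IsFiniteMeasure m] [IsFiniteMeasure m']
    (h : m univ = m' univ) (hm : en m m ≠ ⊤) (hm' : en m' m' ≠ ⊤) : en m m' ≠ ⊤ := fun htop => by
  have := two_mul_en_le m m' h
  rw [htop, ENNReal.mul_top two_ne_zero, top_le_iff] at this
  exact ENNReal.add_ne_top.mpr ⟨hm, hm'⟩ this

/-- The function `c^n`, bounded and continuous. -/
def cayPow (n : ℕ) : BoundedContinuousFunction ℝ ℂ :=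
  BoundedContinuousFunction.ofNormedAddCommGroup (fun x => cay x ^ n) (continuous_cay.pow n) 1
    fun x => by rw [norm_pow, norm_cay, one_pow]

/-- The *-algebra generated by the injective function c separates measures. As c conj c = 1, its
monomials are powers of c or their conjugates, so coefficients with n ≥ 0 suffice. -/
theorem eq_of_cayCoeff_eq {m m' : Measure ℝ} [IsFiniteMeasure m] [IsFiniteMeasure m']
    (h : ∀ n, cayCoeff m n = cayCoeff m' n) : m = m' := by
  have hprod : ∀ k l x, cay x ^ k * conj (cay x ^ l) =
      if l ≤ k then cay x ^ (k - l) else conj (cay x ^ (l - k)) := fun k l x => by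
    have h1 : cay x * conj (cay x) = 1 := by
      rw [Complex.mul_conj, Complex.normSq_eq_norm_sq, norm_cay]; simp
    split_ifs with hkl
    · obtain ⟨d, rfl⟩ := Nat.exists_eq_add_of_le hkl
      rw [Nat.add_sub_cancel_left, pow_add, map_pow, mul_right_comm, ← mul_pow, h1, one_pow,
        one_mul]
    · obtain ⟨d, rfl⟩ := Nat.exists_eq_add_of_le (le_of_not_ge hkl)
      rw [Nat.add_sub_cancel_left, pow_add, map_mul, ← mul_assoc, map_pow, ← mul_pow, h1, one_pow,
        one_mul]
  set A : StarSubalgebra ℂ (BoundedContinuousFunction ℝ ℂ) := StarAlgebra.adjoin ℂ {cayPow 1}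
  refine ext_of_forall_mem_subalgebra_integral_eq_of_polish (𝕜 := ℂ) (A := A) ?_ ?_
  · intro x y hxy
    refine ⟨cayPow 1, ⟨_, ⟨cayPow 1, StarAlgebra.self_mem_adjoin_singleton ℂ _, rfl⟩, rfl⟩, ?_⟩
    simpa [cayPow] using fun h => hxy (cay_injective h)
  · intro g hg
    have hg' : g ∈ Submodule.span ℂ ((Submonoid.closure ({cayPow 1} ∪ star {cayPow 1}) :
        Submonoid (BoundedContinuousFunction ℝ ℂ)) : Set (BoundedContinuousFunction ℝ ℂ)) := by
      rw [← Algebra.adjoin_eq_span, ← StarAlgebra.adjoin_toSubalgebra]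
      exact hg
    clear hg
    induction hg' using Submodule.span_induction with
    | mem g hg =>
      have hg2 : ∃ k l : ℕ, ∀ x, g x = cay x ^ k * conj (cay x ^ l) := by
        refine Submonoid.closure_induction (motive := fun g _ => ∃ k l : ℕ, ∀ x, g x = cay x ^ k *
          conj (cay x ^ l)) ?_ ⟨0, 0, fun x => by simp⟩ ?_ hg
        · rintro f (hf | hf)
          · rw [mem_singleton_iff] at hf
            exact ⟨1, 0, fun x => by simp [hf, cayPow]⟩
          · rw [Set.star_singleton, mem_singleton_iff] at hf
            exact ⟨0, 1, fun x => by simp [hf, cayPow]⟩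
        · rintro f f' _ _ ⟨k, l, hf⟩ ⟨k', l', hf'⟩
          refine ⟨k + k', l + l', fun x => ?_⟩
          rw [BoundedContinuousFunction.mul_apply, hf, hf', pow_add, pow_add, map_mul]
          ring
      obtain ⟨k, l, hkl⟩ := hg2
      simp_rw [hkl, hprod]
      split_ifs
      · exact h _
      · rw [integral_conj, integral_conj]
        exact congrArg _ (h _)
    | zero => simp
    | add f g _ _ hf hg =>
      simp only [BoundedContinuousFunction.add_apply]
      rw [integral_add (f.integrable _) (g.integrable _), integral_add (f.integrable _)
        (g.integrable _), hf, hg]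
    | smul c f _ hf =>
      simp only [BoundedContinuousFunction.smul_apply, integral_smul]
      rw [hf]

/-- Equality leaves no room for the defect of any Fourier mode. This is the strictness behind
uniqueness. -/
theorem eq_of_two_mul_en_eq {m m' : Measure ℝ} [IsFiniteMeasure m] [IsFiniteMeasure m']
    (h : m univ = m' univ) (hm : en m m ≠ ⊤) (hm' : en m' m' ≠ ⊤)
    (heq : en m m + en m' m' ≤ 2 * en m m') : m = m' := by
  refine eq_of_cayCoeff_eq fun n => ?_
  rcases n.eq_zero_or_pos with rfl | hn
  · simp [cayCoeff, Measure.real, h]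
  have h1 := (two_mul_en_add_le m m' h n).trans heq
  have h2 : 2 * en m m' ≠ ⊤ := ENNReal.mul_ne_top (by simp) (en_ne_top h hm hm')
  have h3 : ENNReal.ofReal (‖cayCoeff m n - cayCoeff m' n‖ ^ 2 / n) = 0 := by
    by_contra h4
    exact absurd h1 (not_le.mpr (ENNReal.lt_add_right h2 h4))
  rw [ENNReal.ofReal_eq_zero] at h3
  have hn' : (0:ℝ) < n := by exact_mod_cast hn
  rw [div_le_iff₀ hn', zero_mul] at h3
  have h5 := le_antisymm h3 (sq_nonneg _)
  rw [sq_eq_zero_iff, norm_eq_zero, sub_eq_zero] at h5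
  exact h5

/-! ### The potential -/

/-- A constant which makes the potential nonnegative. -/
def potConst (a : ℝ) : ℝ := 8 * a + 30

/-- The limiting potential, shifted to be nonnegative and extended to the line by symmetry. -/
def pot (a x : ℝ) : ℝ :=
  |x| - 2 * √(a * |x|) - 3 / 4 * Real.log (1 + x ^ 2) + potConst a

/-- The part of the interaction with the negative half-line absorbed by the potential. -/
def absorb (x : ℝ) : ℝ := 1 / 2 * Real.log (1 + x ^ 2) + 1 / 2 * Real.log 2

theorem absorb_nonneg (x : ℝ) : 0 ≤ absorb x := by
  have h1 : 0 ≤ Real.log (1 + x ^ 2) := Real.log_nonneg (by nlinarith [sq_nonneg x])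
  have h2 : 0 ≤ Real.log 2 := Real.log_nonneg (by norm_num)
  unfold absorb; linarith

theorem continuous_absorb : Continuous absorb := by
  unfold absorb
  refine (continuous_const.mul (Continuous.log (by fun_prop) fun x => ?_)).add continuous_const
  positivity

theorem continuous_pot (a : ℝ) : Continuous (pot a) := by
  unfold pot
  refine Continuous.add (Continuous.sub (by fun_prop) (continuous_const.mul
    (Continuous.log (by fun_prop) fun x => ?_))) continuous_const
  positivity

/-- Half of |x| is spent on the square root and the logarithms, through 2√(a|x|) ≤ |x|/8 + 8a and
log(1+|x|) ≤ (1+|x|)/10 + 8. The constant in `potConst` pays for the rest, and the remaining |x|/2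
yields tightness and integrability. -/
theorem le_pot {a : ℝ} (ha : 0 < a) (x : ℝ) : |x| / 2 + 2 * absorb x ≤ pot a x := by
  have hx := abs_nonneg x
  have h1 : 2 * √(a * |x|) ≤ |x| / 8 + 8 * a := by
    have : √(a * |x|) ≤ (|x| / 8 + 8 * a) / 2 := by
      rw [Real.sqrt_le_left (by positivity)]
      nlinarith [sq_nonneg (|x| / 8 - 8 * a)]
    linarith
  have h2 : Real.log (1 + x ^ 2) ≤ 2 * ((1 + |x|) / 10 + 8) := by
    have h3 : Real.log (1 + x ^ 2) ≤ Real.log ((1 + |x|) ^ 2) := by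
      refine Real.log_le_log (by positivity) ?_
      nlinarith [sq_abs x]
    rw [Real.log_pow] at h3
    have h4 : Real.log (1 + |x|) ≤ (1 + |x|) / 10 + 8 := by
      have h5 := Real.log_le_sub_one_of_pos (x := (1 + |x|) / 10) (by positivity)
      have h6 := Real.log_le_sub_one_of_pos (x := 10) (by norm_num)
      rw [Real.log_div (by positivity) (by norm_num)] at h5
      linarith
    push_cast at h3
    linarith
  have h7 : Real.log 2 ≤ 1 := by
    have := Real.log_le_sub_one_of_pos (x := 2) (by norm_num)
    linarith
  unfold pot absorb potConst
  linarith

theorem pot_nonneg {a : ℝ} (ha : 0 < a) (x : ℝ) : 0 ≤ pot a x := by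
  have := le_pot ha x
  have := absorb_nonneg x
  have := abs_nonneg x
  linarith

/-- Opposite signs give |x - u| ≥ |u|, so the singularity of the kernel can only occur as u tends to
0. It is split into a function of x, left to the potential, and a function of u, left to the
constraint. -/
theorem lk_le {x u : ℝ} (hx : 0 ≤ x) (hu : u < 0) :
    lk x u ≤ absorb x + max (-Real.log (-u)) 0 := by
  have hne : x ≠ u := by linarith
  have hr : 0 < -u := by linarith
  rw [lk_eq hne, absorb]
  have h2 : Real.log (-u) ≤ Real.log |x - u| := by
    refine Real.log_le_log hr ?_
    rw [abs_of_pos (by linarith)]; linarith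
  have h3 : 1 / 2 * Real.log (1 + u ^ 2) ≤
      1 / 2 * Real.log 2 + Real.log (-u) + max (-Real.log (-u)) 0 := by
    rcases le_total 1 (-u) with h4 | h4
    · have h5 : Real.log (1 + u ^ 2) ≤ Real.log (2 * (-u) ^ 2) :=
        Real.log_le_log (by positivity) (by nlinarith)
      rw [Real.log_mul two_ne_zero (by positivity), Real.log_pow] at h5
      push_cast at h5
      linarith [le_max_right (-Real.log (-u)) 0]
    · have h5 : Real.log (1 + u ^ 2) ≤ Real.log 2 :=
        Real.log_le_log (by positivity) (by nlinarith)
      linarith [le_max_left (-Real.log (-u)) 0]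
  linarith

/-- Above the level L, each of the two parts of `lk_le` is charged with half of the level. -/
theorem kern_le {x u : ℝ} (hx : 0 ≤ x) (hu : u ≤ 0) {L : ℝ} (hL : 0 ≤ L) :
    kern x u ≤ ENNReal.ofReal (kT L x u) +
      (ENNReal.ofReal (absorb x - L / 2) + ell (L / 2) (-u)) := by
  rcases hu.eq_or_lt with rfl | hu
  · simp [ell]
  have hne : x ≠ u := by linarith
  rw [kern_of_ne hne, kT_eq_min hne, ell, if_neg (by linarith)]
  rcases le_total (lk x u) L with h | h
  · rw [min_eq_left h]; exact le_self_add
  rw [min_eq_right h]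
  have h1 := lk_le hx hu
  calc ENNReal.ofReal (lk x u) ≤ ENNReal.ofReal (L + (max (absorb x - L / 2) 0 +
        max (-Real.log (-u) - L / 2) 0)) := by
        apply ENNReal.ofReal_le_ofReal
        have h4 : max (-Real.log (-u)) 0 ≤ max (-Real.log (-u) - L / 2) 0 + L / 2 := by
          refine max_le ?_ ?_
          · linarith [le_max_left (-Real.log (-u) - L / 2) 0]
          · linarith [le_max_right (-Real.log (-u) - L / 2) 0]
        linarith [le_max_left (absorb x - L / 2) 0]
    _ = _ := by
        rw [ENNReal.ofReal_add hL (by positivity), ENNReal.ofReal_add (by positivity)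
          (by positivity), ENNReal.ofReal_max, ENNReal.ofReal_max]
        simp

/-- Here `absorb` is cut at L as well, in order to be compared with the bounded function `psi`. -/
theorem ofReal_kT_le {x u : ℝ} (hx : 0 ≤ x) (hu : u ≤ 0) {L : ℝ} :
    ENNReal.ofReal (kT L x u) ≤ ENNReal.ofReal (min (absorb x) L) + ell 0 (-u) := by
  have h1 : ENNReal.ofReal (kT L x u) ≤ ENNReal.ofReal (absorb x) + ell 0 (-u) := by
    refine (ofReal_kT_le_kern L x u).trans ((kern_le hx hu le_rfl).trans ?_)
    have := kT_le 0 x u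
    rw [ENNReal.ofReal_of_nonpos this, zero_add, zero_div, sub_zero]
  have h2 : ENNReal.ofReal (kT L x u) ≤ ENNReal.ofReal L + ell 0 (-u) :=
    (ENNReal.ofReal_le_ofReal (kT_le L x u)).trans le_self_add
  rw [ENNReal.ofReal_min]
  rcases min_cases (ENNReal.ofReal (absorb x)) (ENNReal.ofReal L) with h | h <;> rw [h.1] <;>
    assumption

/-! ### Measures on the half-lines as measures on the line -/

/-- A measure on `ℝ_+` as a measure on the line. -/
def mP (μ : ProbabilityMeasure RPlus) : Measure ℝ := (μ : Measure RPlus).map Subtype.val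

/-- A measure on `ℝ_-` as a measure on the line. -/
def nM (ν : FiniteMeasure RMinus) : Measure ℝ := (ν : Measure RMinus).map Subtype.val

instance (μ : ProbabilityMeasure RPlus) : IsProbabilityMeasure (mP μ) :=
  Measure.isProbabilityMeasure_map measurable_subtype_coe.aemeasurable

instance (ν : FiniteMeasure RMinus) : IsFiniteMeasure (nM ν) := by unfold nM; infer_instance

theorem ae_mP (μ : ProbabilityMeasure RPlus) : ∀ᵐ x ∂mP μ, 0 ≤ x :=
  (ae_map_iff measurable_subtype_coe.aemeasurable measurableSet_Ici).mpr (.of_forall fun x => x.2)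

theorem ae_nM (ν : FiniteMeasure RMinus) : ∀ᵐ x ∂nM ν, x ≤ 0 :=
  (ae_map_iff measurable_subtype_coe.aemeasurable measurableSet_Iic).mpr (.of_forall fun x => x.2)

theorem nM_univ {α a : ℝ} {ν : FiniteMeasure RMinus} (hν : ν ∈ E α a) : nM ν univ = 1 / 2 := by
  rw [nM, Measure.map_apply measurable_subtype_coe MeasurableSet.univ, preimage_univ,
    ← FiniteMeasure.ennreal_mass, mass_of_mem_E hν]
  simp

theorem measurable_ell (M : ℝ) : Measurable (ell M) := (antitone_ell M).measurable

theorem measurable_ell_neg (M : ℝ) : Measurable fun u : ℝ => ell M (-u) :=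
  (measurable_ell M).comp measurable_neg

theorem lintegral_ell_nM_le {α a : ℝ} (hα : 0 ≤ α) (ha : 0 < a) {ν : FiniteMeasure RMinus}
    (hν : ν ∈ E α a) {M : ℝ} (hM : 0 ≤ M) :
    ∫⁻ u, ell M (-u) ∂nM ν ≤ ENNReal.ofReal (8 * √a * Real.exp (-(M / 4))) := by
  rw [nM, lintegral_map (measurable_ell_neg M) measurable_subtype_coe]
  exact lintegral_ell_le_of_mem_E hα ha hν hM

/-- The mutual energy is compared with self-energies for equal masses only, so ν is doubled first.
-/
theorem en_nM_ne_top {α a : ℝ} {μ : ProbabilityMeasure RPlus} {ν : FiniteMeasure RMinus}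
    (hν : ν ∈ E α a) (hm : en (mP μ) (mP μ) ≠ ⊤) (hn : en (nM ν) (nM ν) ≠ ⊤) :
    en (mP μ) (nM ν) ≠ ⊤ := by
  have h1 : en (mP μ) (((2 : ℝ≥0) : ℝ≥0∞) • nM ν) ≠ ⊤ := by
    have : IsFiniteMeasure (((2 : ℝ≥0) : ℝ≥0∞) • nM ν) := Measure.smul_finite _ (by simp)
    refine en_ne_top ?_ hm ?_
    · rw [Measure.smul_apply, nM_univ hν, measure_univ]
      simp [ENNReal.mul_inv_cancel]
    · rw [en_smul_left, en_smul_right]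
      exact ENNReal.mul_ne_top (by simp) (ENNReal.mul_ne_top (by simp) hn)
  rw [en_smul_right] at h1
  intro h
  rw [h] at h1
  exact h1 (ENNReal.mul_top (by simp))

/-! ### The rate function as a real number -/

theorem coe_toReal_ennreal {x : ℝ≥0∞} (h : x ≠ ⊤) : ((x.toReal : ℝ) : EReal) = (x : EReal) := by
  lift x to ℝ≥0 using h
  rfl

/-- The integral of the shifted potential. -/
def potInt (a : ℝ) (m : Measure ℝ) : ℝ≥0∞ := ∫⁻ x, ENNReal.ofReal (pot a x) ∂m

/-- The rate function, when all the terms are finite. -/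
def Jreal (a : ℝ) (m n : Measure ℝ) : ℝ :=
  (en m m).toReal - (en m n).toReal + (en n n).toReal + (potInt a m).toReal - potConst a

theorem eintegral_circlePotential {a : ℝ} (ha : 0 < a) (μ : ProbabilityMeasure RPlus) :
    eintegral ((mP μ).map T) (circlePotential a) =
      if potInt a (mP μ) = ⊤ then ⊤ else (((potInt a (mP μ)).toReal - potConst a : ℝ) : EReal) := by
  have hT : MeasurableEmbedding T := continuous_T.measurableEmbedding T_injective
  have hc : 0 ≤ potConst a := by unfold potConst; linarith
  have hV : ∀ᵐ x ∂mP μ, x - 2 * √(a * x) - 3 / 4 * Real.log (1 + x ^ 2) = pot a x - potConst a := by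
    filter_upwards [ae_mP μ] with x hx
    rw [pot, abs_of_nonneg hx]; ring
  have e1 : ∫⁻ x, (circlePotential a x).toENNReal ∂(mP μ).map T
      = ∫⁻ x, ENNReal.ofReal (pot a x - potConst a) ∂mP μ := by
    rw [hT.lintegral_map]
    refine lintegral_congr_ae ?_
    filter_upwards [hV] with x hx
    rw [circlePotential_T, hx, EReal.toENNReal_of_ne_top (EReal.coe_ne_top _), EReal.toReal_coe]
  have e2 : ∫⁻ x, (-circlePotential a x).toENNReal ∂(mP μ).map T
      = ∫⁻ x, ENNReal.ofReal (-(pot a x - potConst a)) ∂mP μ := by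
    rw [hT.lintegral_map]
    refine lintegral_congr_ae ?_
    filter_upwards [hV] with x hx
    rw [circlePotential_T, hx, ← EReal.coe_neg, EReal.toENNReal_of_ne_top (EReal.coe_ne_top _),
      EReal.toReal_coe]
  have hB : ∫⁻ x, ENNReal.ofReal (-(pot a x - potConst a)) ∂mP μ ≠ ⊤ := by
    refine ne_top_of_le_ne_top (ENNReal.ofReal_ne_top (r := potConst a)) ?_
    calc _ ≤ ∫⁻ x, ENNReal.ofReal (potConst a) ∂mP μ :=
          lintegral_mono fun x => ENNReal.ofReal_le_ofReal (by linarith [pot_nonneg ha x])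
      _ = _ := by simp
  have hle : potInt a (mP μ) ≤ ∫⁻ x, ENNReal.ofReal (pot a x - potConst a) ∂mP μ +
      ENNReal.ofReal (potConst a) := by
    calc potInt a (mP μ) ≤ ∫⁻ x, (ENNReal.ofReal (pot a x - potConst a) +
          ENNReal.ofReal (potConst a)) ∂mP μ := lintegral_mono fun x => by
            refine le_trans (le_of_eq ?_) ENNReal.ofReal_add_le
            rw [sub_add_cancel]
      _ = _ := by rw [lintegral_add_right _ measurable_const]; simp
  have hle' : ∫⁻ x, ENNReal.ofReal (pot a x - potConst a) ∂mP μ ≤ potInt a (mP μ) :=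
    lintegral_mono fun x => ENNReal.ofReal_le_ofReal (by linarith)
  rw [eintegral, e1, e2]
  split_ifs with h
  · rw [h, top_le_iff, ENNReal.add_eq_top] at hle
    rcases hle with hle | hle
    · rw [hle]
      lift ∫⁻ x, ENNReal.ofReal (-(pot a x - potConst a)) ∂mP μ to ℝ≥0 using hB with b
      exact EReal.top_sub_coe b
    · exact absurd hle ENNReal.ofReal_ne_top
  · have hi : Integrable (pot a) (mP μ) := by
      refine ⟨(continuous_pot a).aestronglyMeasurable, ?_⟩
      rw [hasFiniteIntegral_iff_ofReal (.of_forall fun x => pot_nonneg ha x)]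
      exact lt_top_iff_ne_top.mpr h
    have h1 := integral_eq_lintegral_pos_part_sub_lintegral_neg_part
      (hi.sub (integrable_const (potConst a)))
    have h2 : ∫ x, pot a x ∂mP μ = (potInt a (mP μ)).toReal :=
      integral_eq_lintegral_of_nonneg_ae (.of_forall fun x => pot_nonneg ha x)
        (continuous_pot a).aestronglyMeasurable
    simp only [Pi.sub_apply] at h1
    rw [integral_sub hi (integrable_const _), h2] at h1
    simp only [integral_const, probReal_univ, smul_eq_mul, one_mul] at h1
    rw [h1]
    have hA := ne_top_of_le_ne_top h hle'
    rw [EReal.coe_sub, coe_toReal_ennreal hA, coe_toReal_ennreal hB]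

theorem J_eq {α a : ℝ} (ha : 0 < a) (μ : ProbabilityMeasure RPlus)
    {ν : FiniteMeasure RMinus} (hν : ν ∈ E α a) (h1 : en (mP μ) (mP μ) ≠ ⊤)
    (h2 : en (nM ν) (nM ν) ≠ ⊤) (h3 : potInt a (mP μ) ≠ ⊤) :
    J a μ ν = (Jreal a (mP μ) (nM ν) : ℝ) := by
  have hm : (μ : Measure RPlus).map (fun x : RPlus => T (x : ℝ)) = (mP μ).map T :=
    (Measure.map_map continuous_T.measurable measurable_subtype_coe).symm
  have hn : (ν : Measure RMinus).map (fun x : RMinus => T (x : ℝ)) = (nM ν).map T :=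
    (Measure.map_map continuous_T.measurable measurable_subtype_coe).symm
  have h4 := en_nM_ne_top hν h1 h2
  rw [J, circleJ, hm, hn, logEnergy_map_T, logEnergy_map_T, logEnergy_map_T, if_pos,
    eintegral_circlePotential ha, if_neg h3, ← coe_toReal_ennreal h1,
    ← coe_toReal_ennreal h2, ← coe_toReal_ennreal h4, Jreal]
  · norm_cast
    rw [add_sub_assoc]
  · refine ⟨⟨?_, ?_⟩, ?_, ?_⟩ <;> simp [h1, h2]

theorem J_eq_top {α a : ℝ} (ha : 0 < a) (μ : ProbabilityMeasure RPlus)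
    {ν : FiniteMeasure RMinus} (hν : ν ∈ E α a) (h : ¬ (en (mP μ) (mP μ) ≠ ⊤ ∧
      en (nM ν) (nM ν) ≠ ⊤ ∧ potInt a (mP μ) ≠ ⊤)) :
    J a μ ν = ⊤ := by
  have hm : (μ : Measure RPlus).map (fun x : RPlus => T (x : ℝ)) = (mP μ).map T :=
    (Measure.map_map continuous_T.measurable measurable_subtype_coe).symm
  have hn : (ν : Measure RMinus).map (fun x : RMinus => T (x : ℝ)) = (nM ν).map T :=
    (Measure.map_map continuous_T.measurable measurable_subtype_coe).symm
  rw [J, circleJ, hm, hn, logEnergy_map_T, logEnergy_map_T, logEnergy_map_T]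
  split_ifs with h5
  · have h1 : en (mP μ) (mP μ) ≠ ⊤ := fun h' => h5.1.1 (by rw [h']; rfl)
    have h2 : en (nM ν) (nM ν) ≠ ⊤ := fun h' => h5.2.1 (by rw [h']; rfl)
    have h3 : potInt a (mP μ) = ⊤ := by by_contra h3; exact h ⟨h1, h2, h3⟩
    have h4 := en_nM_ne_top hν h1 h2
    rw [eintegral_circlePotential ha, if_pos h3, ← coe_toReal_ennreal h1,
      ← coe_toReal_ennreal h2, ← coe_toReal_ennreal h4]
    norm_cast
  · rfl

/-! ### Truncated functionals -/

/-- The truncated potential. -/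
def psi (a L x : ℝ) : ℝ := min ((1 - 1 / L) * pot a x - 1 / 2 * max (absorb x - L / 2) 0) L

/-- The truncated rate function. -/
def phi (a L : ℝ) (m n : Measure ℝ) : ℝ :=
  enT L m m - enT L m n + enT L n n + ∫ x, psi a L x ∂m - potConst a

/-- The truncation error. -/
def tau (a L : ℝ) : ℝ := 8 * √a * Real.exp (-(L / 8))

theorem tau_nonneg (a L : ℝ) : 0 ≤ tau a L := by unfold tau; positivity

theorem tendsto_tau (a : ℝ) : Tendsto (fun L : ℕ => tau a L) atTop (𝓝 0) := by
  have h : Tendsto (fun L : ℕ => Real.exp (-((L : ℝ) / 8))) atTop (𝓝 0) :=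
    Real.tendsto_exp_neg_atTop_nhds_zero.comp
      (tendsto_natCast_atTop_atTop.atTop_div_const (by norm_num))
  simpa [tau] using h.const_mul (8 * √a)

theorem continuous_psi (a L : ℝ) : Continuous (psi a L) := by
  have := continuous_pot a
  have := continuous_absorb
  unfold psi
  fun_prop

theorem psi_le (a L x : ℝ) : psi a L x ≤ L := min_le_right _ _

/-- The two corrections in `psi` have distinct roles: the subtracted half of the excess of `absorb`
pays for truncating the mutual energy, and the share 1/L of the potential pays for the copy missing
in `hamil`. -/
theorem psi_add_le (a L x : ℝ) :
    psi a L x + 1 / 2 * max (absorb x - L / 2) 0 ≤ (1 - 1 / L) * pot a x :=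
  le_sub_iff_add_le.mp (min_le_left _ _)

/-- The first half will dominate the truncated mutual energy by `enT_le`; the second is what remains
for coercivity. -/
theorem le_psi {a L : ℝ} (ha : 0 < a) (hL : 4 ≤ L) (x : ℝ) :
    1 / 2 * min (absorb x) L + 1 / 2 * min (pot a x / 2) L ≤ psi a L x := by
  have h1 := le_pot ha x
  have h2 := abs_nonneg x
  have h3 := absorb_nonneg x
  have h5 := pot_nonneg ha x
  have h4 : 1 / L ≤ 1 / 4 := one_div_le_one_div_of_le (by norm_num) hL
  have h6 : max (absorb x - L / 2) 0 ≤ absorb x := max_le (by linarith) h3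
  have h7 : 1 / L * pot a x ≤ 1 / 4 * pot a x := mul_le_mul_of_nonneg_right h4 h5
  refine le_min ?_ ?_
  · linarith [min_le_left (absorb x) L, min_le_left (pot a x / 2) L]
  · linarith [min_le_right (absorb x) L, min_le_right (pot a x / 2) L]

theorem psi_nonneg {a L : ℝ} (ha : 0 < a) (hL : 4 ≤ L) (x : ℝ) : 0 ≤ psi a L x := by
  refine le_trans ?_ (le_psi ha hL x)
  have := absorb_nonneg x
  have := pot_nonneg ha x
  positivity

theorem integrable_psi {a L : ℝ} (ha : 0 < a) (hL : 4 ≤ L) (m : Measure ℝ) [IsFiniteMeasure m] :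
    Integrable (psi a L) m :=
  Integrable.of_bound (continuous_psi a L).aestronglyMeasurable L (.of_forall fun x => by
    rw [Real.norm_of_nonneg (psi_nonneg ha hL x)]; exact psi_le a L x)

theorem lintegral_prod_add_le {m n : Measure ℝ} [IsProbabilityMeasure m] [IsFiniteMeasure n]
    (hn : n univ = 1 / 2) {f g : ℝ → ℝ≥0∞} (hf : Measurable f) (hg : Measurable g) :
    ∫⁻ p, (f p.1 + g p.2) ∂m.prod n = 1 / 2 * ∫⁻ x, f x ∂m + ∫⁻ x, g x ∂n := by
  rw [lintegral_add_left (by fun_prop), lintegral_prod _ (by fun_prop),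
    lintegral_prod _ (by fun_prop)]
  simp [hn, lintegral_mul_const, hf, mul_comm]

theorem ae_prod_sign (μ : ProbabilityMeasure RPlus) (ν : FiniteMeasure RMinus) :
    ∀ᵐ p ∂(mP μ).prod (nM ν), 0 ≤ p.1 ∧ p.2 ≤ 0 :=
  (Measure.quasiMeasurePreserving_fst.ae (ae_mP μ)).and
    (Measure.quasiMeasurePreserving_snd.ae (ae_nM ν))

/-- The mutual energy is at most its truncation, up to controlled terms. -/
theorem en_le {α a : ℝ} (hα : 0 ≤ α) (ha : 0 < a) (μ : ProbabilityMeasure RPlus)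
    {ν : FiniteMeasure RMinus} (hν : ν ∈ E α a) {L : ℝ} (hL : 0 ≤ L) :
    en (mP μ) (nM ν) ≤ ENNReal.ofReal (enT L (mP μ) (nM ν)) +
      (1 / 2 * ∫⁻ x, ENNReal.ofReal (absorb x - L / 2) ∂mP μ + ENNReal.ofReal (tau a L)) := by
  calc en (mP μ) (nM ν) ≤ ∫⁻ p, (ENNReal.ofReal (kT L p.1 p.2) +
        (ENNReal.ofReal (absorb p.1 - L / 2) + ell (L / 2) (-p.2))) ∂(mP μ).prod (nM ν) := by
        refine lintegral_mono_ae ?_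
        filter_upwards [ae_prod_sign μ ν] with p hp
        exact kern_le hp.1 hp.2 hL
    _ ≤ _ := by
        rw [lintegral_add_left (continuous_kT L).measurable.ennreal_ofReal, ← ofReal_enT hL]
        refine add_le_add le_rfl ?_
        rw [lintegral_prod_add_le (nM_univ hν)
          (continuous_absorb.measurable.sub_const _).ennreal_ofReal
          (measurable_ell_neg _)]
        refine add_le_add le_rfl ((lintegral_ell_nM_le hα ha hν (by linarith)).trans (le_of_eq ?_))
        rw [tau]; congr 4; ring

theorem en_le_ofReal {α a : ℝ} (hα : 0 ≤ α) (ha : 0 < a) (μ : ProbabilityMeasure RPlus)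
    {ν : FiniteMeasure RMinus} (hν : ν ∈ E α a) {L : ℝ} (hL : 0 ≤ L)
    (hj : Integrable (fun x => max (absorb x - L / 2) 0) (mP μ)) :
    en (mP μ) (nM ν) ≤ ENNReal.ofReal (enT L (mP μ) (nM ν) +
      (1 / 2 * ∫ x, max (absorb x - L / 2) 0 ∂mP μ + tau a L)) := by
  have h0 : 0 ≤ ∫ x, max (absorb x - L / 2) 0 ∂mP μ := integral_nonneg fun x => le_max_right _ _
  have ht := tau_nonneg a L
  have hz := enT_nonneg hL (mP μ) (nM ν)
  refine (en_le hα ha μ hν hL).trans ?_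
  rw [ENNReal.ofReal_add hz (by positivity), ENNReal.ofReal_add (by positivity) ht,
    ENNReal.ofReal_mul (by norm_num), ofReal_integral_eq_lintegral_ofReal hj
    (.of_forall fun x => le_max_right _ _)]
  refine add_le_add le_rfl (add_le_add (le_of_eq ?_) le_rfl)
  congr 1
  · rw [ENNReal.ofReal_div_of_pos two_pos]; simp
  · refine lintegral_congr fun x => ?_
    rw [ENNReal.ofReal_max]; simp

theorem enT_le {α a : ℝ} (hα : 0 ≤ α) (ha : 0 < a) (μ : ProbabilityMeasure RPlus)
    {ν : FiniteMeasure RMinus} (hν : ν ∈ E α a) {L : ℝ} (hL : 0 ≤ L) :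
    enT L (mP μ) (nM ν) ≤ 1 / 2 * ∫ x, min (absorb x) L ∂mP μ + tau a 0 := by
  have hnn : ∀ x, 0 ≤ min (absorb x) L := fun x => le_min (absorb_nonneg x) hL
  have hc : Continuous fun x => min (absorb x) L := continuous_absorb.min continuous_const
  have h0 : 0 ≤ ∫ x, min (absorb x) L ∂mP μ := integral_nonneg hnn
  have hi : Integrable (fun x => min (absorb x) L) (mP μ) :=
    Integrable.of_bound hc.aestronglyMeasurable L (.of_forall fun x => by
      rw [Real.norm_of_nonneg (hnn x)]; exact min_le_right _ _)
  have ht := tau_nonneg a 0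
  rw [← ENNReal.ofReal_le_ofReal_iff (by positivity), ofReal_enT hL]
  calc _ ≤ ∫⁻ p, (ENNReal.ofReal (min (absorb p.1) L) + ell 0 (-p.2)) ∂(mP μ).prod (nM ν) := by
        refine lintegral_mono_ae ?_
        filter_upwards [ae_prod_sign μ ν] with p hp
        exact ofReal_kT_le hp.1 hp.2
    _ ≤ _ := by
        rw [lintegral_prod_add_le (nM_univ hν) hc.measurable.ennreal_ofReal
          (measurable_ell_neg _), ENNReal.ofReal_add (by positivity) ht,
          ENNReal.ofReal_mul (by norm_num), ofReal_integral_eq_lintegral_ofReal hi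
          (.of_forall hnn)]
        refine add_le_add (le_of_eq ?_)
          ((lintegral_ell_nM_le hα ha hν le_rfl).trans (le_of_eq ?_))
        · congr 1
          rw [ENNReal.ofReal_div_of_pos two_pos]; simp
        · rw [tau]; congr 4; ring

/-- The only negative term, the mutual energy, is absorbed by half of `psi` up to a constant that
does not depend on ν, thanks to membership in ℰ. -/
theorem phi_coercive {α a : ℝ} (hα : 0 ≤ α) (ha : 0 < a) (μ : ProbabilityMeasure RPlus)
    {ν : FiniteMeasure RMinus} (hν : ν ∈ E α a) {L : ℝ} (hL : 4 ≤ L) :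
    enT L (mP μ) (mP μ) + enT L (nM ν) (nM ν) + 1 / 2 * ∫ x, min (pot a x / 2) L ∂mP μ ≤
      phi a L (mP μ) (nM ν) + potConst a + tau a 0 := by
  have h1 := enT_le hα ha μ hν (by linarith : 0 ≤ L)
  have hb : ∀ f : ℝ → ℝ, Continuous f → (∀ x, 0 ≤ f x) →
      Integrable (fun x => min (f x) L) (mP μ) := fun f hf h0 =>
    Integrable.of_bound (hf.min continuous_const).aestronglyMeasurable L (.of_forall fun x => by
      rw [Real.norm_of_nonneg (le_min (h0 x) (by linarith))]; exact min_le_right _ _)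
  have i1 := hb absorb continuous_absorb absorb_nonneg
  have i2 := hb (fun x => pot a x / 2) ((continuous_pot a).div_const _)
    fun x => by have := pot_nonneg ha x; positivity
  have h2 := integral_mono ((i1.const_mul (1 / 2)).add (i2.const_mul (1 / 2)))
    (integrable_psi ha hL (mP μ)) (le_psi ha hL)
  simp only [Pi.add_apply] at h2
  rw [integral_add (i1.const_mul _) (i2.const_mul _), integral_const_mul, integral_const_mul] at h2
  unfold phi
  linarith

/-- Truncation lowers the self-energies, and raises the negative mutual term by an excess which
`psi` compensates up to `tau`. -/
theorem phi_sub_tau_le_J {α a : ℝ} (hα : 0 ≤ α) (ha : 0 < a) (μ : ProbabilityMeasure RPlus)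
    {ν : FiniteMeasure RMinus} (hν : ν ∈ E α a) {L : ℝ} (hL : 4 ≤ L) :
    ((phi a L (mP μ) (nM ν) - tau a L : ℝ) : EReal) ≤ J a μ ν := by
  by_cases h : en (mP μ) (mP μ) ≠ ⊤ ∧ en (nM ν) (nM ν) ≠ ⊤ ∧ potInt a (mP μ) ≠ ⊤
  swap
  · rw [J_eq_top ha μ hν h]; exact le_top
  obtain ⟨h1, h2, h3⟩ := h
  have hL0 : 0 ≤ L := by linarith
  rw [J_eq ha μ hν h1 h2 h3, EReal.coe_le_coe_iff]
  have h4 := en_nM_ne_top hν h1 h2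
  have e1 : enT L (mP μ) (mP μ) ≤ (en (mP μ) (mP μ)).toReal :=
    (ENNReal.ofReal_le_iff_le_toReal h1).mp (ofReal_enT_le_en hL0 _ _)
  have e2 : enT L (nM ν) (nM ν) ≤ (en (nM ν) (nM ν)).toReal :=
    (ENNReal.ofReal_le_iff_le_toReal h2).mp (ofReal_enT_le_en hL0 _ _)
  have hi : Integrable (pot a) (mP μ) := by
    refine ⟨(continuous_pot a).aestronglyMeasurable, ?_⟩
    rw [hasFiniteIntegral_iff_ofReal (.of_forall fun x => pot_nonneg ha x)]
    exact lt_top_iff_ne_top.mpr h3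
  have hp : ∫ x, pot a x ∂mP μ = (potInt a (mP μ)).toReal :=
    integral_eq_lintegral_of_nonneg_ae (.of_forall fun x => pot_nonneg ha x)
      (continuous_pot a).aestronglyMeasurable
  have hcm : Continuous fun x => max (absorb x - L / 2) 0 :=
    (continuous_absorb.sub continuous_const).max continuous_const
  have hj : Integrable (fun x => max (absorb x - L / 2) 0) (mP μ) := by
    refine hi.mono' hcm.aestronglyMeasurable (.of_forall fun x => ?_)
    rw [Real.norm_of_nonneg (le_max_right _ _)]
    have := le_pot ha x
    have := absorb_nonneg x
    have := abs_nonneg x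
    exact max_le (by linarith) (pot_nonneg ha x)
  have e3 : (en (mP μ) (nM ν)).toReal ≤ enT L (mP μ) (nM ν) +
      (1 / 2 * ∫ x, max (absorb x - L / 2) 0 ∂mP μ + tau a L) := by
    have h0 : 0 ≤ ∫ x, max (absorb x - L / 2) 0 ∂mP μ := integral_nonneg fun x => le_max_right _ _
    have ht := tau_nonneg a L
    have hz := enT_nonneg hL0 (mP μ) (nM ν)
    exact ENNReal.toReal_le_of_le_ofReal (by positivity) (en_le_ofReal hα ha μ hν hL0 hj)
  have e4 : ∫ x, psi a L x ∂mP μ + 1 / 2 * ∫ x, max (absorb x - L / 2) 0 ∂mP μ ≤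
      ∫ x, pot a x ∂mP μ := by
    rw [← integral_const_mul, ← integral_add (integrable_psi ha hL _) (hj.const_mul _)]
    refine integral_mono ((integrable_psi ha hL _).add (hj.const_mul _)) hi fun x => ?_
    refine (psi_add_le a L x).trans ?_
    have : 0 ≤ 1 / L * pot a x := by have := pot_nonneg ha x; positivity
    linarith
  unfold phi Jreal
  linarith

theorem tendsto_enT {m n : Measure ℝ} [IsFiniteMeasure m] [IsFiniteMeasure n] (h : en m n ≠ ⊤) :
    Tendsto (fun L : ℕ => enT L m n) atTop (𝓝 (en m n).toReal) := by
  have h1 : Tendsto (fun L : ℕ => ENNReal.ofReal (enT L m n)) atTop (𝓝 (en m n)) := by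
    rw [en_eq_iSup]
    exact tendsto_atTop_iSup fun k l hkl =>
      ENNReal.ofReal_le_ofReal (enT_mono (Nat.cast_nonneg _) (by exact_mod_cast hkl) _ _)
  refine ((ENNReal.tendsto_toReal h).comp h1).congr fun L => ?_
  exact ENNReal.toReal_ofReal (enT_nonneg (Nat.cast_nonneg _) _ _)

theorem en_le_of_enT_le {m n : Measure ℝ} [IsFiniteMeasure m] [IsFiniteMeasure n] {C : ℝ}
    (h : ∀ᶠ L : ℕ in atTop, enT L m n ≤ C) : en m n ≤ ENNReal.ofReal C := by
  obtain ⟨L₀, h⟩ := eventually_atTop.mp h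
  rw [en_eq_iSup]
  refine iSup_le fun k => ENNReal.ofReal_le_ofReal ?_
  exact (enT_mono (Nat.cast_nonneg _) (by exact_mod_cast le_max_left k L₀) _ _).trans
    (h (max k L₀) (le_max_right _ _))

/-- The rate function is bounded as soon as its truncations are. -/
theorem J_le_of_eventually {α a : ℝ} (hα : 0 ≤ α) (ha : 0 < a) (μ : ProbabilityMeasure RPlus)
    {ν : FiniteMeasure RMinus} (hν : ν ∈ E α a) {c : ℝ}
    (h : ∀ᶠ L : ℕ in atTop, phi a L (mP μ) (nM ν) ≤ c + tau a L) : J a μ ν ≤ c := by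
  set C := c + tau a 0 + potConst a + tau a 0
  have hmono : ∀ L : ℕ, tau a L ≤ tau a 0 := fun L => by
    unfold tau
    have : (0:ℝ) ≤ L := Nat.cast_nonneg L
    gcongr
  have hnn : ∀ (L : ℕ) x, 0 ≤ min (pot a x / 2) (L : ℝ) := fun L x =>
    le_min (by have := pot_nonneg ha x; positivity) (Nat.cast_nonneg _)
  -- Coercivity bounds each truncated term separately, so each limit term is finite and `J` takes
  -- its real form; only then can the limit be taken in the difference.
  have hC : ∀ᶠ L : ℕ in atTop, enT L (mP μ) (mP μ) ≤ C ∧ enT L (nM ν) (nM ν) ≤ C ∧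
      ∫ x, min (pot a x / 2) (L : ℝ) ∂mP μ ≤ 2 * C := by
    filter_upwards [h, eventually_ge_atTop 4] with L hL h4
    have h5 := phi_coercive hα ha μ hν (L := L) (by exact_mod_cast h4)
    have h6 := enT_nonneg (Nat.cast_nonneg L) (mP μ) (mP μ)
    have h7 := enT_nonneg (Nat.cast_nonneg L) (nM ν) (nM ν)
    have h8 : 0 ≤ ∫ x, min (pot a x / 2) (L : ℝ) ∂mP μ := integral_nonneg (hnn L)
    have := hmono L
    refine ⟨?_, ?_, ?_⟩ <;> simp only [C] <;> linarith
  have h1 : en (mP μ) (mP μ) ≠ ⊤ := ne_top_of_le_ne_top ENNReal.ofReal_ne_top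
    (en_le_of_enT_le (hC.mono fun L h => h.1))
  have h2 : en (nM ν) (nM ν) ≠ ⊤ := ne_top_of_le_ne_top ENNReal.ofReal_ne_top
    (en_le_of_enT_le (hC.mono fun L h => h.2.1))
  have h3 : potInt a (mP μ) ≠ ⊤ := by
    have hlim : ∀ x, Tendsto (fun L : ℕ => ENNReal.ofReal (min (pot a x / 2) (L : ℝ))) atTop
        (𝓝 (ENNReal.ofReal (pot a x / 2))) := fun x => by
      refine tendsto_const_nhds.congr' ?_
      filter_upwards [eventually_ge_atTop ⌈pot a x / 2⌉₊] with L hL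
      rw [min_eq_left ((Nat.le_ceil _).trans (by exact_mod_cast hL))]
    have hle : ∫⁻ x, ENNReal.ofReal (pot a x / 2) ∂mP μ ≤ ENNReal.ofReal (2 * C) := by
      calc _ = ∫⁻ x, liminf (fun L : ℕ => ENNReal.ofReal (min (pot a x / 2) (L : ℝ))) atTop ∂mP μ :=
            lintegral_congr fun x => (hlim x).liminf_eq.symm
        _ ≤ liminf (fun L : ℕ => ∫⁻ x, ENNReal.ofReal (min (pot a x / 2) (L : ℝ)) ∂mP μ) atTop :=
            lintegral_liminf_le fun L => by
              have := continuous_pot a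
              exact Measurable.ennreal_ofReal (Continuous.measurable (by fun_prop))
        _ ≤ _ := by
            refine liminf_le_of_frequently_le' (Eventually.frequently ?_)
            filter_upwards [hC] with L hL
            rw [← ofReal_integral_eq_lintegral_ofReal _ (.of_forall (hnn L))]
            · exact ENNReal.ofReal_le_ofReal hL.2.2
            · have := continuous_pot a
              exact Integrable.of_bound (Continuous.aestronglyMeasurable (by fun_prop)) L
                (.of_forall fun x => by
                  rw [Real.norm_of_nonneg (hnn L x)]; exact min_le_right _ _)
    intro htop
    have : potInt a (mP μ) = 2 * ∫⁻ x, ENNReal.ofReal (pot a x / 2) ∂mP μ := by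
      rw [← lintegral_const_mul _ ((continuous_pot a).measurable.div_const _).ennreal_ofReal, potInt]
      refine lintegral_congr fun x => ?_
      rw [← ENNReal.ofReal_ofNat 2, ← ENNReal.ofReal_mul (by norm_num)]
      congr 1; ring
    rw [this] at htop
    exact ENNReal.mul_ne_top (by simp) (ne_top_of_le_ne_top ENNReal.ofReal_ne_top hle) htop
  rw [J_eq ha μ hν h1 h2 h3, EReal.coe_le_coe_iff]
  have hi : Integrable (pot a) (mP μ) := by
    refine ⟨(continuous_pot a).aestronglyMeasurable, ?_⟩
    rw [hasFiniteIntegral_iff_ofReal (.of_forall fun x => pot_nonneg ha x)]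
    exact lt_top_iff_ne_top.mpr h3
  have hp : ∫ x, pot a x ∂mP μ = (potInt a (mP μ)).toReal :=
    integral_eq_lintegral_of_nonneg_ae (.of_forall fun x => pot_nonneg ha x)
      (continuous_pot a).aestronglyMeasurable
  have hpsi : Tendsto (fun L : ℕ => ∫ x, psi a L x ∂mP μ) atTop (𝓝 (∫ x, pot a x ∂mP μ)) := by
    -- The level is kept at least 4, where `psi` is nonnegative and dominated by `pot`.
    have hpsi' : Tendsto (fun L : ℕ => ∫ x, psi a (max L 4 : ℕ) x ∂mP μ) atTop
        (𝓝 (∫ x, pot a x ∂mP μ)) := by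
      refine tendsto_integral_of_dominated_convergence (pot a)
        (fun L => (continuous_psi a _).aestronglyMeasurable) hi (fun L => .of_forall fun x => ?_)
        (.of_forall fun x => ?_)
      · have h4 : (4:ℝ) ≤ (max L 4 : ℕ) := by exact_mod_cast le_max_right L 4
        rw [Real.norm_of_nonneg (psi_nonneg ha h4 x)]
        have h5 := psi_add_le a (max L 4 : ℕ) x
        have h6 : 0 ≤ 1 / ((max L 4 : ℕ) : ℝ) * pot a x := by
          have := pot_nonneg ha x; positivity
        linarith [le_max_right (absorb x - ((max L 4 : ℕ) : ℝ) / 2) 0]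
      · have h7 : Tendsto (fun L : ℕ => (1 - 1 / (L : ℝ)) * pot a x) atTop (𝓝 (pot a x)) := by
          simpa using (tendsto_one_div_atTop_nhds_zero_nat.const_sub 1).mul_const (pot a x)
        refine h7.congr' ?_
        filter_upwards [eventually_ge_atTop 4, eventually_ge_atTop ⌈pot a x⌉₊,
          eventually_ge_atTop ⌈2 * absorb x⌉₊] with L h4 h5 h6
        have h5' : pot a x ≤ L := (Nat.le_ceil _).trans (by exact_mod_cast h5)
        have h6' : 2 * absorb x ≤ L := (Nat.le_ceil _).trans (by exact_mod_cast h6)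
        have h8 : 0 ≤ 1 / (L : ℝ) * pot a x := by have := pot_nonneg ha x; positivity
        rw [max_eq_left h4, psi, max_eq_right (by linarith), mul_zero, sub_zero,
          min_eq_left (by linarith)]
    refine hpsi'.congr' ?_
    filter_upwards [eventually_ge_atTop 4] with L hL
    rw [max_eq_left hL]
  have hlim : Tendsto (fun L : ℕ => phi a L (mP μ) (nM ν)) atTop (𝓝 (Jreal a (mP μ) (nM ν))) := by
    unfold phi Jreal
    rw [← hp]
    exact ((((tendsto_enT h1).sub (tendsto_enT (en_nM_ne_top hν h1 h2))).add
      (tendsto_enT h2)).add hpsi).sub_const _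
  have hc : Tendsto (fun L : ℕ => c + tau a L) atTop (𝓝 c) := by
    simpa using (tendsto_tau a).const_add c
  exact le_of_tendsto_of_tendsto hlim hc h

/-! ### Continuity of the truncated functionals -/

/-- The truncated kernel is bounded and continuous, and the product of probability measures is
weakly continuous. This is why measures of mass 1/2 are doubled into `pM`. -/
theorem continuous_enT {L : ℝ} (hL : 0 ≤ L) :
    Continuous fun q : ProbabilityMeasure ℝ × ProbabilityMeasure ℝ =>
      enT L (q.1 : Measure ℝ) (q.2 : Measure ℝ) := by
  let f : BoundedContinuousFunction (ℝ × ℝ) ℝ :=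
    BoundedContinuousFunction.ofNormedAddCommGroup (fun p => kT L p.1 p.2) (continuous_kT L) L
      fun p => by rw [Real.norm_of_nonneg (kT_nonneg hL _ _)]; exact kT_le _ _ _
  exact (ProbabilityMeasure.continuous_integral_boundedContinuousFunction f).comp
    ProbabilityMeasure.continuous_prod

theorem enT_smul_left (L : ℝ) (c : ℝ≥0∞) (m n : Measure ℝ) [SFinite m] [SFinite n] :
    enT L (c • m) n = c.toReal * enT L m n := by
  simp only [enT, Measure.prod_smul_left, integral_smul_measure, smul_eq_mul]

theorem enT_smul_right (L : ℝ) (c : ℝ≥0∞) (m n : Measure ℝ) [SFinite m] [SFinite n] :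
    enT L m (c • n) = c.toReal * enT L m n := by
  have : SFinite (c • n) := inferInstance
  rw [enT_comm, enT_smul_left, enT_comm]

/-- A measure on `ℝ_+` as a probability measure on the line. -/
def pP (μ : ProbabilityMeasure RPlus) : ProbabilityMeasure ℝ :=
  μ.map (f := Subtype.val) measurable_subtype_coe.aemeasurable

theorem coe_pP (μ : ProbabilityMeasure RPlus) : (pP μ : Measure ℝ) = mP μ := rfl

theorem continuous_pP : Continuous pP := ProbabilityMeasure.continuous_map continuous_subtype_val

/-- A measure of mass `1/2` on `ℝ_-` as a probability measure on the line. -/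
def pM {α a : ℝ} (ν : E α a) : ProbabilityMeasure ℝ :=
  ⟨(2 : ℝ≥0) • nM ν, ⟨by
    rw [Measure.smul_apply, nM_univ ν.2]
    change ((2 : ℝ≥0) : ℝ≥0∞) * (1 / 2) = 1
    rw [ENNReal.coe_ofNat, one_div, ENNReal.mul_inv_cancel two_ne_zero (by simp)]⟩⟩

theorem nM_eq_smul_pM {α a : ℝ} (ν : E α a) : nM ν = (1 / 2 : ℝ≥0∞) • (pM ν : Measure ℝ) := by
  change nM ν = (1 / 2 : ℝ≥0∞) • (((2 : ℝ≥0) : ℝ≥0∞) • nM ν)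
  rw [smul_smul, ENNReal.coe_ofNat, one_div, ENNReal.inv_mul_cancel two_ne_zero (by simp), one_smul]

theorem continuous_pM {α a : ℝ} : Continuous (pM : E α a → ProbabilityMeasure ℝ) := by
  rw [(ProbabilityMeasure.toFiniteMeasure_isEmbedding ℝ).continuous_iff]
  have h : Continuous fun ν : E α a => (2 : ℝ≥0) • (ν : FiniteMeasure RMinus).map Subtype.val :=
    Continuous.const_smul ((FiniteMeasure.continuous_map (f := Subtype.val)
      continuous_subtype_val).comp continuous_subtype_val) (2 : ℝ≥0)
  exact h

theorem continuous_phi {α a : ℝ} (ha : 0 < a) {L : ℝ} (hL : 4 ≤ L) :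
    Continuous fun p : ProbabilityMeasure RPlus × E α a => phi a L (mP p.1) (nM p.2) := by
  have h0 : 0 ≤ L := by linarith
  let f : BoundedContinuousFunction ℝ ℝ :=
    BoundedContinuousFunction.ofNormedAddCommGroup (psi a L) (continuous_psi a L) L
      fun x => by rw [Real.norm_of_nonneg (psi_nonneg ha hL x)]; exact psi_le a L x
  have h1 : Continuous fun p : ProbabilityMeasure RPlus × E α a => pP p.1 :=
    continuous_pP.comp continuous_fst
  have h2 : Continuous fun p : ProbabilityMeasure RPlus × E α a => pM p.2 :=
    continuous_pM.comp continuous_snd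
  have c1 := (continuous_enT h0).comp (h1.prodMk h1)
  have c2 := (continuous_enT h0).comp (h1.prodMk h2)
  have c3 := (continuous_enT h0).comp (h2.prodMk h2)
  have c4 := (ProbabilityMeasure.continuous_integral_boundedContinuousFunction f).comp h1
  have key : ∀ p : ProbabilityMeasure RPlus × E α a, phi a L (mP p.1) (nM p.2) =
      enT L (pP p.1) (pP p.1) - 1 / 2 * enT L (pP p.1) (pM p.2) +
      1 / 4 * enT L (pM p.2) (pM p.2) + ∫ x, f x ∂(pP p.1 : Measure ℝ) - potConst a := fun p => by
    rw [phi, nM_eq_smul_pM, enT_smul_right _ _, enT_smul_right _ _,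
      enT_smul_left, coe_pP]
    simp only [one_div, ENNReal.toReal_inv, ENNReal.toReal_ofNat]
    rw [show ∫ x, psi a L x ∂mP p.1 = ∫ x, f x ∂mP p.1 from rfl]
    ring
  simp_rw [key]
  exact (((c1.sub (continuous_const.mul c2)).add (continuous_const.mul c3)).add c4).sub
    continuous_const

/-! ### Tightness -/

/-- The origin of `ℝ_+`. -/
def zP : RPlus := ⟨0, self_mem_Ici⟩

/-- The origin of `ℝ_-`. -/
def zM : RMinus := ⟨0, self_mem_Iic⟩

/-- Pairs of measures with prescribed tails. -/
def tightSet (α a : ℝ) (R : ℕ → ℝ) : Set (ProbabilityMeasure RPlus × E α a) :=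
  {p | ∀ k : ℕ, p.1 (Metric.closedBall zP (R k))ᶜ ≤ 1 / ((k : ℝ≥0) + 1) ∧
    (p.2 : FiniteMeasure RMinus) (Metric.closedBall zM (R k))ᶜ ≤ 1 / ((k : ℝ≥0) + 1)}

theorem isCompact_tightSet {α a : ℝ} (hα : 0 ≤ α) (ha : 0 < a) (R : ℕ → ℝ) :
    IsCompact (tightSet α a R) := by
  have hu : Tendsto (fun k : ℕ => 1 / ((k : ℝ≥0) + 1)) atTop (𝓝 0) :=
    tendsto_one_div_add_atTop_nhds_zero_nat
  have h1 := isCompact_setOfPred_probabilityMeasure_mass_eq_compl_isCompact_le hu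
    (fun k => isCompact_closedBall zP (R k)) (.inl inferInstance)
  have h2 := isCompact_setOfPred_finiteMeasure_mass_eq_compl_isCompact_le (1 / 2) hu
    (fun k => isCompact_closedBall zM (R k)) (.inl inferInstance)
  have h3 := (isClosed_E hα ha).isClosedEmbedding_subtypeVal.isCompact_preimage h2
  convert h1.prod h3 using 1
  ext p
  simp only [tightSet, mem_ofPred_eq, mem_prod, mem_preimage, forall_and]
  have := mass_of_mem_E p.2.2
  tauto

/-- Points far out on the half-line all lie close to (0,1) on the circle. -/
theorem chord_le_inv {R x y : ℝ} (hR : 1 ≤ R) (hx : x ≤ -R) (hy : y ≤ -R) : chord x y ≤ R⁻¹ := by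
  wlog hxy : x ≤ y generalizing x y
  · rw [chord_comm]; exact this hy hx (le_of_not_ge hxy)
  have h1 : |x - y| ≤ √(1 + x ^ 2) := by
    rw [abs_of_nonpos (by linarith)]
    refine Real.le_sqrt_of_sq_le ?_
    nlinarith
  have h2 : R ≤ √(1 + y ^ 2) := by
    refine Real.le_sqrt_of_sq_le ?_
    nlinarith
  rw [chord, div_le_iff₀ (by positivity)]
  calc |x - y| ≤ √(1 + x ^ 2) * 1 := by rw [mul_one]; exact h1
    _ ≤ √(1 + x ^ 2) * (R⁻¹ * √(1 + y ^ 2)) := by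
        gcongr
        rw [inv_mul_eq_div, le_div_iff₀ (by linarith), one_mul]; exact h2
    _ = _ := by ring

/-- Pairs in the far tail have truncated kernel L. So the energy of ν alone, with no potential,
prevents mass from escaping. -/
theorem enT_tail {L : ℝ} (hL : 0 ≤ L) (n : Measure ℝ) [IsFiniteMeasure n] :
    L * n.real (Iio (-Real.exp L)) ^ 2 ≤ enT L n n := by
  set S := Iio (-Real.exp L)
  have hS : MeasurableSet (S ×ˢ S) := measurableSet_Iio.prod measurableSet_Iio
  calc L * n.real S ^ 2 = ∫ p, (S ×ˢ S).indicator (fun _ => L) p ∂n.prod n := by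
        rw [integral_indicator hS, setIntegral_const, measureReal_prod_prod, smul_eq_mul]
        ring
    _ ≤ _ := by
        refine integral_mono ((integrable_const L).indicator hS) (integrable_kT hL _) fun p => ?_
        by_cases hp : p ∈ S ×ˢ S
        · rw [indicator_of_mem hp]
          have h1 := chord_le_inv (Real.one_le_exp hL) (le_of_lt hp.1) (le_of_lt hp.2)
          rw [← Real.exp_neg] at h1
          simp only [kT, max_eq_right h1, Real.log_exp, neg_neg, le_refl]
        · rw [indicator_of_notMem hp]; exact kT_nonneg hL _ _

theorem phi_tail_mP {α a : ℝ} (hα : 0 ≤ α) (ha : 0 < a) (p : ProbabilityMeasure RPlus × E α a)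
    {L : ℝ} (hL : 4 ≤ L) :
    L * (mP p.1).real (Ioi (4 * L)) ≤
      2 * (phi a L (mP p.1) (nM p.2) + potConst a + tau a 0) := by
  have h1 := phi_coercive hα ha p.1 p.2.2 hL
  have h2 := enT_nonneg (by linarith : 0 ≤ L) (mP p.1) (mP p.1)
  have h3 := enT_nonneg (by linarith : 0 ≤ L) (nM p.2) (nM p.2)
  have hc : Continuous fun x => min (pot a x / 2) L := by
    have := continuous_pot a
    fun_prop
  have hnn : ∀ x, 0 ≤ min (pot a x / 2) L := fun x =>
    le_min (by have := pot_nonneg ha x; positivity) (by linarith)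
  have h4 : L * (mP p.1).real (Ioi (4 * L)) ≤ ∫ x, min (pot a x / 2) L ∂mP p.1 := by
    calc _ = ∫ x, (Ioi (4 * L)).indicator (fun _ => L) x ∂mP p.1 := by
          rw [integral_indicator measurableSet_Ioi, setIntegral_const, smul_eq_mul, mul_comm]
      _ ≤ _ := by
          refine integral_mono ((integrable_const L).indicator measurableSet_Ioi)
            (Integrable.of_bound hc.aestronglyMeasurable L (.of_forall fun x => by
              rw [Real.norm_of_nonneg (hnn x)]; exact min_le_right _ _)) fun x => ?_
          by_cases hx : x ∈ Ioi (4 * L)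
          · rw [indicator_of_mem hx]
            have h5 := le_pot ha x
            have h6 := absorb_nonneg x
            have h7 := le_abs_self x
            rw [mem_Ioi] at hx
            exact le_min (by linarith) le_rfl
          · rw [indicator_of_notMem hx]; exact hnn x
  linarith

theorem phi_tail_nM {α a : ℝ} (hα : 0 ≤ α) (ha : 0 < a) (p : ProbabilityMeasure RPlus × E α a)
    {L : ℝ} (hL : 4 ≤ L) :
    L * (nM p.2).real (Iio (-Real.exp L)) ^ 2 ≤
      phi a L (mP p.1) (nM p.2) + potConst a + tau a 0 := by
  have h1 := phi_coercive hα ha p.1 p.2.2 hL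
  have h2 := enT_nonneg (by linarith : 0 ≤ L) (mP p.1) (mP p.1)
  have h3 := enT_tail (by linarith : 0 ≤ L) (nM p.2)
  have h4 : 0 ≤ ∫ x, min (pot a x / 2) L ∂mP p.1 := integral_nonneg fun x =>
    le_min (show 0 ≤ pot a x / 2 by have := pot_nonneg ha x; positivity)
      (show 0 ≤ L by linarith)
  linarith

theorem exists_tail_radius {α a : ℝ} (hα : 0 ≤ α) (ha : 0 < a) (c : ℝ) (k : ℕ) :
    ∃ L : ℕ, 4 ≤ L ∧ ∃ r : ℝ, ∀ p : ProbabilityMeasure RPlus × E α a,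
      phi a L (mP p.1) (nM p.2) ≤ c → ∀ r' ≥ r,
      p.1 (Metric.closedBall zP r')ᶜ ≤ 1 / ((k : ℝ≥0) + 1) ∧
      (p.2 : FiniteMeasure RMinus) (Metric.closedBall zM r')ᶜ ≤ 1 / ((k : ℝ≥0) + 1) := by
  set C := c + potConst a + tau a 0
  -- The tail bounds are of the form 2C/L for μ and √(C/L) for ν; both have to fall below 1/(k+1).
  obtain ⟨L, hL⟩ := exists_nat_ge (max 4 (max (2 * C * (k + 1)) (C * (k + 1) ^ 2)))
  have hL4 : (4:ℝ) ≤ L := (le_max_left _ _).trans hL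
  have hL1 : 2 * C * (k + 1) ≤ L := (le_max_left _ _).trans ((le_max_right _ _).trans hL)
  have hL2 : C * (k + 1) ^ 2 ≤ L := (le_max_right _ _).trans ((le_max_right _ _).trans hL)
  refine ⟨L, by exact_mod_cast hL4, max (4 * L) (Real.exp L), fun p hp r' hr' => ⟨?_, ?_⟩⟩
  · have h1 := phi_tail_mP hα ha p hL4
    have h2 : ((p.1 (Metric.closedBall zP r')ᶜ : ℝ≥0) : ℝ) ≤ (mP p.1).real (Ioi (4 * L)) := by
      rw [← ProbabilityMeasure.measureReal_eq_coe_coeFn, mP,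
        map_measureReal_apply measurable_subtype_coe measurableSet_Ioi]
      refine measureReal_mono fun x hx => ?_
      simp only [mem_compl_iff, Metric.mem_closedBall, not_le] at hx
      have h3 : dist x zP = x := by
        rw [Subtype.dist_eq, zP, Real.dist_eq, sub_zero, abs_of_nonneg x.2]
      rw [h3] at hx
      exact ((le_max_left _ _).trans hr').trans_lt hx
    rw [← NNReal.coe_le_coe]
    push_cast
    refine h2.trans ?_
    rw [le_div_iff₀ (by positivity)]
    have h4 : L * ((mP p.1).real (Ioi (4 * (L:ℝ))) * (k + 1)) ≤ L * 1 := by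
      have h5 : 2 * (phi a L (mP p.1) (nM p.2) + potConst a + tau a 0) * ((k:ℝ) + 1) ≤
        2 * C * (k + 1) := by gcongr; simp only [C]; linarith
      have h6 := mul_le_mul_of_nonneg_right h1 (by positivity : (0:ℝ) ≤ k + 1)
      linarith
    exact le_of_mul_le_mul_left h4 (by linarith)
  · have h1 := phi_tail_nM hα ha p hL4
    have h2 : (((p.2 : FiniteMeasure RMinus) (Metric.closedBall zM r')ᶜ : ℝ≥0) : ℝ) ≤
        (nM p.2).real (Iio (-Real.exp L)) := by
      rw [← FiniteMeasure.measureReal_eq_coe_coeFn, nM,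
        map_measureReal_apply measurable_subtype_coe measurableSet_Iio]
      refine measureReal_mono fun x hx => ?_
      simp only [mem_compl_iff, Metric.mem_closedBall, not_le] at hx
      have h3 : dist x zM = -x := by
        rw [Subtype.dist_eq, zM, Real.dist_eq, sub_zero, abs_of_nonpos x.2]
      rw [h3] at hx
      have := ((le_max_right _ _).trans hr').trans_lt hx
      simp only [mem_preimage, mem_Iio]
      linarith
    rw [← NNReal.coe_le_coe]
    push_cast
    refine h2.trans ?_
    rw [le_div_iff₀ (by positivity), ← abs_of_nonneg (a := (nM p.2).real _ * _) (by positivity),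
      ← sq_le_one_iff_abs_le_one, mul_pow]
    have h4 : L * ((nM p.2).real (Iio (-Real.exp L)) ^ 2 * ((k:ℝ) + 1) ^ 2) ≤ L * 1 := by
      have h5 : (phi a L (mP p.1) (nM p.2) + potConst a + tau a 0) * ((k:ℝ) + 1) ^ 2 ≤
        C * (k + 1) ^ 2 := by gcongr; simp only [C]; linarith
      have h6 := mul_le_mul_of_nonneg_right h1 (by positivity : (0:ℝ) ≤ ((k:ℝ) + 1) ^ 2)
      linarith
    exact le_of_mul_le_mul_left h4 (by linarith)

theorem exists_radius {α a : ℝ} (p : ProbabilityMeasure RPlus × E α a) (k : ℕ) :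
    ∃ r : ℝ, ∀ r' ≥ r, p.1 (Metric.closedBall zP r')ᶜ ≤ 1 / ((k : ℝ≥0) + 1) ∧
      (p.2 : FiniteMeasure RMinus) (Metric.closedBall zM r')ᶜ ≤ 1 / ((k : ℝ≥0) + 1) := by
  have gen : ∀ {X : Type} [PseudoMetricSpace X] [MeasurableSpace X] [OpensMeasurableSpace X]
      (m : Measure X) [IsFiniteMeasure m] (z : X), ∃ r : ℝ, ∀ r' ≥ r,
      m (Metric.closedBall z r')ᶜ ≤ ((1 / ((k : ℝ≥0) + 1) : ℝ≥0) : ℝ≥0∞) := by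
    intro X _ _ _ m _ z
    have h1 : Tendsto (fun n : ℕ => m (Metric.closedBall z n)ᶜ) atTop (𝓝 0) := by
      have h2 : ⋂ n : ℕ, (Metric.closedBall z (n : ℝ))ᶜ = ∅ := by
        rw [← compl_iUnion, Metric.iUnion_closedBall_nat, compl_univ]
      rw [← measure_empty (μ := m), ← h2]
      refine tendsto_measure_iInter_atTop
        (fun n => Metric.isClosed_closedBall.measurableSet.compl.nullMeasurableSet) ?_
        ⟨0, measure_ne_top _ _⟩
      exact fun i j hij => compl_subset_compl.mpr
        (Metric.closedBall_subset_closedBall (by exact_mod_cast hij))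
    have h3 : (0:ℝ≥0∞) < ((1 / ((k : ℝ≥0) + 1) : ℝ≥0) : ℝ≥0∞) := by
      rw [ENNReal.coe_pos]; positivity
    obtain ⟨n, hn⟩ := (h1.eventually_le_const h3).exists
    exact ⟨n, fun r' hr' => (measure_mono (compl_subset_compl.mpr
      (Metric.closedBall_subset_closedBall hr'))).trans hn⟩
  obtain ⟨r₁, h₁⟩ := gen (p.1 : Measure RPlus) zP
  obtain ⟨r₂, h₂⟩ := gen ((p.2 : FiniteMeasure RMinus) : Measure RMinus) zM
  refine ⟨max r₁ r₂, fun r' hr' => ⟨?_, ?_⟩⟩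
  · rw [← ENNReal.coe_le_coe, ProbabilityMeasure.ennreal_coeFn_eq_coeFn_toMeasure]
    exact h₁ r' ((le_max_left _ _).trans hr')
  · rw [← ENNReal.coe_le_coe, FiniteMeasure.ennreal_coeFn_eq_coeFn_toMeasure]
    exact h₂ r' ((le_max_right _ _).trans hr')

/-- The finitely many terms for which the bound on `phi` may fail are tight one by one. -/
theorem exists_mem_tightSet {α a : ℝ} (hα : 0 ≤ α) (ha : 0 < a) {c : ℝ}
    (p : ℕ → ProbabilityMeasure RPlus × E α a)
    (h : ∀ L : ℕ, 4 ≤ L → ∀ᶠ n in atTop, phi a L (mP (p n).1) (nM (p n).2) ≤ c) :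
    ∃ R, ∀ n, p n ∈ tightSet α a R := by
  have key : ∀ k : ℕ, ∃ r : ℝ, ∀ n, (p n).1 (Metric.closedBall zP r)ᶜ ≤ 1 / ((k : ℝ≥0) + 1) ∧
      ((p n).2 : FiniteMeasure RMinus) (Metric.closedBall zM r)ᶜ ≤ 1 / ((k : ℝ≥0) + 1) := by
    intro k
    obtain ⟨L, hL, r, hr⟩ := exists_tail_radius (α := α) hα ha c k
    obtain ⟨n₀, hn₀⟩ := eventually_atTop.mp (h L hL)
    choose s hs using fun n => exists_radius (p n) k
    obtain ⟨b, hb⟩ := ((Finset.range n₀).image s).bddAbove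
    refine ⟨max r b, fun n => ?_⟩
    rcases lt_or_ge n n₀ with hn | hn
    · exact hs n _ ((hb (Finset.mem_coe.mpr (Finset.mem_image_of_mem s
        (Finset.mem_range.mpr hn)))).trans (le_max_right _ _))
    · exact hr _ (hn₀ n hn) _ (le_max_left _ _)
  choose R hR using key
  exact ⟨R, fun n k => hR k n⟩

theorem tau_le (a : ℝ) (L : ℕ) : tau a L ≤ tau a 0 := by
  unfold tau
  have : (0:ℝ) ≤ L := Nat.cast_nonneg L
  gcongr

/-- The level set is exactly the intersection of the closed sets where `phi` is at most γ + `tau`,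
and `exists_tail_radius` makes it tight. -/
theorem isCompact_level {α a : ℝ} (hα : 0 ≤ α) (ha : 0 < a) (γ : ℝ) :
    IsCompact {p : ProbabilityMeasure RPlus × E α a | J a p.1 p.2 ≤ (γ : EReal)} := by
  have heq : {p : ProbabilityMeasure RPlus × E α a | J a p.1 p.2 ≤ (γ : EReal)} =
      ⋂ L : ℕ, ⋂ _ : 4 ≤ L, {p | phi a L (mP p.1) (nM p.2) ≤ γ + tau a L} := by
    ext p
    simp only [mem_iInter, mem_ofPred_eq]
    constructor
    · intro h L hL
      have := (phi_sub_tau_le_J hα ha p.1 p.2.2 (L := L) (by exact_mod_cast hL)).trans h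
      rw [EReal.coe_le_coe_iff] at this
      linarith
    · intro h
      exact J_le_of_eventually hα ha p.1 p.2.2 (eventually_atTop.mpr ⟨4, h⟩)
  have hcl : IsClosed {p : ProbabilityMeasure RPlus × E α a | J a p.1 p.2 ≤ (γ : EReal)} := by
    rw [heq]
    exact isClosed_iInter fun L => isClosed_iInter fun hL =>
      isClosed_le (continuous_phi ha (by exact_mod_cast hL)) continuous_const
  choose L hL r hr using fun k => exists_tail_radius (α := α) hα ha (γ + tau a 0) k
  refine (isCompact_tightSet hα ha r).of_isClosed_subset hcl ?_
  rw [heq]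
  intro p hp k
  simp only [mem_iInter, mem_ofPred_eq] at hp
  exact hr k p ((hp (L k) (hL k)).trans (by linarith [tau_le a (L k)])) _ le_rfl

/-- A sequence along which the truncated functionals are bounded has a limit point at which the
rate function is bounded. -/
theorem exists_limit {α a : ℝ} (hα : 0 ≤ α) (ha : 0 < a) {c : ℝ}
    (p : ℕ → ProbabilityMeasure RPlus × E α a)
    (h : ∀ L : ℕ, 4 ≤ L → ∀ᶠ n in atTop, phi a L (mP (p n).1) (nM (p n).2) ≤ c + tau a L)
    {F : Set (ProbabilityMeasure RPlus × E α a)} (hF : IsClosed F) (hpF : ∀ n, p n ∈ F) :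
    ∃ q ∈ F, J a q.1 q.2 ≤ c := by
  obtain ⟨R, hR⟩ := exists_mem_tightSet hα ha (c := c + tau a 0) p fun L hL =>
    (h L hL).mono fun n hn => hn.trans (by linarith [tau_le a L])
  have hK := (isCompact_tightSet hα ha R).inter_right hF
  obtain ⟨q, hq, hqc⟩ := hK (f := map p atTop)
    (le_principal_iff.mpr (mem_map.mpr (univ_mem' fun n => ⟨hR n, hpF n⟩)))
  refine ⟨q, hq.2, J_le_of_eventually hα ha q.1 q.2.2 (eventually_atTop.mpr ⟨4, fun L hL => ?_⟩)⟩
  have hcl : IsClosed {p : ProbabilityMeasure RPlus × E α a |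
      phi a L (mP p.1) (nM p.2) ≤ c + tau a L} :=
    isClosed_le (continuous_phi ha (by exact_mod_cast hL)) continuous_const
  exact (isClosed_iff_clusterPt.mp hcl) q (hqc.mono (le_principal_iff.mpr (h L hL)))

/-! ### Uniqueness of the minimizer -/

/-- A measure of finite energy dominated by `σ_N` does not exist. -/
theorem mem_constrained_sigma_of_en {α a : ℝ} (hα : 0 ≤ α) (ha : 0 < a) {ν : FiniteMeasure RMinus}
    (hν : ν ∈ E α a) (h : en (nM ν) (nM ν) ≠ ⊤) : ν ∈ constrained (sigma a) := by
  rcases hν with hν | hν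
  swap
  · exact hν
  simp only [mem_iUnion] at hν
  obtain ⟨N, hN, hm, hle⟩ := hν
  exfalso
  have h0 : (ν : Measure RMinus) (besselSet α a N)ᶜ = 0 :=
    le_antisymm ((hle _).trans (sigmaN_compl_besselSet hα ha hN).le) bot_le
  have h1 : (ν : Measure RMinus) (besselSet α a N) = 0 := by
    rw [← biUnion_of_singleton (besselSet α a N),
      measure_biUnion_null_iff (countable_besselSet hα ha hN)]
    intro u _
    by_contra hu
    refine h (en_eq_top_of_atom (x := (u : ℝ)) fun h2 => hu ?_)
    rw [nM, Measure.map_apply measurable_subtype_coe (measurableSet_singleton _)] at h2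
    exact measure_mono_null (fun v hv => by rw [mem_singleton_iff] at hv; simp [hv]) h2
  have h2 : (ν : Measure RMinus) univ = 0 := by
    rw [← union_compl_self (besselSet α a N)]
    exact measure_union_null h1 h0
  rw [← FiniteMeasure.ennreal_mass, hm] at h2
  simp at h2

theorem exists_nnreal_eq {x : ℝ≥0∞} (h : x ≠ ⊤) : ∃ y : ℝ≥0, (y : ℝ≥0∞) = x :=
  ⟨x.toNNReal, ENNReal.coe_toNNReal h⟩

/-- The midpoint of two probability measures. -/
def midP (μ₀ μ₁ : ProbabilityMeasure RPlus) : ProbabilityMeasure RPlus :=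
  ⟨(1 / 2 : ℝ≥0∞) • ((μ₀ : Measure RPlus) + (μ₁ : Measure RPlus)), ⟨by
    simp only [Measure.smul_apply, Measure.add_apply, measure_univ, smul_eq_mul, one_div]
    rw [one_add_one_eq_two, ENNReal.inv_mul_cancel two_ne_zero (by simp)]⟩⟩

theorem mP_midP (μ₀ μ₁ : ProbabilityMeasure RPlus) :
    mP (midP μ₀ μ₁) = (1 / 2 : ℝ≥0∞) • (mP μ₀ + mP μ₁) := by
  change Measure.map Subtype.val ((1 / 2 : ℝ≥0∞) • ((μ₀ : Measure RPlus) + (μ₁ : Measure RPlus))) = _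
  rw [Measure.map_smul, Measure.map_add _ _ measurable_subtype_coe]
  rfl

/-- The midpoint of two finite measures. -/
def midM (ν₀ ν₁ : FiniteMeasure RMinus) : FiniteMeasure RMinus :=
  (1 / 2 : ℝ≥0) • (ν₀ + ν₁)

theorem nM_midM (ν₀ ν₁ : FiniteMeasure RMinus) :
    nM (midM ν₀ ν₁) = (1 / 2 : ℝ≥0∞) • (nM ν₀ + nM ν₁) := by
  have : ((1 / 2 : ℝ≥0) : ℝ≥0∞) = 1 / 2 := by
    rw [ENNReal.coe_div two_ne_zero]; simp
  change Measure.map Subtype.val (((1 / 2 : ℝ≥0) : ℝ≥0∞) •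
    ((ν₀ : Measure RMinus) + (ν₁ : Measure RMinus))) = _
  rw [this, Measure.map_smul, Measure.map_add _ _ measurable_subtype_coe]
  rfl

theorem midM_mem {a : ℝ} {ν₀ ν₁ : FiniteMeasure RMinus} (h₀ : ν₀ ∈ constrained (sigma a))
    (h₁ : ν₁ ∈ constrained (sigma a)) : midM ν₀ ν₁ ∈ constrained (sigma a) := by
  have hc : ((1 / 2 : ℝ≥0) : ℝ≥0∞) = 1 / 2 := by
    rw [ENNReal.coe_div two_ne_zero]; simp
  constructor
  · have h2 : (midM ν₀ ν₁).mass = 1 / 2 * (ν₀.mass + ν₁.mass) := by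
      simp only [midM, FiniteMeasure.mass, FiniteMeasure.coeFn_smul, FiniteMeasure.coeFn_add,
        Pi.smul_apply, Pi.add_apply, smul_eq_mul]
    rw [h2, h₀.1, h₁.1, add_halves, mul_one]
  · rw [Measure.le_iff]
    intro s _
    change ((1 / 2 : ℝ≥0) : ℝ≥0∞) * ((ν₀ : Measure RMinus) s + (ν₁ : Measure RMinus) s) ≤ _
    rw [hc]
    calc _ ≤ 1 / 2 * (sigma a s + sigma a s) := by
          gcongr
          · exact h₀.2
          · exact h₁.2
      _ = sigma a s := by
          rw [← two_mul, ← mul_assoc, one_div, ENNReal.inv_mul_cancel two_ne_zero (by simp), one_mul]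

/-- The minimizer of the rate function is unique. -/
theorem eq_of_minimal {α a : ℝ} (hα : 0 ≤ α) (ha : 0 < a)
    {p q : ProbabilityMeasure RPlus × E α a} {c : ℝ} (hp : J a p.1 p.2 = c) (hq : J a q.1 q.2 = c)
    (hmin : ∀ r : ProbabilityMeasure RPlus × E α a, (c : EReal) ≤ J a r.1 r.2) : p = q := by
  obtain ⟨μ₀, ν₀, hν₀⟩ := p
  obtain ⟨μ₁, ν₁, hν₁⟩ := q
  simp only at hp hq
  have fin : ∀ {μ : ProbabilityMeasure RPlus} {ν : FiniteMeasure RMinus}, ν ∈ E α a →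
      J a μ ν = c → en (mP μ) (mP μ) ≠ ⊤ ∧ en (nM ν) (nM ν) ≠ ⊤ ∧ potInt a (mP μ) ≠ ⊤ := by
    intro μ ν hν h
    by_contra hcon
    rw [J_eq_top ha μ hν hcon] at h
    exact EReal.coe_ne_top _ h.symm
  obtain ⟨a0, b0, w0⟩ := fin hν₀ hp
  obtain ⟨a1, b1, w1⟩ := fin hν₁ hq
  have c00 := en_nM_ne_top hν₀ a0 b0
  have c01 := en_nM_ne_top hν₁ a0 b1
  have c10 := en_nM_ne_top hν₀ a1 b0
  have c11 := en_nM_ne_top hν₁ a1 b1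
  have hmu : mP μ₀ univ = mP μ₁ univ := by simp
  have hnu : nM ν₀ univ = nM ν₁ univ := by rw [nM_univ hν₀, nM_univ hν₁]
  have a01 := en_ne_top hmu a0 a1
  have b01 := en_ne_top hnu b0 b1
  -- ℰ itself need not be convex, but its elements of finite energy lie below σ, and so does their
  -- midpoint.
  have k₀ := mem_constrained_sigma_of_en hα ha hν₀ b0
  have k₁ := mem_constrained_sigma_of_en hα ha hν₁ b1
  have hmem : midM ν₀ ν₁ ∈ E α a := Or.inr (midM_mem k₀ k₁)
  rw [J_eq ha μ₀ hν₀ a0 b0 w0, EReal.coe_eq_coe_iff, Jreal] at hp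
  rw [J_eq ha μ₁ hν₁ a1 b1 w1, EReal.coe_eq_coe_iff, Jreal] at hq
  have hJ := hmin (midP μ₀ μ₁, ⟨midM ν₀ ν₁, hmem⟩)
  obtain ⟨A00, hA00⟩ := exists_nnreal_eq a0
  obtain ⟨A11, hA11⟩ := exists_nnreal_eq a1
  obtain ⟨A01, hA01⟩ := exists_nnreal_eq a01
  obtain ⟨B00, hB00⟩ := exists_nnreal_eq b0
  obtain ⟨B11, hB11⟩ := exists_nnreal_eq b1
  obtain ⟨B01, hB01⟩ := exists_nnreal_eq b01
  obtain ⟨C00, hC00⟩ := exists_nnreal_eq c00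
  obtain ⟨C01, hC01⟩ := exists_nnreal_eq c01
  obtain ⟨C10, hC10⟩ := exists_nnreal_eq c10
  obtain ⟨C11, hC11⟩ := exists_nnreal_eq c11
  obtain ⟨W0, hW0⟩ := exists_nnreal_eq w0
  obtain ⟨W1, hW1⟩ := exists_nnreal_eq w1
  have hA10 : en (mP μ₁) (mP μ₀) = A01 := by rw [en_comm, hA01]
  have hB10 : en (nM ν₁) (nM ν₀) = B01 := by rw [en_comm, hB01]
  have hD00 : en (nM ν₀) (mP μ₀) = C00 := by rw [en_comm, hC00]
  have hD01 : en (nM ν₁) (mP μ₀) = C01 := by rw [en_comm, hC01]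
  have hD10 : en (nM ν₀) (mP μ₁) = C10 := by rw [en_comm, hC10]
  have hD11 : en (nM ν₁) (mP μ₁) = C11 := by rw [en_comm, hC11]
  have half : (1 / 2 : ℝ≥0∞) = ((1 / 2 : ℝ≥0) : ℝ≥0∞) := by
    rw [ENNReal.coe_div two_ne_zero]; simp
  have e1 : en (mP (midP μ₀ μ₁)) (mP (midP μ₀ μ₁)) =
      ((1 / 4 * (A00 + 2 * A01 + A11) : ℝ≥0) : ℝ≥0∞) := by
    rw [mP_midP, half, en_smul_left, en_smul_right, en_add_left, en_add_right, en_add_right,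
      ← hA00, ← hA01, ← hA11, hA10]
    norm_cast
    ring
  have e2 : en (nM (midM ν₀ ν₁)) (nM (midM ν₀ ν₁)) =
      ((1 / 4 * (B00 + 2 * B01 + B11) : ℝ≥0) : ℝ≥0∞) := by
    rw [nM_midM, half, en_smul_left, en_smul_right, en_add_left, en_add_right, en_add_right,
      ← hB00, ← hB01, ← hB11, hB10]
    norm_cast
    ring
  have e3 : en (mP (midP μ₀ μ₁)) (nM (midM ν₀ ν₁)) =
      ((1 / 4 * (C00 + C01 + C10 + C11) : ℝ≥0) : ℝ≥0∞) := by
    rw [mP_midP, nM_midM, half, en_smul_left, en_smul_right, en_add_left, en_add_right,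
      en_add_right, ← hC00, ← hC01, ← hC10, ← hC11]
    norm_cast
    ring
  have e4 : potInt a (mP (midP μ₀ μ₁)) = ((1 / 2 * (W0 + W1) : ℝ≥0) : ℝ≥0∞) := by
    rw [mP_midP, potInt, lintegral_smul_measure, lintegral_add_measure, ← potInt, ← potInt,
      ← hW0, ← hW1, half]
    norm_cast
  have d1 := J_eq ha (midP μ₀ μ₁) hmem (by rw [e1]; exact ENNReal.coe_ne_top)
    (by rw [e2]; exact ENNReal.coe_ne_top) (by rw [e4]; exact ENNReal.coe_ne_top)
  rw [d1, EReal.coe_le_coe_iff, Jreal, e1, e2, e3, e4] at hJ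
  rw [← hA00, ← hB00, ← hC00, ← hW0] at hp
  rw [← hA11, ← hB11, ← hC11, ← hW1] at hq
  simp only [ENNReal.coe_toReal, NNReal.coe_mul, NNReal.coe_add, NNReal.coe_div, NNReal.coe_one,
    NNReal.coe_ofNat] at hJ hp hq
  -- The difference `m₁ - m₂` is (μ₀ - μ₁) - (ν₀ - ν₁)/2. Exchanging the two ν's keeps both measures
  -- positive and of equal mass, so positivity of the energy applies to a signed charge without
  -- leaving measures.
  set m₁ := mP μ₀ + (1 / 2 : ℝ≥0∞) • nM ν₁
  set m₂ := mP μ₁ + (1 / 2 : ℝ≥0∞) • nM ν₀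
  have f1 : en m₁ m₁ = ((A00 + C01 + 1 / 4 * B11 : ℝ≥0) : ℝ≥0∞) := by
    simp only [m₁]
    rw [half, en_add_left, en_add_right, en_add_right, en_smul_left, en_smul_left, en_smul_right,
      en_smul_right, ← hA00, ← hC01, ← hB11, hD01]
    norm_cast
    ring
  have f2 : en m₂ m₂ = ((A11 + C10 + 1 / 4 * B00 : ℝ≥0) : ℝ≥0∞) := by
    simp only [m₂]
    rw [half, en_add_left, en_add_right, en_add_right, en_smul_left, en_smul_left, en_smul_right,
      en_smul_right, ← hA11, ← hC10, ← hB00, hD10]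
    norm_cast
    ring
  have f3 : en m₁ m₂ = ((A01 + 1 / 2 * C00 + 1 / 2 * C11 + 1 / 4 * B01 : ℝ≥0) : ℝ≥0∞) := by
    simp only [m₁, m₂]
    rw [half, en_add_left, en_add_right, en_add_right, en_smul_left, en_smul_left, en_smul_right,
      en_smul_right, ← hA01, ← hC00, hD11, hB10]
    norm_cast
    ring
  have hfin : ∀ ν : FiniteMeasure RMinus, IsFiniteMeasure ((1 / 2 : ℝ≥0∞) • nM ν) := fun ν =>
    Measure.smul_finite _ (by simp)
  have := hfin ν₀
  have := hfin ν₁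
  have hmass : m₁ univ = m₂ univ := by
    simp only [m₁, m₂, Measure.add_apply, Measure.smul_apply, hmu, hnu]
  have g1 := two_mul_en_le m₁ m₂ hmass
  rw [f1, f2, f3] at g1
  have g2 := two_mul_en_le (nM ν₀) (nM ν₁) hnu
  rw [← hB00, ← hB01, ← hB11] at g2
  -- Minimality at the midpoint says that the defect for `m₁`, `m₂` plus 3/4 of that for ν₀, ν₁ is
  -- at most 0. Both defects are nonnegative, hence both vanish.
  have g1' : 2 * (A01 + 1 / 2 * C00 + 1 / 2 * C11 + 1 / 4 * B01) ≤
      A00 + C01 + 1 / 4 * B11 + (A11 + C10 + 1 / 4 * B00) := by exact_mod_cast g1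
  have g2' : 2 * B01 ≤ B00 + B11 := by exact_mod_cast g2
  have g1'' : 2 * ((A01 : ℝ) + 1 / 2 * C00 + 1 / 2 * C11 + 1 / 4 * B01) ≤
      A00 + C01 + 1 / 4 * B11 + (A11 + C10 + 1 / 4 * B00) := by exact_mod_cast g1'
  have g2'' : 2 * (B01 : ℝ) ≤ B00 + B11 := by exact_mod_cast g2'
  have hm : m₁ = m₂ := by
    refine eq_of_two_mul_en_eq hmass (by rw [f1]; exact ENNReal.coe_ne_top)
      (by rw [f2]; exact ENNReal.coe_ne_top) ?_
    rw [f1, f2, f3]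
    have : A00 + C01 + 1 / 4 * B11 + (A11 + C10 + 1 / 4 * B00) ≤
        2 * (A01 + 1 / 2 * C00 + 1 / 2 * C11 + 1 / 4 * B01) := by
      rw [← NNReal.coe_le_coe]
      push_cast
      linarith
    exact_mod_cast this
  have hn : nM ν₀ = nM ν₁ := by
    refine eq_of_two_mul_en_eq hnu b0 b1 ?_
    rw [← hB00, ← hB01, ← hB11]
    have : B00 + B11 ≤ 2 * B01 := by
      rw [← NNReal.coe_le_coe]
      push_cast
      linarith
    exact_mod_cast this
  have hmm : mP μ₀ = mP μ₁ := by
    simp only [m₁, m₂, hn] at hm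
    exact (Measure.add_left_inj _ _ _).mp hm
  have i1 : μ₀ = μ₁ := by
    apply Subtype.ext
    have he : MeasurableEmbedding (Subtype.val : RPlus → ℝ) :=
      MeasurableEmbedding.subtype_coe measurableSet_Ici
    have := congrArg (Measure.comap (Subtype.val : RPlus → ℝ)) hmm
    rwa [mP, mP, he.comap_map, he.comap_map] at this
  have i2 : ν₀ = ν₁ := by
    apply Subtype.ext
    have he : MeasurableEmbedding (Subtype.val : RMinus → ℝ) :=
      MeasurableEmbedding.subtype_coe measurableSet_Iic
    have := congrArg (Measure.comap (Subtype.val : RMinus → ℝ)) hn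
    rwa [nM, nM, he.comap_map, he.comap_map] at this
  subst i1 i2
  rfl

/-! ### The density of the gas in terms of the circle energy -/

/-- Half the logarithm of `1 + x²`. -/
def hlog (x : ℝ) : ℝ := 1 / 2 * Real.log (1 + x ^ 2)

theorem hlog_nonneg (x : ℝ) : 0 ≤ hlog x := by
  have : 0 ≤ Real.log (1 + x ^ 2) := Real.log_nonneg (by nlinarith [sq_nonneg x])
  unfold hlog; linarith

theorem exp_two_hlog (x : ℝ) : Real.exp (2 * hlog x) = 1 + x ^ 2 := by
  rw [hlog, ← mul_assoc, mul_one_div_cancel two_ne_zero, one_mul, Real.exp_log (by positivity)]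

theorem lk_self (x : ℝ) : lk x x = 0 := by rw [lk, chord_self, Real.log_zero, neg_zero]

theorem abs_sub_eq_exp {x y : ℝ} (h : x ≠ y) : |x - y| = Real.exp (hlog x + hlog y - lk x y) := by
  rw [lk_eq h, hlog, hlog, sub_sub_cancel, Real.exp_log (abs_pos.mpr (sub_ne_zero.mpr h))]

/-- Each ordered pair contributes `hlog` at both ends, so every point is counted 2(k-1) times; the
diagonal terms are harmless because `lk_self` is 0. -/
theorem vandermonde_det_sq {k : ℕ} {v : Fin k → ℝ} (hv : Function.Injective v) :
    (Matrix.vandermonde v).det ^ 2 =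
      Real.exp (2 * ((k : ℝ) - 1) * ∑ i, hlog (v i) - ∑ i, ∑ j, lk (v i) (v j)) := by
  have h1 : (Matrix.vandermonde v).det ^ 2 = ∏ i, ∏ j ∈ ({i} : Finset (Fin k))ᶜ, |v j - v i| := by
    rw [Matrix.det_vandermonde, ← Finset.prod_prod_Ioi_mul_eq_prod_prod_off_diag
      (fun j i => |v j - v i|), ← Finset.prod_pow]
    refine Finset.prod_congr rfl fun i _ => ?_
    rw [← Finset.prod_pow]
    refine Finset.prod_congr rfl fun j _ => ?_
    rw [abs_sub_comm (v i) (v j), ← sq, sq_abs]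
  have h2 : ∀ i, ∏ j ∈ ({i} : Finset (Fin k))ᶜ, |v j - v i| =
      Real.exp (∑ j ∈ ({i} : Finset (Fin k))ᶜ, (hlog (v j) + hlog (v i) - lk (v j) (v i))) := by
    intro i
    rw [Real.exp_sum]
    refine Finset.prod_congr rfl fun j hj => abs_sub_eq_exp fun h => ?_
    simp only [Finset.mem_compl, Finset.mem_singleton] at hj
    exact hj (hv h)
  have h3 : ∀ i, ∑ j ∈ ({i} : Finset (Fin k))ᶜ, (hlog (v j) + hlog (v i) - lk (v j) (v i)) =
      ∑ j, hlog (v j) + ((k : ℝ) - 2) * hlog (v i) - ∑ j, lk (v i) (v j) := by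
    intro i
    have h4 := Finset.sum_compl_add_sum ({i} : Finset (Fin k))
      (fun j => hlog (v j) + hlog (v i) - lk (v j) (v i))
    have h5 : ∑ j, (hlog (v j) + hlog (v i) - lk (v j) (v i)) =
        ∑ j, hlog (v j) + (k : ℝ) * hlog (v i) - ∑ j, lk (v j) (v i) := by
      rw [Finset.sum_sub_distrib, Finset.sum_add_distrib, Finset.sum_const, Finset.card_univ,
        Fintype.card_fin, nsmul_eq_mul]
    rw [Finset.sum_singleton, lk_self, h5] at h4
    simp_rw [lk_comm (v i)]
    linarith
  rw [h1]
  simp_rw [h2, h3]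
  rw [← Real.exp_sum]
  congr 1
  rw [Finset.sum_sub_distrib, Finset.sum_add_distrib, Finset.sum_const, Finset.card_univ,
    Fintype.card_fin, nsmul_eq_mul, ← Finset.mul_sum]
  ring

/-- The interaction energy of a configuration. -/
def interact {k l : ℕ} (x : Fin k → ℝ) (u : Fin l → ℝ) : ℝ :=
  ∑ i, ∑ j, lk (x i) (x j) + ∑ i, ∑ j, lk (u i) (u j) - ∑ i, ∑ j, lk (x i) (u j)

theorem prod_sub_eq {k l : ℕ} {x : Fin k → ℝ} {u : Fin l → ℝ} (hx : ∀ i, 0 < x i)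
    (hu : ∀ j, u j < 0) : ∏ i, ∏ j, (x i - u j) =
      Real.exp ((l : ℝ) * ∑ i, hlog (x i) + (k : ℝ) * ∑ j, hlog (u j) -
        ∑ i, ∑ j, lk (x i) (u j)) := by
  have h1 : ∀ i j, x i - u j = Real.exp (hlog (x i) + hlog (u j) - lk (x i) (u j)) := fun i j => by
    have h := abs_sub_eq_exp (x := x i) (y := u j) (by linarith [hx i, hu j])
    rwa [abs_of_pos (by linarith [hx i, hu j])] at h
  simp_rw [h1, ← Real.exp_sum]
  congr 1
  simp only [Finset.sum_sub_distrib, Finset.sum_add_distrib, Finset.sum_const, Finset.card_univ,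
    Fintype.card_fin, nsmul_eq_mul, Finset.mul_sum]

theorem exp_potential {α a : ℝ} (hα : 0 ≤ α) (ha : 0 < a) {N : ℕ} (hN : 1 ≤ N) {x : ℝ}
    (hx : 0 < x) : Real.exp (-(N * potential α a N x)) = weight α a N x := by
  have hN' : (0:ℝ) < N := by exact_mod_cast hN
  have : -(N * potential α a N x) = Real.log (weight α a N x) := by
    unfold potential; field_simp
  rw [this, Real.exp_log (weight_pos hα ha hN hx)]

/-- The points of a configuration, as real numbers. -/
abbrev xs {n : ℕ} (ω : Config n) : Fin (2 * n) → ℝ := fun i => ω.1 i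

/-- The points of a configuration, as real numbers. -/
abbrev us {n : ℕ} (ω : Config n) : Fin n → ℝ := fun i => ω.2 i

/-- The powers of `hlog` add up to 2(2n-1) - n = 3n-2 at each x and to 2(n-1) - 2n = -2 at each u.
The former gives the coefficient 3/4 of log(1+x²) in the limiting potential, the latter makes
|u|/(1+u²) the one-point factor on the negative side. -/
theorem gasDensity_eq {α a : ℝ} (hα : 0 ≤ α) (ha : 0 < a) {n : ℕ} (hn : 1 ≤ n) {ω : Config n}
    (hx : ∀ i, 0 < xs ω i) (hu : ∀ j, us ω j < 0) (hxi : Function.Injective (xs ω))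
    (hui : Function.Injective (us ω)) :
    gasDensity α a n ω = ENNReal.ofReal (Real.exp (-interact (xs ω) (us ω)) *
      (∏ i, weight α a (2 * n) (xs ω i) * Real.exp ((3 * n - 2) * hlog (xs ω i))) *
      ∏ j, |us ω j| / (1 + us ω j ^ 2)) := by
  have h1 : ∏ i, Real.exp (-((2 * n : ℕ) * potential α a (2 * n) (ω.1 i))) =
      ∏ i, weight α a (2 * n) (xs ω i) :=
    Finset.prod_congr rfl fun i _ => exp_potential hα ha (by omega) (hx i)
  have h2 : ∏ j, |us ω j| / (1 + us ω j ^ 2) =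
      (∏ j, |us ω j|) * Real.exp (-(2 * ∑ j, hlog (us ω j))) := by
    rw [Finset.mul_sum, ← Finset.sum_neg_distrib, Real.exp_sum, ← Finset.prod_mul_distrib]
    refine Finset.prod_congr rfl fun j _ => ?_
    rw [Real.exp_neg, exp_two_hlog, div_eq_mul_inv]
  have h3 := vandermonde_det_sq hxi
  have h4 := vandermonde_det_sq hui
  have h5 := prod_sub_eq hx hu
  rw [gasDensity, h1, h3, h4, h5, h2, Finset.prod_mul_distrib, ← Real.exp_sum, ← Finset.mul_sum,
    ← Real.exp_add, ← Real.exp_sub]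
  congr 1
  rw [show ∀ E1 E2 E3 W U : ℝ, Real.exp E1 * (W * Real.exp E2) * (U * Real.exp E3) =
    Real.exp (E1 + E2 + E3) * W * U from fun E1 E2 E3 W U => by
      rw [Real.exp_add, Real.exp_add]; ring]
  congr 3
  unfold interact
  push_cast
  ring

theorem gasDensity_eq_zero {α a : ℝ} {n : ℕ} {ω : Config n}
    (h : ¬ (Function.Injective (xs ω) ∧ Function.Injective (us ω))) :
    gasDensity α a n ω = 0 := by
  rw [not_and_or] at h
  unfold gasDensity
  rcases h with h | h
  · rw [← Matrix.det_vandermonde_ne_zero_iff, not_not] at h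
    rw [show (fun i => (ω.1 i : ℝ)) = xs ω from rfl, h]
    simp
  · rw [← Matrix.det_vandermonde_ne_zero_iff, not_not] at h
    rw [show (fun j => (ω.2 j : ℝ)) = us ω from rfl, h]
    simp

/-- `N²` times the energy of a configuration, for `N = 2n`. -/
def hamil (a : ℝ) {n : ℕ} (ω : Config n) : ℝ :=
  interact (xs ω) (us ω) + (2 * n - 1) * ∑ i, (pot a (xs ω i) - potConst a)

theorem measurable_hamil (a : ℝ) (n : ℕ) : Measurable (hamil a : Config n → ℝ) := by
  have h1 : ∀ i, Measurable fun ω : Config n => xs ω i := fun i =>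
    measurable_subtype_coe.comp ((measurable_pi_apply i).comp measurable_fst)
  have h2 : ∀ i, Measurable fun ω : Config n => us ω i := fun i =>
    measurable_subtype_coe.comp ((measurable_pi_apply i).comp measurable_snd)
  have h3 : ∀ {f g : Config n → ℝ}, Measurable f → Measurable g →
      Measurable fun ω => lk (f ω) (g ω) := fun hf hg => measurable_lk.comp (hf.prodMk hg)
  have h4 : ∀ i, Measurable fun ω : Config n => pot a (xs ω i) := fun i =>
    (continuous_pot a).measurable.comp (h1 i)
  unfold hamil interact
  refine Measurable.add (Measurable.sub (Measurable.add ?_ ?_) ?_) (measurable_const.mul ?_)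
  · exact Finset.measurable_sum _ fun i _ => Finset.measurable_sum _ fun j _ => h3 (h1 i) (h1 j)
  · exact Finset.measurable_sum _ fun i _ => Finset.measurable_sum _ fun j _ => h3 (h2 i) (h2 j)
  · exact Finset.measurable_sum _ fun i _ => Finset.measurable_sum _ fun j _ => h3 (h1 i) (h2 j)
  · exact Finset.measurable_sum _ fun i _ => (h4 i).sub_const _

/-- The integrable factor of the density carried by each point of `ℝ_+`. -/
def fac (α x : ℝ) : ℝ := x ^ α * Real.exp (-(x / 2))

theorem gasDensity_le {α a : ℝ} (hα : 0 ≤ α) (ha : 0 < a) : ∃ C : ℝ, 0 < C ∧ ∀ n : ℕ, 1 ≤ n →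
    ∀ ω : Config n, (∀ i, 0 < xs ω i) → (∀ j, us ω j < 0) →
    gasDensity α a n ω ≤ ENNReal.ofReal (Real.exp (-hamil a ω) *
      ((C * ((2 * n : ℕ) : ℝ) ^ α) ^ (2 * n)) *
      ((∏ i, fac α (xs ω i)) * ∏ j, |us ω j| / (1 + us ω j ^ 2))) := by
  obtain ⟨C, hC, hw⟩ := weight_le hα ha
  refine ⟨C * Real.exp (potConst a), by positivity, fun n hn ω hx hu => ?_⟩
  by_cases hinj : Function.Injective (xs ω) ∧ Function.Injective (us ω)
  swap
  · rw [gasDensity_eq_zero hinj]; exact bot_le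
  rw [gasDensity_eq hα ha hn hx hu hinj.1 hinj.2]
  apply ENNReal.ofReal_le_ofReal
  have h1 : ∀ i, weight α a (2 * n) (xs ω i) * Real.exp ((3 * n - 2) * hlog (xs ω i)) ≤
      Real.exp (-((2 * n - 1) * (pot a (xs ω i) - potConst a))) *
      (C * Real.exp (potConst a) * ((2 * n : ℕ) : ℝ) ^ α) * fac α (xs ω i) := by
    intro i
    set x := xs ω i
    have hx' : 0 < x := hx i
    have h2 := hw (2 * n) (by omega) x hx'
    have h3 := le_pot ha x
    rw [abs_of_pos hx'] at h3
    have h4 : pot a x = x - 2 * √(a * x) - 3 / 2 * hlog x + potConst a := by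
      rw [pot, abs_of_pos hx', hlog]; ring
    have h5 := absorb_nonneg x
    have h6 := hlog_nonneg x
    calc _ ≤ C * ((2 * n : ℕ) : ℝ) ^ α * x ^ α * Real.exp (-((2 * n : ℕ) * (x - 2 * √(a * x)))) *
          Real.exp ((3 * n - 2) * hlog x) := by gcongr
      -- Only 2n-1 of the 2n copies of the potential go into `hamil`; the last one, together with -2
      -- `hlog`, becomes the integrable factor exp(-x/2).
      _ = C * ((2 * n : ℕ) : ℝ) ^ α * x ^ α * Real.exp (-((2 * n - 1) * (pot a x - potConst a)) +
          (potConst a - pot a x - 2 * hlog x)) := by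
          rw [mul_assoc _ (Real.exp _), ← Real.exp_add, h4]
          congr 2
          push_cast
          ring
      _ ≤ C * ((2 * n : ℕ) : ℝ) ^ α * x ^ α * Real.exp (-((2 * n - 1) * (pot a x - potConst a)) +
          (potConst a + -(x / 2))) := by
          gcongr
          linarith
      _ = _ := by
          rw [fac, Real.exp_add, Real.exp_add]; ring
  have hwp : ∀ i, 0 ≤ weight α a (2 * n) (xs ω i) * Real.exp ((3 * n - 2) * hlog (xs ω i)) :=
    fun i => mul_nonneg (weight_pos hα ha (by omega) (hx i)).le (Real.exp_pos _).le
  have h7 := Finset.prod_le_prod (fun i (_ : i ∈ Finset.univ) => hwp i) fun i _ => h1 i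
  have h8 : ∏ i, (Real.exp (-((2 * n - 1) * (pot a (xs ω i) - potConst a))) *
      (C * Real.exp (potConst a) * ((2 * n : ℕ) : ℝ) ^ α) * fac α (xs ω i)) =
      Real.exp (-((2 * n - 1) * ∑ i, (pot a (xs ω i) - potConst a))) *
        (C * Real.exp (potConst a) * ((2 * n : ℕ) : ℝ) ^ α) ^ (2 * n) *
        ∏ i, fac α (xs ω i) := by
    rw [Finset.prod_mul_distrib, Finset.prod_mul_distrib, Finset.prod_const, Finset.card_univ,
      Fintype.card_fin, ← Real.exp_sum, Finset.sum_neg_distrib, ← Finset.mul_sum]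
  rw [h8] at h7
  have hU : 0 ≤ ∏ j, |us ω j| / (1 + us ω j ^ 2) := Finset.prod_nonneg fun j _ => by positivity
  calc _ ≤ Real.exp (-interact (xs ω) (us ω)) *
        (Real.exp (-((2 * n - 1) * ∑ i, (pot a (xs ω i) - potConst a))) *
        (C * Real.exp (potConst a) * ((2 * n : ℕ) : ℝ) ^ α) ^ (2 * n) *
        ∏ i, fac α (xs ω i)) * ∏ j, |us ω j| / (1 + us ω j ^ 2) := by gcongr
    _ = _ := by
        rw [hamil, neg_add, Real.exp_add]; ring

/-! ### Empirical measures -/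

/-- A multiple of a finite sum of Dirac masses. -/
def emp {k : ℕ} (c : ℝ≥0∞) (y : Fin k → ℝ) : Measure ℝ := c • ∑ i, Measure.dirac (y i)

theorem lintegral_emp {k : ℕ} (c : ℝ≥0∞) (y : Fin k → ℝ) (f : ℝ → ℝ≥0∞) :
    ∫⁻ x, f x ∂emp c y = c * ∑ i, f (y i) := by
  rw [emp, lintegral_smul_measure, lintegral_finsetSum_measure]
  simp

theorem integrable_emp {k : ℕ} {c : ℝ≥0∞} (hc : c ≠ ⊤) (y : Fin k → ℝ) (f : ℝ → ℝ) :
    Integrable f (emp c y) :=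
  (integrable_finsetSum_measure.mpr fun i _ => integrable_dirac (by simp)).smul_measure hc

theorem integral_emp {k : ℕ} (c : ℝ≥0∞) (y : Fin k → ℝ) (f : ℝ → ℝ) :
    ∫ x, f x ∂emp c y = c.toReal * ∑ i, f (y i) := by
  rw [emp, integral_smul_measure, integral_finsetSum_measure fun i _ => integrable_dirac (by simp)]
  simp

instance {k : ℕ} (c : ℝ≥0) (y : Fin k → ℝ) : IsFiniteMeasure (emp (c : ℝ≥0∞) y) := by
  unfold emp
  exact Measure.smul_finite _ ENNReal.coe_ne_top

theorem enT_emp {k l : ℕ} {L : ℝ} (hL : 0 ≤ L) (c d : ℝ≥0) (y : Fin k → ℝ) (z : Fin l → ℝ) :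
    enT L (emp c y) (emp d z) = c * d * ∑ i, ∑ j, kT L (y i) (z j) := by
  rw [enT, integral_prod _ (integrable_kT hL _)]
  simp_rw [integral_emp]
  simp only [ENNReal.coe_toReal, ← Finset.mul_sum]
  ring

theorem en_emp {k l : ℕ} (c d : ℝ≥0) (y : Fin k → ℝ) (z : Fin l → ℝ) :
    en (emp c y) (emp d z) = c * d * ∑ i, ∑ j, kern (y i) (z j) := by
  rw [en, lintegral_prod _ measurable_kern.aemeasurable]
  simp_rw [lintegral_emp]
  simp only [← Finset.mul_sum]
  ring

theorem mP_eq_emp {n : ℕ} {ω : Config n} {μ : ProbabilityMeasure RPlus}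
    (h : μ.toFiniteMeasure = muN ω) :
    mP μ = emp ((((2 * n : ℕ) : ℝ≥0)⁻¹ : ℝ≥0) : ℝ≥0∞) (xs ω) := by
  have h1 : (μ : Measure RPlus) = ((((2 * n : ℕ) : ℝ≥0)⁻¹ : ℝ≥0) : ℝ≥0∞) •
      ∑ i, Measure.dirac (ω.1 i) := by
    have h2 := congrArg FiniteMeasure.toMeasure h
    rw [muN, FiniteMeasure.toMeasure_smul, FiniteMeasure.toMeasure_sum] at h2
    exact h2
  rw [mP, h1, Measure.map_smul, emp, Measure.map_finset_sum' measurable_subtype_coe.aemeasurable]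
  simp only [Measure.map_dirac' measurable_subtype_coe]

theorem nM_eq_emp {n : ℕ} {ω : Config n} {ν : FiniteMeasure RMinus} (h : ν = nuN ω) :
    nM ν = emp ((((2 * n : ℕ) : ℝ≥0)⁻¹ : ℝ≥0) : ℝ≥0∞) (us ω) := by
  have h1 : (ν : Measure RMinus) = ((((2 * n : ℕ) : ℝ≥0)⁻¹ : ℝ≥0) : ℝ≥0∞) •
      ∑ i, Measure.dirac (ω.2 i) := by
    have h2 := congrArg FiniteMeasure.toMeasure h
    rw [nuN, FiniteMeasure.toMeasure_smul, FiniteMeasure.toMeasure_sum] at h2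
    exact h2
  rw [nM, h1, Measure.map_smul, emp, Measure.map_finset_sum' measurable_subtype_coe.aemeasurable]
  simp only [Measure.map_dirac' measurable_subtype_coe]

/-- Truncation gives the diagonal the value L instead of infinity; after division by N² this
self-interaction is O(L/N). -/
theorem sum_kT_le {k : ℕ} {L : ℝ} {y : Fin k → ℝ} (hy : Function.Injective y) :
    ∑ i, ∑ j, kT L (y i) (y j) ≤ k * L + ∑ i, ∑ j, lk (y i) (y j) := by
  have h1 : ∀ i, ∑ j, kT L (y i) (y j) ≤ L + ∑ j, lk (y i) (y j) := fun i => by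
    have h2 : ∑ j, (if i = j then L else 0) = L := by simp
    rw [← h2, ← Finset.sum_add_distrib]
    refine Finset.sum_le_sum fun j _ => ?_
    split_ifs with hij
    · rw [hij, kT_self, lk_self, add_zero]; simp
    · rw [kT_eq_min (hy.ne hij), zero_add]; exact min_le_left _ _
  refine (Finset.sum_le_sum fun i _ => h1 i).trans (le_of_eq ?_)
  rw [Finset.sum_add_distrib, Finset.sum_const, Finset.card_univ, Fintype.card_fin, nsmul_eq_mul]

/-- The truncated rate function at the empirical measures is controlled by the energy. -/
theorem phi_le_hamil {α a : ℝ} (hα : 0 ≤ α) (ha : 0 < a) {n : ℕ} (hn : 1 ≤ n) {ω : Config n}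
    (hu : ∀ j, us ω j < 0) (hx : ∀ i, 0 < xs ω i)
    (hxi : Function.Injective (xs ω)) (hui : Function.Injective (us ω))
    {p : ProbabilityMeasure RPlus × E α a} (hp1 : p.1.toFiniteMeasure = muN ω)
    (hp2 : (p.2 : FiniteMeasure RMinus) = nuN ω) {L : ℝ} (hL : 4 ≤ L) (hLn : L ≤ 2 * n) :
    phi a L (mP p.1) (nM p.2) ≤ hamil a ω / (2 * n) ^ 2 + tau a L + 3 / 2 * L / (2 * n) := by
  have hL0 : 0 ≤ L := by linarith
  have hn' : (0:ℝ) < n := by exact_mod_cast hn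
  have hm := mP_eq_emp hp1
  have hν := nM_eq_emp hp2
  set c : ℝ≥0 := ((2 * n : ℕ) : ℝ≥0)⁻¹ with hc
  have hcr : (c : ℝ) = 1 / (2 * n) := by rw [hc]; push_cast; rw [one_div]
  have hj : Integrable (fun x => max (absorb x - L / 2) 0) (mP p.1) := by
    rw [hm]; exact integrable_emp ENNReal.coe_ne_top _ _
  have h3 := en_le_ofReal hα ha p.1 p.2.2 hL0 hj
  have h0 : 0 ≤ ∫ x, max (absorb x - L / 2) 0 ∂mP p.1 := integral_nonneg fun x => le_max_right _ _
  have ht := tau_nonneg a L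
  have hz := enT_nonneg hL0 (mP p.1) (nM p.2)
  have hen : en (mP p.1) (nM p.2) =
      ENNReal.ofReal (c * c * ∑ i, ∑ j, lk (xs ω i) (us ω j)) := by
    have hk : ∀ i j, kern (xs ω i) (us ω j) = ENNReal.ofReal (lk (xs ω i) (us ω j)) :=
      fun i j => kern_of_ne (by linarith [hx i, hu j])
    rw [hm, hν, en_emp, ENNReal.ofReal_mul (by positivity), ENNReal.ofReal_mul (by positivity),
      ENNReal.ofReal_coe_nnreal,
      ENNReal.ofReal_sum_of_nonneg fun i _ => Finset.sum_nonneg fun j _ => lk_nonneg _ _]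
    congr 1
    refine Finset.sum_congr rfl fun i _ => ?_
    rw [ENNReal.ofReal_sum_of_nonneg fun j _ => lk_nonneg _ _]
    exact Finset.sum_congr rfl fun j _ => hk i j
  rw [hen, ENNReal.ofReal_le_ofReal_iff (by positivity)] at h3
  have e1 : enT L (mP p.1) (mP p.1) = c * c * ∑ i, ∑ j, kT L (xs ω i) (xs ω j) := by
    rw [hm, enT_emp hL0]
  have e2 : enT L (nM p.2) (nM p.2) = c * c * ∑ i, ∑ j, kT L (us ω i) (us ω j) := by
    rw [hν, enT_emp hL0]
  have e3 : ∫ x, psi a L x ∂mP p.1 = c * ∑ i, psi a L (xs ω i) := by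
    rw [hm, integral_emp, ENNReal.coe_toReal]
  have e4 : ∫ x, max (absorb x - L / 2) 0 ∂mP p.1 =
      c * ∑ i, max (absorb (xs ω i) - L / 2) 0 := by
    rw [hm, integral_emp, ENNReal.coe_toReal]
  have s1 := sum_kT_le (L := L) hxi
  have s2 := sum_kT_le (L := L) hui
  -- Since L ≤ N, the factor 1 - 1/L of `psi` is at most the factor 1 - 1/N coming from the N-1
  -- copies of the potential in `hamil`.
  have s3 : ∑ i, psi a L (xs ω i) + 1 / 2 * ∑ i, max (absorb (xs ω i) - L / 2) 0 ≤
      (1 - 1 / (2 * n)) * ∑ i, pot a (xs ω i) := by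
    rw [Finset.mul_sum, Finset.mul_sum, ← Finset.sum_add_distrib]
    refine Finset.sum_le_sum fun i _ => (psi_add_le a L _).trans ?_
    have := pot_nonneg ha (xs ω i)
    have : 1 / (2 * (n:ℝ)) ≤ 1 / L := one_div_le_one_div_of_le (by linarith) hLn
    gcongr
  rw [e4] at h3
  rw [phi, e1, e2, e3]
  unfold hamil interact
  rw [Finset.sum_sub_distrib, Finset.sum_const, Finset.card_univ, Fintype.card_fin, nsmul_eq_mul]
  have hCV : 0 ≤ potConst a := by unfold potConst; linarith
  have hcn : (c : ℝ) * (2 * n) = 1 := by rw [hcr]; field_simp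
  have hc0 : (0:ℝ) ≤ c := c.2
  have t1 := mul_le_mul_of_nonneg_left s1 (mul_nonneg hc0 hc0)
  have t2 := mul_le_mul_of_nonneg_left s2 (mul_nonneg hc0 hc0)
  have t3 := mul_le_mul_of_nonneg_left s3 hc0
  have r1 : (c : ℝ) * c * (((2 * n : ℕ) : ℝ) * L) = L / (2 * n) := by
    push_cast; rw [hcr]; field_simp
  have r2 : (c : ℝ) * c * ((n : ℝ) * L) = 1 / 2 * (L / (2 * n)) := by
    rw [hcr]; field_simp
  have r3 : (c : ℝ) * ((1 - 1 / (2 * n)) * ∑ i, pot a (xs ω i)) =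
      c * c * ((2 * n - 1) * ∑ i, pot a (xs ω i)) := by
    rw [hcr]; field_simp
  have r4 : ∀ X : ℝ, X / (2 * n) ^ 2 = c * c * X := fun X => by rw [hcr]; field_simp
  have r5 : (c : ℝ) * c * ((2 * n - 1) * (((2 * n : ℕ) : ℝ) * potConst a)) ≤ potConst a := by
    have : (c : ℝ) * c * ((2 * n - 1) * (((2 * n : ℕ) : ℝ) * potConst a)) =
        potConst a - c * potConst a := by
      push_cast; rw [hcr]; field_simp
    rw [this]
    have := mul_nonneg hc0 hCV
    linarith
  rw [r4]
  rw [mul_add, r1] at t1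
  rw [mul_add, r2] at t2
  rw [r3, mul_add] at t3
  have r6 : 3 / 2 * L / (2 * n) = L / (2 * n) + 1 / 2 * (L / (2 * (n:ℝ))) := by ring
  rw [r6]
  simp only [mul_sub, mul_add] at t3 r5 ⊢
  linarith

/-! ### Reference measures -/

/-- The configurations which the reference measure charges. -/
def Good (α a : ℝ) (n : ℕ) : Set (Config n) :=
  {ω | (∀ i, 0 < xs ω i) ∧ ∀ j, ω.2 j ∈ besselSet α a (2 * n)}

theorem besselSet_neg {α a : ℝ} (ha : 0 < a) {N : ℕ} (hN : 1 ≤ N) {u : RMinus}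
    (hu : u ∈ besselSet α a N) : (u : ℝ) < 0 := by
  have := (sOf_eq_of_besselSet ha hN hu).1
  have hp := Real.pi_pos
  have hs := Real.sqrt_pos.mpr ha
  rw [eq_neg_sOf_sq ha u]
  have : 0 < (Real.pi * sOf a u / (2 * √a)) ^ 2 := by positivity
  linarith

/-- Lebesgue measure on `ℝ_+`. -/
abbrev lebP : Measure RPlus := Measure.comap Subtype.val (volume : Measure ℝ)

instance sigmaFinite_lebP : SigmaFinite lebP := by
  refine SigmaFinite.of_map _ measurable_subtype_coe.aemeasurable ?_
  rw [map_comap_subtype_coe measurableSet_Ici]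
  infer_instance

theorem lebP_singleton (x : RPlus) : lebP {x} = 0 := by
  rw [lebP, (MeasurableEmbedding.subtype_coe measurableSet_Ici).comap_apply]
  simp

theorem ae_good {α a : ℝ} (hα : 0 ≤ α) (ha : 0 < a) {n : ℕ} (hn : 1 ≤ n) :
    ∀ᵐ ω ∂gasBase α a n, ω ∈ Good α a n := by
  have := sigmaFinite_sigmaN hα ha (N := 2 * n) (by omega)
  have h1 : ∀ᵐ x : RPlus ∂lebP, (0:ℝ) < x := by
    rw [ae_iff]
    refine measure_mono_null (fun x hx => ?_) (lebP_singleton zP)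
    exact Subtype.ext (le_antisymm (not_lt.mp hx) x.2)
  have h2 : ∀ᵐ u ∂sigmaN α a (2 * n), u ∈ besselSet α a (2 * n) :=
    sigmaN_compl_besselSet hα ha (by omega)
  have h3 : ∀ i, ∀ᵐ x ∂(Measure.pi fun _ : Fin (2 * n) => lebP), (0:ℝ) < x i := fun i =>
    (Measure.quasiMeasurePreserving_eval (fun _ : Fin (2 * n) => lebP) i).ae h1
  have h4 : ∀ j, ∀ᵐ u ∂(Measure.pi fun _ : Fin n => sigmaN α a (2 * n)),
      u j ∈ besselSet α a (2 * n) := fun j => (Measure.quasiMeasurePreserving_eval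
        (fun _ : Fin n => sigmaN α a (2 * n)) j).ae h2
  exact (Measure.quasiMeasurePreserving_fst.ae (ae_all_iff.mpr h3)).and
    (Measure.quasiMeasurePreserving_snd.ae (ae_all_iff.mpr h4))

/-! ### One-particle factors and upper bounds for the mass -/

theorem lintegral_pi_prod {X : Type*} [MeasurableSpace X] {m : Measure X} [SigmaFinite m]
    {f : X → ℝ} (hf : Integrable f m) (h0 : ∀ x, 0 ≤ f x) (k : ℕ) :
    ∫⁻ x : Fin k → X, ENNReal.ofReal (∏ i, f (x i)) ∂Measure.pi (fun _ => m) =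
      ENNReal.ofReal ((∫ x, f x ∂m) ^ k) := by
  rw [← ofReal_integral_eq_lintegral_ofReal (Integrable.fintype_prod (f := fun _ => f) fun _ => hf)
    (.of_forall fun x => Finset.prod_nonneg fun i _ => h0 _), integral_fintype_prod_eq_pow,
    Fintype.card_fin]

theorem integrable_fac {α : ℝ} (hα : 0 ≤ α) : Integrable (fun x : RPlus => fac α x) lebP := by
  have h1 : IntegrableOn (fac α) (Ici 0) := by
    rw [integrableOn_Ici_iff_integrableOn_Ioi]
    have := integrableOn_rpow_mul_exp_neg_mul_rpow (p := 1) (s := α) (b := 1 / 2) (by linarith)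
      one_pos (by norm_num)
    refine this.congr_fun (fun x _ => ?_) measurableSet_Ioi
    simp only [fac, Real.rpow_one]
    congr 2; ring
  have he : MeasurableEmbedding (Subtype.val : RPlus → ℝ) :=
    MeasurableEmbedding.subtype_coe measurableSet_Ici
  have h2 := MeasurableEmbedding.integrable_map_iff (g := fac α) (μ := lebP) he
  rw [map_comap_subtype_coe measurableSet_Ici] at h2
  exact h2.mp h1

theorem fac_nonneg {α : ℝ} (x : RPlus) : 0 ≤ fac α x := by
  have : (0:ℝ) ≤ x := x.2
  unfold fac; positivity

/-- The factor of the density carried by each point of `ℝ_-`. -/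
def facM (u : ℝ) : ℝ := |u| / (1 + u ^ 2)

theorem facM_nonneg (u : ℝ) : 0 ≤ facM u := by unfold facM; positivity

/-- The factor decays like 1/|u|, that is like t⁻² in the square root coordinate, so its integral
against σ_N is bounded uniformly in N. -/
theorem lintegral_facM_le {α a : ℝ} (hα : 0 ≤ α) (ha : 0 < a) : ∃ K : ℝ, 0 < K ∧ ∀ N : ℕ, 1 ≤ N →
    ∫⁻ u, ENNReal.ofReal (facM (u : ℝ)) ∂sigmaN α a N ≤ ENNReal.ofReal K := by
  set φ : ℝ → ℝ≥0∞ := fun r => if r ≤ 1 then 1 else ENNReal.ofReal (1 / r)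
  have hφ : Antitone φ := by
    intro r s hrs
    simp only [φ]
    split_ifs with h1 h2 h2
    · exact le_rfl
    · linarith
    · rw [← ENNReal.ofReal_one]
      apply ENNReal.ofReal_le_ofReal
      rw [div_le_one (by linarith)]; linarith
    · apply ENNReal.ofReal_le_ofReal
      exact one_div_le_one_div_of_le (by linarith) hrs
  have h1 : ∀ u : RMinus, ENNReal.ofReal (facM (u : ℝ)) ≤ φ (-(u : ℝ)) := fun u => by
    have hu : (u : ℝ) ≤ 0 := u.2
    simp only [φ, facM, abs_of_nonpos hu]
    split_ifs with h
    · rw [← ENNReal.ofReal_one]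
      apply ENNReal.ofReal_le_ofReal
      rw [div_le_one (by positivity)]
      nlinarith [sq_nonneg (u : ℝ)]
    · apply ENNReal.ofReal_le_ofReal
      rw [div_le_div_iff₀ (by positivity) (by linarith)]
      nlinarith
  have hs := Real.sqrt_pos.mpr ha
  have h2 : ∫⁻ t in Ioi (0:ℝ), φ ((t / √a) ^ 2) < ⊤ := by
    rw [← Ioc_union_Ioi_eq_Ioi hs.le]
    refine (lintegral_union_le _ _ _).trans_lt (ENNReal.add_lt_top.mpr ⟨?_, ?_⟩)
    · calc ∫⁻ t in Ioc 0 √a, φ ((t / √a) ^ 2) ≤ ∫⁻ t in Ioc 0 √a, 1 := by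
            refine lintegral_mono fun t => ?_
            simp only [φ]
            split_ifs with h
            · exact le_rfl
            · rw [← ENNReal.ofReal_one]
              apply ENNReal.ofReal_le_ofReal
              rw [div_le_one (by linarith)]; linarith
        _ < ⊤ := by simp
    · have h3 : IntegrableOn (fun t : ℝ => a * t ^ (-2 : ℝ)) (Ioi √a) :=
        (integrableOn_Ioi_rpow_of_lt (by norm_num) hs).const_mul a
      refine lt_of_le_of_lt (setLIntegral_mono' measurableSet_Ioi fun t ht => ?_)
        (Integrable.lintegral_lt_top h3)
      have ht' : √a < t := ht
      have ht0 : 0 < t := hs.trans ht'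
      have h4 : (1:ℝ) < (t / √a) ^ 2 := by
        have : 1 < t / √a := by rw [lt_div_iff₀ hs]; linarith
        nlinarith
      simp only [φ, if_neg (not_le.mpr h4)]
      apply ENNReal.ofReal_le_ofReal
      rw [div_pow, Real.sq_sqrt ha.le, Real.rpow_neg ht0.le, Real.rpow_two, one_div_div,
        div_eq_mul_inv]
  refine ⟨(∫⁻ t in Ioi (0:ℝ), φ ((t / √a) ^ 2)).toReal + 1, by positivity, fun N hN => ?_⟩
  calc _ ≤ ∫⁻ u, φ (-(u : ℝ)) ∂sigmaN α a N := lintegral_mono h1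
    _ ≤ _ := lintegral_sigmaN_le hα ha hN hφ
    _ = ENNReal.ofReal (∫⁻ t in Ioi (0:ℝ), φ ((t / √a) ^ 2)).toReal :=
        (ENNReal.ofReal_toReal h2.ne).symm
    _ ≤ _ := ENNReal.ofReal_le_ofReal (by linarith)

theorem measurable_facM : Measurable fun u : RMinus => facM (u : ℝ) := by
  unfold facM
  fun_prop

/-- The unnormalized law of the gas. -/
def unnorm (α a : ℝ) (n : ℕ) : Measure (Config n) :=
  (gasBase α a n).withDensity (gasDensity α a n)

theorem measurableSet_injective (n : ℕ) : MeasurableSet {ω : Config n |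
    Function.Injective (xs ω) ∧ Function.Injective (us ω)} := by
  have h1 : ∀ i, Measurable fun ω : Config n => xs ω i := fun i =>
    measurable_subtype_coe.comp ((measurable_pi_apply i).comp measurable_fst)
  have h2 : ∀ i, Measurable fun ω : Config n => us ω i := fun i =>
    measurable_subtype_coe.comp ((measurable_pi_apply i).comp measurable_snd)
  have gen : ∀ {k : ℕ} (y : Config n → Fin k → ℝ), (∀ i, Measurable fun ω => y ω i) →
      MeasurableSet {ω | Function.Injective (y ω)} := by
    intro k y hy
    have : {ω | Function.Injective (y ω)} = ⋂ i, ⋂ j, ⋂ _ : i ≠ j, {ω | y ω i = y ω j}ᶜ := by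
      ext ω
      simp only [mem_ofPred_eq, mem_iInter, mem_compl_iff]
      exact ⟨fun h i j hij he => hij (h he), fun h i j he => by_contra fun hij => h i j hij he⟩
    rw [this]
    exact MeasurableSet.iInter fun i => MeasurableSet.iInter fun j => MeasurableSet.iInter fun _ =>
      (measurableSet_eq_fun (hy i) (hy j)).compl
  exact (gen _ h1).inter (gen _ h2)

/-- A lower bound c for the energy on an event costs exp(-c) times the product of the one-particle
integrals. The remaining factor (K N^α)^N is subexponential at speed N². -/
theorem unnorm_le {α a : ℝ} (hα : 0 ≤ α) (ha : 0 < a) : ∃ K : ℝ, 0 < K ∧ ∀ n : ℕ, 1 ≤ n →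
    ∀ (c : ℝ) (A : Set (Config n)), (∀ ω ∈ A, ω ∈ Good α a n → Function.Injective (xs ω) →
      Function.Injective (us ω) → c ≤ hamil a ω) →
    unnorm α a n A ≤
      ENNReal.ofReal (Real.exp (-c) * (K * ((2 * n : ℕ) : ℝ) ^ α) ^ (2 * n)) := by
  obtain ⟨C, hC, hD⟩ := gasDensity_le hα ha
  obtain ⟨K, hK, hq⟩ := lintegral_facM_le hα ha
  set I : ℝ := ∫ x : RPlus, fac α x ∂lebP
  have hI : 0 ≤ I := integral_nonneg fun x => fac_nonneg x
  refine ⟨C * (I + 1) * (K + 1), by positivity, fun n hn c A hA => ?_⟩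
  have := sigmaFinite_sigmaN hα ha (N := 2 * n) (by omega)
  set D : ℝ := Real.exp (-c) * (C * ((2 * n : ℕ) : ℝ) ^ α) ^ (2 * n)
  have hD0 : 0 ≤ D := by positivity
  -- Events need not be measurable, so `A` is enlarged to a measurable set on which the energy bound
  -- still holds or the density vanishes.
  set B : Set (Config n) := {ω | c ≤ hamil a ω} ∪
    {ω : Config n | Function.Injective (xs ω) ∧ Function.Injective (us ω)}ᶜ
  have hB : MeasurableSet B :=
    (measurableSet_le measurable_const (measurable_hamil a n)).union (measurableSet_injective n).compl
  have hsub : A ⊆ B ∪ (Good α a n)ᶜ := by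
    intro ω hω
    by_cases hg : ω ∈ Good α a n
    · by_cases hi : Function.Injective (xs ω) ∧ Function.Injective (us ω)
      · exact .inl (.inl (hA ω hω hg hi.1 hi.2))
      · exact .inl (.inr hi)
    · exact .inr hg
  have hnull : unnorm α a n (Good α a n)ᶜ = 0 :=
    withDensity_absolutelyContinuous _ _ (ae_good hα ha hn)
  set G : Config n → ℝ≥0∞ := fun ω => ENNReal.ofReal (∏ i, fac α (ω.1 i)) *
    ENNReal.ofReal (∏ j, facM (ω.2 j))
  have hbound : ∀ᵐ ω ∂gasBase α a n, ω ∈ B → gasDensity α a n ω ≤ ENNReal.ofReal D * G ω := by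
    filter_upwards [ae_good hα ha hn] with ω hg hωB
    by_cases hi : Function.Injective (xs ω) ∧ Function.Injective (us ω)
    swap
    · rw [gasDensity_eq_zero hi]; exact bot_le
    have hc : c ≤ hamil a ω := by
      rcases hωB with h | h
      · exact h
      · exact absurd hi h
    refine (hD n hn ω hg.1 fun j => besselSet_neg ha (by omega) (hg.2 j)).trans ?_
    have p1 : 0 ≤ ∏ i, fac α (xs ω i) := Finset.prod_nonneg fun i _ => fac_nonneg _
    have p2 : 0 ≤ ∏ j, facM (us ω j) := Finset.prod_nonneg fun i _ => facM_nonneg _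
    have hGe : G ω = ENNReal.ofReal ((∏ i, fac α (xs ω i)) * ∏ j, facM (us ω j)) :=
      (ENNReal.ofReal_mul p1).symm
    rw [hGe, ← ENNReal.ofReal_mul hD0]
    apply ENNReal.ofReal_le_ofReal
    have : 0 ≤ (∏ i, fac α (xs ω i)) * ∏ j, facM (us ω j) := mul_nonneg p1 p2
    calc _ ≤ Real.exp (-c) * (C * ((2 * n : ℕ) : ℝ) ^ α) ^ (2 * n) *
          ((∏ i, fac α (xs ω i)) * ∏ j, facM (us ω j)) := by
          refine mul_le_mul_of_nonneg_right ?_ this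
          gcongr
      _ = _ := rfl
  have hG : ∫⁻ ω, G ω ∂gasBase α a n ≤ ENNReal.ofReal (I ^ (2 * n)) * ENNReal.ofReal (K ^ n) := by
    have hfi := integrable_fac hα
    have hgi : Integrable (fun u : RMinus => facM (u : ℝ)) (sigmaN α a (2 * n)) := by
      refine ⟨measurable_facM.aestronglyMeasurable, ?_⟩
      rw [hasFiniteIntegral_iff_ofReal (.of_forall fun u => facM_nonneg _)]
      exact (hq (2 * n) (by omega)).trans_lt ENNReal.ofReal_lt_top
    have hm1 : AEMeasurable (fun x : Fin (2 * n) → RPlus => ENNReal.ofReal (∏ i, fac α (x i)))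
        (Measure.pi fun _ => lebP) :=
      (Integrable.fintype_prod (f := fun _ x => fac α (x : RPlus))
        fun _ => hfi).aestronglyMeasurable.aemeasurable.ennreal_ofReal
    have hm2 : AEMeasurable (fun x : Fin n → RMinus => ENNReal.ofReal (∏ i, facM (x i)))
        (Measure.pi fun _ => sigmaN α a (2 * n)) :=
      (Integrable.fintype_prod (f := fun _ x => facM (x : RMinus))
        fun _ => hgi).aestronglyMeasurable.aemeasurable.ennreal_ofReal
    rw [gasBase, lintegral_prod_mul hm1 hm2, lintegral_pi_prod hfi fac_nonneg,
      lintegral_pi_prod hgi fun u => facM_nonneg _]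
    refine mul_le_mul' le_rfl (ENNReal.ofReal_le_ofReal ?_)
    refine pow_le_pow_left₀ (integral_nonneg fun u => facM_nonneg _) ?_ n
    rw [← ENNReal.ofReal_le_ofReal_iff hK.le,
      ofReal_integral_eq_lintegral_ofReal hgi (.of_forall fun u => facM_nonneg _)]
    exact hq (2 * n) (by omega)
  calc unnorm α a n A ≤ unnorm α a n B + unnorm α a n (Good α a n)ᶜ :=
        (measure_mono hsub).trans (measure_union_le _ _)
    _ = ∫⁻ ω in B, gasDensity α a n ω ∂gasBase α a n := by
        rw [hnull, add_zero, unnorm, withDensity_apply _ hB]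
    _ ≤ ∫⁻ ω in B, ENNReal.ofReal D * G ω ∂gasBase α a n := setLIntegral_mono_ae' hB hbound
    _ ≤ ∫⁻ ω, ENNReal.ofReal D * G ω ∂gasBase α a n := setLIntegral_le_lintegral _ _
    _ = ENNReal.ofReal D * ∫⁻ ω, G ω ∂gasBase α a n :=
        lintegral_const_mul' _ _ ENNReal.ofReal_ne_top
    _ ≤ ENNReal.ofReal D * (ENNReal.ofReal (I ^ (2 * n)) * ENNReal.ofReal (K ^ n)) := by gcongr
    _ ≤ _ := by
        rw [← ENNReal.ofReal_mul (by positivity), ← ENNReal.ofReal_mul hD0]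
        apply ENNReal.ofReal_le_ofReal
        have k1 : I ^ (2 * n) ≤ (I + 1) ^ (2 * n) := by gcongr; linarith
        have k2 : K ^ n ≤ (K + 1) ^ (2 * n) := calc
          K ^ n ≤ (K + 1) ^ n := by gcongr; linarith
          _ ≤ _ := pow_le_pow_right₀ (by linarith) (by omega)
        calc D * (I ^ (2 * n) * K ^ n) ≤ D * ((I + 1) ^ (2 * n) * (K + 1) ^ (2 * n)) := by gcongr
          _ = _ := by simp only [D]; rw [← mul_pow, mul_assoc, ← mul_pow]; congr 2; ring

/-! ### Upper bounds for the unnormalized law -/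

theorem eventually_log_le (A B : ℝ) {ε : ℝ} (hε : 0 < ε) :
    ∀ᶠ n : ℕ in atTop, A + B * Real.log ((2 * n : ℕ) : ℝ) ≤ ε * ((2 * n : ℕ) : ℝ) := by
  have h1 : Tendsto (fun n : ℕ => ((2 * n : ℕ) : ℝ)) atTop atTop :=
    tendsto_natCast_atTop_atTop.comp (tendsto_id.const_mul_atTop' two_pos)
  have h2 : (fun x : ℝ => A + B * Real.log x) =o[atTop] (id : ℝ → ℝ) :=
    (Asymptotics.isLittleO_const_id_atTop A).add (Real.isLittleO_log_id_atTop.const_mul_left B)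
  filter_upwards [h1.eventually (h2.bound hε), h1.eventually_ge_atTop 0] with n hn h0
  rw [Real.norm_eq_abs, Real.norm_eq_abs, id, abs_of_nonneg h0] at hn
  exact (le_abs_self _).trans hn

/-- The logarithm of the left side is O(N log N). -/
theorem eventually_pow_le {K α ε : ℝ} (hK : 0 < K) (hε : 0 < ε) : ∀ᶠ n : ℕ in atTop,
    (K * ((2 * n : ℕ) : ℝ) ^ α) ^ (2 * n) ≤ Real.exp (ε * ((2 * n : ℕ) : ℝ) ^ 2) := by
  filter_upwards [eventually_log_le (Real.log K) α hε, eventually_ge_atTop 1] with n hn h1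
  have hN : (0:ℝ) < ((2 * n : ℕ) : ℝ) := by exact_mod_cast (by omega : 0 < 2 * n)
  have hp : 0 < K * ((2 * n : ℕ) : ℝ) ^ α := by positivity
  rw [← Real.exp_log hp, ← Real.exp_nat_mul, Real.exp_le_exp, Real.log_mul hK.ne' (by positivity),
    Real.log_rpow hN]
  calc ((2 * n : ℕ) : ℝ) * _ ≤ ((2 * n : ℕ) : ℝ) * (ε * ((2 * n : ℕ) : ℝ)) := by gcongr
    _ = _ := by ring

/-- If the bound failed along a subsequence, the empirical measures would have truncated energies
eventually below `d` up to `tau`, and `exists_limit` would produce a point of the closed set F with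
`J` at most `d`. -/
theorem eventually_le_hamil {α a : ℝ} (hα : 0 ≤ α) (ha : 0 < a)
    {F : Set (ProbabilityMeasure RPlus × E α a)} (hF : IsClosed F) {c d : ℝ} (hcd : c < d)
    (h : ∀ p ∈ F, (d : EReal) < J a p.1 p.2) : ∀ᶠ n : ℕ in atTop, ∀ ω ∈ event n F,
      ω ∈ Good α a n → Function.Injective (xs ω) → Function.Injective (us ω) →
      c * ((2 * n : ℕ) : ℝ) ^ 2 ≤ hamil a ω := by
  by_contra hcon
  rw [not_eventually] at hcon
  obtain ⟨φ, hφ, hφn⟩ := extraction_of_frequently_atTop (hcon.and_eventually (eventually_ge_atTop 1))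
  have hex : ∀ k, ∃ ω : Config (φ k), ω ∈ event (φ k) F ∧ ω ∈ Good α a (φ k) ∧
      Function.Injective (xs ω) ∧ Function.Injective (us ω) ∧
      hamil a ω < c * ((2 * φ k : ℕ) : ℝ) ^ 2 := fun k => by
    have := (hφn k).1
    push Not at this
    obtain ⟨ω, h1, h2, h3, h4, h5⟩ := this
    exact ⟨ω, h1, h2, h3, h4, h5⟩
  choose ω h1 h2 h3 h4 h5 using hex
  choose p hpF hp1 hp2 using h1
  suffices hlim : ∀ L : ℕ, 4 ≤ L → ∀ᶠ k in atTop,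
      phi a L (mP (p k).1) (nM (p k).2) ≤ d + tau a L by
    obtain ⟨q, hqF, hq⟩ := exists_limit hα ha p hlim hF hpF
    exact absurd (h q hqF) (not_lt.mpr hq)
  intro L hL
  have hφt : Tendsto (fun k => (2 * φ k : ℝ)) atTop atTop :=
    (tendsto_natCast_atTop_atTop.comp hφ.tendsto_atTop).const_mul_atTop two_pos
  filter_upwards [hφt.eventually_ge_atTop (L : ℝ),
    hφt.eventually_ge_atTop (3 / 2 * L / (d - c))] with k hk1 hk2
  have hn := (hφn k).2
  have hn' : (0:ℝ) < φ k := by exact_mod_cast hn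
  have hL' : (4:ℝ) ≤ L := by exact_mod_cast hL
  have key := phi_le_hamil hα ha hn (fun j => besselSet_neg ha (by omega) ((h2 k).2 j)) (h2 k).1
    (h3 k) (h4 k) (hp1 k) (hp2 k) hL' hk1
  have e1 : hamil a (ω k) / (2 * φ k) ^ 2 ≤ c := by
    rw [div_le_iff₀ (by positivity)]
    have := h5 k
    push_cast at this
    exact this.le
  have e2 : 3 / 2 * L / (2 * φ k) ≤ d - c := by
    rw [div_le_iff₀ (by linarith)] at hk2 ⊢
    linarith
  linarith

theorem eventually_unnorm_event_le {α a : ℝ} (hα : 0 ≤ α) (ha : 0 < a)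
    {F : Set (ProbabilityMeasure RPlus × E α a)} (hF : IsClosed F) {c d : ℝ} (hcd : c < d)
    (h : ∀ p ∈ F, (d : EReal) < J a p.1 p.2) : ∀ᶠ n : ℕ in atTop,
      unnorm α a n (event n F) ≤ ENNReal.ofReal (Real.exp (-(c * ((2 * n : ℕ) : ℝ) ^ 2))) := by
  obtain ⟨K, hK, hun⟩ := unnorm_le hα ha
  filter_upwards [eventually_le_hamil hα ha hF (show (c + d) / 2 < d by linarith) h,
    eventually_pow_le (α := α) hK (show 0 < (d - c) / 2 by linarith),
    eventually_ge_atTop 1] with n h1 h2 h3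
  refine (hun n h3 _ _ h1).trans (ENNReal.ofReal_le_ofReal ?_)
  calc _ ≤ Real.exp (-((c + d) / 2 * ((2 * n : ℕ) : ℝ) ^ 2)) *
        Real.exp ((d - c) / 2 * ((2 * n : ℕ) : ℝ) ^ 2) := by gcongr
    _ = _ := by rw [← Real.exp_add]; congr 1; ring

/-- For fixed N the points u stay away from 0, so the mutual term is at most n `absorb` + const for
each x, which (2n-1) copies of the potential dominate. This gives the finiteness of the partition
function. -/
theorem exists_le_hamil {α a : ℝ} (hα : 0 ≤ α) (ha : 0 < a) {n : ℕ} (hn : 1 ≤ n) :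
    ∃ c : ℝ, ∀ ω ∈ Good α a n, c ≤ hamil a ω := by
  set B : ℝ := max (-Real.log ((1 / (√a * ((2 * n : ℕ) : ℝ))) ^ 2)) 0
  have hn' : (1:ℝ) ≤ n := by exact_mod_cast hn
  refine ⟨-((2 * n) * (n * B)) - (2 * n - 1) * (2 * n * potConst a), fun ω hω => ?_⟩
  have h1 : ∀ i j, lk (xs ω i) (us ω j) ≤ absorb (xs ω i) + B := fun i j => by
    have hneg := besselSet_neg ha (by omega) (hω.2 j)
    refine (lk_le (hω.1 i).le hneg).trans ?_
    refine add_le_add le_rfl (max_le_max (neg_le_neg (Real.log_le_log ?_ ?_)) le_rfl)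
    · have hs := Real.sqrt_pos.mpr ha
      have hN : (0:ℝ) < ((2 * n : ℕ) : ℝ) := by exact_mod_cast (by omega : 0 < 2 * n)
      positivity
    obtain ⟨hk, hk2⟩ := besselIndex_pos hα ha (by omega) (hω.2 j)
    have hs := Real.sqrt_pos.mpr ha
    have hN : (0:ℝ) < ((2 * n : ℕ) : ℝ) := by exact_mod_cast (by omega : 0 < 2 * n)
    refine le_trans ?_ hk2
    gcongr
    exact_mod_cast hk
  have h2 : ∑ i, ∑ j, lk (xs ω i) (us ω j) ≤ ∑ i, (n * absorb (xs ω i) + n * B) := by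
    refine Finset.sum_le_sum fun i _ => (Finset.sum_le_sum fun j _ => h1 i j).trans (le_of_eq ?_)
    rw [Finset.sum_const, Finset.card_univ, Fintype.card_fin, nsmul_eq_mul, mul_add]
  have h3 : ∑ i, (n * absorb (xs ω i)) ≤ (2 * n - 1) * ∑ i, pot a (xs ω i) := by
    rw [Finset.mul_sum]
    refine Finset.sum_le_sum fun i _ => ?_
    have p1 := le_pot ha (xs ω i)
    have p2 := absorb_nonneg (xs ω i)
    have p3 := abs_nonneg (xs ω i)
    calc n * absorb (xs ω i) ≤ (2 * n - 1) * absorb (xs ω i) := by gcongr; linarith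
      _ ≤ _ := by
        refine mul_le_mul_of_nonneg_left ?_ (by linarith)
        linarith
  have h4 : 0 ≤ ∑ i, ∑ j, lk (xs ω i) (xs ω j) :=
    Finset.sum_nonneg fun i _ => Finset.sum_nonneg fun j _ => lk_nonneg _ _
  have h5 : 0 ≤ ∑ i, ∑ j, lk (us ω i) (us ω j) :=
    Finset.sum_nonneg fun i _ => Finset.sum_nonneg fun j _ => lk_nonneg _ _
  rw [Finset.sum_add_distrib, Finset.sum_const, Finset.card_univ, Fintype.card_fin,
    nsmul_eq_mul] at h2
  unfold hamil interact
  rw [Finset.sum_sub_distrib, Finset.sum_const, Finset.card_univ, Fintype.card_fin, nsmul_eq_mul]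
  push_cast at h2 ⊢
  linarith

theorem unnorm_univ_ne_top {α a : ℝ} (hα : 0 ≤ α) (ha : 0 < a) {n : ℕ} (hn : 1 ≤ n) :
    unnorm α a n univ ≠ ⊤ := by
  obtain ⟨K, hK, hun⟩ := unnorm_le hα ha
  obtain ⟨c, hc⟩ := exists_le_hamil hα ha hn
  exact ((hun n hn c univ fun ω _ hω _ _ => hc ω hω).trans_lt ENNReal.ofReal_lt_top).ne

/-! ### Lower bounds for the unnormalized law -/

theorem unnorm_univ (α a : ℝ) (n : ℕ) : unnorm α a n univ = partitionFunction α a n := by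
  rw [unnorm, withDensity_apply _ MeasurableSet.univ, setLIntegral_univ, partitionFunction]

/-- The energy of a configuration, with the full weight of the potential. -/
def energy (a : ℝ) {n : ℕ} (ω : Config n) : ℝ :=
  interact (xs ω) (us ω) + 2 * n * ∑ i, (pot a (xs ω i) - potConst a)

theorem measurable_energy (a : ℝ) (n : ℕ) : Measurable (energy a : Config n → ℝ) := by
  have h : (energy a : Config n → ℝ) = fun ω => hamil a ω + ∑ i, (pot a (xs ω i) - potConst a) := by
    funext ω
    unfold energy hamil
    ring
  rw [h]
  refine (measurable_hamil a n).add (Finset.measurable_sum _ fun i _ => Measurable.sub_const ?_ _)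
  exact (continuous_pot a).measurable.comp
    (measurable_subtype_coe.comp ((measurable_pi_apply i).comp measurable_fst))

/-- The points on the negative side are frozen at a tuple of atoms, of mass N⁻¹ each; all the
freedom is left to the points x. -/
theorem le_unnorm {α a δ B : ℝ} (hα : 0 ≤ α) (ha : 0 < a) (hδ : 0 < δ) : ∃ c : ℝ, 0 < c ∧
    ∃ p : ℕ, ∀ n : ℕ, 1 ≤ n → ∀ (h : ℝ) (A : Set (Fin (2 * n) → RPlus)) (u : Fin n → RMinus),
      MeasurableSet A → (∀ j, u j ∈ besselSet α a (2 * n)) → Function.Injective u →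
      (∀ x ∈ A, (∀ i, (x i : ℝ) ∈ Icc δ B) ∧ Function.Injective x ∧ energy a (x, u) ≤ h) →
      ENNReal.ofReal (Real.exp (-h) * (c / ((2 * n : ℕ) : ℝ) ^ p) ^ (2 * n) * ∏ j, facM (u j)) *
        (Measure.pi (fun _ => lebP) A * ((2 * n : ℕ) : ℝ≥0∞)⁻¹ ^ n) ≤
      unnorm α a n (A ×ˢ {u}) := by
  obtain ⟨c, hc, p, hw⟩ := le_weight (B := B) hα ha hδ
  refine ⟨c / (1 + B ^ 2), by positivity, p, fun n hn h A u hA hu hui hx => ?_⟩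
  have := sigmaFinite_sigmaN hα ha (N := 2 * n) (by omega)
  have hm : MeasurableSet (A ×ˢ ({u} : Set (Fin n → RMinus))) :=
    hA.prod (measurableSet_singleton u)
  have hbase : gasBase α a n (A ×ˢ {u}) =
      Measure.pi (fun _ => lebP) A * ((2 * n : ℕ) : ℝ≥0∞)⁻¹ ^ n := by
    rw [gasBase, Measure.prod_prod, ← Set.univ_pi_singleton, Measure.pi_pi,
      Finset.prod_congr rfl fun j _ => sigmaN_singleton (hu j), Finset.prod_const,
      Finset.card_univ, Fintype.card_fin]
  rw [unnorm, withDensity_apply _ hm, ← hbase, ← setLIntegral_const]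
  refine setLIntegral_mono_ae' hm (.of_forall fun ω hω => ?_)
  obtain ⟨x, v⟩ := ω
  obtain ⟨hxA, rfl⟩ : x ∈ A ∧ v = u := hω
  obtain ⟨hxI, hxi, hxe⟩ := hx x hxA
  have hx0 : ∀ i, 0 < xs (x, v) i := fun i => hδ.trans_le (hxI i).1
  rw [gasDensity_eq hα ha hn hx0 (fun j => besselSet_neg ha (by omega) (hu j))
    (Subtype.val_injective.comp hxi) (Subtype.val_injective.comp hui)]
  apply ENNReal.ofReal_le_ofReal
  have h1 : ∀ i, Real.exp (-(2 * n * (pot a (xs (x, v) i) - potConst a))) *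
      (c / (1 + B ^ 2) / ((2 * n : ℕ) : ℝ) ^ p) ≤
      weight α a (2 * n) (xs (x, v) i) * Real.exp ((3 * n - 2) * hlog (xs (x, v) i)) := by
    intro i
    set y := xs (x, v) i
    have hy : 0 < y := hx0 i
    have hyI : y ∈ Icc δ B := hxI i
    have h2 := hw (2 * n) (by omega) y hyI
    have h4 : pot a y = y - 2 * √(a * y) - 3 / 2 * hlog y + potConst a := by
      rw [pot, abs_of_pos hy, hlog]; ring
    have h5 : (1 + B ^ 2)⁻¹ ≤ Real.exp (-(2 * hlog y)) := by
      rw [Real.exp_neg, exp_two_hlog]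
      gcongr
      exact hyI.2
    calc _ = c / ((2 * n : ℕ) : ℝ) ^ p * (Real.exp (-(2 * n * (pot a y - potConst a))) *
          (1 + B ^ 2)⁻¹) := by ring
      _ ≤ c / ((2 * n : ℕ) : ℝ) ^ p * (Real.exp (-(2 * n * (pot a y - potConst a))) *
          Real.exp (-(2 * hlog y))) := by gcongr
      _ = c / ((2 * n : ℕ) : ℝ) ^ p * Real.exp (-((2 * n : ℕ) * (y - 2 * √(a * y)))) *
          Real.exp ((3 * n - 2) * hlog y) := by
          rw [mul_assoc _ (Real.exp _), ← Real.exp_add, ← Real.exp_add, h4]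
          congr 2
          push_cast
          ring
      _ ≤ _ := by gcongr
  have h7 := Finset.prod_le_prod (fun i (_ : i ∈ Finset.univ) => by positivity) fun i _ => h1 i
  rw [Finset.prod_mul_distrib, Finset.prod_const, Finset.card_univ, Fintype.card_fin,
    ← Real.exp_sum, Finset.sum_neg_distrib, ← Finset.mul_sum] at h7
  have hP : 0 ≤ ∏ j, facM (v j) := Finset.prod_nonneg fun j _ => facM_nonneg _
  calc _ ≤ Real.exp (-energy a (x, v)) * (c / (1 + B ^ 2) / ((2 * n : ℕ) : ℝ) ^ p) ^ (2 * n) *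
        ∏ j, facM (v j) := by gcongr
    _ = Real.exp (-interact (xs (x, v)) (us (x, v))) *
        (Real.exp (-(2 * n * ∑ i, (pot a (xs (x, v) i) - potConst a))) *
        (c / (1 + B ^ 2) / ((2 * n : ℕ) : ℝ) ^ p) ^ (2 * n)) * ∏ j, facM (v j) := by
        rw [energy, neg_add, Real.exp_add]; ring
    _ ≤ _ := by
        refine mul_le_mul_of_nonneg_right ?_ hP
        exact mul_le_mul_of_nonneg_left h7 (Real.exp_pos _).le

/-! ### Positivity of the partition function -/

/-- The point of `ℝ_-` of given coordinate. -/
def uOf (a s : ℝ) : RMinus :=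
  ⟨-(Real.pi * s / (2 * √a)) ^ 2, by simp only [mem_Iic]; nlinarith [sq_nonneg (Real.pi * s / (2 * √a))]⟩

theorem sOf_uOf {a s : ℝ} (ha : 0 < a) (hs : 0 ≤ s) : sOf a (uOf a s) = s := by
  have := Real.sqrt_pos.mpr ha
  have hp := Real.pi_pos
  rw [sOf, uOf, neg_neg, Real.sqrt_sq (by positivity)]
  field_simp

theorem uOf_injOn {a : ℝ} (ha : 0 < a) : InjOn (uOf a) (Ici 0) := fun s hs t ht h => by
  rw [← sOf_uOf ha hs, h, sOf_uOf ha ht]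

theorem lebP_preimage {S : Set ℝ} (hS : MeasurableSet S) (h : S ⊆ Ici 0) :
    lebP (Subtype.val ⁻¹' S) = volume S := by
  rw [← Measure.map_apply measurable_subtype_coe hS, map_comap_subtype_coe measurableSet_Ici,
    Measure.restrict_apply hS, inter_eq_left.mpr h]

theorem exists_besselSet_tuple {α a : ℝ} (hα : 0 ≤ α) (ha : 0 < a) {n : ℕ} (hn : 1 ≤ n) :
    ∃ u : Fin n → RMinus, (∀ j, u j ∈ besselSet α a (2 * n)) ∧ Function.Injective u := by
  -- Every window of length 2π far out contains a zero; windows starting 7 > 2π apart are disjoint.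
  obtain ⟨R, hR, hz⟩ := exists_besselJ_zero hα (ω := 1 / 2) (by norm_num) (by norm_num)
  have hp := Real.pi_pos
  have hp4 := Real.pi_lt_d2
  have hz' : ∀ j : Fin n, ∃ z ∈ Icc (R + 7 * (j : ℝ)) (R + 7 * (j : ℝ) + Real.pi / (1 / 2)),
      besselJ α z = 0 := fun j => hz _ (by have : (0:ℝ) ≤ j := by positivity
                                           linarith)
  choose z hzI hz0 using hz'
  have hN : (0:ℝ) < ((2 * n : ℕ) : ℝ) := by exact_mod_cast (by omega : 0 < 2 * n)
  have hzpos : ∀ j, 0 < z j := fun j => by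
    have := (hzI j).1
    have : (0:ℝ) ≤ (j : ℝ) := by positivity
    linarith
  have hmono : StrictMono z := by
    intro i j hij
    have h1 := (hzI i).2
    have h2 := (hzI j).1
    have h3 : (i : ℝ) + 1 ≤ j := by exact_mod_cast hij
    linarith
  have hs : ∀ j, 0 < z j / (Real.pi * ((2 * n : ℕ) : ℝ)) := fun j => by have := hzpos j; positivity
  refine ⟨fun j => uOf a (z j / (Real.pi * ((2 * n : ℕ) : ℝ))), fun j => ?_, fun i j h => ?_⟩
  · refine mem_besselSet_of_zero ha (by omega) ?_ ?_
    · rw [sOf_uOf ha (hs j).le]; exact hs j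
    · rw [sOf_uOf ha (hs j).le, mul_div_cancel₀ _ (by positivity)]; exact hz0 j
  · have := uOf_injOn ha (hs i).le (hs j).le h
    rw [div_left_inj' (by positivity)] at this
    exact hmono.injective this

theorem unnorm_univ_ne_zero {α a : ℝ} (hα : 0 ≤ α) (ha : 0 < a) {n : ℕ} (hn : 1 ≤ n) :
    unnorm α a n univ ≠ 0 := by
  obtain ⟨u, hu, hui⟩ := exists_besselSet_tuple hα ha hn
  set I : Fin (2 * n) → Set ℝ := fun i => Icc ((i : ℝ) + 1) ((i : ℝ) + 3 / 2)
  set box : Set (Fin (2 * n) → RPlus) := univ.pi fun i => Subtype.val ⁻¹' I i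
  have hbm : MeasurableSet box := MeasurableSet.univ_pi fun i => measurable_subtype_coe measurableSet_Icc
  have hbox : Measure.pi (fun _ => lebP) box ≠ 0 := by
    rw [Measure.pi_pi, Finset.prod_ne_zero_iff]
    intro i _
    rw [lebP_preimage measurableSet_Icc fun x hx => ?_, Real.volume_Icc]
    · simp; norm_num
    · have : (0:ℝ) ≤ (i : ℝ) := by positivity
      simp only [mem_Ici]; linarith [hx.1]
  -- The energy is finite at each point of the box, so the box is a countable union of its sublevel
  -- sets and one of these has positive volume.
  set A : ℕ → Set (Fin (2 * n) → RPlus) := fun h => box ∩ {x | energy a (x, u) ≤ h}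
  have hAm : ∀ h, MeasurableSet (A h) := fun h => hbm.inter (measurableSet_le
    ((measurable_energy a n).comp (measurable_id.prodMk measurable_const)) measurable_const)
  have hU : ⋃ h, A h = box := by
    refine subset_antisymm (iUnion_subset fun h => inter_subset_left) fun x hx => ?_
    obtain ⟨h, hh⟩ := exists_nat_ge (energy a (x, u))
    exact mem_iUnion.mpr ⟨h, hx, hh⟩
  obtain ⟨h, hh⟩ := exists_measure_pos_of_not_measure_iUnion_null
    (μ := Measure.pi fun _ => lebP) (s := A) (by rwa [hU])
  obtain ⟨c, hc, p, key⟩ := le_unnorm (δ := 1) (B := 2 * n + 1) hα ha one_pos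
  have h1 := key n hn h (A h) u (hAm h) hu hui fun x hx => by
    have hxI : ∀ i, (x i : ℝ) ∈ I i := fun i => hx.1 i (mem_univ i)
    refine ⟨fun i => ⟨?_, ?_⟩, ?_, hx.2⟩
    · have : (0:ℝ) ≤ (i : ℝ) := by positivity
      linarith [(hxI i).1]
    · have : (i : ℝ) + 1 ≤ 2 * n := by exact_mod_cast i.2
      linarith [(hxI i).2]
    · have : StrictMono x := fun i j hij => by
        have h3 : (i : ℝ) + 1 ≤ j := by exact_mod_cast hij
        have : (x i : ℝ) < x j := by linarith [(hxI i).2, (hxI j).1]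
        exact this
      exact this.injective
  intro h0
  have hz : unnorm α a n (A h ×ˢ {u}) = 0 := measure_mono_null (subset_univ _) h0
  rw [hz, nonpos_iff_eq_zero, mul_eq_zero, mul_eq_zero] at h1
  have hN : (0:ℝ) < ((2 * n : ℕ) : ℝ) := by exact_mod_cast (by omega : 0 < 2 * n)
  rcases h1 with h1 | h1 | h1
  · rw [ENNReal.ofReal_eq_zero] at h1
    have : 0 < ∏ j, facM (u j) := Finset.prod_pos fun j _ => by
      have := besselSet_neg ha (by omega) (hu j)
      have := abs_pos.mpr this.ne
      unfold facM; positivity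
    have : 0 < Real.exp (-(h:ℝ)) * (c / ((2 * n : ℕ) : ℝ) ^ p) ^ (2 * n) * ∏ j, facM (u j) := by
      positivity
    linarith
  · exact hh.ne' h1
  · exact (ENNReal.pow_ne_zero (ENNReal.inv_ne_zero.mpr (ENNReal.natCast_ne_top _)) n) h1

/-! ### The empirical measures belong to the spaces -/

theorem mass_smul_sum_diracProba {X : Type*} [MeasurableSpace X] {k : ℕ} (c : ℝ≥0)
    (y : Fin k → X) : (c • ∑ i, (diracProba (y i)).toFiniteMeasure).mass = c * k := by
  rw [← ENNReal.coe_inj, FiniteMeasure.ennreal_mass, FiniteMeasure.toMeasure_smul,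
    FiniteMeasure.toMeasure_sum, Measure.smul_apply, Measure.finsetSum_apply]
  simp [ENNReal.smul_def]

theorem nuN_mem {α a : ℝ} {n : ℕ} (hn : 1 ≤ n) {ω : Config n}
    (hu : ∀ j, ω.2 j ∈ besselSet α a (2 * n)) (hui : Function.Injective (us ω)) :
    nuN ω ∈ E α a := by
  refine .inl (mem_iUnion.mpr ⟨2 * n, mem_iUnion.mpr ⟨by omega, ?_, ?_⟩⟩)
  · rw [nuN, mass_smul_sum_diracProba]
    have : (n : ℝ≥0) ≠ 0 := by exact_mod_cast (by omega : n ≠ 0)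
    push_cast
    field_simp
  · rw [nuN, FiniteMeasure.toMeasure_smul, FiniteMeasure.toMeasure_sum]
    refine Measure.le_iff.mpr fun s hs => ?_
    have hc : ((((2 * n : ℕ) : ℝ≥0)⁻¹ : ℝ≥0) : ℝ≥0∞) = ((2 * n : ℕ) : ℝ≥0∞)⁻¹ := by
      rw [ENNReal.coe_inv (by exact_mod_cast (by omega : 2 * n ≠ 0)), ENNReal.coe_natCast]
    rw [Measure.smul_apply, Measure.finsetSum_apply, sigmaN, Measure.smul_apply,
      Measure.sum_apply _ hs, ENNReal.smul_def, hc, smul_eq_mul, smul_eq_mul]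
    gcongr
    have := ENNReal.tsum_comp_le_tsum_of_injective
      (f := fun j : Fin n => (⟨ω.2 j, hu j⟩ : besselSet α a (2 * n)))
      (fun i j h => hui (congrArg Subtype.val (congrArg Subtype.val h)))
      (fun u => Measure.dirac (u : RMinus) s)
    rwa [tsum_fintype] at this

theorem exists_pair {α a : ℝ} {n : ℕ} (hn : 1 ≤ n) {ω : Config n}
    (hu : ∀ j, ω.2 j ∈ besselSet α a (2 * n)) (hui : Function.Injective (us ω)) :
    ∃ p : ProbabilityMeasure RPlus × E α a,
      p.1.toFiniteMeasure = muN ω ∧ (p.2 : FiniteMeasure RMinus) = nuN ω := by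
  have h1 : (muN ω).mass = 1 := by
    rw [muN, mass_smul_sum_diracProba]
    exact inv_mul_cancel₀ (by exact_mod_cast (by omega : 2 * n ≠ 0))
  have h2 : IsProbabilityMeasure (muN ω : Measure RPlus) := ⟨by
    rw [← FiniteMeasure.ennreal_mass, h1, ENNReal.coe_one]⟩
  exact ⟨(⟨muN ω, h2⟩, ⟨nuN ω, nuN_mem hn hu hui⟩), rfl, rfl⟩

theorem ae_unnorm {α a : ℝ} (hα : 0 ≤ α) (ha : 0 < a) {n : ℕ} (hn : 1 ≤ n) :
    ∀ᵐ ω ∂unnorm α a n, ω ∈ event (α := α) (a := a) n univ := by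
  have h1 : ∀ᵐ ω ∂unnorm α a n, ω ∈ Good α a n :=
    (withDensity_absolutelyContinuous _ _).ae_le (ae_good hα ha hn)
  have h2 : ∀ᵐ ω ∂unnorm α a n, Function.Injective (xs ω) ∧ Function.Injective (us ω) := by
    have hm := (measurableSet_injective n).compl
    rw [ae_iff]
    change unnorm α a n {ω : Config n | Function.Injective (xs ω) ∧ Function.Injective (us ω)}ᶜ = 0
    rw [unnorm, withDensity_apply _ hm]
    exact (setLIntegral_congr_fun hm fun ω hω => gasDensity_eq_zero hω).trans lintegral_zero
  filter_upwards [h1, h2] with ω hg hi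
  obtain ⟨p, hp⟩ := exists_pair hn hg.2 hi.2
  exact ⟨p, mem_univ _, hp⟩

theorem gas_eq (α a : ℝ) (n : ℕ) : gas α a n = (unnorm α a n univ)⁻¹ • unnorm α a n := by
  rw [unnorm_univ]; rfl

theorem isProbabilityMeasure_gas {α a : ℝ} (hα : 0 ≤ α) (ha : 0 < a) {n : ℕ} (hn : 1 ≤ n) :
    IsProbabilityMeasure (gas α a n) := ⟨by
  rw [gas_eq, Measure.smul_apply, smul_eq_mul,
    ENNReal.inv_mul_cancel (unnorm_univ_ne_zero hα ha hn) (unnorm_univ_ne_top hα ha hn)]⟩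

theorem ae_gas {α a : ℝ} (hα : 0 ≤ α) (ha : 0 < a) {n : ℕ} (hn : 1 ≤ n) :
    ∀ᵐ ω ∂gas α a n, ω ∈ event (α := α) (a := a) n univ := by
  rw [gas_eq]
  exact Measure.ae_smul_measure (ae_unnorm hα ha hn) _

/-! ### Quantiles -/

/-- Points of `[A, B]` which cut a measure into `k` pieces of mass `h`. -/
structure IsQuantiles (ρ : Measure ℝ) (A B : ℝ) (k : ℕ) (h : ℝ) (t : ℕ → ℝ) : Prop where
  mem : ∀ j, t j ∈ Icc A B
  mono : ∀ {i j}, i ≤ j → j ≤ k → t i ≤ t j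
  mass : ∀ {i j}, i ≤ j → j ≤ k → ρ.real (Ioc (t i) (t j)) = ((j : ℝ) - i) * h

theorem real_le_of_le_smul {ρ m : Measure ℝ} {C : ℝ≥0} (hρ : ρ ≤ (C : ℝ≥0∞) • m) {s : Set ℝ}
    (hs : m s ≠ ⊤) : ρ.real s ≤ C * m.real s := by
  have h1 : ρ s ≤ (C : ℝ≥0∞) * m s := hρ s
  have := ENNReal.toReal_mono (ENNReal.mul_ne_top ENNReal.coe_ne_top hs) h1
  rwa [ENNReal.toReal_mul, ENNReal.coe_toReal] at this

/-- The bounded density makes the distribution function Lipschitz, so the intermediate value theorem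
provides points of prescribed mass. -/
theorem exists_quantiles {ρ : Measure ℝ} [IsFiniteMeasure ρ] {C : ℝ≥0}
    (hρ : ρ ≤ (C : ℝ≥0∞) • volume) {A B : ℝ} (hAB : A ≤ B) (hs : ρ (Icc A B)ᶜ = 0) {k : ℕ} {h : ℝ}
    (hh : 0 < h) (hk : ρ.real univ = k * h) : ∃ t, IsQuantiles ρ A B k h t := by
  set G : ℝ → ℝ := fun x => ρ.real (Iic x)
  have hG : ∀ {x y}, x ≤ y → G y - G x = ρ.real (Ioc x y) := fun {x y} hxy => by
    have h1 := measureReal_union (μ := ρ) (s₁ := Iic x) (s₂ := Ioc x y)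
      (disjoint_left.mpr fun z hz hz' => not_lt.mpr hz hz'.1) measurableSet_Ioc
    rw [Iic_union_Ioc_eq_Iic hxy] at h1
    simp only [G]
    linarith
  have hGm : Monotone G := fun x y hxy => measureReal_mono (Iic_subset_Iic.mpr hxy)
  have hGc : Continuous G := by
    refine (LipschitzWith.of_le_add_mul C fun x y => ?_).continuous
    rcases le_total x y with hxy | hxy
    · have := hGm hxy
      have : 0 ≤ C * dist x y := by positivity
      linarith
    · have h1 := real_le_of_le_smul (s := Ioc y x) hρ (by simp)
      rw [← hG hxy, Real.volume_real_Ioc_of_le hxy] at h1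
      rw [Real.dist_eq, abs_of_nonneg (by linarith)]
      linarith
  have hA : G A = 0 := by
    have h1 : ρ {A} = 0 := le_antisymm ((hρ {A}).trans (by simp)) bot_le
    have : ρ (Iic A) = 0 := by
      refine measure_mono_null (fun x hx => ?_) (measure_union_null h1 hs)
      rcases eq_or_lt_of_le (show x ≤ A from hx) with h | h
      · exact .inl h
      · exact .inr fun h' => not_le.mpr h h'.1
    simp [G, measureReal_def, this]
  have hB : G B = k * h := by
    rw [← hk]
    refine measureReal_congr ?_
    rw [ae_eq_univ]
    exact measure_mono_null (compl_subset_compl.mpr Icc_subset_Iic_self) hs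
  -- The minimum with `k` extends the sequence beyond the last quantile, where only its location in
  -- [A, B] matters.
  have hex : ∀ j : ℕ, ∃ x ∈ Icc A B, G x = (min j k : ℕ) * h := fun j => by
    refine intermediate_value_Icc hAB hGc.continuousOn ⟨?_, ?_⟩
    · rw [hA]; positivity
    · rw [hB]; gcongr; exact min_le_right _ _
  choose t ht hGt using hex
  have hmono : ∀ {i j}, i ≤ j → j ≤ k → t i ≤ t j := fun {i j} hij hj => by
    rcases eq_or_lt_of_le hij with rfl | hlt
    · exact le_rfl
    by_contra! hcon
    have := hGm hcon.le
    rw [hGt, hGt, min_eq_left hj, min_eq_left (hij.trans hj)] at this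
    have h2 : (i : ℝ) < j := by exact_mod_cast hlt
    nlinarith
  refine ⟨t, ht, hmono, fun {i j} hij hj => ?_⟩
  rw [← hG (hmono hij hj), hGt, hGt, min_eq_left hj, min_eq_left (hij.trans hj)]
  ring

theorem IsQuantiles.gap {ρ : Measure ℝ} {A B h : ℝ} {k : ℕ} {t : ℕ → ℝ}
    (ht : IsQuantiles ρ A B k h t) {C : ℝ≥0} (hρ : ρ ≤ (C : ℝ≥0∞) • volume) {i j : ℕ} (hij : i ≤ j)
    (hj : j ≤ k) : ((j : ℝ) - i) * h ≤ C * (t j - t i) := by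
  have := real_le_of_le_smul (s := Ioc (t i) (t j)) hρ (by simp)
  rwa [ht.mass hij hj, Real.volume_real_Ioc_of_le (ht.mono hij hj)] at this

theorem integrable_of_continuousOn {ρ : Measure ℝ} [IsFiniteMeasure ρ] {A B : ℝ}
    (hs : ρ (Icc A B)ᶜ = 0) {g : ℝ → ℝ} (hg : ContinuousOn g (Icc A B)) : Integrable g ρ := by
  have h1 : ρ.restrict (Icc A B) = ρ := Measure.restrict_eq_self_of_ae_mem (by
    rw [ae_iff]; exact hs)
  have h2 : IntegrableOn g (Icc A B) ρ := hg.integrableOn_compact isCompact_Icc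
  rwa [IntegrableOn, h1] at h2

/-- On each cell the error is at most h Λ times the length of the cell, and the lengths telescope.
-/
theorem IsQuantiles.abs_sum_sub_integral_le {ρ : Measure ℝ} [IsFiniteMeasure ρ] {A B h : ℝ} {k : ℕ}
    {t : ℕ → ℝ} (ht : IsQuantiles ρ A B k h t) (hh : 0 ≤ h) (hk : ρ.real univ = k * h)
    {g : ℝ → ℝ} (hg : Integrable g ρ) {Λ : ℝ} (hΛ0 : 0 ≤ Λ)
    (hΛ : ∀ x ∈ Icc A B, ∀ y ∈ Icc A B, |g x - g y| ≤ Λ * |x - y|) {y : Fin k → ℝ}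
    (hy : ∀ j : Fin k, y j ∈ Icc (t j) (t (j + 1))) :
    |h * ∑ j, g (y j) - ∫ x, g x ∂ρ| ≤ Λ * (B - A) * h := by
  have h0 : ρ (Ioc (t 0) (t k))ᶜ = 0 := by
    rw [← measureReal_eq_zero_iff, measureReal_compl measurableSet_Ioc, hk,
      ht.mass (Nat.zero_le k) le_rfl]
    simp
  have h1 : ∫ x, g x ∂ρ = ∑ j : Fin k, ∫ x in Ioc (t j) (t (j + 1)), g x ∂ρ := by
    have hr : ρ.restrict (Ioc (t 0) (t k)) = ρ :=
      Measure.restrict_eq_self_of_ae_mem (by rw [ae_iff]; exact h0)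
    have hr' : ∫ x, g x ∂ρ = ∫ x in Ioc (t 0) (t k), g x ∂ρ := by rw [hr]
    rw [hr', ← intervalIntegral.integral_of_le (ht.mono (Nat.zero_le k) le_rfl),
      ← intervalIntegral.sum_integral_adjacent_intervals fun j _ => hg.intervalIntegrable,
      Finset.sum_range]
    refine Finset.sum_congr rfl fun j _ => ?_
    exact intervalIntegral.integral_of_le (ht.mono (Nat.le_succ _) j.2)
  have h2 : ∀ j : Fin k, |h * g (y j) - ∫ x in Ioc (t j) (t (j + 1)), g x ∂ρ| ≤
      Λ * (t (j + 1) - t j) * h := fun j => by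
    have hm : ρ.real (Ioc (t j) (t (j + 1))) = h := by
      have := ht.mass (Nat.le_succ j) j.2
      push_cast at this
      rw [this]; ring
    have h3 : h * g (y j) - ∫ x in Ioc (t j) (t (j + 1)), g x ∂ρ =
        ∫ x in Ioc (t j) (t (j + 1)), (g (y j) - g x) ∂ρ := by
      rw [integral_sub (integrable_const _) hg.integrableOn, setIntegral_const, hm, smul_eq_mul]
    rw [h3, ← Real.norm_eq_abs]
    refine (norm_setIntegral_le_of_norm_le_const (C := Λ * (t (j + 1) - t j)) (measure_lt_top _ _)
      fun x hx => ?_).trans (le_of_eq (by rw [hm]))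
    have hyI : y j ∈ Icc A B := ⟨(ht.mem j).1.trans (hy j).1, (hy j).2.trans (ht.mem _).2⟩
    have hxI : x ∈ Icc A B := ⟨(ht.mem j).1.trans hx.1.le, hx.2.trans (ht.mem _).2⟩
    refine (hΛ _ hyI _ hxI).trans (mul_le_mul_of_nonneg_left ?_ hΛ0)
    rw [abs_le]
    constructor <;> linarith [(hy j).1, (hy j).2, hx.1, hx.2]
  rw [h1, Finset.mul_sum, ← Finset.sum_sub_distrib]
  refine (Finset.abs_sum_le_sum_abs _ _).trans ((Finset.sum_le_sum fun j _ => h2 j).trans ?_)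
  rw [← Finset.sum_mul, ← Finset.mul_sum, ← Finset.sum_range (fun j => t (j + 1) - t j),
    Finset.sum_range_sub]
  gcongr
  · exact (ht.mem _).2
  · exact (ht.mem _).1

theorem exists_lipschitz_polynomial (q : Polynomial ℝ) (A B : ℝ) : ∃ Λ : ℝ, 0 ≤ Λ ∧
    ∀ x ∈ Icc A B, ∀ y ∈ Icc A B, |q.eval x - q.eval y| ≤ Λ * |x - y| := by
  obtain ⟨Λ, hΛ⟩ := (isCompact_Icc (a := A) (b := B)).exists_bound_of_continuousOn
    (q.derivative.continuous.continuousOn)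
  refine ⟨max Λ 0, le_max_right _ _, fun x hx y hy => ?_⟩
  have := Convex.norm_image_sub_le_of_norm_deriv_le (f := fun x => q.eval x) (s := Icc A B)
    (C := max Λ 0) (fun z _ => q.differentiableAt)
    (fun z hz => by rw [Polynomial.deriv]; exact (hΛ z hz).trans (le_max_left _ _))
    (convex_Icc A B) hy hx
  simpa only [Real.norm_eq_abs] using this

/-- Riemann sums along quantiles converge, uniformly in the choice of the points. -/
theorem exists_step_of_quantiles {ρ : Measure ℝ} [IsFiniteMeasure ρ] {A B : ℝ}
    (hs : ρ (Icc A B)ᶜ = 0) (hAB : A ≤ B) {g : ℝ → ℝ} (hg : ContinuousOn g (Icc A B)) {ε : ℝ}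
    (hε : 0 < ε) : ∃ h₀ : ℝ, 0 < h₀ ∧ ∀ (k : ℕ) (h : ℝ) (t : ℕ → ℝ), 0 ≤ h → h ≤ h₀ →
      ρ.real univ = k * h → IsQuantiles ρ A B k h t →
      ∀ y : Fin k → ℝ, (∀ j : Fin k, y j ∈ Icc (t j) (t (j + 1))) →
      |h * ∑ j, g (y j) - ∫ x, g x ∂ρ| ≤ ε := by
  set M := ρ.real univ
  have hM : 0 ≤ M := measureReal_nonneg
  set η := ε / (4 * (M + 1))
  have hη : 0 < η := by positivity
  -- The function `g` is merely continuous; a polynomial close to it is Lipschitz on [A, B].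
  obtain ⟨q, hq⟩ := exists_polynomial_near_of_continuousOn A B g hg η hη
  obtain ⟨Λ, hΛ0, hΛ⟩ := exists_lipschitz_polynomial q A B
  refine ⟨ε / (2 * (Λ * (B - A) + 1)), ?_, fun k h t hh hh0 hk ht y hy => ?_⟩
  · have : 0 ≤ Λ * (B - A) := mul_nonneg hΛ0 (by linarith)
    positivity
  have hyI : ∀ j, y j ∈ Icc A B := fun j =>
    ⟨(ht.mem j).1.trans (hy j).1, (hy j).2.trans (ht.mem _).2⟩
  have i1 := integrable_of_continuousOn hs hg
  have i2 := integrable_of_continuousOn hs (q.continuous.continuousOn (s := Icc A B))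
  have h1 := ht.abs_sum_sub_integral_le hh hk i2 hΛ0 hΛ hy
  have h2 : |∫ x, g x ∂ρ - ∫ x, q.eval x ∂ρ| ≤ η * M := by
    rw [← integral_sub i1 i2, ← Real.norm_eq_abs]
    refine norm_integral_le_of_norm_le_const ?_
    have : ∀ᵐ x ∂ρ, x ∈ Icc A B := by rw [ae_iff]; exact hs
    filter_upwards [this] with x hx
    rw [Real.norm_eq_abs, abs_sub_comm]
    exact (hq x hx).le
  have h3 : |h * ∑ j, g (y j) - h * ∑ j, q.eval (y j)| ≤ η * M := by
    rw [← mul_sub, ← Finset.sum_sub_distrib, abs_mul, abs_of_nonneg hh, hk]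
    calc h * |∑ j, (g (y j) - q.eval (y j))| ≤ h * ∑ j : Fin k, η := by
          refine mul_le_mul_of_nonneg_left ?_ hh
          refine (Finset.abs_sum_le_sum_abs _ _).trans (Finset.sum_le_sum fun j _ => ?_)
          rw [abs_sub_comm]
          exact (hq _ (hyI j)).le
      _ = _ := by
          rw [Finset.sum_const, Finset.card_univ, Fintype.card_fin, nsmul_eq_mul]; ring
  have h4 : Λ * (B - A) * h ≤ ε / 2 := by
    have hD : 0 ≤ Λ * (B - A) := mul_nonneg hΛ0 (by linarith)
    rw [le_div_iff₀ (by positivity)] at hh0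
    nlinarith
  have h5 : η * M ≤ ε / 4 := by
    have : η * (M + 1) = ε / 4 := by simp only [η]; field_simp
    nlinarith
  rw [abs_le] at *
  constructor <;> linarith

/-! ### Configurations of Bessel zeros following a measure -/

/-- In each cell of a measure dominated by `(1-ε)σ` there is a rescaled Bessel zero, and these
points are well separated. -/
theorem exists_besselSet_in_cells {α a : ℝ} (hα : 0 ≤ α) (ha : 0 < a) {ρ : Measure ℝ} {ε : ℝ≥0}
    (hε0 : 0 < ε) (hε1 : ε < 1) (hρ : ρ ≤ ((1 - ε : ℝ≥0) : ℝ≥0∞) • volume) {A B : ℝ} (hA : 0 < A) :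
    ∃ η : ℝ, 0 < η ∧ ∀ᶠ n : ℕ in atTop, ∀ t : ℕ → ℝ,
      IsQuantiles ρ A B n (1 / ((2 * n : ℕ) : ℝ)) t →
      ∃ u : Fin n → RMinus, (∀ j, u j ∈ besselSet α a (2 * n)) ∧
        (∀ j : Fin n, sOf a (u j) ∈ Icc (t j) (t (j + 1))) ∧
        ∀ i j : Fin n, i < j → η * ((j : ℝ) - i) / ((2 * n : ℕ) : ℝ) ≤ sOf a (u j) - sOf a (u i) := by
  set e : ℝ := (ε : ℝ)
  have he0 : 0 < e := hε0
  have he1 : e < 1 := hε1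
  have hp := Real.pi_pos
  obtain ⟨R, hR, hz⟩ := exists_besselJ_zero hα (ω := 1 - e / 2) (by linarith) (by linarith)
  -- A cell of mass 1/N has length at least 1/((1-ε)N), while a zero is found within 1/((1-ε/2)N) of
  -- its left end. The difference η/N is a free margin at the right end, which separates points of
  -- neighbouring cells.
  set η : ℝ := 1 / (1 - e) - 1 / (1 - e / 2)
  have hη : 0 < η := sub_pos.mpr (one_div_lt_one_div_of_lt (by linarith) (by linarith))
  have h1e : 0 < 1 - e := by linarith
  have h2e : 0 < 1 - e / 2 := by linarith
  have hηle : η ≤ 1 / (1 - e) := by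
    have : 0 < 1 / (1 - e / 2) := by positivity
    simp only [η]; linarith
  have hlarge : Tendsto (fun n : ℕ => (n : ℝ)) atTop atTop := tendsto_natCast_atTop_atTop
  refine ⟨η, hη, ?_⟩
  filter_upwards [hlarge.eventually_ge_atTop (R / (Real.pi * A)), eventually_ge_atTop 1]
    with n hn hn1 t ht
  set N : ℝ := ((2 * n : ℕ) : ℝ) with hN
  have hN0 : 0 < N := by rw [hN]; exact_mod_cast (by omega : 0 < 2 * n)
  have hNR : R ≤ Real.pi * N * A := by
    rw [div_le_iff₀ (by positivity)] at hn
    have h5 : (n : ℝ) * (Real.pi * A) ≤ N * (Real.pi * A) := by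
      gcongr
      rw [hN]; exact_mod_cast (by omega)
    linarith
  have hgap : ∀ {i j : ℕ}, i ≤ j → j ≤ n → ((j : ℝ) - i) / ((1 - e) * N) ≤ t j - t i := by
    intro i j hij hj
    have h3 := ht.gap hρ hij hj
    rw [NNReal.coe_sub hε1.le, NNReal.coe_one] at h3
    rw [div_le_iff₀ (by positivity)]
    have h4 : ((j : ℝ) - i) * (1 / N) * N ≤ (1 - e) * (t j - t i) * N :=
      mul_le_mul_of_nonneg_right h3 hN0.le
    rw [mul_assoc, one_div_mul_cancel hN0.ne', mul_one] at h4
    linarith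
  have hz' : ∀ j : Fin n, ∃ z ∈ Icc (Real.pi * N * t j)
      (Real.pi * N * t j + Real.pi / (1 - e / 2)), besselJ α z = 0 := fun j => hz _ (by
    have := (ht.mem j).1
    calc R ≤ Real.pi * N * A := hNR
      _ ≤ _ := by gcongr)
  choose z hzI hz0 using hz'
  have ht0 : ∀ j : ℕ, 0 < t j := fun j => hA.trans_le (ht.mem j).1
  have hzpos : ∀ j, 0 < z j := fun j => by
    have := (hzI j).1
    have : 0 < Real.pi * N * t j := by have := ht0 j; positivity
    linarith
  have hs : ∀ j, 0 < z j / (Real.pi * N) := fun j => by have := hzpos j; positivity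
  have hlow : ∀ j : Fin n, t j ≤ z j / (Real.pi * N) := fun j => by
    rw [le_div_iff₀ (by positivity)]; linarith [(hzI j).1]
  have hup : ∀ j : Fin n, z j / (Real.pi * N) ≤ t (j + 1) - η / N := fun j => by
    have h3 : z j / (Real.pi * N) ≤ t j + 1 / ((1 - e / 2) * N) := by
      rw [div_le_iff₀ (by positivity)]
      refine (hzI j).2.trans (le_of_eq ?_)
      field_simp
    have h4 := hgap (Nat.le_succ j) j.2
    have h5 : (((j : ℕ) + 1 : ℕ) : ℝ) - (j : ℕ) = 1 := by push_cast; ring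
    rw [Nat.succ_eq_add_one, h5] at h4
    have h6 : η / N = 1 / ((1 - e) * N) - 1 / ((1 - e / 2) * N) := by
      simp only [η]; field_simp
    linarith
  refine ⟨fun j => uOf a (z j / (Real.pi * N)), fun j => ?_, fun j => ?_, fun i j hij => ?_⟩
  · refine mem_besselSet_of_zero ha (by omega) ?_ ?_
    · rw [sOf_uOf ha (hs j).le]; exact hs j
    · rw [sOf_uOf ha (hs j).le, mul_div_cancel₀ _ (by positivity)]; exact hz0 j
  · rw [sOf_uOf ha (hs j).le]
    have : 0 < η / N := by positivity
    exact ⟨hlow j, by linarith [hup j]⟩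
  · rw [sOf_uOf ha (hs j).le, sOf_uOf ha (hs i).le]
    have hij' : (i : ℕ) + 1 ≤ j := hij
    have h3 := hgap hij' j.2.le
    -- Between the points of cells i and j lie j - i - 1 full cells and the margin of cell i; both
    -- are bounded below by η per unit of index.
    have h4 : η * ((j : ℝ) - i) / N ≤ ((j : ℝ) - ((i : ℕ) + 1 : ℕ)) / ((1 - e) * N) + η / N := by
      push_cast
      have h5 : (0:ℝ) ≤ (j : ℝ) - i - 1 := by
        have : ((i : ℕ) : ℝ) + 1 ≤ (j : ℕ) := by exact_mod_cast hij'
        linarith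
      have h6 := mul_le_mul_of_nonneg_right hηle h5
      have h7 : ((j : ℝ) - (i + 1)) / ((1 - e) * N) = 1 / (1 - e) * ((j : ℝ) - i - 1) / N := by
        field_simp; ring
      rw [h7, ← add_div]
      gcongr
      linarith
    linarith [hup i, hlow j]

/-! ### Configurations following a pair of measures -/

/-- A measure on `ℝ_-` in the coordinate where `σ` is Lebesgue measure. -/
def sM (a : ℝ) (ν : FiniteMeasure RMinus) : Measure ℝ := (ν : Measure RMinus).map (sOf a)

instance (a : ℝ) (ν : FiniteMeasure RMinus) : IsFiniteMeasure (sM a ν) := by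
  unfold sM; infer_instance

theorem sM_univ {α a : ℝ} {ν : FiniteMeasure RMinus} (hν : ν ∈ E α a) : sM a ν univ = 1 / 2 := by
  rw [← nM_univ hν, sM, nM, Measure.map_apply (continuous_sOf a).measurable MeasurableSet.univ,
    Measure.map_apply measurable_subtype_coe MeasurableSet.univ, preimage_univ, preimage_univ]

/-- Pairs of measures with compact supports away from the origin, with a bounded density and
strictly below the constraint. -/
structure IsNice (a : ℝ) (μ : ProbabilityMeasure RPlus) (ν : FiniteMeasure RMinus)
    (δ B A S : ℝ) (C ε : ℝ≥0) : Prop where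
  pos_left : 0 < δ
  le_left : δ ≤ B
  support_left : mP μ (Icc δ B)ᶜ = 0
  le_density : (μ : Measure RPlus) ≤ (C : ℝ≥0∞) • lebP
  pos_right : 0 < A
  le_right : A ≤ S
  support_right : sM a ν (Icc A S)ᶜ = 0
  eps_pos : 0 < ε
  eps_lt : ε < 1
  le_constraint : sM a ν ≤ ((1 - ε : ℝ≥0) : ℝ≥0∞) • volume

theorem IsNice.mP_le {a : ℝ} {μ : ProbabilityMeasure RPlus} {ν : FiniteMeasure RMinus}
    {δ B A S : ℝ} {C ε : ℝ≥0} (h : IsNice a μ ν δ B A S C ε) : mP μ ≤ (C : ℝ≥0∞) • volume := by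
  refine (Measure.map_mono h.le_density measurable_subtype_coe).trans ?_
  rw [Measure.map_smul, map_comap_subtype_coe measurableSet_Ici]
  exact Measure.le_iff.mpr fun s _ => by
    simp only [Measure.smul_apply, smul_eq_mul]
    exact mul_le_mul' le_rfl (Measure.restrict_apply_le _ s)

/-- The points of a configuration lie in the successive cells of two sequences. -/
def Follows (a : ℝ) {n : ℕ} (t t' : ℕ → ℝ) (ω : Config n) : Prop :=
  (∀ i : Fin (2 * n), xs ω i ∈ Icc (t i) (t (i + 1))) ∧ ∀ j : Fin n, sOf a (ω.2 j) ∈ Icc (t' j) (t' (j + 1))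

theorem uOf_sOf {a : ℝ} (ha : 0 < a) (u : RMinus) : uOf a (sOf a u) = u :=
  Subtype.ext (eq_neg_sOf_sq ha u).symm

theorem continuous_uOf (a : ℝ) : Continuous (uOf a) := by unfold uOf; fun_prop

theorem integral_smul_sum_dirac {X : Type*} [MeasurableSpace X] [MeasurableSingletonClass X]
    {k : ℕ} (c : ℝ≥0) (y : Fin k → X) (f : X → ℝ) :
    ∫ x, f x ∂((c • ∑ i, (diracProba (y i)).toFiniteMeasure : FiniteMeasure X) : Measure X) =
      c * ∑ i, f (y i) := by
  rw [FiniteMeasure.toMeasure_smul, FiniteMeasure.toMeasure_sum, ENNReal.smul_def,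
    integral_smul_measure]
  change _ • ∫ x, f x ∂(∑ i, Measure.dirac (y i)) = _
  rw [integral_finsetSum_measure fun i _ => integrable_dirac (by simp)]
  simp

theorem tendsto_of_follows {α a : ℝ} (ha : 0 < a) {p : ProbabilityMeasure RPlus × E α a}
    {δ B A S : ℝ} {C ε : ℝ≥0} (hp : IsNice a p.1 p.2 δ B A S C ε) {φ : ℕ → ℕ}
    (hφ : Tendsto φ atTop atTop) (h1φ : ∀ k, 1 ≤ φ k)
    {t t' : ℕ → ℕ → ℝ}
    (ht : ∀ k, IsQuantiles (mP p.1) δ B (2 * φ k) (1 / ((2 * φ k : ℕ) : ℝ)) (t k))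
    (ht' : ∀ k, IsQuantiles (sM a p.2) A S (φ k) (1 / ((2 * φ k : ℕ) : ℝ)) (t' k))
    {ω : ∀ k, Config (φ k)} (hω : ∀ k, Follows a (t k) (t' k) (ω k))
    {q : ℕ → ProbabilityMeasure RPlus × E α a} (hq1 : ∀ k, (q k).1.toFiniteMeasure = muN (ω k))
    (hq2 : ∀ k, ((q k).2 : FiniteMeasure RMinus) = nuN (ω k)) : Tendsto q atTop (𝓝 p) := by
  have hN : ∀ k, (0:ℝ) < ((2 * φ k : ℕ) : ℝ) := fun k => by
    have := h1φ k
    exact_mod_cast (by omega : 0 < 2 * φ k)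
  have hstep : ∀ h₀ : ℝ, 0 < h₀ → ∀ᶠ k in atTop, 1 / ((2 * φ k : ℕ) : ℝ) ≤ h₀ := fun h₀ h0 => by
    have h1 : Tendsto (fun k => ((2 * φ k : ℕ) : ℝ)) atTop atTop :=
      tendsto_natCast_atTop_atTop.comp (hφ.const_mul_atTop' two_pos)
    filter_upwards [h1.eventually_ge_atTop (1 / h₀)] with k hk
    rw [div_le_iff₀ (hN k)]
    rw [div_le_iff₀ h0] at hk
    linarith
  have hm1 : ∀ k, (mP p.1).real univ = (2 * φ k : ℕ) * (1 / ((2 * φ k : ℕ) : ℝ)) := fun k => by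
    rw [mul_one_div_cancel (hN k).ne']; simp
  have hm2 : ∀ k, (sM a p.2).real univ = (φ k : ℕ) * (1 / ((2 * φ k : ℕ) : ℝ)) := fun k => by
    rw [measureReal_def, sM_univ p.2.2]
    have h2 := hN k
    push_cast at h2 ⊢
    have h3 : (φ k : ℝ) ≠ 0 := fun h => by rw [h] at h2; simp at h2
    rw [ENNReal.toReal_div]
    simp only [ENNReal.toReal_one, ENNReal.toReal_ofNat]
    field_simp
  have e1 : Tendsto (fun k => (q k).1) atTop (𝓝 p.1) := by
    rw [ProbabilityMeasure.tendsto_iff_forall_integral_tendsto]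
    intro f
    set g : ℝ → ℝ := fun x => f (projIci 0 x)
    have hg : Continuous g := f.continuous.comp
      (Continuous.subtype_mk (continuous_const.max continuous_id) _)
    have hI : ∫ x, f x ∂(p.1 : Measure RPlus) = ∫ x, g x ∂mP p.1 := by
      rw [mP, integral_map measurable_subtype_coe.aemeasurable hg.aestronglyMeasurable]
      simp only [g, projIci_coe]
    rw [hI, Metric.tendsto_atTop']
    intro η hη
    obtain ⟨h₀, h0, hh⟩ := exists_step_of_quantiles hp.support_left hp.le_left hg.continuousOn
      (half_pos hη)
    obtain ⟨K, hK⟩ := eventually_atTop.mp (hstep h₀ h0)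
    refine ⟨K, fun k hk => ?_⟩
    have h1 := hh _ _ (t k) (one_div_pos.mpr (hN k)).le (hK k hk.le) (hm1 k) (ht k) (xs (ω k))
      (hω k).1
    have h2 : ∫ x, f x ∂((q k).1 : Measure RPlus) =
        1 / ((2 * φ k : ℕ) : ℝ) * ∑ i, g (xs (ω k) i) := by
      change ∫ x, f x ∂((q k).1.toFiniteMeasure : Measure RPlus) = _
      rw [hq1, muN, integral_smul_sum_dirac]
      simp only [g, projIci_coe]
      rw [one_div]
      push_cast
      rfl
    rw [h2, Real.dist_eq]
    linarith
  have e2 : Tendsto (fun k => (q k).2) atTop (𝓝 p.2) := by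
    rw [tendsto_subtype_rng, FiniteMeasure.tendsto_iff_forall_integral_tendsto]
    intro f
    set g : ℝ → ℝ := fun x => f (uOf a x)
    have hg : Continuous g := f.continuous.comp (continuous_uOf a)
    have hI : ∫ x, f x ∂((p.2 : FiniteMeasure RMinus) : Measure RMinus) =
        ∫ x, g x ∂sM a p.2 := by
      rw [sM, integral_map (continuous_sOf a).measurable.aemeasurable hg.aestronglyMeasurable]
      simp only [g, uOf_sOf ha]
    rw [hI, Metric.tendsto_atTop']
    intro η hη
    obtain ⟨h₀, h0, hh⟩ := exists_step_of_quantiles hp.support_right hp.le_right hg.continuousOn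
      (half_pos hη)
    obtain ⟨K, hK⟩ := eventually_atTop.mp (hstep h₀ h0)
    refine ⟨K, fun k hk => ?_⟩
    have h1 := hh _ _ (t' k) (one_div_pos.mpr (hN k)).le (hK k hk.le) (hm2 k) (ht' k)
      (fun j => sOf a ((ω k).2 j)) (hω k).2
    have h2 : ∫ x, f x ∂(((q k).2 : FiniteMeasure RMinus) : Measure RMinus) =
        1 / ((2 * φ k : ℕ) : ℝ) * ∑ j, g (sOf a ((ω k).2 j)) := by
      rw [hq2, nuN, integral_smul_sum_dirac]
      simp only [g, uOf_sOf ha]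
      rw [one_div]
      push_cast
      rfl
    rw [h2, Real.dist_eq]
    linarith
  exact (e1.prodMk_nhds e2 : Tendsto (fun k => ((q k).1, (q k).2)) atTop (𝓝 (p.1, p.2)))

/-- Configurations which follow a pair of measures have empirical measures close to them. -/
theorem eventually_mem_of_follows {α a : ℝ} (ha : 0 < a) {p : ProbabilityMeasure RPlus × E α a}
    {δ B A S : ℝ} {C ε : ℝ≥0} (hp : IsNice a p.1 p.2 δ B A S C ε)
    {O : Set (ProbabilityMeasure RPlus × E α a)} (hO : IsOpen O) (hpO : p ∈ O) :
    ∀ᶠ n : ℕ in atTop, ∀ t t' : ℕ → ℝ,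
      IsQuantiles (mP p.1) δ B (2 * n) (1 / ((2 * n : ℕ) : ℝ)) t →
      IsQuantiles (sM a p.2) A S n (1 / ((2 * n : ℕ) : ℝ)) t' → ∀ ω : Config n, Follows a t t' ω →
      ∀ q : ProbabilityMeasure RPlus × E α a, q.1.toFiniteMeasure = muN ω →
      (q.2 : FiniteMeasure RMinus) = nuN ω → q ∈ O := by
  -- Uniformity over all quantiles and configurations follows from the sequential statement:
  -- failures along a subsequence would still have to converge to `p`.
  by_contra hcon
  rw [not_eventually] at hcon
  obtain ⟨φ, hφ, hφn⟩ := extraction_of_frequently_atTop (hcon.and_eventually (eventually_ge_atTop 1))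
  have hex : ∀ k, ∃ t t' : ℕ → ℝ, ∃ ω : Config (φ k), ∃ q : ProbabilityMeasure RPlus × E α a,
      IsQuantiles (mP p.1) δ B (2 * φ k) (1 / ((2 * φ k : ℕ) : ℝ)) t ∧
      IsQuantiles (sM a p.2) A S (φ k) (1 / ((2 * φ k : ℕ) : ℝ)) t' ∧ Follows a t t' ω ∧
      q.1.toFiniteMeasure = muN ω ∧ (q.2 : FiniteMeasure RMinus) = nuN ω ∧ q ∉ O := fun k => by
    have := (hφn k).1
    push Not at this
    obtain ⟨t, t', h1, h2, ω, h3, q, h4, h5, h6⟩ := this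
    exact ⟨t, t', ω, q, h1, h2, h3, h4, h5, h6⟩
  choose t t' ω q h1 h2 h3 h4 h5 h6 using hex
  have hq := tendsto_of_follows ha hp hφ.tendsto_atTop (fun k => (hφn k).2) h1 h2 h3 h4 h5
  obtain ⟨k, hk⟩ := (hq.eventually (hO.mem_nhds hpO)).exists
  exact h6 k hk

/-! ### The energy of the configurations of Bessel zeros -/

theorem sum_one_div_sqrt_le (n : ℕ) : ∑ d ∈ Finset.range n, √(1 / (d : ℝ)) ≤ 2 * √n := by
  rcases n with _ | n
  · simp
  have h : ∀ n : ℕ, ∑ d ∈ Finset.range (n + 1), √(1 / (d : ℝ)) ≤ 2 * √n := by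
    intro n
    induction n with
    | zero => simp
    | succ n ih =>
      rw [Finset.sum_range_succ]
      have h1 : √(n : ℝ) ≤ √((n + 1 : ℕ) : ℝ) := Real.sqrt_le_sqrt (by push_cast; linarith)
      have h2 : 0 < √((n + 1 : ℕ) : ℝ) := Real.sqrt_pos.mpr (by positivity)
      have h3 : √(n : ℝ) ^ 2 = n := Real.sq_sqrt (by positivity)
      have h4 : √((n + 1 : ℕ) : ℝ) ^ 2 = n + 1 := by rw [Real.sq_sqrt (by positivity)]; push_cast; ring
      have h5 : √(1 / ((n + 1 : ℕ) : ℝ)) = 1 / √((n + 1 : ℕ) : ℝ) := by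
        rw [Real.sqrt_div zero_le_one, Real.sqrt_one]
      have h6 : 1 / √((n + 1 : ℕ) : ℝ) ≤ 2 * √((n + 1 : ℕ) : ℝ) - 2 * √n := by
        rw [div_le_iff₀ h2]
        nlinarith [Real.sqrt_nonneg (n : ℝ)]
      rw [h5]
      linarith
  refine (h n).trans ?_
  gcongr
  linarith

/-- The natural subtraction gives 0 for j ≤ i, and division by 0 makes such terms vanish: only pairs
i < j are counted. -/
theorem sum_sqrt_sub_le {n : ℕ} {N : ℝ} (hN : (n : ℝ) ≤ N) :
    ∑ i : Fin n, ∑ j : Fin n, √(N / ((j - i : ℕ) : ℝ)) ≤ n * (2 * N) := by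
  have hN0 : 0 ≤ N := le_trans (by positivity) hN
  have h1 : ∀ i : Fin n, ∑ j : Fin n, √(N / ((j - i : ℕ) : ℝ)) ≤ 2 * N := fun i => by
    rw [← Finset.sum_range (fun j => √(N / ((j - i : ℕ) : ℝ)))]
    have h2 : Finset.range n = Finset.range (i + (n - i)) := by congr 1; omega
    rw [h2, Finset.sum_range_add]
    have h3 : ∑ x ∈ Finset.range i, √(N / ((x - i : ℕ) : ℝ)) = 0 := by
      refine Finset.sum_eq_zero fun x hx => ?_
      rw [Nat.sub_eq_zero_of_le (Finset.mem_range.mp hx).le]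
      simp
    have h4 : ∑ x ∈ Finset.range (n - i), √(N / ((i + x - i : ℕ) : ℝ)) ≤
        √N * ∑ x ∈ Finset.range n, √(1 / (x : ℝ)) := by
      rw [Finset.mul_sum]
      calc _ = ∑ x ∈ Finset.range (n - i), √N * √(1 / (x : ℝ)) := by
            refine Finset.sum_congr rfl fun x _ => ?_
            rw [← Real.sqrt_mul hN0, Nat.add_sub_cancel_left, mul_one_div]
        _ ≤ _ := Finset.sum_le_sum_of_subset_of_nonneg
            (Finset.range_mono (Nat.sub_le _ _)) fun x _ _ => by positivity
    have h5 : √N * ∑ x ∈ Finset.range n, √(1 / (x : ℝ)) ≤ √N * (2 * √N) := by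
      refine mul_le_mul_of_nonneg_left ((sum_one_div_sqrt_le n).trans ?_) (Real.sqrt_nonneg _)
      gcongr
    have h6 : √N * (2 * √N) = 2 * N := by
      rw [mul_left_comm, Real.mul_self_sqrt hN0]
    rw [h3, zero_add]
    linarith
  refine (Finset.sum_le_sum fun i _ => h1 i).trans (le_of_eq ?_)
  rw [Finset.sum_const, Finset.card_univ, Fintype.card_fin, nsmul_eq_mul]

theorem hlog_le_hlog {x y : ℝ} (h : |x| ≤ |y|) : hlog x ≤ hlog y := by
  unfold hlog
  have := sq_le_sq.mpr h
  gcongr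

/-- Points which are d cells apart have `lk` at most D + log(N/d), a singularity so weak that its
excess over L is small on average. This replaces, for the frozen points u, the averaging used for
the points x. -/
theorem exists_sum_lk_le {a A S η : ℝ} (ha : 0 < a) (hA : 0 < A) (hη : 0 < η) : ∃ D : ℝ,
    ∀ (n : ℕ) (u : Fin n → RMinus), (∀ j, sOf a (u j) ∈ Icc A S) →
    (∀ i j : Fin n, i < j →
      η * ((j : ℝ) - i) / ((2 * n : ℕ) : ℝ) ≤ sOf a (u j) - sOf a (u i)) →
    ∀ L : ℝ, 0 ≤ L → ∑ i, ∑ j, lk (u i) (u j) ≤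
      ∑ i, ∑ j, kT L (u i) (u j) + Real.exp ((D - L) / 2) * (4 * ((2 * n : ℕ) : ℝ) ^ 2) := by
  have hs := Real.sqrt_pos.mpr ha
  have hp := Real.pi_pos
  set κ := (Real.pi / (2 * √a)) ^ 2
  have hκ : 0 < κ := by positivity
  have hu2 : ∀ u : RMinus, (u : ℝ) = -(κ * sOf a u ^ 2) := fun u => by
    rw [eq_neg_sOf_sq ha u]; simp only [κ]; ring
  set D := 2 * hlog (κ * S ^ 2) - Real.log (2 * A * κ * η)
  refine ⟨D, fun n u hu hgap L hL => ?_⟩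
  set N : ℝ := ((2 * n : ℕ) : ℝ) with hNdef
  have hlt : ∀ i j : Fin n, i < j → lk (u i) (u j) ≤
      kT L (u i) (u j) + 2 * Real.exp ((D - L) / 2) * √(N / ((j - i : ℕ) : ℝ)) := by
    intro i j hij
    have hn : 0 < n := i.pos
    have hN : 0 < N := by rw [hNdef]; exact_mod_cast (by omega : 0 < 2 * n)
    have hijN : (i : ℕ) < j := hij
    have hd : (((j : ℕ) - (i : ℕ) : ℕ) : ℝ) = (j : ℝ) - i := Nat.cast_sub hijN.le
    have hd0 : (0:ℝ) < (j : ℝ) - i := by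
      have : ((i : ℕ) : ℝ) < (j : ℕ) := by exact_mod_cast hijN
      linarith
    have hg := hgap i j hij
    set d : ℝ := (j : ℝ) - i
    have hi := hu i
    have hj := hu j
    have hpos : 0 < η * d / N := by positivity
    have hdiff : κ * (2 * A) * (η * d / N) ≤ (u i : ℝ) - u j := by
      rw [hu2 (u i), hu2 (u j)]
      have h1 : (2 * A) * (η * d / N) ≤
          (sOf a (u j) + sOf a (u i)) * (sOf a (u j) - sOf a (u i)) := by
        have : 2 * A ≤ sOf a (u j) + sOf a (u i) := by linarith [hi.1, hj.1]
        gcongr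
        linarith
      nlinarith [mul_le_mul_of_nonneg_left h1 hκ.le]
    have hdp : 0 < κ * (2 * A) * (η * d / N) := by positivity
    have hne : (u i : ℝ) ≠ u j := by intro h; rw [h, sub_self] at hdiff; linarith
    have hH : ∀ k, hlog (u k) ≤ hlog (κ * S ^ 2) := fun k => by
      refine hlog_le_hlog ?_
      have h0 : 0 ≤ sOf a (u k) := sOf_nonneg a _
      rw [hu2, abs_neg, abs_of_nonneg (by positivity), abs_of_nonneg (by positivity)]
      have := (hu k).2
      gcongr
    have hlk : lk (u i) (u j) ≤ D + Real.log (N / d) := by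
      rw [lk_eq hne, abs_of_pos (by linarith)]
      have h1 := Real.log_le_log hdp hdiff
      have h2 : κ * (2 * A) * (η * d / N) = 2 * A * κ * η / (N / d) := by field_simp
      rw [h2, Real.log_div (by positivity) (by positivity)] at h1
      have h3 := hH i
      have h4 := hH j
      unfold hlog at h3 h4
      simp only [D, hlog]
      linarith
    rw [kT_eq_min hne, hd]
    rcases le_total (lk (u i) (u j)) L with h | h
    · rw [min_eq_left h]
      have : 0 ≤ 2 * Real.exp ((D - L) / 2) * √(N / d) := by positivity
      linarith
    · rw [min_eq_right h]
      have hNd : 0 < N / d := by positivity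
      -- Applied to exp((D-L)/2) √(N/d), the inequality log s ≤ s - 1 turns the excess over L into a
      -- multiple of √(N/d), whose sum is O(N²).
      have h1 := Real.log_le_sub_one_of_pos
        (show 0 < Real.exp ((D - L) / 2) * √(N / d) by positivity)
      rw [Real.log_mul (Real.exp_pos _).ne' (Real.sqrt_pos.mpr hNd).ne', Real.log_exp,
        Real.log_sqrt hNd.le] at h1
      linarith
  have hall : ∀ i j : Fin n, lk (u i) (u j) ≤ kT L (u i) (u j) + 2 * Real.exp ((D - L) / 2) *
      (√(N / ((j - i : ℕ) : ℝ)) + √(N / ((i - j : ℕ) : ℝ))) := by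
    intro i j
    rcases lt_trichotomy i j with h | rfl | h
    · refine (hlt i j h).trans ?_
      gcongr
      linarith [Real.sqrt_nonneg (N / ((i - j : ℕ) : ℝ))]
    · rw [lk_self, kT_self]; positivity
    · rw [lk_comm, kT_comm]
      refine (hlt j i h).trans ?_
      gcongr
      linarith [Real.sqrt_nonneg (N / ((j - i : ℕ) : ℝ))]
  have hnN : (n : ℝ) ≤ N := by rw [hNdef]; exact_mod_cast (by omega)
  have hS := sum_sqrt_sub_le hnN
  have hS' : ∑ i : Fin n, ∑ j : Fin n, √(N / ((i - j : ℕ) : ℝ)) ≤ n * (2 * N) := by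
    rw [Finset.sum_comm]; exact hS
  calc ∑ i, ∑ j, lk (u i) (u j) ≤ ∑ i, ∑ j, (kT L (u i) (u j) + 2 * Real.exp ((D - L) / 2) *
      (√(N / ((j - i : ℕ) : ℝ)) + √(N / ((i - j : ℕ) : ℝ)))) :=
        Finset.sum_le_sum fun i _ => Finset.sum_le_sum fun j _ => hall i j
    _ = ∑ i, ∑ j, kT L (u i) (u j) + 2 * Real.exp ((D - L) / 2) *
        (∑ i : Fin n, ∑ j : Fin n, √(N / ((j - i : ℕ) : ℝ)) +
          ∑ i : Fin n, ∑ j : Fin n, √(N / ((i - j : ℕ) : ℝ))) := by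
        simp only [Finset.sum_add_distrib, Finset.mul_sum, mul_add]
    _ ≤ ∑ i, ∑ j, kT L (u i) (u j) + 2 * Real.exp ((D - L) / 2) *
        (n * (2 * N) + n * (2 * N)) := by gcongr
    _ = _ := by
        have : N = 2 * n := by rw [hNdef]; push_cast; ring
        rw [this]; ring

theorem continuous_enT_nM {α a : ℝ} {L : ℝ} (hL : 0 ≤ L) :
    Continuous fun p : ProbabilityMeasure RPlus × E α a => enT L (nM p.2) (nM p.2) := by
  have h2 : Continuous fun p : ProbabilityMeasure RPlus × E α a => pM p.2 :=
    continuous_pM.comp continuous_snd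
  simp_rw [nM_eq_smul_pM, enT_smul_right L (1 / 2), enT_smul_left]
  exact continuous_const.mul (continuous_const.mul ((continuous_enT hL).comp (h2.prodMk h2)))

theorem continuous_enT_mP_nM {α a : ℝ} {L : ℝ} (hL : 0 ≤ L) (μ : ProbabilityMeasure RPlus) :
    Continuous fun p : ProbabilityMeasure RPlus × E α a => enT L (mP μ) (nM p.2) := by
  have h2 : Continuous fun p : ProbabilityMeasure RPlus × E α a => pM p.2 :=
    continuous_pM.comp continuous_snd
  simp_rw [nM_eq_smul_pM, enT_smul_right L (1 / 2), ← coe_pP]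
  exact continuous_const.mul ((continuous_enT hL).comp (continuous_const.prodMk h2))

/-! ### Product measures -/

/-- The product measure is the largest outer measure with the given values on boxes, and the bound
is clear on boxes. No densities and no measurability of `A` are needed. -/
theorem pi_le_pow_mul_pi {X : Type*} [MeasurableSpace X] {k : ℕ} {P : Fin k → Measure X}
    [∀ i, SigmaFinite (P i)] {m : Measure X} [SigmaFinite m] {c : ℝ≥0∞} (hc0 : c ≠ 0) (hc : c ≠ ⊤)
    (h : ∀ i, P i ≤ c • m) (A : Set (Fin k → X)) :
    Measure.pi P A ≤ c ^ k * Measure.pi (fun _ => m) A := by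
  have hck : c ^ k ≠ 0 := pow_ne_zero k hc0
  have hck' : c ^ k ≠ ⊤ := ENNReal.pow_ne_top hc
  have h1 : ((c ^ k)⁻¹ • Measure.pi P).toOuterMeasure ≤
      OuterMeasure.pi fun _ : Fin k => m.toOuterMeasure := by
    rw [OuterMeasure.le_pi]
    intro s _
    change ((c ^ k)⁻¹ • Measure.pi P) (univ.pi s) ≤ ∏ i, m (s i)
    rw [Measure.smul_apply, Measure.pi_pi, smul_eq_mul, ← ENNReal.div_eq_inv_mul]
    refine ENNReal.div_le_of_le_mul ?_
    calc ∏ i, P i (s i) ≤ ∏ i, c * m (s i) := Finset.prod_le_prod' fun i _ => h i (s i)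
      _ = _ := by
        rw [Finset.prod_mul_distrib, Finset.prod_const, Finset.card_univ, Fintype.card_fin, mul_comm]
  have h2 : (c ^ k)⁻¹ • Measure.pi P ≤ Measure.pi fun _ : Fin k => m := by
    rw [Measure.pi_def (fun _ : Fin k => m)]
    exact Measure.le_iff.mpr fun s hs => by
      rw [toMeasure_apply _ _ hs]
      exact h1 s
  have h3 := h2 A
  rw [Measure.smul_apply, smul_eq_mul, ← ENNReal.div_eq_inv_mul,
    ENNReal.div_le_iff_le_mul (.inl hck) (.inl hck')] at h3
  rwa [mul_comm]

theorem sum_lintegral_restrict_le {X : Type*} [MeasurableSpace X] {k : ℕ} {s : Fin k → Set X}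
    (hs : ∀ i, MeasurableSet (s i)) (hd : Pairwise (Function.onFun Disjoint s)) (m : Measure X)
    (f : X → ℝ≥0∞) : ∑ i, ∫⁻ x in s i, f x ∂m ≤ ∫⁻ x, f x ∂m := by
  have h := Measure.restrict_iUnion (μ := m) hd hs
  rw [Measure.sum_fintype] at h
  rw [← lintegral_finsetSum_measure, ← h]
  exact setLIntegral_le_lintegral _ _

/-- The mean energy of independent points, each of them distributed according to the restriction
of a measure to a cell. -/
theorem lintegral_pi_cells_le {X : Type*} [MeasurableSpace X] {k : ℕ} {s : Fin k → Set X}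
    (hs : ∀ i, MeasurableSet (s i)) (hd : Pairwise (Function.onFun Disjoint s)) {m : Measure X}
    [SFinite m] {c : ℝ≥0∞} [∀ i, IsProbabilityMeasure (c • m.restrict (s i))]
    {K : X → X → ℝ≥0∞} (hK : Measurable fun p : X × X => K p.1 p.2) {f : X → ℝ≥0∞}
    (hf : Measurable f) :
    ∫⁻ x, (∑ i, ∑ j ∈ {i}ᶜ, K (x i) (x j) + ∑ i, f (x i))
        ∂Measure.pi (fun i => c • m.restrict (s i)) ≤
      c * c * ∫⁻ x, ∫⁻ y, K x y ∂m ∂m + c * ∫⁻ x, f x ∂m := by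
  set P : Fin k → Measure X := fun i => c • m.restrict (s i)
  have hfi : ∀ i, Measurable fun x : Fin k → X => f (x i) := fun i => hf.comp (measurable_pi_apply i)
  have hKij : ∀ i j, Measurable fun x : Fin k → X => K (x i) (x j) := fun i j =>
    hK.comp (f := fun x : Fin k → X => (x i, x j))
      ((measurable_pi_apply i).prodMk (measurable_pi_apply j))
  have h1 : ∀ i, ∫⁻ x, f (x i) ∂Measure.pi P = c * ∫⁻ x in s i, f x ∂m := fun i => by
    rw [← smul_eq_mul, ← lintegral_smul_measure]
    exact (measurePreserving_eval P i).lintegral_comp hf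
  have h2 : ∀ i j, i ≠ j → ∫⁻ x, K (x i) (x j) ∂Measure.pi P =
      c * c * ∫⁻ x in s i, ∫⁻ y in s j, K x y ∂m ∂m := fun i j hij => by
    -- Distinct coordinates are independent, so a pair is distributed according to a product of two
    -- restrictions.
    have hind := (ProbabilityTheory.iIndepFun_pi (μ := P) (X := fun _ x => x)
      fun i => aemeasurable_id).indepFun hij
    rw [ProbabilityTheory.indepFun_iff_map_prod_eq_prod_map_map
      (measurable_pi_apply i).aemeasurable (measurable_pi_apply j).aemeasurable] at hind
    have hi : (Measure.pi P).map (fun x => x i) = P i := (measurePreserving_eval P i).map_eq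
    have hj : (Measure.pi P).map (fun x => x j) = P j := (measurePreserving_eval P j).map_eq
    rw [hi, hj] at hind
    have h3 := lintegral_map (μ := Measure.pi P) hK
      ((measurable_pi_apply i).prodMk (measurable_pi_apply j))
    rw [hind] at h3
    rw [← h3, lintegral_prod _ hK.aemeasurable]
    simp only [P, lintegral_smul_measure, smul_eq_mul]
    rw [lintegral_const_mul _ hK.lintegral_prod_right', mul_assoc]
  rw [lintegral_add_left (Finset.measurable_sum _ fun i _ => Finset.measurable_sum _ fun j _ =>
    hKij i j), lintegral_finsetSum _ fun i _ => hfi i,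
    lintegral_finsetSum _ fun i _ => Finset.measurable_sum _ fun j _ => hKij i j]
  simp_rw [h1, ← Finset.mul_sum]
  gcongr ?_ + c * ?_
  · calc _ = ∑ i, ∑ j ∈ {i}ᶜ, c * c * ∫⁻ x in s i, ∫⁻ y in s j, K x y ∂m ∂m := by
          refine Finset.sum_congr rfl fun i _ => ?_
          rw [lintegral_finsetSum _ fun j _ => hKij i j]
          refine Finset.sum_congr rfl fun j hj => h2 i j ?_
          rintro rfl
          simp at hj
      -- Adding the diagonal cells back only increases the sum, as the kernel is nonnegative.
      _ ≤ ∑ i, ∑ j, c * c * ∫⁻ x in s i, ∫⁻ y in s j, K x y ∂m ∂m :=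
          Finset.sum_le_sum fun i _ => Finset.sum_le_sum_of_subset (Finset.subset_univ _)
      _ = c * c * ∑ i, ∫⁻ x in s i, ∑ j, ∫⁻ y in s j, K x y ∂m ∂m := by
          simp_rw [← Finset.mul_sum]
          congr 1
          refine Finset.sum_congr rfl fun i _ => ?_
          rw [lintegral_finsetSum _ fun j _ => hK.lintegral_prod_right']
      _ ≤ c * c * ∑ i, ∫⁻ x in s i, ∫⁻ y, K x y ∂m ∂m := by
          gcongr
          exact sum_lintegral_restrict_le hs hd m _
      _ ≤ _ := by
          gcongr
          exact sum_lintegral_restrict_le hs hd m _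
  · exact sum_lintegral_restrict_le hs hd m f

/-- The points of `ℝ_+` in the cells of a sequence. -/
def cell (t : ℕ → ℝ) (i : ℕ) : Set RPlus := Subtype.val ⁻¹' Ioc (t i) (t (i + 1))

theorem measurableSet_cell (t : ℕ → ℝ) (i : ℕ) : MeasurableSet (cell t i) :=
  measurable_subtype_coe measurableSet_Ioc

theorem IsQuantiles.lt_of_cells {ρ : Measure ℝ} {A B h : ℝ} {k : ℕ} {t : ℕ → ℝ}
    (ht : IsQuantiles ρ A B k h t) {i j : ℕ} (hij : i < j) (hj : j ≤ k) {x y : RPlus}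
    (hx : x ∈ cell t i) (hy : y ∈ cell t j) : (x : ℝ) < y :=
  (hx.2.trans (ht.mono hij hj)).trans_lt hy.1

theorem IsQuantiles.pairwise_disjoint_cell {ρ : Measure ℝ} {A B h : ℝ} {k : ℕ} {t : ℕ → ℝ}
    (ht : IsQuantiles ρ A B k h t) :
    Pairwise (Function.onFun Disjoint fun i : Fin k => cell t i) := by
  intro i j hij
  refine disjoint_left.mpr fun x hx hx' => ?_
  rcases lt_or_gt_of_ne hij with h | h
  · exact lt_irrefl _ (ht.lt_of_cells h j.2.le hx hx')
  · exact lt_irrefl _ (ht.lt_of_cells h i.2.le hx' hx)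

/-- Among the points of the cells of a measure, those of almost minimal energy have a volume which
is not too small. -/
theorem le_volume_cells {μ : ProbabilityMeasure RPlus} {C : ℝ≥0} (hC : C ≠ 0)
    (hμ : (μ : Measure RPlus) ≤ (C : ℝ≥0∞) • lebP) {δ B : ℝ} {N : ℕ} (hN : 1 ≤ N) {t : ℕ → ℝ}
    (ht : IsQuantiles (mP μ) δ B N (1 / (N : ℝ)) t) {f : ℝ → ℝ≥0∞} (hf : Measurable f)
    {w e : ℝ} (hw : 0 ≤ w) (he : 0 < e)
    (hwf : en (mP μ) (mP μ) + ∫⁻ x, f x ∂mP μ ≤ ENNReal.ofReal w) :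
    ∃ A : Set (Fin N → RPlus), MeasurableSet A ∧
      (∀ x ∈ A, (∀ i : Fin N, x i ∈ cell t i) ∧ ∑ i, ∑ j ∈ {i}ᶜ, kern (x i) (x j) +
        ∑ i, (N : ℝ≥0∞) * f (x i) ≤ ENNReal.ofReal ((N : ℝ) ^ 2 * (w + e))) ∧
      ENNReal.ofReal (e / (w + e)) ≤ ((N : ℝ≥0∞) * C) ^ N * Measure.pi (fun _ => lebP) A := by
  have hN0 : (N : ℝ≥0∞) ≠ 0 := by exact_mod_cast (by omega : N ≠ 0)
  have hNr : (0:ℝ) < N := by exact_mod_cast hN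
  have hm : ∀ i : Fin N, (μ : Measure RPlus) (cell t i) = (N : ℝ≥0∞)⁻¹ := fun i => by
    have h1 := ht.mass (Nat.le_succ i) i.2
    have h2 : (μ : Measure RPlus) (cell t i) = mP μ (Ioc (t i) (t (i + 1))) :=
      (Measure.map_apply measurable_subtype_coe measurableSet_Ioc).symm
    rw [h2, ← ENNReal.ofReal_toReal (measure_ne_top (mP μ) _)]
    change ENNReal.ofReal ((mP μ).real (Ioc (t i) (t (i + 1)))) = _
    have h3 : (((i : ℕ) + 1 : ℕ) : ℝ) - (i : ℕ) = 1 := by push_cast; ring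
    rw [Nat.succ_eq_add_one, h3, one_mul] at h1
    rw [h1, one_div, ENNReal.ofReal_inv_of_pos hNr, ENNReal.ofReal_natCast]
  -- The normalized restriction of μ to each cell: cells have mass 1/N.
  set P : Fin N → Measure RPlus := fun i => (N : ℝ≥0∞) • (μ : Measure RPlus).restrict (cell t i)
  have hP : ∀ i, IsProbabilityMeasure (P i) := fun i => ⟨by
    simp only [P, Measure.smul_apply, Measure.restrict_apply_univ, hm, smul_eq_mul]
    exact ENNReal.mul_inv_cancel hN0 (ENNReal.natCast_ne_top N)⟩
  set H : (Fin N → RPlus) → ℝ≥0∞ := fun x => ∑ i, ∑ j ∈ {i}ᶜ, kern (x i) (x j) +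
    ∑ i, (N : ℝ≥0∞) * f (x i)
  have hK : Measurable fun p : RPlus × RPlus => kern p.1 p.2 :=
    measurable_kern.comp ((measurable_subtype_coe.comp measurable_fst).prodMk
      (measurable_subtype_coe.comp measurable_snd))
  have hf' : Measurable fun x : RPlus => (N : ℝ≥0∞) * f x :=
    (hf.comp measurable_subtype_coe).const_mul _
  have hHm : Measurable H := by
    refine Measurable.add ?_ ?_
    · exact Finset.measurable_sum _ fun i _ => Finset.measurable_sum _ fun j _ =>
        hK.comp (f := fun x : Fin N → RPlus => (x i, x j))
          ((measurable_pi_apply i).prodMk (measurable_pi_apply j))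
    · exact Finset.measurable_sum _ fun i _ => hf'.comp (measurable_pi_apply i)
  have hen : ∫⁻ x : RPlus, ∫⁻ y : RPlus, kern x y ∂(μ : Measure RPlus) ∂(μ : Measure RPlus) =
      en (mP μ) (mP μ) := by
    rw [en, lintegral_prod _ measurable_kern.aemeasurable, mP,
      lintegral_map measurable_kern.lintegral_prod_right' measurable_subtype_coe]
    refine lintegral_congr fun x => ?_
    exact (lintegral_map (f := fun y => kern x y)
      (measurable_kern.comp measurable_prodMk_left) measurable_subtype_coe).symm
  have hfm : ∫⁻ x : RPlus, (N : ℝ≥0∞) * f x ∂(μ : Measure RPlus) =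
      (N : ℝ≥0∞) * ∫⁻ x, f x ∂mP μ := by
    rw [mP, lintegral_map hf measurable_subtype_coe]
    exact lintegral_const_mul _ (hf.comp measurable_subtype_coe)
  have hHint : ∫⁻ x, H x ∂Measure.pi P ≤ ENNReal.ofReal ((N : ℝ) ^ 2 * w) := by
    refine (lintegral_pi_cells_le (fun i => measurableSet_cell t i) ht.pairwise_disjoint_cell
      (K := fun x y : RPlus => kern x y) hK hf').trans ?_
    rw [hen, hfm, ← mul_assoc, ← mul_add, ENNReal.ofReal_mul (by positivity),
      ENNReal.ofReal_pow hNr.le, ENNReal.ofReal_natCast, ← sq]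
    gcongr
  have hwe : 0 < (N : ℝ) ^ 2 * (w + e) := by positivity
  set D : Set (Fin N → RPlus) := {x | ENNReal.ofReal ((N : ℝ) ^ 2 * (w + e)) ≤ H x}
  -- Markov's inequality: the mean of `H` is at most N² w, so `H` stays below N² (w + e) with
  -- probability at least e/(w + e).
  have hD : Measure.pi P D ≤ ENNReal.ofReal (w / (w + e)) := by
    refine (meas_ge_le_lintegral_div hHm.aemeasurable (ENNReal.ofReal_pos.mpr hwe).ne'
      ENNReal.ofReal_ne_top).trans ?_
    refine ENNReal.div_le_of_le_mul (hHint.trans ?_)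
    rw [← ENNReal.ofReal_mul (by positivity)]
    apply ENNReal.ofReal_le_ofReal
    apply le_of_eq
    field_simp
  have hcells : ∀ᵐ x ∂Measure.pi P, ∀ i : Fin N, x i ∈ cell t i := by
    rw [ae_all_iff]
    intro i
    have : ∀ᵐ x ∂P i, x ∈ cell t i :=
      Measure.ae_smul_measure (ae_restrict_mem (measurableSet_cell t i)) _
    exact (Measure.quasiMeasurePreserving_eval P i).ae this
  set A : Set (Fin N → RPlus) := (univ.pi fun i : Fin N => cell t i) ∩ Dᶜ
  have hDm : MeasurableSet D := measurableSet_le measurable_const hHm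
  have hAm : MeasurableSet A :=
    (MeasurableSet.univ_pi fun i : Fin N => measurableSet_cell t i).inter hDm.compl
  refine ⟨A, hAm, fun x hx => ⟨fun i => hx.1 i (mem_univ i), (not_le.mp (show ¬ _ ≤ H x from hx.2)).le⟩, ?_⟩
  have hAD : Measure.pi P A = Measure.pi P Dᶜ := by
    refine measure_congr ?_
    filter_upwards [hcells] with x hx
    exact propext ⟨fun h => h.2, fun h => ⟨fun i _ => hx i, h⟩⟩
  have h1 : ENNReal.ofReal (e / (w + e)) ≤ Measure.pi P A := by
    rw [hAD, prob_compl_eq_one_sub hDm]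
    refine le_trans (le_of_eq ?_) (tsub_le_tsub_left hD 1)
    rw [← ENNReal.ofReal_one, ← ENNReal.ofReal_sub _ (by positivity)]
    congr 1
    field_simp
    ring
  refine h1.trans (pi_le_pow_mul_pi ?_ ?_ (fun i => ?_) A)
  · exact mul_ne_zero hN0 (by exact_mod_cast hC)
  · exact ENNReal.mul_ne_top (ENNReal.natCast_ne_top N) ENNReal.coe_ne_top
  · refine Measure.le_iff.mpr fun s _ => ?_
    simp only [P, Measure.smul_apply, smul_eq_mul]
    rw [mul_assoc]
    exact mul_le_mul' le_rfl ((Measure.restrict_apply_le _ s).trans (hμ s))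

/-! ### The lower bound at nice pairs of measures -/

theorem kT_le_lk {x y : ℝ} (h : x ≠ y) (L : ℝ) : kT L x y ≤ lk x y := by
  rw [kT_eq_min h]; exact min_le_left _ _

theorem absorb_le_absorb {x y : ℝ} (hx : 0 ≤ x) (h : x ≤ y) : absorb x ≤ absorb y := by
  unfold absorb; gcongr

/-- Subexponential factors are eventually negligible. -/
theorem eventually_exp_le_factor {θ c f₀ C e : ℝ} (hθ : 0 < θ) (hc : 0 < c) (hf : 0 < f₀)
    (hC : 0 < C) (he : 0 < e) (p : ℕ) : ∀ᶠ n : ℕ in atTop,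
      Real.exp (-(e * ((2 * n : ℕ) : ℝ) ^ 2)) ≤
        (c / ((2 * n : ℕ) : ℝ) ^ p) ^ (2 * n) * f₀ ^ n *
          (θ / (((2 * n : ℕ) : ℝ) * C) ^ (2 * n) * (((2 * n : ℕ) : ℝ)⁻¹) ^ n) := by
  set g := min f₀ 1
  have hg : 0 < g := lt_min hf one_pos
  have hK : 0 < C / (c * g) := by positivity
  filter_upwards [eventually_pow_le (α := ((p + 2 : ℕ) : ℝ)) hK (half_pos he),
    eventually_log_le (-Real.log θ) 0 (half_pos he), eventually_ge_atTop 1] with n h1 h2 hn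
  set N : ℝ := ((2 * n : ℕ) : ℝ) with hNdef
  have hN : 1 ≤ N := by rw [hNdef]; exact_mod_cast (by omega : 1 ≤ 2 * n)
  have hN0 : 0 < N := by linarith
  rw [Real.rpow_natCast] at h1
  have h3 : Real.exp (-(e / 2 * N ^ 2)) ≤ θ := by
    rw [← Real.le_log_iff_exp_le hθ]
    have : e / 2 * N ≤ e / 2 * N ^ 2 := by gcongr; nlinarith
    linarith
  have h4 : Real.exp (-(e / 2 * N ^ 2)) ≤ ((C / (c * g) * N ^ (p + 2)) ^ (2 * n))⁻¹ := by
    rw [Real.exp_neg]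
    gcongr
  have h5 : g ^ (2 * n) ≤ f₀ ^ n := calc
    g ^ (2 * n) ≤ g ^ n := pow_le_pow_of_le_one hg.le (min_le_right _ _) (by omega)
    _ ≤ f₀ ^ n := by gcongr; exact min_le_left _ _
  have h6 : N⁻¹ ^ (2 * n) ≤ N⁻¹ ^ n :=
    pow_le_pow_of_le_one (by positivity) (inv_le_one_of_one_le₀ hN) (by omega)
  calc Real.exp (-(e * N ^ 2)) = Real.exp (-(e / 2 * N ^ 2)) * Real.exp (-(e / 2 * N ^ 2)) := by
        rw [← Real.exp_add]; congr 1; ring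
    _ ≤ θ * ((C / (c * g) * N ^ (p + 2)) ^ (2 * n))⁻¹ := by gcongr
    _ = (c / N ^ p) ^ (2 * n) * g ^ (2 * n) * (θ / (N * C) ^ (2 * n) * N⁻¹ ^ (2 * n)) := by
        rw [div_eq_mul_inv θ, mul_assoc θ, mul_left_comm _ θ, ← inv_pow, ← inv_pow, ← mul_pow,
          ← mul_pow, ← mul_pow]
        congr 2
        field_simp
        ring
    _ ≤ _ := by gcongr

/-- On a compact set of points u away from 0, the mutual kernel is bounded by a function of x alone
and the factor `facM` is bounded below. -/
theorem IsNice.exists_pot_const {a : ℝ} (ha : 0 < a) {A S : ℝ} (hA : 0 < A) :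
    ∃ b f₀ : ℝ, 0 ≤ b ∧ 0 < f₀ ∧ ∀ u : RMinus, sOf a u ∈ Icc A S → (u : ℝ) < 0 ∧ f₀ ≤ facM u ∧
      ∀ x : ℝ, 0 ≤ x → lk x u ≤ absorb x + b := by
  have hs := Real.sqrt_pos.mpr ha
  have hp := Real.pi_pos
  set κ := (Real.pi / (2 * √a)) ^ 2
  have hκ : 0 < κ := by positivity
  have hu2 : ∀ u : RMinus, (u : ℝ) = -(κ * sOf a u ^ 2) := fun u => by
    rw [eq_neg_sOf_sq ha u]; simp only [κ]; ring
  refine ⟨max (-Real.log (κ * A ^ 2)) 0, κ * A ^ 2 / (1 + (κ * S ^ 2) ^ 2), le_max_right _ _,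
    by positivity, fun u hu => ?_⟩
  have h0 : 0 < sOf a u := hA.trans_le hu.1
  have hneg : (u : ℝ) < 0 := by rw [hu2]; have : 0 < κ * sOf a u ^ 2 := by positivity
                                linarith
  have hlow : κ * A ^ 2 ≤ -(u : ℝ) := by rw [hu2, neg_neg]; gcongr; exact hu.1
  have hup : -(u : ℝ) ≤ κ * S ^ 2 := by rw [hu2, neg_neg]; gcongr; exact hu.2
  refine ⟨hneg, ?_, fun x hx => (lk_le hx hneg).trans ?_⟩
  · rw [facM, abs_of_neg hneg]
    have : (u : ℝ) ^ 2 ≤ (κ * S ^ 2) ^ 2 := by nlinarith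
    have h1 : (0:ℝ) ≤ -u := by linarith
    gcongr
  · exact add_le_add le_rfl (max_le_max (neg_le_neg (Real.log_le_log (by positivity) hlow)) le_rfl)

theorem en_eq_ofReal_enT {m n : Measure ℝ} [IsFiniteMeasure m] [IsFiniteMeasure n] {L : ℝ}
    (hL : 0 ≤ L) (h : ∀ᵐ p ∂m.prod n, p.1 ≠ p.2 ∧ lk p.1 p.2 ≤ L) :
    en m n = ENNReal.ofReal (enT L m n) := by
  rw [en, ofReal_enT hL]
  refine lintegral_congr_ae (h.mono fun p hp => ?_)
  change kern p.1 p.2 = ENNReal.ofReal (kT L p.1 p.2)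
  rw [kern_of_ne hp.1, kT_eq_min hp.1, min_eq_left hp.2]

set_option maxHeartbeats 400000 in
/-- The lower bound at a nice pair of measures. -/
theorem eventually_le_unnorm_of_isNice {α a : ℝ} (hα : 0 ≤ α) (ha : 0 < a)
    {p : ProbabilityMeasure RPlus × E α a} {δ B A S : ℝ} {C ε : ℝ≥0}
    (hp : IsNice a p.1 p.2 δ B A S C ε) {O : Set (ProbabilityMeasure RPlus × E α a)}
    (hO : IsOpen O) (hpO : p ∈ O) {c : ℝ} (hc : J a p.1 p.2 < (c : EReal)) : ∀ᶠ n : ℕ in atTop,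
      ENNReal.ofReal (Real.exp (-(c * ((2 * n : ℕ) : ℝ) ^ 2))) ≤ unnorm α a n (event n O) := by
  have hfin : en (mP p.1) (mP p.1) ≠ ⊤ ∧ en (nM p.2) (nM p.2) ≠ ⊤ ∧ potInt a (mP p.1) ≠ ⊤ := by
    by_contra h
    rw [J_eq_top ha p.1 p.2.2 h] at hc
    exact absurd hc (not_lt.mpr le_top)
  obtain ⟨hen1, hen2, hpot⟩ := hfin
  rw [J_eq ha p.1 p.2.2 hen1 hen2 hpot, EReal.coe_lt_coe_iff] at hc
  set d := Jreal a (mP p.1) (nM p.2) with hd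
  obtain ⟨b, f₀, hb, hf₀, hbu⟩ := IsNice.exists_pot_const (S := S) ha hp.pos_right
  -- Four of these eight units bound the energy in excess of `d`: one for the mutual energy, one for
  -- Markov's inequality and two for the points u. The other four pay for the subexponential
  -- factors.
  set e := (c - d) / 8
  have he : 0 < e := by simp only [e]; linarith
  have hB0 : 0 ≤ B := hp.pos_left.le.trans hp.le_left
  -- A bound for the mutual kernel on the product of the supports, so that truncating at this level
  -- does not change the mutual energy.
  set L : ℝ := absorb B + b
  have hL : 0 ≤ L := add_nonneg (absorb_nonneg _) hb
  have hlkL : ∀ x ∈ Icc δ B, ∀ u : RMinus, sOf a u ∈ Icc A S → lk x u ≤ L := fun x hx u hu => by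
    have h0 : 0 ≤ x := hp.pos_left.le.trans hx.1
    exact ((hbu u hu).2.2 x h0).trans (add_le_add (absorb_le_absorb h0 hx.2) le_rfl)
  have haeP : ∀ᵐ x ∂mP p.1, x ∈ Icc δ B := by rw [ae_iff]; exact hp.support_left
  have haeM : ∀ᵐ u ∂((p.2 : FiniteMeasure RMinus) : Measure RMinus), sOf a u ∈ Icc A S := by
    have h1 : ∀ᵐ s ∂sM a p.2, s ∈ Icc A S := by rw [ae_iff]; exact hp.support_right
    exact ae_of_ae_map (continuous_sOf a).measurable.aemeasurable h1
  have hmut : en (mP p.1) (nM p.2) = ENNReal.ofReal (enT L (mP p.1) (nM p.2)) := by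
    refine en_eq_ofReal_enT hL ?_
    have h2 : ∀ᵐ u ∂nM p.2, ∀ x ∈ Icc δ B, x ≠ u ∧ lk x u ≤ L := by
      have he : MeasurableEmbedding (Subtype.val : RMinus → ℝ) :=
        MeasurableEmbedding.subtype_coe measurableSet_Iic
      rw [nM, he.ae_map_iff]
      filter_upwards [haeM] with u hu x hx
      have := (hbu u hu).1
      exact ⟨by linarith [hp.pos_left, hx.1], hlkL x hx u hu⟩
    have h3 := Measure.quasiMeasurePreserving_fst (μ := mP p.1) (ν := nM p.2) |>.ae haeP
    have h4 := Measure.quasiMeasurePreserving_snd (μ := mP p.1) (ν := nM p.2) |>.ae h2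
    filter_upwards [h3, h4] with q h5 h6
    exact h6 _ h5
  obtain ⟨η, hη, hcells⟩ := exists_besselSet_in_cells hα ha hp.eps_pos hp.eps_lt
    hp.le_constraint hp.pos_right (B := S)
  obtain ⟨D, hD⟩ := exists_sum_lk_le (S := S) ha hp.pos_right hη
  -- Chosen so that the error term of `exists_sum_lk_le` is at most e N².
  set L' : ℝ := max (D - 2 * Real.log (e / 4)) 0
  have hL' : 0 ≤ L' := le_max_right _ _
  have hexp : Real.exp ((D - L') / 2) * 4 ≤ e := by
    have h1 : Real.exp ((D - L') / 2) ≤ e / 4 := by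
      rw [← Real.le_log_iff_exp_le (by positivity)]
      have := le_max_left (D - 2 * Real.log (e / 4)) 0
      simp only [L']
      linarith
    linarith
  set I₁ := (en (mP p.1) (mP p.1)).toReal
  set I₂ := (en (nM p.2) (nM p.2)).toReal
  set I₃ := enT L (mP p.1) (nM p.2)
  have hI3 : 0 ≤ I₃ := enT_nonneg hL _ _
  set V := (potInt a (mP p.1)).toReal
  have hdeq : d = I₁ - I₃ + I₂ + (V - potConst a) := by
    rw [hd, Jreal, hmut, ENNReal.toReal_ofReal hI3]
    simp only [I₁, I₂, V]
    ring
  set w := I₁ + (V - I₃ + b / 2) + e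
  have hV : V = ∫ x, pot a x ∂mP p.1 := by
    simp only [V, potInt]
    rw [integral_eq_lintegral_of_nonneg_ae (.of_forall fun x => pot_nonneg ha x)
      (continuous_pot a).aestronglyMeasurable]
  obtain ⟨c₀, hc₀, r, hlow⟩ := le_unnorm (α := α) (B := B) hα ha hp.pos_left
  -- Being close to `p` in this neighbourhood also controls the truncated energies in which the
  -- empirical measure of the points u occurs.
  set O' : Set (ProbabilityMeasure RPlus × E α a) := O ∩
    ({q | I₃ - e < enT L (mP p.1) (nM q.2)} ∩ {q | enT L' (nM q.2) (nM q.2) < I₂ + e})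
  have hO' : IsOpen O' := hO.inter ((isOpen_lt continuous_const (continuous_enT_mP_nM hL _)).inter
    (isOpen_lt (continuous_enT_nM hL') continuous_const))
  have hpO' : p ∈ O' := by
    refine ⟨hpO, ?_, ?_⟩
    · change I₃ - e < I₃
      linarith
    · have h1 := ofReal_enT_le_en hL' (nM p.2) (nM p.2)
      have h2 : enT L' (nM p.2) (nM p.2) ≤ I₂ := by
        rwa [ENNReal.ofReal_le_iff_le_toReal hen2] at h1
      change enT L' (nM p.2) (nM p.2) < I₂ + e
      linarith
  set C' : ℝ≥0 := C + 1
  have hC' : C' ≠ 0 := by positivity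
  have hdens : (p.1 : Measure RPlus) ≤ (C' : ℝ≥0∞) • lebP :=
    hp.le_density.trans (Measure.le_iff.mpr fun s _ => by
      simp only [Measure.smul_apply, smul_eq_mul]
      gcongr
      exact_mod_cast le_self_add)
  have hC'0 : (0:ℝ) < C' := by positivity
  filter_upwards [eventually_mem_of_follows ha hp hO' hpO', hcells,
    eventually_exp_le_factor (θ := e / (|w| + e)) (by positivity) hc₀ hf₀ hC'0
      (show 0 < 4 * e by linarith) r, eventually_ge_atTop 1] with n hmem hcell hfac hn
  set N : ℝ := ((2 * n : ℕ) : ℝ) with hNdef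
  have hN : 0 < N := by rw [hNdef]; exact_mod_cast (by omega : 0 < 2 * n)
  have hN2 : N = 2 * n := by rw [hNdef]; push_cast; ring
  have hn0 : (0:ℝ) < n := by exact_mod_cast hn
  obtain ⟨t, ht⟩ := exists_quantiles hp.mP_le hp.le_left hp.support_left (k := 2 * n)
    (h := 1 / N) (by positivity) (by rw [← hNdef, mul_one_div_cancel hN.ne']; simp)
  obtain ⟨t', ht'⟩ := exists_quantiles hp.le_constraint hp.le_right hp.support_right (k := n)
    (h := 1 / N) (by positivity) (by
      rw [measureReal_def, sM_univ p.2.2, hN2, ENNReal.toReal_div]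
      simp only [ENNReal.toReal_one, ENNReal.toReal_ofNat]
      field_simp)
  obtain ⟨u, hu, huI, hgap⟩ := hcell t' ht'
  have huAS : ∀ j, sOf a (u j) ∈ Icc A S := fun j =>
    ⟨(ht'.mem j).1.trans (huI j).1, (huI j).2.trans (ht'.mem _).2⟩
  have hult : ∀ i j : Fin n, i < j → sOf a (u i) < sOf a (u j) := fun i j hij => by
    have h1 := hgap i j hij
    have h2 : ((i : ℕ) : ℝ) < (j : ℕ) := by exact_mod_cast hij
    have h3 : 0 < η * ((j : ℝ) - i) / N := by
      have : 0 < (j : ℝ) - i := by linarith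
      positivity
    linarith
  have hui : Function.Injective u := by
    intro i j hij
    by_contra hne
    rcases lt_or_gt_of_ne hne with h | h
    · exact (hult i j h).ne (by rw [hij])
    · exact (hult j i h).ne (by rw [hij])
  have hui' : Function.Injective fun j => (u j : ℝ) := Subtype.val_injective.comp hui
  set cc : ℝ≥0 := ((2 * n : ℕ) : ℝ≥0)⁻¹ with hcc
  have hccN : (cc : ℝ) * N = 1 := by
    rw [hcc, NNReal.coe_inv, NNReal.coe_natCast]
    exact inv_mul_cancel₀ hN.ne'
  have hcc0 : (0:ℝ) ≤ cc := cc.2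
  have hx0 : ∀ i : ℕ, 0 ≤ t i := fun i => hp.pos_left.le.trans (ht.mem i).1
  -- An arbitrary companion for `u`: its only use is to have a configuration following both
  -- measures, whose second empirical measure depends on `u` alone.
  obtain ⟨x₀, hx₀⟩ : ∃ x₀ : Fin (2 * n) → RPlus, ∀ i : Fin (2 * n), (x₀ i : ℝ) ∈ Icc (t i) (t (i + 1)) :=
    ⟨fun i => ⟨t (i + 1), hx0 _⟩, fun i => ⟨ht.mono (Nat.le_succ _) i.2, le_rfl⟩⟩
  obtain ⟨q₀, hq₀1, hq₀2⟩ := exists_pair (α := α) (a := a) hn (ω := (x₀, u)) hu hui'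
  have hfol : Follows a t t' ((x₀, u) : Config n) := ⟨hx₀, huI⟩
  have hq₀ : q₀ ∈ O' := hmem t t' ht ht' (x₀, u) hfol q₀ hq₀1 hq₀2
  have hus : us ((x₀, u) : Config n) = fun j => (u j : ℝ) := rfl
  have hnM := nM_eq_emp hq₀2
  rw [hus, ← hcc] at hnM
  obtain ⟨-, hE1, hE2⟩ := hq₀
  simp only [mem_ofPred_eq] at hE1 hE2
  rw [hnM] at hE1 hE2
  rw [enT_emp hL'] at hE2
  have huu : ∑ i, ∑ j, lk (u i) (u j) ≤ N ^ 2 * (I₂ + 2 * e) := by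
    have h1 := hD n u huAS hgap L' hL'
    have h2 : ∑ i, ∑ j, kT L' (u i) (u j) ≤ N ^ 2 * (I₂ + e) := by
      have h3 := mul_le_mul_of_nonneg_left hE2.le (sq_nonneg N)
      have h4 : N ^ 2 * (cc * cc * ∑ i, ∑ j, kT L' (u i) (u j)) =
          (cc * N) ^ 2 * ∑ i, ∑ j, kT L' (u i) (u j) := by ring
      rw [h4, hccN] at h3
      linarith
    have h3 : Real.exp ((D - L') / 2) * (4 * N ^ 2) ≤ e * N ^ 2 := by
      rw [← mul_assoc]; gcongr
    linarith
  -- The potential felt by the points x once the points u are frozen. The shift by b/2 makes it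
  -- nonnegative on the half-line, as Markov's inequality requires; it is subtracted again at the
  -- end.
  set G : ℝ → ℝ := fun x => pot a x - cc * ∑ j, kT L x (u j) + b / 2
  have hKc : Continuous fun x : ℝ => cc * ∑ j, kT L x (u j) :=
    continuous_const.mul (continuous_finsetSum _ fun j _ =>
      (continuous_kT L).comp (continuous_id.prodMk continuous_const))
  have hGc : Continuous G := ((continuous_pot a).sub hKc).add continuous_const
  have hG0 : ∀ x, 0 ≤ x → 0 ≤ G x := fun x hx => by
    have h1 : ∑ j, kT L x (u j) ≤ n * (absorb x + b) := by
      refine (Finset.sum_le_sum fun j _ => (kT_le_lk (by linarith [(hbu _ (huAS j)).1]) L).trans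
        ((hbu _ (huAS j)).2.2 x hx)).trans (le_of_eq ?_)
      rw [Finset.sum_const, Finset.card_univ, Fintype.card_fin, nsmul_eq_mul]
    have h2 := mul_le_mul_of_nonneg_left h1 hcc0
    have h3 : (cc : ℝ) * (n * (absorb x + b)) = 1 / 2 * (absorb x + b) := by
      rw [hN2] at hccN
      linear_combination (1 / 2 * (absorb x + b)) * hccN
    have h4 := le_pot ha x
    have h5 := absorb_nonneg x
    have h6 := abs_nonneg x
    simp only [G]
    linarith
  have hint : ∫ x, G x ∂mP p.1 ≤ V - I₃ + e + b / 2 := by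
    have i1 := integrable_of_continuousOn hp.support_left (continuous_pot a).continuousOn
    have i2 := integrable_of_continuousOn hp.support_left hKc.continuousOn
    have h1 : ∫ x, (cc : ℝ) * ∑ j, kT L x (u j) ∂mP p.1 =
        enT L (mP p.1) (emp cc fun j => (u j : ℝ)) := by
      rw [enT, integral_prod _ (integrable_kT hL _)]
      simp_rw [integral_emp, ENNReal.coe_toReal]
    have h2 : ∫ x, G x ∂mP p.1 = V - enT L (mP p.1) (emp cc fun j => (u j : ℝ)) + b / 2 := by
      simp only [G]
      have i3 : Integrable (fun x => pot a x - cc * ∑ j, kT L x (u j)) (mP p.1) := i1.sub i2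
      rw [integral_add i3 (integrable_const _), integral_sub i1 i2, h1, ← hV]
      simp
    linarith
  have haeG : 0 ≤ᵐ[mP p.1] G := by filter_upwards [ae_mP p.1] with x hx using hG0 x hx
  have hGi : Integrable G (mP p.1) := integrable_of_continuousOn hp.support_left hGc.continuousOn
  have hGint0 : 0 ≤ ∫ x, G x ∂mP p.1 := integral_nonneg_of_ae haeG
  have hI1 : 0 ≤ I₁ := ENNReal.toReal_nonneg
  have hw0 : 0 ≤ w := by simp only [w]; linarith
  have hwf : en (mP p.1) (mP p.1) + ∫⁻ x, ENNReal.ofReal (G x) ∂mP p.1 ≤ ENNReal.ofReal w := by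
    rw [← ofReal_integral_eq_lintegral_ofReal hGi haeG, ← ENNReal.ofReal_toReal hen1,
      ← ENNReal.ofReal_add hI1 hGint0]
    apply ENNReal.ofReal_le_ofReal
    simp only [w]; linarith
  rw [abs_of_nonneg hw0] at hfac
  obtain ⟨X, hXm, hX, hXv⟩ := le_volume_cells hC' hdens (by omega : 1 ≤ 2 * n) ht
    hGc.measurable.ennreal_ofReal hw0 he hwf
  have hXI : ∀ x ∈ X, ∀ i, (x i : ℝ) ∈ Icc δ B := fun x hx i =>
    ⟨(ht.mem i).1.trans ((hX x hx).1 i).1.le, ((hX x hx).1 i).2.trans (ht.mem _).2⟩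
  have hXinj : ∀ x ∈ X, Function.Injective x := fun x hx i j hij => by
    by_contra hne
    rcases lt_or_gt_of_ne hne with h | h
    · have := ht.lt_of_cells h j.2.le ((hX x hx).1 i) ((hX x hx).1 j)
      rw [hij] at this; exact lt_irrefl _ this
    · have := ht.lt_of_cells h i.2.le ((hX x hx).1 j) ((hX x hx).1 i)
      rw [hij] at this; exact lt_irrefl _ this
  have hXe : ∀ x ∈ X, energy a (x, u) ≤ (d + 4 * e) * N ^ 2 := by
    intro x hx
    have h1 := (hX x hx).2
    have k1 : ∀ i, ∑ j ∈ ({i} : Finset (Fin (2 * n)))ᶜ, kern (x i) (x j) =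
        ENNReal.ofReal (∑ j, lk (x i) (x j)) := fun i => by
      rw [Fintype.sum_eq_add_sum_compl i, lk_self, zero_add,
        ENNReal.ofReal_sum_of_nonneg fun j _ => lk_nonneg _ _]
      refine Finset.sum_congr rfl fun j hj => kern_of_ne fun h => ?_
      have : i = j := hXinj x hx (Subtype.ext h)
      simp [this] at hj
    have k2 : ∀ i, (((2 * n : ℕ) : ℝ≥0∞)) * ENNReal.ofReal (G (x i)) =
        ENNReal.ofReal (N * G (x i)) := fun i => by
      rw [ENNReal.ofReal_mul hN.le, ENNReal.ofReal_natCast]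
    simp_rw [k1, k2] at h1
    have hGx : ∀ i, 0 ≤ N * G (x i) := fun i => mul_nonneg hN.le (hG0 _ (x i).2)
    have hlk0 : ∀ i, 0 ≤ ∑ j, lk (x i) (x j) := fun i => Finset.sum_nonneg fun j _ => lk_nonneg _ _
    rw [← ENNReal.ofReal_sum_of_nonneg fun i _ => hlk0 i,
      ← ENNReal.ofReal_sum_of_nonneg fun i _ => hGx i,
      ← ENNReal.ofReal_add (Finset.sum_nonneg fun i _ => hlk0 i)
        (Finset.sum_nonneg fun i _ => hGx i), ENNReal.ofReal_le_ofReal_iff (by positivity)] at h1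
    have k3 : ∑ i, N * G (x i) = 2 * n * ∑ i, pot a (x i) - ∑ i, ∑ j, lk (x i) (u j) +
        N ^ 2 * (b / 2) := by
      have k4 : ∀ i, N * G (x i) = N * pot a (x i) - ∑ j, lk (x i) (u j) + N * (b / 2) := fun i => by
        have k5 : ∑ j, kT L (x i) (u j) = ∑ j, lk (x i) (u j) := by
          refine Finset.sum_congr rfl fun j _ => ?_
          have hne : (x i : ℝ) ≠ u j := by
            have : (0:ℝ) ≤ x i := (x i).2
            linarith [(hbu _ (huAS j)).1]
          rw [kT_eq_min hne, min_eq_left (hlkL _ (hXI x hx i) _ (huAS j))]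
        simp only [G]
        rw [k5]
        linear_combination (-∑ j, lk (x i) (u j)) * hccN
      rw [Finset.sum_congr rfl fun i _ => k4 i, Finset.sum_add_distrib, Finset.sum_sub_distrib,
        ← Finset.mul_sum, Finset.sum_const, Finset.card_univ, Fintype.card_fin, nsmul_eq_mul,
        ← hNdef, hN2]
      ring
    rw [k3] at h1
    unfold energy interact
    rw [Finset.sum_sub_distrib, Finset.sum_const, Finset.card_univ, Fintype.card_fin, nsmul_eq_mul,
      ← hNdef]
    have k6 : (2 * n : ℝ) * (∑ i, pot a (x i) - N * potConst a) =
        2 * n * ∑ i, pot a (x i) - N ^ 2 * potConst a := by rw [hN2]; ring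
    rw [k6]
    have k7 : (d + 4 * e) * N ^ 2 = N ^ 2 * (w + e) + N ^ 2 * (I₂ + 2 * e) - N ^ 2 * (b / 2) -
        N ^ 2 * potConst a := by rw [hdeq]; simp only [w]; ring
    linarith
  have hmain := hlow n hn ((d + 4 * e) * N ^ 2) X u hXm hu hui fun x hx =>
    ⟨hXI x hx, hXinj x hx, hXe x hx⟩
  have hsub : X ×ˢ {u} ⊆ event n O := by
    rintro ⟨x, v⟩ ⟨hx, rfl : v = u⟩
    obtain ⟨q, hq1, hq2⟩ := exists_pair (α := α) (a := a) hn (ω := (x, v)) hu hui'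
    have hfol' : Follows a t t' ((x, v) : Config n) :=
      ⟨fun i => ⟨((hX x hx).1 i).1.le, ((hX x hx).1 i).2⟩, huI⟩
    exact ⟨q, (hmem t t' ht ht' (x, v) hfol' q hq1 hq2).1, hq1, hq2⟩
  refine le_trans ?_ (hmain.trans (measure_mono hsub))
  have hvol : ENNReal.ofReal (e / (w + e) / (N * C') ^ (2 * n)) ≤
      Measure.pi (fun _ => lebP) X := by
    rw [ENNReal.ofReal_div_of_pos (by positivity)]
    refine ENNReal.div_le_of_le_mul' ?_
    rw [ENNReal.ofReal_pow (by positivity), ENNReal.ofReal_mul hN.le, ENNReal.ofReal_natCast,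
      ENNReal.ofReal_coe_nnreal]
    exact hXv
  have hinv : ENNReal.ofReal (N⁻¹ ^ n) = ((2 * n : ℕ) : ℝ≥0∞)⁻¹ ^ n := by
    rw [ENNReal.ofReal_pow (by positivity), ENNReal.ofReal_inv_of_pos hN, ENNReal.ofReal_natCast]
  have hprod : f₀ ^ n ≤ ∏ j, facM (u j) := by
    calc f₀ ^ n = ∏ j : Fin n, f₀ := by
          rw [Finset.prod_const, Finset.card_univ, Fintype.card_fin]
      _ ≤ _ := Finset.prod_le_prod (fun j _ => hf₀.le) fun j _ => (hbu _ (huAS j)).2.1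
  calc ENNReal.ofReal (Real.exp (-(c * N ^ 2)))
      = ENNReal.ofReal (Real.exp (-((d + 4 * e) * N ^ 2)) * Real.exp (-(4 * e * N ^ 2))) := by
        rw [← Real.exp_add]; congr 2; simp only [e]; ring
    _ ≤ ENNReal.ofReal (Real.exp (-((d + 4 * e) * N ^ 2)) * ((c₀ / N ^ r) ^ (2 * n) * f₀ ^ n *
          (e / (w + e) / (N * C') ^ (2 * n) * N⁻¹ ^ n))) := by gcongr
    _ = ENNReal.ofReal (Real.exp (-((d + 4 * e) * N ^ 2)) * (c₀ / N ^ r) ^ (2 * n) * f₀ ^ n) *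
          (ENNReal.ofReal (e / (w + e) / (N * C') ^ (2 * n)) * ENNReal.ofReal (N⁻¹ ^ n)) := by
        rw [← ENNReal.ofReal_mul (by positivity), ← ENNReal.ofReal_mul (by positivity)]
        congr 1; ring
    _ ≤ _ := by
        rw [hinv]
        gcongr

/-! ### Measures on the half-lines from measures on the line -/

theorem exists_mP_eq {m : Measure ℝ} [IsProbabilityMeasure m] (h : m (Iio 0) = 0) :
    ∃ μ : ProbabilityMeasure RPlus, mP μ = m := by
  have h1 : (m.comap Subtype.val : Measure RPlus).map Subtype.val = m := by
    rw [map_comap_subtype_coe measurableSet_Ici]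
    refine Measure.restrict_eq_self_of_ae_mem ?_
    rw [ae_iff]
    refine measure_mono_null (fun x hx => ?_) h
    exact not_le.mp (show ¬ (0:ℝ) ≤ x from hx)
  have h2 : IsProbabilityMeasure (m.comap Subtype.val : Measure RPlus) := ⟨by
    have := congrArg (fun m : Measure ℝ => m univ) h1
    simp only [Measure.map_apply measurable_subtype_coe MeasurableSet.univ, preimage_univ,
      measure_univ] at this
    exact this⟩
  exact ⟨⟨_, h2⟩, h1⟩

theorem le_lebP_of_mP_le {μ : ProbabilityMeasure RPlus} {C : ℝ≥0∞} (h : mP μ ≤ C • volume) :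
    (μ : Measure RPlus) ≤ C • lebP := by
  have he : MeasurableEmbedding (Subtype.val : RPlus → ℝ) :=
    MeasurableEmbedding.subtype_coe measurableSet_Ici
  refine Measure.le_iff.mpr fun s _ => ?_
  have h1 := h (Subtype.val '' s)
  rw [mP, he.map_apply, preimage_image_eq _ Subtype.val_injective] at h1
  rwa [Measure.smul_apply, lebP, he.comap_apply]

theorem tendsto_of_mP {μ : ℕ → ProbabilityMeasure RPlus} {μ₀ : ProbabilityMeasure RPlus}
    (h : ∀ f : BoundedContinuousFunction ℝ ℝ,
      Tendsto (fun k => ∫ x, f x ∂mP (μ k)) atTop (𝓝 (∫ x, f x ∂mP μ₀))) :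
    Tendsto μ atTop (𝓝 μ₀) := by
  rw [ProbabilityMeasure.tendsto_iff_forall_integral_tendsto]
  intro f
  have hpc : Continuous (projIci (0:ℝ)) := Continuous.subtype_mk (continuous_const.max continuous_id) _
  have key : ∀ μ : ProbabilityMeasure RPlus, ∫ x, f x ∂(μ : Measure RPlus) =
      ∫ x, f.compContinuous ⟨projIci (0:ℝ), hpc⟩ x ∂mP μ := fun μ => by
    rw [mP, integral_map measurable_subtype_coe.aemeasurable
      (BoundedContinuousFunction.continuous _).aestronglyMeasurable]
    simp only [BoundedContinuousFunction.compContinuous_apply, ContinuousMap.coe_mk, projIci_coe]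
  simp_rw [key]
  exact h _

theorem exists_sM_eq {a : ℝ} (ha : 0 < a) {m : Measure ℝ} [IsFiniteMeasure m] (h : m (Iio 0) = 0) :
    ∃ ν : FiniteMeasure RMinus, sM a ν = m := by
  refine ⟨⟨m.map (uOf a), inferInstance⟩, ?_⟩
  change (m.map (uOf a)).map (sOf a) = m
  rw [Measure.map_map (continuous_sOf a).measurable (continuous_uOf a).measurable]
  have h1 : sOf a ∘ uOf a =ᵐ[m] id := by
    have : ∀ᵐ s ∂m, 0 ≤ s := by
      rw [ae_iff]
      simp only [not_le]
      exact h
    filter_upwards [this] with s hs using sOf_uOf ha hs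
  rw [Measure.map_congr h1, Measure.map_id]

theorem nM_eq_map {a : ℝ} (ha : 0 < a) (ν : FiniteMeasure RMinus) :
    nM ν = (sM a ν).map fun s => (uOf a s : ℝ) := by
  have hm : Measurable fun s => (uOf a s : ℝ) :=
    measurable_subtype_coe.comp (continuous_uOf a).measurable
  rw [sM, Measure.map_map hm (continuous_sOf a).measurable, nM]
  congr 1
  funext u
  exact (congrArg Subtype.val (uOf_sOf ha u)).symm

theorem mem_constrained_of_sM {a : ℝ} (ha : 0 < a) {ν : FiniteMeasure RMinus}
    (h : sM a ν ≤ volume) (hm : sM a ν univ = 1 / 2) : ν ∈ constrained (sigma a) := by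
  refine ⟨?_, le_sigma_of_map_sOf_le ha h⟩
  rw [← ENNReal.coe_inj, FiniteMeasure.ennreal_mass]
  rw [sM, Measure.map_apply (continuous_sOf a).measurable MeasurableSet.univ, preimage_univ] at hm
  rw [hm]
  simp

theorem sM_Iio (a : ℝ) (ν : FiniteMeasure RMinus) : sM a ν (Iio 0) = 0 := by
  rw [sM, Measure.map_apply (continuous_sOf a).measurable measurableSet_Iio]
  have : sOf a ⁻¹' Iio 0 = ∅ := by
    ext u
    simpa using sOf_nonneg a u
  rw [this, measure_empty]

theorem tendsto_of_sM {α a : ℝ} (ha : 0 < a) {ν : ℕ → E α a} {ν₀ : E α a}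
    (h : ∀ f : BoundedContinuousFunction ℝ ℝ,
      Tendsto (fun k => ∫ x, f x ∂sM a (ν k)) atTop (𝓝 (∫ x, f x ∂sM a ν₀))) :
    Tendsto ν atTop (𝓝 ν₀) := by
  rw [tendsto_subtype_rng, FiniteMeasure.tendsto_iff_forall_integral_tendsto]
  intro f
  have key : ∀ ν : FiniteMeasure RMinus, ∫ x, f x ∂(ν : Measure RMinus) =
      ∫ x, f.compContinuous ⟨uOf a, continuous_uOf a⟩ x ∂sM a ν := fun ν => by
    rw [sM, integral_map (continuous_sOf a).measurable.aemeasurable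
      (BoundedContinuousFunction.continuous _).aestronglyMeasurable]
    simp only [BoundedContinuousFunction.compContinuous_apply, ContinuousMap.coe_mk, uOf_sOf ha]
  simp_rw [key]
  exact h _

/-! ### Closure of the set of pairs where the lower bound holds -/

/-- The large deviation lower bound holds around `p`. -/
def LowerBound (α a : ℝ) (p : ProbabilityMeasure RPlus × E α a) : Prop :=
  ∀ O : Set (ProbabilityMeasure RPlus × E α a), IsOpen O → p ∈ O → ∀ c : ℝ,
    J a p.1 p.2 < (c : EReal) → ∀ᶠ n : ℕ in atTop,
      ENNReal.ofReal (Real.exp (-(c * ((2 * n : ℕ) : ℝ) ^ 2))) ≤ unnorm α a n (event n O)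

/-- All the terms of the rate function are finite. -/
def FiniteTerms (a : ℝ) (μ : ProbabilityMeasure RPlus) (ν : FiniteMeasure RMinus) : Prop :=
  en (mP μ) (mP μ) ≠ ⊤ ∧ en (nM ν) (nM ν) ≠ ⊤ ∧ potInt a (mP μ) ≠ ⊤

theorem lowerBound_of_finiteTerms {α a : ℝ} (ha : 0 < a) {p : ProbabilityMeasure RPlus × E α a}
    (h : FiniteTerms a p.1 p.2 → LowerBound α a p) : LowerBound α a p := by
  intro O hO hp c hc
  by_cases hf : FiniteTerms a p.1 p.2
  · exact h hf O hO hp c hc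
  · rw [J_eq_top ha p.1 p.2.2 hf] at hc
    exact absurd hc (not_lt.mpr le_top)

theorem eventually_le_add_of_tendsto {y x : ℕ → ℝ≥0∞} {z : ℝ≥0∞} (hz : z ≠ ⊤)
    (hy : Tendsto y atTop (𝓝 z)) (hx : ∀ᶠ k in atTop, x k ≤ y k) {η : ℝ} (hη : 0 < η) :
    ∀ᶠ k in atTop, x k ≠ ⊤ ∧ (x k).toReal ≤ z.toReal + η := by
  have h1 : z < z + ENNReal.ofReal η :=
    ENNReal.lt_add_right hz (by simpa using hη)
  have hne : z + ENNReal.ofReal η ≠ ⊤ := ENNReal.add_ne_top.mpr ⟨hz, ENNReal.ofReal_ne_top⟩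
  filter_upwards [hy.eventually_lt_const h1, hx] with k h2 h3
  have h4 := h3.trans h2.le
  refine ⟨ne_top_of_le_ne_top hne h4, ?_⟩
  have := ENNReal.toReal_mono hne h4
  rwa [ENNReal.toReal_add hz ENNReal.ofReal_ne_top, ENNReal.toReal_ofReal hη.le] at this

/-- Upper bounds suffice for the three positive terms of the rate. The mutual energy, entering with
a minus sign, must be bounded below along the sequence, and for this one continuous truncation of it
is enough. -/
theorem lowerBound_of_tendsto {α a : ℝ} (ha : 0 < a)
    {p : ℕ → ProbabilityMeasure RPlus × E α a} {q : ProbabilityMeasure RPlus × E α a}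
    (hq : FiniteTerms a q.1 q.2) (hpq : Tendsto p atTop (𝓝 q))
    (hp : ∀ᶠ k in atTop, LowerBound α a (p k)) {y₁ y₂ y₃ : ℕ → ℝ≥0∞}
    (h₁ : Tendsto y₁ atTop (𝓝 (en (mP q.1) (mP q.1))))
    (h₁' : ∀ᶠ k in atTop, en (mP (p k).1) (mP (p k).1) ≤ y₁ k)
    (h₂ : Tendsto y₂ atTop (𝓝 (en (nM q.2) (nM q.2))))
    (h₂' : ∀ᶠ k in atTop, en (nM (p k).2) (nM (p k).2) ≤ y₂ k)
    (h₃ : Tendsto y₃ atTop (𝓝 (potInt a (mP q.1))))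
    (h₃' : ∀ᶠ k in atTop, potInt a (mP (p k).1) ≤ y₃ k) : LowerBound α a q := by
  intro O hO hqO c hc
  obtain ⟨f1, f2, f3⟩ := hq
  rw [J_eq ha q.1 q.2.2 f1 f2 f3, EReal.coe_lt_coe_iff] at hc
  set d := Jreal a (mP q.1) (nM q.2) with hd
  set η := (c - d) / 6
  have hη : 0 < η := by simp only [η]; linarith
  have f4 := en_nM_ne_top q.2.2 f1 f2
  obtain ⟨L, hL⟩ := ((tendsto_enT f4).eventually_const_lt
    (show (en (mP q.1) (nM q.2)).toReal - η < (en (mP q.1) (nM q.2)).toReal by linarith)).exists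
  have hL0 : (0:ℝ) ≤ L := Nat.cast_nonneg L
  have hcont : Continuous fun p : ProbabilityMeasure RPlus × E α a =>
      enT L (mP p.1) (nM p.2) := by
    have c1 : Continuous fun p : ProbabilityMeasure RPlus × E α a => pP p.1 :=
      continuous_pP.comp continuous_fst
    have c2 : Continuous fun p : ProbabilityMeasure RPlus × E α a => pM p.2 :=
      continuous_pM.comp continuous_snd
    simp_rw [nM_eq_smul_pM, enT_smul_right _ (1 / 2), ← coe_pP]
    exact continuous_const.mul ((continuous_enT hL0).comp (c1.prodMk c2))
  have hmut := ((hcont.tendsto q).comp hpq).eventually_const_lt hL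
  obtain ⟨k, hkO, hkL, hk1, hk2, hk3, hk4⟩ := ((hpq.eventually (hO.mem_nhds hqO)).and (hp.and
    ((eventually_le_add_of_tendsto f1 h₁ h₁' hη).and ((eventually_le_add_of_tendsto f2 h₂ h₂' hη).and
    ((eventually_le_add_of_tendsto f3 h₃ h₃' hη).and hmut))))).exists
  refine hkL O hO hkO c ?_
  have g4 := en_nM_ne_top (p k).2.2 hk1.1 hk2.1
  have hm : enT L (mP (p k).1) (nM (p k).2) ≤ (en (mP (p k).1) (nM (p k).2)).toReal :=
    (ENNReal.ofReal_le_iff_le_toReal g4).mp (ofReal_enT_le_en hL0 _ _)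
  rw [J_eq ha (p k).1 (p k).2.2 hk1.1 hk2.1 hk3.1, EReal.coe_lt_coe_iff]
  have hk4' : (en (mP q.1) (nM q.2)).toReal - η < enT L (mP (p k).1) (nM (p k).2) := hk4
  have e1 := hk1.2
  have e2 := hk2.2
  have e3 := hk3.2
  have e4 : d = c - 6 * η := by simp only [η]; ring
  rw [Jreal] at hd ⊢
  linarith

/-! ### Regularization of a measure on `ℝ_+` -/

/-- The uniform probability measure on `[0, 1]`. -/
abbrev unif : Measure ℝ := volume.restrict (Icc 0 1)

instance : IsProbabilityMeasure unif := ⟨by simp [unif]⟩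

/-- The average of the translates of a measure by the points of `[0, h]`. -/
def moll (m : Measure ℝ) (h : ℝ) : Measure ℝ := (m.prod unif).map fun z => z.1 + h * z.2

theorem measurable_add_mul (h : ℝ) : Measurable fun z : ℝ × ℝ => z.1 + h * z.2 := by fun_prop

instance (m : Measure ℝ) [IsProbabilityMeasure m] (h : ℝ) : IsProbabilityMeasure (moll m h) :=
  Measure.isProbabilityMeasure_map (measurable_add_mul h).aemeasurable

theorem lintegral_moll (m : Measure ℝ) [SFinite m] (h : ℝ) {g : ℝ → ℝ≥0∞} (hg : Measurable g) :
    ∫⁻ x, g x ∂moll m h = ∫⁻ s, ∫⁻ x, g (x + h * s) ∂m ∂unif := by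
  rw [moll, lintegral_map hg (measurable_add_mul h)]
  exact lintegral_prod_symm (fun z => g (z.1 + h * z.2)) (hg.comp (measurable_add_mul h)).aemeasurable

theorem ae_unif : ∀ᵐ s ∂unif, s ∈ Icc (0:ℝ) 1 := ae_restrict_mem measurableSet_Icc

theorem moll_compl_Icc {m : Measure ℝ} [SFinite m] {A B h : ℝ} (hm : m (Icc A B)ᶜ = 0) (h0 : 0 ≤ h) :
    moll m h (Icc A (B + h))ᶜ = 0 := by
  have h1 : ∀ᵐ x ∂m, x ∈ Icc A B := by rw [ae_iff]; exact hm
  have h2 := Measure.quasiMeasurePreserving_fst (μ := m) (ν := unif) |>.ae h1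
  have h3 := Measure.quasiMeasurePreserving_snd (μ := m) (ν := unif) |>.ae ae_unif
  rw [moll, Measure.map_apply (measurable_add_mul h) measurableSet_Icc.compl]
  change (m.prod unif) {z | ¬ (z.1 + h * z.2 ∈ Icc A (B + h))} = 0
  rw [← ae_iff]
  filter_upwards [h2, h3] with z h4 h5
  have h6 : 0 ≤ h * z.2 := mul_nonneg h0 h5.1
  have h7 : h * z.2 ≤ h := mul_le_of_le_one_right h0 h5.2
  exact ⟨by linarith [h4.1], by linarith [h4.2]⟩

theorem moll_le (m : Measure ℝ) [IsProbabilityMeasure m] {h : ℝ} (h0 : 0 < h) :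
    moll m h ≤ ENNReal.ofReal (1 / h) • volume := by
  refine Measure.le_iff.mpr fun s hs => ?_
  rw [moll, Measure.map_apply (measurable_add_mul h) hs,
    Measure.prod_apply (measurable_add_mul h hs)]
  calc _ ≤ ∫⁻ x, ENNReal.ofReal (1 / h) * volume s ∂m := by
        refine lintegral_mono fun x => ?_
        have h1 : Prod.mk x ⁻¹' ((fun z : ℝ × ℝ => z.1 + h * z.2) ⁻¹' s) =
            (fun t => h * t) ⁻¹' ((fun t => x + t) ⁻¹' s) := rfl
        rw [h1]
        refine (Measure.restrict_apply_le _ _).trans ?_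
        rw [Real.volume_preimage_mul_left h0.ne', measure_preimage_add, abs_of_pos (by positivity),
          one_div]
    _ = _ := by simp

/-- Equivalent to 1 + (x+r)² ≤ (1 + x²) exp(2r). -/
theorem hlog_add_le {x r : ℝ} (hr : 0 ≤ r) : hlog (x + r) ≤ hlog x + r := by
  have h1 := Real.quadratic_le_exp_of_nonneg (show 0 ≤ 2 * r by linarith)
  have h2 : 1 + (x + r) ^ 2 ≤ (1 + x ^ 2) * Real.exp (2 * r) := by
    have : (1 + x ^ 2) * (1 + 2 * r + (2 * r) ^ 2 / 2) ≤ (1 + x ^ 2) * Real.exp (2 * r) := by gcongr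
    nlinarith [mul_nonneg hr (sq_nonneg (1 - x)), sq_nonneg r, mul_nonneg hr (sq_nonneg x),
      mul_nonneg (sq_nonneg r) (sq_nonneg x)]
  have h3 := Real.log_le_log (by positivity) h2
  rw [Real.log_mul (by positivity) (Real.exp_pos _).ne', Real.log_exp] at h3
  unfold hlog
  linarith

/-- A common translation leaves |x - y| unchanged, so only the weights `hlog` move. -/
theorem kern_add_le {x y r : ℝ} (hx : 0 ≤ x) (hy : 0 ≤ y) (hr : 0 ≤ r) :
    kern (x + r) (y + r) ≤ kern x y + ENNReal.ofReal (2 * r) := by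
  by_cases hxy : x = y
  · rw [hxy, kern_self y]; simp
  rw [kern_of_ne hxy, kern_of_ne (by simpa using hxy),
    ← ENNReal.ofReal_add (lk_nonneg _ _) (by linarith)]
  apply ENNReal.ofReal_le_ofReal
  rw [lk_eq hxy, lk_eq (by simpa using hxy), add_sub_add_right_eq_sub]
  have h1 := hlog_add_le (x := x) hr
  have h2 := hlog_add_le (x := y) hr
  unfold hlog at h1 h2
  linarith

theorem en_map_add_le {m : Measure ℝ} [IsProbabilityMeasure m] (hm : ∀ᵐ x ∂m, 0 ≤ x) {r : ℝ}
    (hr : 0 ≤ r) : en (m.map (· + r)) (m.map (· + r)) ≤ en m m + ENNReal.ofReal (2 * r) := by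
  have ha : Measurable fun x : ℝ => x + r := measurable_add_const r
  rw [en, Measure.map_prod_map m m ha ha, lintegral_map measurable_kern (ha.prodMap ha)]
  have h1 := Measure.quasiMeasurePreserving_fst (μ := m) (ν := m) |>.ae hm
  have h2 := Measure.quasiMeasurePreserving_snd (μ := m) (ν := m) |>.ae hm
  calc _ ≤ ∫⁻ z, (kern z.1 z.2 + ENNReal.ofReal (2 * r)) ∂m.prod m := by
        refine lintegral_mono_ae ?_
        filter_upwards [h1, h2] with z h3 h4 using kern_add_le h3 h4 hr
    _ = _ := by rw [lintegral_add_left measurable_kern]; simp [en]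

theorem en_moll_left (m n : Measure ℝ) [SFinite m] [SFinite n] (h : ℝ) :
    en (moll m h) n = ∫⁻ s, en (m.map (· + h * s)) n ∂unif := by
  have : SFinite (moll m h) := by unfold moll; infer_instance
  rw [en, lintegral_prod _ measurable_kern.aemeasurable,
    lintegral_moll m h measurable_kern.lintegral_prod_right']
  refine lintegral_congr fun s => ?_
  rw [en, lintegral_prod _ measurable_kern.aemeasurable,
    lintegral_map measurable_kern.lintegral_prod_right' (measurable_add_const _)]

/-- The mollified measure is a mean of translates. By positivity the mutual energy of two translates
is at most the mean of their self-energies, and each of these has grown by at most 2h. -/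
theorem en_moll_le {m : Measure ℝ} [IsProbabilityMeasure m] (hm : ∀ᵐ x ∂m, 0 ≤ x) {h : ℝ}
    (h0 : 0 ≤ h) : en (moll m h) (moll m h) ≤ en m m + ENNReal.ofReal (2 * h) := by
  have hprob : ∀ s, IsProbabilityMeasure (m.map (· + h * s)) := fun s =>
    Measure.isProbabilityMeasure_map (measurable_add_const _).aemeasurable
  have key : ∀ s ∈ Icc (0:ℝ) 1, ∀ s' ∈ Icc (0:ℝ) 1,
      en (m.map (· + h * s')) (m.map (· + h * s)) ≤ en m m + ENNReal.ofReal (2 * h) := by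
    intro s hs s' hs'
    have h1 : ∀ s ∈ Icc (0:ℝ) 1, en (m.map (· + h * s)) (m.map (· + h * s)) ≤
        en m m + ENNReal.ofReal (2 * h) := fun s hs => by
      refine (en_map_add_le hm (mul_nonneg h0 hs.1)).trans ?_
      gcongr
      exact mul_le_of_le_one_right h0 hs.2
    have h2 := two_mul_en_le (m.map (· + h * s')) (m.map (· + h * s)) (by simp)
    have h3 := h2.trans (add_le_add (h1 s' hs') (h1 s hs))
    rw [← two_mul] at h3
    exact (ENNReal.mul_le_mul_iff_right two_ne_zero (by simp)).mp h3
  rw [en_moll_left]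
  calc _ ≤ ∫⁻ _, (en m m + ENNReal.ofReal (2 * h)) ∂unif := by
        refine lintegral_mono_ae (ae_unif.mono fun s hs => ?_)
        rw [en_comm, en_moll_left]
        calc _ ≤ ∫⁻ _, (en m m + ENNReal.ofReal (2 * h)) ∂unif :=
              lintegral_mono_ae (ae_unif.mono fun s' hs' => key s hs s' hs')
          _ = _ := by simp
    _ = _ := by simp

/-- The square root and the logarithm enter with a minus sign and increase, so only the linear term
contributes. -/
theorem pot_add_le {a x r : ℝ} (ha : 0 < a) (hx : 0 ≤ x) (hr : 0 ≤ r) :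
    pot a (x + r) ≤ pot a x + r := by
  unfold pot
  rw [abs_of_nonneg hx, abs_of_nonneg (add_nonneg hx hr)]
  have h1 : √(a * x) ≤ √(a * (x + r)) := Real.sqrt_le_sqrt (by gcongr; linarith)
  have h2 : Real.log (1 + x ^ 2) ≤ Real.log (1 + (x + r) ^ 2) := by gcongr; linarith
  linarith

theorem potInt_moll_le {a : ℝ} (ha : 0 < a) {m : Measure ℝ} [IsProbabilityMeasure m]
    (hm : ∀ᵐ x ∂m, 0 ≤ x) {h : ℝ} (h0 : 0 ≤ h) :
    potInt a (moll m h) ≤ potInt a m + ENNReal.ofReal h := by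
  have hpm : Measurable fun x => ENNReal.ofReal (pot a x) :=
    (continuous_pot a).measurable.ennreal_ofReal
  rw [potInt, lintegral_moll m h hpm]
  calc _ ≤ ∫⁻ _, (potInt a m + ENNReal.ofReal h) ∂unif := by
        refine lintegral_mono_ae (ae_unif.mono fun s hs => ?_)
        calc _ ≤ ∫⁻ x, (ENNReal.ofReal (pot a x) + ENNReal.ofReal h) ∂m := by
              refine lintegral_mono_ae (hm.mono fun x hx => ?_)
              rw [← ENNReal.ofReal_add (pot_nonneg ha x) h0]
              apply ENNReal.ofReal_le_ofReal
              have := pot_add_le ha hx (mul_nonneg h0 hs.1)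
              have : h * s ≤ h := mul_le_of_le_one_right h0 hs.2
              linarith
          _ = _ := by rw [lintegral_add_left hpm]; simp [potInt]
    _ = _ := by simp

theorem tendsto_integral_moll (m : Measure ℝ) [IsProbabilityMeasure m] {h : ℕ → ℝ}
    (hh : Tendsto h atTop (𝓝 0)) (f : BoundedContinuousFunction ℝ ℝ) :
    Tendsto (fun k => ∫ x, f x ∂moll m (h k)) atTop (𝓝 (∫ x, f x ∂m)) := by
  have h1 : ∀ k, ∫ x, f x ∂moll m (h k) = ∫ z, f (z.1 + h k * z.2) ∂m.prod unif := fun k =>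
    integral_map (measurable_add_mul _).aemeasurable f.continuous.aestronglyMeasurable
  have h2 : ∫ x, f x ∂m = ∫ z, f z.1 ∂m.prod unif := by
    rw [integral_fun_fst]; simp
  simp_rw [h1, h2]
  refine tendsto_integral_of_dominated_convergence (fun _ => ‖f‖) (fun k => ?_)
    (integrable_const _) (fun k => .of_forall fun z => f.norm_coe_le_norm _)
    (.of_forall fun z => ?_)
  · exact (f.continuous.comp (by fun_prop)).aestronglyMeasurable
  · refine (f.continuous.tendsto _).comp ?_
    have := (hh.mul_const z.2).const_add z.1
    simpa using this

/-- The lower bound at a pair of measures with compact supports away from the origin, the second of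
which is strictly below the constraint. -/
theorem lowerBound_of_compact {α a : ℝ} (hα : 0 ≤ α) (ha : 0 < a)
    {p : ProbabilityMeasure RPlus × E α a} {δ B A S : ℝ} {ε : ℝ≥0} (hδ : 0 < δ) (hδB : δ ≤ B)
    (hP : mP p.1 (Icc δ B)ᶜ = 0) (hA : 0 < A) (hAS : A ≤ S) (hM : sM a p.2 (Icc A S)ᶜ = 0)
    (hε0 : 0 < ε) (hε1 : ε < 1) (hle : sM a p.2 ≤ ((1 - ε : ℝ≥0) : ℝ≥0∞) • volume) :
    LowerBound α a p := by
  refine lowerBound_of_finiteTerms ha fun hfin => ?_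
  set h : ℕ → ℝ := fun k => 1 / ((k : ℝ) + 1)
  have h0 : ∀ k, 0 < h k := fun k => by simp only [h]; positivity
  have hh : Tendsto h atTop (𝓝 0) := tendsto_one_div_add_atTop_nhds_zero_nat
  have hsupp : ∀ k, moll (mP p.1) (h k) (Icc δ (B + h k))ᶜ = 0 := fun k =>
    moll_compl_Icc hP (h0 k).le
  have hex : ∀ k, ∃ μ : ProbabilityMeasure RPlus, mP μ = moll (mP p.1) (h k) := fun k =>
    exists_mP_eq <| measure_mono_null (show Iio (0:ℝ) ⊆ (Icc δ (B + h k))ᶜ from fun x hx hx' => by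
      linarith [hx'.1, show x < 0 from hx]) (hsupp k)
  choose μ hμ using hex
  have hconv : Tendsto μ atTop (𝓝 p.1) := tendsto_of_mP fun f => by
    simp_rw [hμ]
    exact tendsto_integral_moll _ hh f
  have hlim : ∀ (z : ℝ≥0∞) (C : ℝ), Tendsto (fun k => z + ENNReal.ofReal (C * h k)) atTop (𝓝 z) :=
    fun z C => by
      have h1 : Tendsto (fun k => ENNReal.ofReal (C * h k)) atTop (𝓝 0) := by
        rw [← ENNReal.ofReal_zero]
        refine ENNReal.tendsto_ofReal ?_
        simpa using hh.const_mul C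
      simpa using tendsto_const_nhds.add h1
  refine lowerBound_of_tendsto ha (p := fun k => (μ k, p.2)) hfin
    (hconv.prodMk_nhds tendsto_const_nhds) (.of_forall fun k => ?_)
    (hlim _ 2) (.of_forall fun k => ?_) tendsto_const_nhds (.of_forall fun k => le_rfl)
    (hlim _ 1) (.of_forall fun k => ?_)
  · have hn : IsNice a (μ k) p.2 δ (B + h k) A S (Real.toNNReal (1 / h k)) ε :=
      { pos_left := hδ
        le_left := by linarith [h0 k]
        support_left := by rw [hμ]; exact hsupp k
        le_density := le_lebP_of_mP_le (by rw [hμ]; exact moll_le _ (h0 k))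
        pos_right := hA
        le_right := hAS
        support_right := hM
        eps_pos := hε0
        eps_lt := hε1
        le_constraint := hle }
    intro O hO hpO c hc
    exact eventually_le_unnorm_of_isNice hα ha (p := (μ k, p.2)) hn hO hpO hc
  · simp only [hμ]
    exact en_moll_le (ae_mP p.1) (h0 k).le
  · simp only [hμ, one_mul]
    exact potInt_moll_le ha (ae_mP p.1) (h0 k).le

/-! ### Truncation of a measure on `(0, ∞)` -/

/-- An exhaustion of `(0, ∞)` by compact intervals. -/
def window (k : ℕ) : Set ℝ := Icc (1 / ((k : ℝ) + 1)) ((k : ℝ) + 1)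

theorem measurableSet_window (k : ℕ) : MeasurableSet (window k) := measurableSet_Icc

theorem monotone_window : Monotone window := fun k l hkl => by
  have h1 : (k : ℝ) ≤ l := by exact_mod_cast hkl
  exact Icc_subset_Icc (by gcongr) (by linarith)

theorem iUnion_window : ⋃ k, window k = Ioi (0:ℝ) := by
  ext x
  simp only [mem_iUnion, mem_Ioi]
  constructor
  · rintro ⟨k, hk⟩
    exact lt_of_lt_of_le (by positivity) hk.1
  · intro hx
    obtain ⟨k, hk⟩ := exists_nat_one_div_lt hx
    obtain ⟨l, hl⟩ := exists_nat_ge x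
    refine ⟨max k l, monotone_window (le_max_left k l) |> fun _ => ⟨?_, ?_⟩⟩
    · refine le_trans ?_ hk.le
      have : (k : ℝ) ≤ (max k l : ℕ) := by exact_mod_cast le_max_left k l
      gcongr
    · have : (l : ℝ) ≤ (max k l : ℕ) := by exact_mod_cast le_max_right k l
      linarith

section

variable {m : Measure ℝ}

/-- The factor restoring the mass of a truncated measure. -/
def truncFactor (m : Measure ℝ) (k : ℕ) : ℝ≥0∞ := m univ * (m (window k))⁻¹

/-- The restriction of a measure to a compact interval, with the same total mass. -/
def trunc (m : Measure ℝ) (k : ℕ) : Measure ℝ := truncFactor m k • m.restrict (window k)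

theorem trunc_le (k : ℕ) : trunc m k ≤ truncFactor m k • m := by
  refine Measure.le_iff.mpr fun s _ => ?_
  simp only [trunc, Measure.smul_apply, smul_eq_mul]
  exact mul_le_mul_right (Measure.restrict_apply_le _ _) _

theorem trunc_compl_window (k : ℕ) : trunc m k (window k)ᶜ = 0 := by
  simp [trunc, Measure.restrict_apply (measurableSet_window k).compl]

theorem restrict_Ioi_of_null (h : m (Iic 0) = 0) : m.restrict (Ioi 0) = m := by
  refine Measure.restrict_eq_self_of_ae_mem ?_
  rw [ae_iff]
  simp only [mem_Ioi, not_lt]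
  exact h

theorem tendsto_measure_window (h : m (Iic 0) = 0) :
    Tendsto (fun k => m (window k)) atTop (𝓝 (m univ)) := by
  have h1 := tendsto_measure_iUnion_atTop (μ := m) monotone_window
  rwa [iUnion_window, ← Measure.restrict_apply_univ, restrict_Ioi_of_null h] at h1

theorem eventually_measure_window_ne_zero (h : m (Iic 0) = 0) (h0 : m univ ≠ 0) :
    ∀ᶠ k in atTop, m (window k) ≠ 0 :=
  (tendsto_measure_window h).eventually_ne h0

variable [IsFiniteMeasure m]

theorem tendsto_truncFactor (h : m (Iic 0) = 0) (h0 : m univ ≠ 0) :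
    Tendsto (truncFactor m) atTop (𝓝 1) := by
  rw [← ENNReal.mul_inv_cancel h0 (measure_ne_top m univ)]
  exact ENNReal.Tendsto.const_mul (tendsto_measure_window h).inv (.inr (measure_ne_top m univ))

theorem trunc_univ {k : ℕ} (hk : m (window k) ≠ 0) : trunc m k univ = m univ := by
  rw [trunc, Measure.smul_apply, Measure.restrict_apply_univ, smul_eq_mul, truncFactor, mul_assoc,
    ENNReal.inv_mul_cancel hk (measure_ne_top _ _), mul_one]

theorem tendsto_integral_trunc (h : m (Iic 0) = 0) (h0 : m univ ≠ 0)
    (f : BoundedContinuousFunction ℝ ℝ) :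
    Tendsto (fun k => ∫ x, f x ∂trunc m k) atTop (𝓝 (∫ x, f x ∂m)) := by
  have h1 := tendsto_setIntegral_of_monotone (μ := m) (f := f) measurableSet_window monotone_window
    (f.integrable m).integrableOn
  rw [iUnion_window, restrict_Ioi_of_null h] at h1
  have h2 := (ENNReal.tendsto_toReal ENNReal.one_ne_top).comp (tendsto_truncFactor h h0)
  have h3 := h2.mul h1
  simp only [ENNReal.toReal_one, one_mul] at h3
  refine h3.congr fun k => ?_
  rw [trunc, integral_smul_measure]
  rfl

theorem tendsto_mul_truncFactor (h : m (Iic 0) = 0) (h0 : m univ ≠ 0) (z : ℝ≥0∞) :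
    Tendsto (fun k => truncFactor m k * z) atTop (𝓝 z) := by
  simpa using ENNReal.Tendsto.mul_const (b := z) (tendsto_truncFactor h h0) (.inl one_ne_zero)

theorem tendsto_truncFactor_mul_mul (h : m (Iic 0) = 0) (h0 : m univ ≠ 0) (z : ℝ≥0∞) :
    Tendsto (fun k => truncFactor m k * (truncFactor m k * z)) atTop (𝓝 z) := by
  have h1 := tendsto_truncFactor h h0
  have := ENNReal.Tendsto.mul_const (b := z)
    (ENNReal.Tendsto.mul h1 (.inl one_ne_zero) h1 (.inl one_ne_zero)) (.inl (by simp))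
  simpa [mul_assoc] using this

end

theorem en_le_of_le_smul {m n : Measure ℝ} [SFinite m] [SFinite n] {c : ℝ≥0∞} (h : n ≤ c • m) :
    en n n ≤ c * (c * en m m) := by
  rw [← en_smul_right, ← en_smul_left]
  exact en_mono h h

theorem potInt_le_of_le_smul {a : ℝ} {m n : Measure ℝ} {c : ℝ≥0∞} (h : n ≤ c • m) :
    potInt a n ≤ c * potInt a m := by
  unfold potInt
  rw [← smul_eq_mul, ← lintegral_smul_measure]
  exact lintegral_mono' h le_rfl

theorem nM_le_of_sM_le {a : ℝ} (ha : 0 < a) {ν ν' : FiniteMeasure RMinus} {c : ℝ≥0∞}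
    (h : sM a ν' ≤ c • sM a ν) : nM ν' ≤ c • nM ν := by
  have hm : Measurable fun s => (uOf a s : ℝ) :=
    measurable_subtype_coe.comp (continuous_uOf a).measurable
  rw [nM_eq_map ha, nM_eq_map ha, ← Measure.map_smul]
  exact Measure.map_mono h hm

/-- The lower bound at a pair of measures, the second of which is strictly below the constraint. -/
theorem lowerBound_of_le {α a : ℝ} (hα : 0 ≤ α) (ha : 0 < a)
    {p : ProbabilityMeasure RPlus × E α a} {ε : ℝ≥0} (hε0 : 0 < ε) (hε1 : ε < 1)
    (hle : sM a p.2 ≤ ((1 - ε : ℝ≥0) : ℝ≥0∞) • volume) : LowerBound α a p := by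
  refine lowerBound_of_finiteTerms ha fun hfin => ?_
  -- Finite energy excludes an atom at 0, so the windows exhaust the mass of μ; for ν this follows
  -- from the bounded density.
  have hP : mP p.1 (Iic 0) = 0 := by
    refine measure_mono_null Iio_union_right.ge (measure_union_null ?_ (by_contra fun h =>
      hfin.1 (en_eq_top_of_atom h)))
    have := ae_mP p.1
    rw [ae_iff] at this
    simp only [not_le] at this
    exact this
  have hM : sM a p.2 (Iic 0) = 0 := by
    refine measure_mono_null Iio_union_right.ge (measure_union_null (sM_Iio a _) (nonpos_iff_eq_zero.mp ((hle {0}).trans ?_)))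
    simp
  have hP0 : mP p.1 univ ≠ 0 := by simp
  have hM1 := sM_univ p.2.2
  have hM0 : sM a p.2 univ ≠ 0 := by rw [hM1]; simp
  -- Restoring the mass after truncation multiplies by a factor tending to 1, so half of the margin
  -- below the constraint is given up.
  have hε2 : ε / 2 < 1 := (half_le_self zero_le).trans_lt hε1
  have hlt : ((1 - ε : ℝ≥0) : ℝ≥0∞) < ((1 - ε / 2 : ℝ≥0) : ℝ≥0∞) := by
    refine ENNReal.coe_lt_coe.mpr (tsub_lt_tsub_left_of_le hε1.le (half_lt_self hε0))
  obtain ⟨K, hK⟩ := eventually_atTop.mp ((eventually_measure_window_ne_zero hP hP0).and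
    ((eventually_measure_window_ne_zero hM hM0).and
    ((tendsto_mul_truncFactor hM hM0 _).eventually_lt_const hlt)))
  have hshift : Tendsto (fun k => k + K) atTop atTop := tendsto_add_atTop_nat K
  have hμ : ∀ k, ∃ μ : ProbabilityMeasure RPlus, mP μ = trunc (mP p.1) (k + K) := fun k => by
    have : IsProbabilityMeasure (trunc (mP p.1) (k + K)) :=
      ⟨by rw [trunc_univ (hK _ le_add_self).1, measure_univ]⟩
    refine exists_mP_eq (nonpos_iff_eq_zero.mp ((trunc_le _ _).trans ?_))
    rw [Measure.smul_apply, measure_mono_null Iio_subset_Iic_self hP, smul_zero]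
  choose μ hμ using hμ
  have hle' : ∀ k, trunc (sM a p.2) (k + K) ≤ ((1 - ε / 2 : ℝ≥0) : ℝ≥0∞) • volume := fun k => by
    refine (trunc_le _).trans (Measure.le_iff.mpr fun s _ => ?_)
    have h1 := hle s
    simp only [Measure.smul_apply, smul_eq_mul] at h1 ⊢
    calc _ ≤ truncFactor (sM a p.2) (k + K) * (((1 - ε : ℝ≥0) : ℝ≥0∞) * volume s) := by gcongr
      _ ≤ _ := by
        rw [← mul_assoc]
        gcongr
        exact (hK _ le_add_self).2.2.le
  have hν : ∀ k, ∃ ν : E α a, sM a ν = trunc (sM a p.2) (k + K) := fun k => by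
    have hu := trunc_univ (hK (k + K) le_add_self).2.1
    have : IsFiniteMeasure (trunc (sM a p.2) (k + K)) := ⟨by rw [hu]; exact measure_lt_top _ _⟩
    obtain ⟨ν, hν⟩ := exists_sM_eq ha (m := trunc (sM a p.2) (k + K)) (by
      refine nonpos_iff_eq_zero.mp ((trunc_le _ _).trans ?_)
      rw [Measure.smul_apply, sM_Iio, smul_zero])
    refine ⟨⟨ν, .inr (mem_constrained_of_sM ha ?_ ?_)⟩, hν⟩
    · rw [hν]
      refine (hle' k).trans (Measure.le_iff.mpr fun s _ => ?_)
      rw [Measure.smul_apply, smul_eq_mul]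
      exact mul_le_of_le_one_left zero_le (by exact_mod_cast tsub_le_self)
    · rw [hν, hu, hM1]
  choose ν hν using hν
  have hconv1 : Tendsto μ atTop (𝓝 p.1) := tendsto_of_mP fun f => by
    simp_rw [hμ]
    exact (tendsto_integral_trunc hP hP0 f).comp hshift
  have hconv2 : Tendsto ν atTop (𝓝 p.2) := tendsto_of_sM ha fun f => by
    simp_rw [hν]
    exact (tendsto_integral_trunc hM hM0 f).comp hshift
  refine lowerBound_of_tendsto ha (p := fun k => (μ k, ν k)) hfin
    (hconv1.prodMk_nhds hconv2) (.of_forall fun k => ?_)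
    ((tendsto_truncFactor_mul_mul hP hP0 _).comp hshift) (.of_forall fun k => ?_)
    ((tendsto_truncFactor_mul_mul hM hM0 _).comp hshift) (.of_forall fun k => ?_)
    ((tendsto_mul_truncFactor hP hP0 _).comp hshift) (.of_forall fun k => ?_)
  · have hk : 1 / (((k + K : ℕ) : ℝ) + 1) ≤ ((k + K : ℕ) : ℝ) + 1 := by
      have : (0:ℝ) ≤ ((k + K : ℕ) : ℝ) := Nat.cast_nonneg _
      rw [div_le_iff₀ (by positivity)]
      nlinarith
    exact lowerBound_of_compact hα ha (p := (μ k, ν k)) (by positivity) hk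
      (by rw [hμ]; exact trunc_compl_window _) (by positivity) hk
      (by rw [hν]; exact trunc_compl_window _) (half_pos hε0) hε2 (by rw [hν]; exact hle' k)
  · exact en_le_of_le_smul (by rw [hμ]; exact trunc_le _)
  · exact en_le_of_le_smul (nM_le_of_sM_le ha (by rw [hν]; exact trunc_le _))
  · exact potInt_le_of_le_smul (by rw [hμ]; exact trunc_le _)

/-! ### Explicit measures with finite energy -/

/-- Lebesgue measure on `[1, 2]`. -/
abbrev leb12 : Measure ℝ := volume.restrict (Icc 1 2)

instance : IsProbabilityMeasure leb12 :=
  ⟨by rw [Measure.restrict_apply_univ, Real.volume_Icc]; norm_num⟩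

theorem lintegral_const_sub_log_ne_top (C : ℝ) :
    ∫⁻ t in Icc (-1) 1, ENNReal.ofReal (C - Real.log t) ≠ ⊤ := by
  have h : IntegrableOn (fun t => C - Real.log t) (Icc (-1) 1) := by
    have h1 : IntervalIntegrable (fun t => C - Real.log t) volume (-1) 1 :=
      intervalIntegrable_const.sub intervalIntegral.intervalIntegrable_log'
    exact (intervalIntegrable_iff_integrableOn_Icc_of_le (by norm_num)).mp h1
  exact (Integrable.lintegral_lt_top h).ne

theorem hlog_le (x : ℝ) : hlog x ≤ x ^ 2 / 2 := by
  have := Real.log_le_sub_one_of_pos (show 0 < 1 + x ^ 2 by positivity)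
  unfold hlog
  linarith

/-- The factorization s² - t² = (s+t)(s-t), with s + t bounded below, reduces the singularity to
log|s - t|; the real logarithm is even, so no absolute value is needed. -/
theorem kern_mul_sq_le {c s t : ℝ} (hc : c ≠ 0) (hs : s ∈ Icc (1:ℝ) 2) (ht : t ∈ Icc (1:ℝ) 2)
    (hst : s ≠ t) : kern (c * s ^ 2) (c * t ^ 2) ≤
      ENNReal.ofReal (16 * c ^ 2 - Real.log |c| - Real.log (s - t)) := by
  have hpos : 0 < s + t := by linarith [hs.1, ht.1]
  have hsub : c * s ^ 2 - c * t ^ 2 = c * ((s + t) * (s - t)) := by ring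
  have hd : s - t ≠ 0 := sub_ne_zero.mpr hst
  have hne : c * s ^ 2 ≠ c * t ^ 2 := by
    rw [← sub_ne_zero, hsub]
    exact mul_ne_zero hc (mul_ne_zero hpos.ne' hd)
  have key : ∀ r ∈ Icc (1:ℝ) 2, hlog (c * r ^ 2) ≤ 8 * c ^ 2 := fun r hr => by
    refine (hlog_le _).trans ?_
    have h1 : r ^ 2 ≤ 4 := by nlinarith [hr.1, hr.2]
    have h2 : (r ^ 2) ^ 2 ≤ 16 := by nlinarith [sq_nonneg r]
    nlinarith [sq_nonneg c]
  have h1 := key s hs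
  have h2 := key t ht
  have h3 : 0 ≤ Real.log (s + t) := Real.log_nonneg (by linarith [hs.1, ht.1])
  rw [kern_of_ne hne, lk_eq hne, hsub, Real.log_abs, Real.log_mul hc (mul_ne_zero hpos.ne' hd),
    Real.log_mul hpos.ne' hd, Real.log_abs]
  apply ENNReal.ofReal_le_ofReal
  unfold hlog at h1 h2
  linarith

theorem en_map_mul_sq_ne_top {c : ℝ} (hc : c ≠ 0) :
    en (leb12.map fun s => c * s ^ 2) (leb12.map fun s => c * s ^ 2) ≠ ⊤ := by
  have hg : Measurable fun s : ℝ => c * s ^ 2 := by fun_prop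
  set C := 16 * c ^ 2 - Real.log |c|
  set F : ℝ → ℝ≥0∞ := (Icc (-1:ℝ) 1).indicator fun t => ENNReal.ofReal (C - Real.log t) with hF
  have hFi : ∫⁻ t, F t ≠ ⊤ := by
    rw [hF, lintegral_indicator measurableSet_Icc]
    exact lintegral_const_sub_log_ne_top C
  rw [en, Measure.map_prod_map _ _ hg hg, lintegral_map measurable_kern (hg.prodMap hg)]
  change ∫⁻ z, kern (c * z.1 ^ 2) (c * z.2 ^ 2) ∂leb12.prod leb12 ≠ ⊤
  have hk : Measurable fun z : ℝ × ℝ => kern (c * z.1 ^ 2) (c * z.2 ^ 2) :=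
    measurable_kern.comp (hg.prodMap hg)
  rw [lintegral_prod _ hk.aemeasurable]
  refine ne_top_of_le_ne_top hFi ?_
  calc _ ≤ ∫⁻ _, (∫⁻ t, F t) ∂leb12 := by
        refine lintegral_mono_ae ((ae_restrict_mem measurableSet_Icc).mono fun s hs => ?_)
        calc _ ≤ ∫⁻ t, F (s - t) ∂leb12 := by
              have hne : ∀ᵐ t ∂leb12, t ≠ s :=
                ae_restrict_of_ae (Measure.ae_ne volume s)
              refine lintegral_mono_ae ?_
              filter_upwards [ae_restrict_mem measurableSet_Icc, hne] with t ht hts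
              have : s - t ∈ Icc (-1:ℝ) 1 := ⟨by linarith [hs.1, ht.2], by linarith [hs.2, ht.1]⟩
              rw [hF, indicator_of_mem this]
              exact kern_mul_sq_le hc hs ht hts.symm
          _ ≤ ∫⁻ t, F (s - t) := lintegral_mono' Measure.restrict_le_self le_rfl
          _ = ∫⁻ t, F t := lintegral_sub_left_eq_self F s
    _ = _ := by simp

/-- A measure below half of the constraint, with finite energy. -/
theorem exists_constrained_half (α : ℝ) {a : ℝ} (ha : 0 < a) :
    ∃ ν : E α a, sM a ν ≤ ((1 / 2 : ℝ≥0) : ℝ≥0∞) • volume ∧ en (nM ν) (nM ν) ≠ ⊤ := by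
  set m₀ : Measure ℝ := ((1 / 2 : ℝ≥0) : ℝ≥0∞) • leb12
  have : IsFiniteMeasure m₀ := Measure.smul_finite _ (by simp)
  obtain ⟨ν, hν⟩ := exists_sM_eq ha (m := m₀) (by
    have : Iio (0:ℝ) ∩ Icc 1 2 = ∅ := by
      ext x
      simp only [mem_inter_iff, mem_Iio, mem_Icc, mem_empty_iff_false, iff_false]
      rintro ⟨h1, h2, -⟩
      linarith
    simp [m₀, Measure.restrict_apply measurableSet_Iio, this])
  have hle : m₀ ≤ ((1 / 2 : ℝ≥0) : ℝ≥0∞) • volume := by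
    refine Measure.le_iff.mpr fun s _ => ?_
    exact mul_le_mul_right (Measure.restrict_apply_le _ _) _
  refine ⟨⟨ν, .inr (mem_constrained_of_sM ha ?_ ?_)⟩, ?_, ?_⟩
  · rw [hν]
    refine hle.trans (Measure.le_iff.mpr fun s _ => ?_)
    rw [Measure.smul_apply, smul_eq_mul]
    exact mul_le_of_le_one_left zero_le (by simp)
  · rw [hν, Measure.smul_apply, measure_univ]
    simp
  · rw [hν]; exact hle
  · have hu : (fun s => (uOf a s : ℝ)) = fun s => -(Real.pi / (2 * √a)) ^ 2 * s ^ 2 := by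
      funext s
      simp only [uOf]
      ring
    change en (nM ν) (nM ν) ≠ ⊤
    rw [nM_eq_map ha, hν, Measure.map_smul, en_smul_left, en_smul_right, hu]
    have := Real.sqrt_pos.mpr ha
    exact ENNReal.mul_ne_top (by simp) (ENNReal.mul_ne_top (by simp)
      (en_map_mul_sq_ne_top (neg_ne_zero.mpr (pow_ne_zero _ (by positivity)))))

theorem exists_finiteTerms (α : ℝ) {a : ℝ} (ha : 0 < a) :
    ∃ p : ProbabilityMeasure RPlus × E α a, FiniteTerms a p.1 p.2 := by
  obtain ⟨ν, -, hν⟩ := exists_constrained_half α ha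
  have hg : Measurable fun s : ℝ => 1 * s ^ 2 := by fun_prop
  have : IsProbabilityMeasure (leb12.map fun s => 1 * s ^ 2) :=
    Measure.isProbabilityMeasure_map hg.aemeasurable
  obtain ⟨μ, hμ⟩ := exists_mP_eq (m := leb12.map fun s => 1 * s ^ 2) (by
    rw [Measure.map_apply hg measurableSet_Iio]
    have : (fun s : ℝ => 1 * s ^ 2) ⁻¹' Iio 0 = ∅ := by
      ext s
      simpa using sq_nonneg s
    rw [this, measure_empty])
  refine ⟨(μ, ν), ?_, hν, ?_⟩
  · rw [hμ]
    exact en_map_mul_sq_ne_top one_ne_zero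
  · have hc : Continuous fun s : ℝ => pot a (1 * s ^ 2) := (continuous_pot a).comp (by fun_prop)
    rw [hμ, potInt, lintegral_map (continuous_pot a).measurable.ennreal_ofReal hg]
    exact (Integrable.lintegral_lt_top hc.integrableOn_Icc).ne

/-! ### The lower bound -/

/-- Expanding the square shows that the mixture changes the energy by O(t). -/
theorem en_mix_le {A B : Measure ℝ} [IsFiniteMeasure A] [IsFiniteMeasure B] {s t : ℝ≥0}
    (hs : s ≤ 1) (ht : t ≤ 1) : en ((s : ℝ≥0∞) • A + (t : ℝ≥0∞) • B) ((s : ℝ≥0∞) • A + (t : ℝ≥0∞) • B) ≤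
      en A A + t * (en A B + (en A B + en B B)) := by
  have h1 : (s : ℝ≥0∞) • A + (t : ℝ≥0∞) • B ≤ A + (t : ℝ≥0∞) • B := by
    refine add_le_add (Measure.le_iff.mpr fun u _ => ?_) le_rfl
    rw [Measure.smul_apply, smul_eq_mul]
    exact mul_le_of_le_one_left zero_le (by exact_mod_cast hs)
  refine (en_mono h1 h1).trans ?_
  rw [en_add_left, en_add_right, en_add_right, en_smul_left, en_smul_left, en_smul_right,
    en_smul_right, en_comm B A, mul_add, mul_add, add_assoc]
  gcongr
  exact mul_le_of_le_one_left zero_le (by exact_mod_cast ht)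

theorem sM_le_volume {α a : ℝ} (hα : 0 ≤ α) (ha : 0 < a) {ν : FiniteMeasure RMinus}
    (hν : ν ∈ E α a) (h : en (nM ν) (nM ν) ≠ ⊤) : sM a ν ≤ volume :=
  (Measure.map_mono (mem_constrained_sigma_of_en hα ha hν h).2 (continuous_sOf a).measurable).trans
    (map_sOf_sigma_le ha)

/-- The large deviation lower bound holds around every pair of measures. -/
theorem lowerBound {α a : ℝ} (hα : 0 ≤ α) (ha : 0 < a) (p : ProbabilityMeasure RPlus × E α a) :
    LowerBound α a p := by
  refine lowerBound_of_finiteTerms ha fun hfin => ?_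
  obtain ⟨ν₀, hν₀, hen⟩ := exists_constrained_half α ha
  have hle := sM_le_volume hα ha p.2.2 hfin.2.1
  have hM := sM_univ p.2.2
  have hM₀ := sM_univ ν₀.2
  set t : ℕ → ℝ≥0 := fun k => 1 / ((k : ℝ≥0) + 1)
  have ht0 : ∀ k, 0 < t k := fun k => by simp only [t]; positivity
  have ht1 : ∀ k, t k ≤ 1 := fun k => by
    simp only [t]
    rw [div_le_one (by positivity)]
    exact le_add_self
  have ht : Tendsto t atTop (𝓝 0) := tendsto_one_div_add_atTop_nhds_zero_nat
  -- Mixing with a measure below σ/2 brings the mixture below (1 - t/2)σ, strictly under the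
  -- constraint.
  set m : ℕ → Measure ℝ := fun k =>
    ((1 - t k : ℝ≥0) : ℝ≥0∞) • sM a p.2 + (t k : ℝ≥0∞) • sM a ν₀ with hm
  have hsum : ∀ k, (1 - t k) + t k * (1 / 2) = 1 - t k / 2 := fun k => by
    have h1 : t k / 2 ≤ 1 := (half_le_self zero_le).trans (ht1 k)
    rw [← NNReal.coe_inj]
    push_cast [NNReal.coe_sub (ht1 k), NNReal.coe_sub h1]
    ring
  have hmle : ∀ k, m k ≤ ((1 - t k / 2 : ℝ≥0) : ℝ≥0∞) • volume := fun k => by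
    refine Measure.le_iff.mpr fun s _ => ?_
    have h1 := hle s
    have h2 := hν₀ s
    rw [← hsum]
    simp only [hm, Measure.add_apply, Measure.smul_apply, smul_eq_mul] at h2 ⊢
    rw [ENNReal.coe_add, ENNReal.coe_mul, add_mul, mul_assoc]
    gcongr
  have hmfin : ∀ k, IsFiniteMeasure (m k) := fun k => by
    have h1 : IsFiniteMeasure (((1 - t k : ℝ≥0) : ℝ≥0∞) • sM a p.2) :=
      Measure.smul_finite _ ENNReal.coe_ne_top
    have h2 : IsFiniteMeasure ((t k : ℝ≥0∞) • sM a ν₀) := Measure.smul_finite _ ENNReal.coe_ne_top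
    exact inferInstanceAs (IsFiniteMeasure (_ + _))
  have hν : ∀ k, ∃ ν : E α a, sM a ν = m k := fun k => by
    obtain ⟨ν, hν⟩ := exists_sM_eq ha (m := m k) (by simp [hm, sM_Iio])
    refine ⟨⟨ν, .inr (mem_constrained_of_sM ha ?_ ?_)⟩, hν⟩
    · rw [hν]
      refine (hmle k).trans (Measure.le_iff.mpr fun s _ => ?_)
      rw [Measure.smul_apply, smul_eq_mul]
      exact mul_le_of_le_one_left zero_le (by exact_mod_cast tsub_le_self)
    · rw [hν]
      simp only [hm, Measure.add_apply, Measure.smul_apply, smul_eq_mul, hM, hM₀]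
      rw [← add_mul, ← ENNReal.coe_add, tsub_add_cancel_of_le (ht1 k), ENNReal.coe_one, one_mul]
  choose ν hν using hν
  have hnM : ∀ k, nM (ν k) = ((1 - t k : ℝ≥0) : ℝ≥0∞) • nM p.2 + (t k : ℝ≥0∞) • nM ν₀ := fun k => by
    have hu : Measurable fun s => (uOf a s : ℝ) :=
      measurable_subtype_coe.comp (continuous_uOf a).measurable
    simp only [nM_eq_map ha, hν, hm, Measure.map_add _ _ hu, Measure.map_smul]
  have hconv : Tendsto ν atTop (𝓝 p.2) := tendsto_of_sM ha fun f => by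
    have h1 : ∀ k, ∫ x, f x ∂sM a (ν k) =
        (1 - (t k : ℝ)) * ∫ x, f x ∂sM a p.2 + t k * ∫ x, f x ∂sM a ν₀ := fun k => by
      rw [hν, hm, integral_add_measure
        ((f.integrable _).smul_measure ENNReal.coe_ne_top)
        ((f.integrable _).smul_measure ENNReal.coe_ne_top), integral_smul_measure,
        integral_smul_measure, ENNReal.coe_toReal, ENNReal.coe_toReal, NNReal.coe_sub (ht1 k)]
      simp only [smul_eq_mul, NNReal.coe_one]
    have h2 : Tendsto (fun k => (t k : ℝ)) atTop (𝓝 0) := by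
      rw [← NNReal.coe_zero]
      exact NNReal.tendsto_coe.mpr ht
    simp_rw [h1]
    simpa using ((h2.const_sub 1).mul_const _).add (h2.mul_const _)
  have hAB : en (nM p.2) (nM ν₀) ≠ ⊤ :=
    en_ne_top ((nM_univ p.2.2).trans (nM_univ ν₀.2).symm) hfin.2.1 hen
  set z := en (nM p.2) (nM ν₀) + (en (nM p.2) (nM ν₀) + en (nM ν₀) (nM ν₀))
  have hz : z ≠ ⊤ := ENNReal.add_ne_top.mpr ⟨hAB, ENNReal.add_ne_top.mpr ⟨hAB, hen⟩⟩
  have hy : Tendsto (fun k => en (nM p.2) (nM p.2) + t k * z) atTop (𝓝 (en (nM p.2) (nM p.2))) := by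
    have h1 := ENNReal.Tendsto.mul_const (b := z) (ENNReal.tendsto_coe.mpr ht) (.inr hz)
    simpa using h1.const_add (en (nM p.2) (nM p.2))
  refine lowerBound_of_tendsto ha (p := fun k => (p.1, ν k)) hfin
    (tendsto_const_nhds.prodMk_nhds hconv) (.of_forall fun k => ?_) tendsto_const_nhds
    (.of_forall fun k => le_rfl) hy (.of_forall fun k => ?_) tendsto_const_nhds
    (.of_forall fun k => le_rfl)
  · refine lowerBound_of_le hα ha (p := (p.1, ν k)) (half_pos (ht0 k))
      ((half_lt_self (ht0 k)).trans_le (ht1 k)) ?_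
    rw [hν]
    exact hmle k
  · rw [hnM]
    exact en_mix_le tsub_le_self (ht1 k)

/-! ### The minimizer -/

theorem J_eq_coe_or_eq_top {α a : ℝ} (ha : 0 < a) (p : ProbabilityMeasure RPlus × E α a) :
    (∃ c : ℝ, J a p.1 p.2 = c) ∨ J a p.1 p.2 = ⊤ := by
  by_cases h : FiniteTerms a p.1 p.2
  · exact .inl ⟨_, J_eq ha p.1 p.2.2 h.1 h.2.1 h.2.2⟩
  · exact .inr (J_eq_top ha p.1 p.2.2 h)

theorem lowerSemicontinuous_J {α a : ℝ} (hα : 0 ≤ α) (ha : 0 < a) :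
    LowerSemicontinuous fun p : ProbabilityMeasure RPlus × E α a => J a p.1 p.2 := by
  rw [lowerSemicontinuous_iff_isClosed_preimage]
  intro y
  induction y with
  | bot =>
    convert isClosed_empty
    ext p
    simp only [mem_preimage, Iic_bot, mem_singleton_iff, mem_empty_iff_false, iff_false]
    rcases J_eq_coe_or_eq_top ha p with ⟨c, hc⟩ | hc <;> simp [hc]
  | coe γ => exact (isCompact_level hα ha γ).isClosed
  | top => simp

/-- A lower semicontinuous function attains its minimum on a compact level set, which is nonempty
because some explicit pair has finite rate. -/
theorem exists_minimizer {α a : ℝ} (hα : 0 ≤ α) (ha : 0 < a) :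
    ∃ (p : ProbabilityMeasure RPlus × E α a) (c : ℝ), J a p.1 p.2 = c ∧
      ∀ q : ProbabilityMeasure RPlus × E α a, (c : EReal) ≤ J a q.1 q.2 := by
  obtain ⟨q₀, hq₀⟩ := exists_finiteTerms α ha
  have hJ₀ := J_eq ha q₀.1 q₀.2.2 hq₀.1 hq₀.2.1 hq₀.2.2
  obtain ⟨p, hp, hmin⟩ := ((lowerSemicontinuous_J hα ha).lowerSemicontinuousOn _).exists_isMinOn
    ⟨q₀, hJ₀.le⟩ (isCompact_level hα ha _)
  obtain ⟨c, hc⟩ : ∃ c : ℝ, J a p.1 p.2 = c := by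
    refine (J_eq_coe_or_eq_top ha p).resolve_right fun h => ?_
    have hp' : J a p.1 p.2 ≤ _ := hp
    rw [h, top_le_iff] at hp'
    exact EReal.coe_ne_top _ hp'
  refine ⟨p, c, hc, fun q => hc ▸ ?_⟩
  by_cases hq : J a q.1 q.2 ≤ (Jreal a (mP q₀.1) (nM q₀.2) : EReal)
  · exact hmin hq
  · exact le_trans hp (not_le.mp hq).le

/-! ### The large deviation principle -/

theorem coe_mul_log_le {s r : ℝ} (hs : 0 < s) {x : ℝ≥0∞} (h : x ≤ ENNReal.ofReal (Real.exp (r * s))) :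
    ((1 / s : ℝ) : EReal) * ENNReal.log x ≤ r := by
  have h1 : ENNReal.log x ≤ ((r * s : ℝ) : EReal) := by
    refine (ENNReal.log_monotone h).trans_eq ?_
    rw [ENNReal.log_ofReal_of_pos (Real.exp_pos _), Real.log_exp]
  calc _ ≤ ((1 / s : ℝ) : EReal) * ((r * s : ℝ) : EReal) :=
        mul_le_mul_of_nonneg_left h1 (by exact_mod_cast (by positivity))
    _ = r := by
        rw [← EReal.coe_mul]
        congr 1
        field_simp

theorem le_coe_mul_log {s r : ℝ} (hs : 0 < s) {x : ℝ≥0∞} (h : ENNReal.ofReal (Real.exp (r * s)) ≤ x) :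
    (r : EReal) ≤ ((1 / s : ℝ) : EReal) * ENNReal.log x := by
  have h1 : ((r * s : ℝ) : EReal) ≤ ENNReal.log x := by
    refine (ENNReal.log_monotone h).trans_eq' ?_
    rw [ENNReal.log_ofReal_of_pos (Real.exp_pos _), Real.log_exp]
  calc (r : EReal) = ((1 / s : ℝ) : EReal) * ((r * s : ℝ) : EReal) := by
        rw [← EReal.coe_mul]
        congr 1
        field_simp
    _ ≤ _ := mul_le_mul_of_nonneg_left h1 (by exact_mod_cast (by positivity))

theorem ofReal_exp_inv (x : ℝ) :
    (ENNReal.ofReal (Real.exp (-x)))⁻¹ = ENNReal.ofReal (Real.exp x) := by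
  rw [← ENNReal.ofReal_inv_of_pos (Real.exp_pos _), ← Real.exp_neg, neg_neg]

theorem ofReal_exp_mul (b c s : ℝ) :
    ENNReal.ofReal (Real.exp (b * s)) * ENNReal.ofReal (Real.exp (-(c * s))) =
      ENNReal.ofReal (Real.exp ((b - c) * s)) := by
  rw [← ENNReal.ofReal_mul (Real.exp_pos _).le, ← Real.exp_add]
  congr 2
  ring

theorem eventually_le_unnorm_univ {α a : ℝ} (hα : 0 ≤ α) (ha : 0 < a)
    {p : ProbabilityMeasure RPlus × E α a} {m b : ℝ} (hp : J a p.1 p.2 = (m : EReal)) (hb : m < b) :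
    ∀ᶠ n : ℕ in atTop,
      ENNReal.ofReal (Real.exp (-(b * ((2 * n : ℕ) : ℝ) ^ 2))) ≤ unnorm α a n univ := by
  filter_upwards [lowerBound hα ha p univ isOpen_univ (mem_univ _) b
    (by rw [hp]; exact_mod_cast hb)] with n hn using hn.trans (measure_mono (subset_univ _))

/-- The closed set is the whole space: almost every configuration has its empirical measures in it.
-/
theorem eventually_unnorm_univ_le {α a : ℝ} (hα : 0 ≤ α) (ha : 0 < a) {m b : ℝ}
    (hm : ∀ q : ProbabilityMeasure RPlus × E α a, (m : EReal) ≤ J a q.1 q.2) (hb : b < m) :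
    ∀ᶠ n : ℕ in atTop,
      unnorm α a n univ ≤ ENNReal.ofReal (Real.exp (-(b * ((2 * n : ℕ) : ℝ) ^ 2))) := by
  have hd : (b + m) / 2 < m := by linarith
  filter_upwards [eventually_unnorm_event_le hα ha isClosed_univ
    (show b < (b + m) / 2 by linarith)
    (fun p _ => (EReal.coe_lt_coe_iff.mpr hd).trans_le (hm p)), eventually_ge_atTop 1] with n hn h1
  refine le_trans (measure_mono_ae ?_) hn
  filter_upwards [ae_unnorm hα ha h1] with ω hω _ using hω

theorem limsup_logProb_le {α a : ℝ} (hα : 0 ≤ α) (ha : 0 < a)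
    {p : ProbabilityMeasure RPlus × E α a} {m : ℝ} (hp : J a p.1 p.2 = (m : EReal))
    {F : Set (ProbabilityMeasure RPlus × E α a)} (hF : IsClosed F) :
    limsup (fun n : ℕ => logProb n F) atTop ≤ -⨅ q ∈ F, (J a q.1 q.2 - (m : EReal)) := by
  rw [EReal.le_neg]
  refine EReal.ge_of_forall_gt_iff_ge.mp fun z hz => ?_
  rw [EReal.le_neg]
  obtain ⟨z', hz', hz''⟩ := EReal.lt_iff_exists_real_btwn.mp hz
  have hzz : z < z' := EReal.coe_lt_coe_iff.mp hz'
  have hJ : ∀ q ∈ F, ((z' + m : ℝ) : EReal) < J a q.1 q.2 := fun q hq => by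
    have h1 : (z' : EReal) < J a q.1 q.2 - (m : EReal) := hz''.trans_le (iInf₂_le q hq)
    rcases J_eq_coe_or_eq_top ha q with ⟨c, hc⟩ | hc
    · rw [hc, ← EReal.coe_sub, EReal.coe_lt_coe_iff] at h1
      rw [hc, EReal.coe_lt_coe_iff]
      linarith
    · rw [hc]
      exact EReal.coe_lt_top _
  -- One δ is lost in the upper bound of the event and one in the lower bound of the partition
  -- function.
  set δ := (z' - z) / 2 with hδ
  have hδ0 : 0 < δ := by linarith
  refine limsup_le_of_le (h := ?_)
  filter_upwards [eventually_unnorm_event_le hα ha hF (c := z' + m - δ) (by linarith) hJ,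
    eventually_le_unnorm_univ hα ha hp (b := m + δ) (by linarith), eventually_ge_atTop 1]
    with n h1 h2 hn
  have hN : (0:ℝ) < ((2 * n : ℕ) : ℝ) ^ 2 := by
    have : 0 < 2 * n := by omega
    positivity
  rw [logProb, ← EReal.coe_neg]
  refine coe_mul_log_le hN ?_
  rw [gas_eq, Measure.smul_apply, smul_eq_mul]
  have h3 := ENNReal.inv_le_inv.mpr h2
  rw [ofReal_exp_inv] at h3
  refine (mul_le_mul' h3 h1).trans_eq ?_
  rw [ofReal_exp_mul]
  congr 3
  rw [hδ]
  ring

theorem le_liminf_logProb {α a : ℝ} (hα : 0 ≤ α) (ha : 0 < a) {m : ℝ}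
    (hm : ∀ q : ProbabilityMeasure RPlus × E α a, (m : EReal) ≤ J a q.1 q.2)
    {O : Set (ProbabilityMeasure RPlus × E α a)} (hO : IsOpen O) :
    -⨅ q ∈ O, (J a q.1 q.2 - (m : EReal)) ≤ liminf (fun n : ℕ => logProb n O) atTop := by
  refine EReal.ge_of_forall_gt_iff_ge.mp fun z hz => ?_
  rw [EReal.lt_neg_comm, ← EReal.coe_neg] at hz
  simp only [iInf_lt_iff] at hz
  obtain ⟨q, hq, hqz⟩ := hz
  obtain ⟨c, hc⟩ : ∃ c : ℝ, J a q.1 q.2 = c := by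
    refine (J_eq_coe_or_eq_top ha q).resolve_right fun h => ?_
    rw [h, EReal.top_sub_coe] at hqz
    exact not_top_lt hqz
  rw [hc, ← EReal.coe_sub, EReal.coe_lt_coe_iff] at hqz
  -- Here the roles are exchanged: one δ for the lower bound of the event, one for the upper bound
  -- of the partition function.
  set δ := (m - c - z) / 2 with hδ
  have hδ0 : 0 < δ := by linarith
  refine le_liminf_of_le (h := ?_)
  filter_upwards [lowerBound hα ha q O hO hq (c + δ)
      (by rw [hc, EReal.coe_lt_coe_iff]; linarith),
    eventually_unnorm_univ_le hα ha hm (b := m - δ) (by linarith), eventually_ge_atTop 1]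
    with n h1 h2 hn
  have hN : (0:ℝ) < ((2 * n : ℕ) : ℝ) ^ 2 := by
    have : 0 < 2 * n := by omega
    positivity
  rw [logProb]
  refine le_coe_mul_log hN ?_
  rw [gas_eq, Measure.smul_apply, smul_eq_mul]
  have h3 := ENNReal.inv_le_inv.mpr h2
  rw [ofReal_exp_inv] at h3
  refine le_trans (le_of_eq ?_) (mul_le_mul' h3 h1)
  rw [ofReal_exp_mul]
  congr 3
  rw [hδ]
  ring

end CoulombGas

end

theorem mainTheorem2 (α a : ℝ) (hα : 0 ≤ α) (ha : 0 < a) :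
    (∀ n : ℕ, 1 ≤ n →
      IsProbabilityMeasure (CoulombGas.gas α a n) ∧
      ∀ᵐ ω ∂CoulombGas.gas α a n,
        ω ∈ CoulombGas.event (α := α) (a := a) n Set.univ) ∧
    (∀ γ : ℝ, IsCompact
      {p : ProbabilityMeasure CoulombGas.RPlus × CoulombGas.E α a |
        CoulombGas.J a p.1 p.2 ≤ (γ : EReal)}) ∧
    ∃ pstar : ProbabilityMeasure CoulombGas.RPlus × CoulombGas.E α a,
      (∀ q : ProbabilityMeasure CoulombGas.RPlus × CoulombGas.E α a,
        CoulombGas.J a pstar.1 pstar.2 ≤ CoulombGas.J a q.1 q.2) ∧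
      (∀ p : ProbabilityMeasure CoulombGas.RPlus × CoulombGas.E α a,
        (∀ q : ProbabilityMeasure CoulombGas.RPlus × CoulombGas.E α a,
          CoulombGas.J a p.1 p.2 ≤ CoulombGas.J a q.1 q.2) → p = pstar) ∧
      (∃ m : ℝ, CoulombGas.J a pstar.1 pstar.2 = (m : EReal)) ∧
      (∀ F : Set (ProbabilityMeasure CoulombGas.RPlus × CoulombGas.E α a), IsClosed F →
        limsup (fun n : ℕ => CoulombGas.logProb n F) atTop ≤
          -⨅ p ∈ F, (CoulombGas.J a p.1 p.2 - CoulombGas.J a pstar.1 pstar.2)) ∧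
      (∀ O : Set (ProbabilityMeasure CoulombGas.RPlus × CoulombGas.E α a), IsOpen O →
        -⨅ p ∈ O, (CoulombGas.J a p.1 p.2 - CoulombGas.J a pstar.1 pstar.2) ≤
          liminf (fun n : ℕ => CoulombGas.logProb n O) atTop) := by
  obtain ⟨p, m, hp, hmin⟩ := CoulombGas.exists_minimizer hα ha
  refine ⟨fun n hn => ⟨CoulombGas.isProbabilityMeasure_gas hα ha hn, CoulombGas.ae_gas hα ha hn⟩,
    CoulombGas.isCompact_level hα ha, p, fun q => hp ▸ hmin q, fun q hq => ?_, ⟨m, hp⟩,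
    fun F hF => ?_, fun O hO => ?_⟩
  · exact CoulombGas.eq_of_minimal hα ha (le_antisymm (hp ▸ hq p) (hmin q)) hp hmin
  · rw [hp]
    exact CoulombGas.limsup_logProb_le hα ha hp hF
  · rw [hp]
    exact CoulombGas.le_liminf_logProb hα ha hmin hO
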